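/- **Setting.** Let $\mathcal L$ be a countable set and $\Lambda$ the set of finite words on $\mathcal L$; write $\overline\alpha$ for the reversal of $\alpha\in\Lambda$. A *planar algebra* $P_\bullet$ with string labels $\mathcal L$ consists of complex vector spaces $(P_\alpha)_{\alpha\in\Lambda}$ and an action of planar tangles (with strings labelled by $\mathcal L$) by multilinear maps, invariant under isotopy and compatible with composition of tangles. It is a *factor planar algebra* if (i) all $P_\alpha$ are finite dimensional and $P_\emptyset\cong\mathbb C$ via the empty diagram $\mapsto 1$; (ii) there are conjugate-linear involutions $*\colon P_\alpha\to P_{\overline\alpha}$ compatible with the reflection of tangles; (iii) for each $x\in P_{\alpha\overline\alpha}$ the closures of $x$ around the right and around the left side agree; (iv) joining all strings of $x$ to those of $y^*$ defines a positive definite inner product on each $P_\alpha$. For $c\in\mathcal L$ let $\delta_c$ be the value of a closed loop labelled $c$. Write $P_{\alpha\to\beta}=P_{\alpha\overline\beta}$ for the elements drawn with $\alpha$ on top and $\beta$ on the bottom; they are composed vertically (top to bottom), tensored horizontally, and have adjoints $x^*\in P_{\beta\to\alpha}$ and rotations by a half turn $\overline x\in P_{\overline\beta\to\overline\alpha}$.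 A *projection* is a $p\in P_{\alpha\to\alpha}$ with $p=p^2=p^*$. A *rigid $C^*$-tensor category* is an abelian, $\mathbb C$-linear monoidal category with bilinear tensor product, finite-dimensional morphism spaces and $\mathrm{End}(1)\cong\mathbb C$, such that: there is an antilinear, contravariant, involutive operation $*$ on morphisms, fixing objects, compatible with $\otimes$, for which the coherence isomorphisms are unitary and $f^*\circ f=0$ implies $f=0$; every object is a finite orthogonal direct sum of simple objects (those with one-dimensional endomorphism space); every object $X$ has a dual $\overline X$ with maps $\mathrm{ev}_X\colon\overline X\otimes X\to1$ and $\mathrm{coev}_X\colon1\to X\otimes\overline X$ satisfying the zig-zag relations and compatible with tensor products; the two rotations of each morphism $f$ by a half turn agree and equal the dual morphism $\overline f$, with $\overline f^{\,*}=\overline{f^*}$; there is a natural unitary $X\cong\overline{\overline X}$ under which $\mathrm{coev}_X=\mathrm{ev}_{\overline X}^*$; and the left and right traces of endomorphisms agree. An *equivalence* of such categories is a functor which is additive, $\mathbb C$-linear, fully faithful, essentially surjective, $*$-preserving, monoidal and dual-preserving (the last two up to coherent natural unitary isomorphisms, compatible with dual morphisms, evaluations and coevaluations). *The category $\mathsf{Pro}(P_\bullet)$.*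 Objects are formal finite direct sums of projections; for projections $p\in P_{\alpha\to\alpha}$, $q\in P_{\beta\to\beta}$ the morphisms $p\to q$ are the $x\in P_{\alpha\to\beta}$ unchanged by composing with $p$ on top and $q$ on the bottom (written $qP_{\alpha\to\beta}p$), and morphisms of direct sums are matrices of such elements. Tensor product, dual and adjoint are horizontal juxtaposition, rotation by a half turn and $*$ (for matrices, the $*$-transpose), extended to direct sums linearly; the unit object is the empty diagram. Moreover $\mathrm{ev}_p$ is the $\alpha$-cup with $\overline p,p$ on top, and $\mathrm{coev}_p$ is the $\alpha$-cap with $p,\overline p$ underneath. *The bimodules $H_p$.* For a projection $p\in P_{\alpha\to\alpha}$ let $H_p=\bigoplus_{\gamma\in\Lambda}\{\xi\in P_{\gamma\to\alpha}:\ \xi\text{ followed by }p\text{ equals }\xi\}$ (Hilbert space direct sum), and let $L^2(M)=H_\emptyset$ be the space for the empty diagram $\Omega$. An element $x\in P_\sigma$ acts on the left of $H_p$ by $x\star\xi=\sum_k x\star_k\xi$, where $x$ is placed to the left of $\xi\in P_{\gamma\to\alpha}$ and the last $k$ strings of $x$ are joined to the first $k$ strings of $\gamma$ (the term is $0$ unless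 their labels match), and on the right similarly, joining the last strings of $\gamma$ to the first strings of $x$. Let $M$ be the von Neumann algebra generated by the left multiplications on $L^2(M)$. The left and right actions of $m\in M$ on $H_p$ are the bounded operators determined by $R\Omega\mapsto R(m\Omega)$, where $R$ runs over the bounded operators $L^2(M)\to H_p$ that commute with all left, respectively all right, multiplications. *The category $\mathsf{Bim}(P_\bullet)$.* Objects are finite direct sums of the $H_p$ (each summand being given together with its projection $p$); morphisms $H_p\to H_q$ are the elements of $qP_{\alpha\to\beta}p$, and matrices of these for direct sums, composed and tensored in $P_\bullet$; $H_p\otimes H_q=H_{p\otimes q}$, the unit object is $H_\emptyset$, the dual of $H_p$ is $H_{\overline p}$, and evaluations, coevaluations and adjoints are given by the same elements of $P_\bullet$ as in $\mathsf{Pro}(P_\bullet)$. **Theorem 3.17 (Pro → Bim equivalence).** Let $P_\bullet$ be a factor planar algebra with a countable set of string labels $\mathcal L$ such that $\delta_c>1$ for all $c\in\mathcal L$. Then the objects of $\mathsf{Bim}(P_\bullet)$ are $M$–$M$ bimodules (commuting normal unital $*$-representations of $M$ and of its opposite algebra), $\mathsf{Pro}(P_\bullet)$ and $\mathsf{Bim}(P_\bullet)$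 are rigid $C^*$-tensor categories, and the map $\mathsf{Pro}(P_\bullet)\to\mathsf{Bim}(P_\bullet)$ given by $p\mapsto H_p$ (extended to direct sums) and by the identity on morphisms is an equivalence of rigid $C^*$-tensor categories. -/

import Mathlib

universe u v

noncomputable section

open CategoryTheory MonoidalCategory

namespace PlanarAlg

/-- Finite words on the set `L` of string labels; the opposite word is `List.reverse`. -/
abbrev Word (L : Type u) := List L

/-- The singular levels of a planar tangle in generic position, read from top to bottom: a local
maximum of a string labelled `c` (two strands are born), a local minimum of a string labelled `c`
(two strands meet), or an internal rectangle filled with an element `x` of the box space of its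
boundary word `w`.  A rectangle is drawn with all of its strings leaving through its top side, and
its distinguished interval is on the rest of the boundary, so that its boundary word, read clockwise
from the distinguished interval, is read along the top side from left to right. -/
inductive Event {L : Type u} (V : Word L → Type v) : Type (max u v)
  | cap (c : L) : Event V
  | cup (c : L) : Event V
  | box (w : Word L) (x : V w) : Event V

/-- A horizontal slice of a tangle with exactly one singular level: vertical strands `left`, then the
event, then vertical strands `right`. -/
structure Layer {L : Type u} (V : Word L → Type v) : Type (max u v) where
  left : Word L
  event : Event V
  right : Word L

variable {L : Type u} {V : Word L → Type v}

/-- The strands entering an event from above. -/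
def Event.top : Event V → Word L
  | .cap _ => []
  | .cup c => [c, c]
  | .box w _ => w

/-- The strands leaving an event below. -/
def Event.bot : Event V → Word L
  | .cap c => [c, c]
  | .cup _ => []
  | .box _ _ => []

/-- `Reads D a b`: the slices `D`, stacked from top to bottom, fit together to a diagram with the
word `a` on its top side and the word `b` on its bottom side. -/
def Reads : List (Layer V) → Word L → Word L → Prop
  | [], a, b => a = b
  | y :: D, a, b => a = y.left ++ y.event.top ++ y.right ∧
      Reads D (y.left ++ y.event.bot ++ y.right) b

/-- Nested local maxima creating the word `a ++ a.reverse` between the strands `l` and `r`. -/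
def caps (l : Word L) : Word L → Word L → List (Layer V)
  | [], _ => []
  | c :: a, r => ⟨l, .cap c, r⟩ :: caps (l ++ [c]) a (c :: r)

/-- Nested local minima closing the word `a ++ a.reverse` between the strands `l` and `r`. -/
def cups (l : Word L) : Word L → Word L → List (Layer V)
  | [], _ => []
  | c :: a, r => cups (l ++ [c]) a (c :: r) ++ [⟨l, .cup c, r⟩]

/-- Place vertical strands `l` on the left and `r` on the right of a slice. -/
def Layer.whisker (l r : Word L) (y : Layer V) : Layer V := ⟨l ++ y.left, y.event, y.right ++ r⟩

/-- The elementary planar isotopies between generic pictures: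
* two events at different horizontal positions may be moved past each other vertically;
* a zigzag in a string may be pulled straight (both orientations);
* an internal rectangle may be turned: bending the strings `b` of a rectangle with boundary word
  `a ++ b` around its right side to the front agrees with bending the strings `a` around its
  left side to the back.  For `b = []` this is the rotation of the rectangle by a full turn. -/
inductive Move : List (Layer V) → List (Layer V) → Prop
  | slide (l m r : Word L) (e f : Event V) :
      Move [⟨l, e, m ++ f.top ++ r⟩, ⟨l ++ e.bot ++ m, f, r⟩]
        [⟨l ++ e.top ++ m, f, r⟩, ⟨l, e, m ++ f.bot ++ r⟩]
  | zigzag (l r : Word L) (c : L) :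
      Move [⟨l, .cap c, c :: r⟩, ⟨l ++ [c], .cup c, r⟩] []
  | zagzig (l r : Word L) (c : L) :
      Move [⟨l ++ [c], .cap c, r⟩, ⟨l, .cup c, c :: r⟩] []
  | turn (l r a b : Word L) (x : V (a ++ b)) :
      Move (caps (l ++ b ++ a) b r ++ [⟨l ++ b, .box (a ++ b) x, b.reverse ++ r⟩] ++ cups l b r)
        (caps l a.reverse (b ++ a ++ r) ++ [⟨l ++ a.reverse, .box (a ++ b) x, a ++ r⟩] ++
          cups l a.reverse r)

/-- A planar tangle in generic position whose external rectangle has boundary word `α` and whose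
internal rectangles are filled with elements of the spaces `V`. -/
structure Tangle (V : Word L → Type v) (α : Word L) : Type (max u v) where
  layers : List (Layer V)
  reads : Reads layers α []

/-- Two tangles differ by one elementary isotopy applied to consecutive slices. -/
def Tangle.Step {α : Word L} (S T : Tangle V α) : Prop :=
  ∃ pre D E post, Move D E ∧ S.layers = pre ++ D ++ post ∧ T.layers = pre ++ E ++ post

/-- Planar isotopy (keeping the external rectangle fixed). -/
def Tangle.Isotopic {α : Word L} (S T : Tangle V α) : Prop := Relation.EqvGen Tangle.Step S T

/-! ### Elementary facts on readable diagrams -/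

theorem reads_append {D E : List (Layer V)} {a b : Word L} :
    Reads (D ++ E) a b ↔ ∃ m, Reads D a m ∧ Reads E m b := by
  induction D generalizing a with
  | nil => simp [Reads]
  | cons y D ih =>
    simp only [List.cons_append, Reads, ih]
    constructor
    · rintro ⟨h, m, h1, h2⟩; exact ⟨m, ⟨h, h1⟩, h2⟩
    · rintro ⟨m, ⟨h, h1⟩, h2⟩; exact ⟨h, m, h1, h2⟩

theorem Reads.append {D E : List (Layer V)} {a b c : Word L} (h : Reads D a b)
    (k : Reads E b c) : Reads (D ++ E) a c := reads_append.2 ⟨b, h, k⟩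

theorem Reads.whisker {D : List (Layer V)} {a b : Word L} (l r : Word L) (h : Reads D a b) :
    Reads (D.map (Layer.whisker l r)) (l ++ a ++ r) (l ++ b ++ r) := by
  induction D generalizing a with
  | nil => simpa [Reads] using h
  | cons y D ih =>
    obtain ⟨rfl, h⟩ := h
    refine ⟨by simp [Layer.whisker], ?_⟩
    have := ih h
    simpa [Layer.whisker] using this

theorem reads_caps (l a r : Word L) :
    Reads (caps (V := V) l a r) (l ++ r) (l ++ a ++ a.reverse ++ r) := by
  induction a generalizing l r with
  | nil => simp [caps, Reads]
  | cons c a ih =>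
    refine ⟨by simp [Event.top], ?_⟩
    simpa [Event.bot] using ih (l ++ [c]) (c :: r)

theorem reads_cups (l a r : Word L) :
    Reads (cups (V := V) l a r) (l ++ a ++ a.reverse ++ r) (l ++ r) := by
  induction a generalizing l r with
  | nil => simp [cups, Reads]
  | cons c a ih =>
    refine Reads.append (b := l ++ [c, c] ++ r) ?_ ?_
    · simpa using ih (l ++ [c]) (c :: r)
    · simp [Reads, Event.top, Event.bot]

theorem reads_box {l w r a b : Word L} (x : V w) (ha : a = l ++ w ++ r) (hb : b = l ++ r) :
    Reads [(⟨l, .box w x, r⟩ : Layer V)] a b := by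
  subst ha hb; simp [Reads, Event.top, Event.bot]

/-- Reflection of an event in a vertical axis, applying the involution to the label of a rectangle. -/
def Event.mirror (st : ∀ α, V α → V α.reverse) : Event V → Event V
  | .cap c => .cap c
  | .cup c => .cup c
  | .box w x => .box w.reverse (st w x)

/-- Reflection of a slice in a vertical axis. -/
def Layer.mirror (st : ∀ α, V α → V α.reverse) (y : Layer V) : Layer V :=
  ⟨y.right.reverse, y.event.mirror st, y.left.reverse⟩

theorem Reads.mirror (st : ∀ α, V α → V α.reverse) {D : List (Layer V)}
    {a b : Word L} (h : Reads D a b) :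
    Reads (D.map (Layer.mirror st)) a.reverse b.reverse := by
  induction D generalizing a with
  | nil => simpa [Reads] using h
  | cons y D ih =>
    obtain ⟨l, e, r⟩ := y
    obtain ⟨rfl, h⟩ := h
    refine ⟨by cases e <;> simp [Layer.mirror, Event.mirror, Event.top], ?_⟩
    have := ih h
    cases e <;> simpa [Layer.mirror, Event.mirror, Event.bot] using this

/-- The reflection of a tangle, all labels replaced by their images under the involution. -/
def Tangle.mirror (st : ∀ α, V α → V α.reverse) {α : Word L} (T : Tangle V α) :
    Tangle V α.reverse := ⟨T.layers.map (Layer.mirror st), by simpa using T.reads.mirror st⟩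

/-! ### The tangles used below -/

/-- The empty tangle. -/
def Tangle.empty : Tangle V [] := ⟨[], rfl⟩

/-- The tangle with one rectangle, connected to the external rectangle by straight strings. -/
def Tangle.single {α : Word L} (x : V α) : Tangle V α := ⟨[⟨[], .box α x, []⟩], by
  apply reads_box <;> simp⟩

/-- A closed loop labelled `c`. -/
def Tangle.loop (c : L) : Tangle V [] := ⟨[⟨[], .cap c, []⟩, ⟨[], .cup c, []⟩], by
  simp [Reads, Event.top, Event.bot]⟩

/-- Through strings labelled `α`, from top to bottom of a rectangle. -/
def Tangle.through (α : Word L) : Tangle V (α ++ α.reverse) := ⟨cups [] α [], by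
  simpa using reads_cups [] α []⟩

/-- Closing a rectangle, with `α` on top and `α` on the bottom, by strings around its right side. -/
def Tangle.closeRight {α : Word L} (x : V (α ++ α.reverse)) : Tangle V [] :=
  ⟨caps [] α [] ++ [⟨[], .box _ x, []⟩],
    Reads.append (b := α ++ α.reverse) (by simpa using reads_caps [] α []) (reads_box _ (by simp) (by simp))⟩

/-- Closing a rectangle, with `α` on top and `α` on the bottom, by strings around its left side. -/
def Tangle.closeLeft {α : Word L} (x : V (α ++ α.reverse)) : Tangle V [] :=
  ⟨caps [] α.reverse [] ++ caps (α.reverse ++ α) α.reverse [] ++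
      [⟨α.reverse, .box _ x, α⟩] ++ cups [] α.reverse [], by
    refine Reads.append (b := α.reverse ++ α) (Reads.append
      (b := α.reverse ++ (α ++ α.reverse) ++ α) (Reads.append (b := α.reverse ++ α) ?_ ?_)
        (reads_box _ rfl rfl)) ?_
    · simpa using reads_caps [] α.reverse []
    · simpa using reads_caps (α.reverse ++ α) α.reverse []
    · simpa using reads_cups [] α.reverse []⟩

/-- Two rectangles side by side; the last strings `k.reverse` of the first are connected to the first
strings `k` of the second. -/
def Tangle.glue {a b c : Word L} (x : V a) (y : V b) (s k t : Word L)
    (ha : a = s ++ k.reverse) (hb : b = k ++ t) (hc : c = s ++ t) : Tangle V c :=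
  ⟨caps s k.reverse t ++ [⟨[], .box a x, b⟩, ⟨[], .box b y, []⟩], by
    refine Reads.append (b := a ++ b) ?_ ?_
    · subst ha hb hc; simpa using reads_caps s k.reverse t
    · simp [Reads, Event.top, Event.bot]⟩

/-- The second rectangle is placed above the first one, between its strings `s` and `t`, and its first
strings `k.reverse` are connected to the strings `k` of the first. -/
def Tangle.insert {a b c : Word L} (x : V a) (y : V b) (s k m t : Word L)
    (ha : a = s ++ k ++ t) (hb : b = k.reverse ++ m) (hc : c = s ++ m ++ t) : Tangle V c :=
  ⟨caps s k (m ++ t) ++ [⟨s ++ k, .box b y, t⟩, ⟨[], .box a x, []⟩], by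
    refine Reads.append (b := s ++ k ++ b ++ t) ?_ ?_
    · subst ha hb hc; simpa using reads_caps s k (m ++ t)
    · subst ha; simp [Reads, Event.top, Event.bot]⟩

/-- Horizontal juxtaposition of a rectangle with top `α` and bottom `β` and a rectangle with top `γ`
and bottom `δ`. -/
def Tangle.tensor {α β γ δ : Word L} (x : V (α ++ β.reverse)) (y : V (γ ++ δ.reverse)) :
    Tangle V ((α ++ γ) ++ (β ++ δ).reverse) :=
  ⟨[⟨α, .box _ y, β.reverse⟩, ⟨[], .box _ x, []⟩], by simp [Reads, Event.top, Event.bot]⟩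

/-- Rotation by a half turn of a rectangle with top `α` and bottom `β`. -/
def Tangle.rotate {α β : Word L} (x : V (α ++ β.reverse)) :
    Tangle V (β.reverse ++ α.reverse.reverse) :=
  ⟨caps (β.reverse ++ α) β.reverse [] ++ [⟨β.reverse, .box _ x, β⟩] ++ cups [] β.reverse [], by
    refine Reads.append (b := β.reverse ++ β) (Reads.append
      (b := β.reverse ++ (α ++ β.reverse) ++ β) ?_ (reads_box _ rfl rfl)) ?_
    · simpa using reads_caps (β.reverse ++ α) β.reverse []
    · simpa using reads_cups [] β.reverse []⟩

/-- The pairing of `x` and `y`, all strings of `x` being connected to those of `y`. -/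
def Tangle.pair {α : Word L} (x : V α) (y : V α.reverse) : Tangle V [] :=
  Tangle.glue x y [] α.reverse [] (by simp) (by simp) rfl

end PlanarAlg

/-- A planar algebra with string labels `L`: box spaces `V α` and an action of planar tangles, given
by the values `Z T` of all tangles `T` filled with elements of the box spaces.  The value is linear in
every label, invariant under planar isotopy, and compatible with composition of tangles: a rectangle
filled with the value of a tangle may be replaced by that tangle. -/
structure PlanarAlgebra (L : Type u) where
  V : PlanarAlg.Word L → Type v
  [addCommGroup : ∀ α, AddCommGroup (V α)]
  [module : ∀ α, Module ℂ (V α)]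
  Z : ∀ {α}, PlanarAlg.Tangle V α → V α
  isotopy : ∀ {α} (S T : PlanarAlg.Tangle V α), S.Isotopic T → Z S = Z T
  naturality : ∀ {α w} (S S' : PlanarAlg.Tangle V α) (T : PlanarAlg.Tangle V w) (pre post l r),
    S.layers = pre ++ [⟨l, .box w (Z T), r⟩] ++ post →
    S'.layers = pre ++ T.layers.map (PlanarAlg.Layer.whisker l r) ++ post → Z S = Z S'
  Z_single : ∀ {α} (x : V α), Z (PlanarAlg.Tangle.single x) = x
  map_add : ∀ {α w} (x y : V w) (S T R : PlanarAlg.Tangle V α) (pre post l r),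
    S.layers = pre ++ [⟨l, .box w (x + y), r⟩] ++ post →
    T.layers = pre ++ [⟨l, .box w x, r⟩] ++ post →
    R.layers = pre ++ [⟨l, .box w y, r⟩] ++ post → Z S = Z T + Z R
  map_smul : ∀ {α w} (z : ℂ) (x : V w) (S T : PlanarAlg.Tangle V α) (pre post l r),
    S.layers = pre ++ [⟨l, .box w (z • x), r⟩] ++ post →
    T.layers = pre ++ [⟨l, .box w x, r⟩] ++ post → Z S = z • Z T

attribute [instance] PlanarAlgebra.addCommGroup PlanarAlgebra.module

open PlanarAlg in
/-- A factor planar algebra: evaluable, involutive, spherical, positive. -/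
structure FactorPlanarAlgebra (L : Type u) extends PlanarAlgebra.{u, v} L where
  finiteDimensional : ∀ α, FiniteDimensional ℂ (V α)
  /-- The empty tangle spans the box space of the empty word, and is not zero there. -/
  evaluable : ∀ x : V [], ∃! z : ℂ, x = z • Z Tangle.empty
  st : ∀ {α}, V α → V α.reverse
  st_add : ∀ {α} (x y : V α), st (x + y) = st x + st y
  st_smul : ∀ {α} (z : ℂ) (x : V α), st (z • x) = (starRingEnd ℂ z) • st x
  st_st : ∀ {α} (x : V α), st (st x) ≍ x
  st_Z : ∀ {α} (T : Tangle V α), st (Z T) = Z (Tangle.mirror (V := V) (fun _ => st) T)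
  spherical : ∀ {α : Word L} (x : V (α ++ α.reverse)),
    Z (Tangle.closeRight x) = Z (Tangle.closeLeft x)
  /-- The form `⟨x, y⟩`, the closed diagram of `x` joined to `y` reflected, is positive definite. -/
  positive : ∀ {α : Word L} (x : V α), x ≠ 0 →
    ∃ t : ℝ, 0 < t ∧ Z (Tangle.pair x (st x)) = (t : ℂ) • Z Tangle.empty

namespace PlanarAlg

variable {L : Type u} {V : Word L → Type v}

/-! ### Calculus of isotopies -/

/-- One elementary isotopy between readable diagrams. -/
def Elem (a b : Word L) (D E : List (Layer V)) : Prop :=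
  Reads D a b ∧ Reads E a b ∧
    ∃ pre X Y post, Move X Y ∧ D = pre ++ X ++ post ∧ E = pre ++ Y ++ post

/-- Planar isotopy of diagrams with top `a` and bottom `b`. -/
def Deform (a b : Word L) (D E : List (Layer V)) : Prop := Relation.EqvGen (Elem a b) D E

namespace Deform

variable {a b c d : Word L} {D E F G : List (Layer V)}

theorem refl (D : List (Layer V)) : Deform a b D D := Relation.EqvGen.refl _
theorem symm (h : Deform a b D E) : Deform a b E D := Relation.EqvGen.symm _ _ h
theorem trans (h : Deform a b D E) (k : Deform a b E F) : Deform a b D F :=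
  Relation.EqvGen.trans _ _ _ h k

theorem of_move (h : Move D E) (hD : Reads D a b) (hE : Reads E a b) : Deform a b D E :=
  Relation.EqvGen.rel _ _ ⟨hD, hE, [], D, E, [], h, by simp, by simp⟩

theorem of_eq (h : D = E) : Deform a b D E := h ▸ refl _

theorem append_left (hF : Reads F a b) (h : Deform b c D E) : Deform a c (F ++ D) (F ++ E) := by
  induction h with
  | rel D E h =>
    obtain ⟨h1, h2, pre, X, Y, post, hm, rfl, rfl⟩ := h
    exact Relation.EqvGen.rel _ _ ⟨hF.append h1, hF.append h2, F ++ pre, X, Y, post, hm,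
      by simp, by simp⟩
  | refl D => exact refl _
  | symm D E _ ih => exact ih.symm
  | trans D E F _ _ ih1 ih2 => exact ih1.trans ih2

theorem append_right (hF : Reads F b c) (h : Deform a b D E) : Deform a c (D ++ F) (E ++ F) := by
  induction h with
  | rel D E h =>
    obtain ⟨h1, h2, pre, X, Y, post, hm, rfl, rfl⟩ := h
    exact Relation.EqvGen.rel _ _ ⟨h1.append hF, h2.append hF, pre, X, Y, post ++ F, hm,
      by simp, by simp⟩
  | refl D => exact refl _
  | symm D E _ ih => exact ih.symm
  | trans D E F _ _ ih1 ih2 => exact ih1.trans ih2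

theorem reads_iff (h : Deform a b D E) : Reads D a b ↔ Reads E a b := by
  induction h with
  | rel D E h => exact ⟨fun _ => h.2.1, fun _ => h.1⟩
  | refl D => rfl
  | symm D E _ ih => exact ih.symm
  | trans D E F _ _ ih1 ih2 => exact ih1.trans ih2

theorem Z_eq (P : PlanarAlgebra.{u, v} L) {α : Word L} {D E : List (Layer P.V)}
    (h : Deform α [] D E) (hD : Reads D α []) (hE : Reads E α []) :
    P.Z ⟨D, hD⟩ = P.Z ⟨E, hE⟩ := by
  induction h with
  | rel D E h =>
    obtain ⟨h1, h2, pre, X, Y, post, hm, rfl, rfl⟩ := h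
    exact P.isotopy _ _ (Relation.EqvGen.rel _ _ ⟨pre, X, Y, post, hm, rfl, rfl⟩)
  | refl D => rfl
  | symm D E _ ih => exact (ih hE hD).symm
  | trans D E F h1 _ ih1 ih2 => exact (ih1 hD ((Deform.reads_iff h1).1 hD)).trans (ih2 _ hE)

end Deform

theorem Z_congr (P : PlanarAlgebra.{u, v} L) {α : Word L} (S T : Tangle P.V α)
    (h : Deform α [] S.layers T.layers) : P.Z S = P.Z T := h.Z_eq P S.reads T.reads

theorem caps_whisker (p q l a r : Word L) :
    (caps (V := V) l a r).map (Layer.whisker p q) = caps (p ++ l) a (r ++ q) := by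
  induction a generalizing l r with
  | nil => simp [caps]
  | cons c a ih => simp [caps, Layer.whisker, ih]

theorem cups_whisker (p q l a r : Word L) :
    (cups (V := V) l a r).map (Layer.whisker p q) = cups (p ++ l) a (r ++ q) := by
  induction a generalizing l r with
  | nil => simp [cups]
  | cons c a ih => simp [cups, Layer.whisker, ih]

theorem caps_append (l a b r : Word L) :
    caps (V := V) l (a ++ b) r = caps l a r ++ caps (l ++ a) b (a.reverse ++ r) := by
  induction a generalizing l r with
  | nil => simp [caps]
  | cons c a ih => simp [caps, ih]

theorem cups_append (l a b r : Word L) :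
    cups (V := V) l (a ++ b) r = cups (l ++ a) b (a.reverse ++ r) ++ cups l a r := by
  induction a generalizing l r with
  | nil => simp [cups]
  | cons c a ih => simp [cups, ih]

theorem caps_mirror (st : ∀ α, V α → V α.reverse) (l a r : Word L) :
    (caps l a r).map (Layer.mirror st) = caps r.reverse a l.reverse := by
  induction a generalizing l r with
  | nil => simp [caps]
  | cons c a ih => simp [caps, Layer.mirror, Event.mirror, ih]

theorem cups_mirror (st : ∀ α, V α → V α.reverse) (l a r : Word L) :
    (cups l a r).map (Layer.mirror st) = cups r.reverse a l.reverse := by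
  induction a generalizing l r with
  | nil => simp [cups]
  | cons c a ih => simp [cups, Layer.mirror, Event.mirror, ih]

/-- Two diagrams at different horizontal positions may be moved past each other. -/
theorem slide_layer (l m r : Word L) (y : Layer V) {E : List (Layer V)} {c d : Word L}
    (hE : Reads E c d) :
    Deform (l ++ (y.left ++ y.event.top ++ y.right) ++ m ++ c ++ r)
      (l ++ (y.left ++ y.event.bot ++ y.right) ++ m ++ d ++ r)
      (Layer.whisker l (m ++ c ++ r) y ::
        E.map (Layer.whisker (l ++ (y.left ++ y.event.bot ++ y.right) ++ m) r))
      (E.map (Layer.whisker (l ++ (y.left ++ y.event.top ++ y.right) ++ m) r) ++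
        [Layer.whisker l (m ++ d ++ r) y]) := by
  induction E generalizing c with
  | nil =>
    obtain rfl : c = d := hE
    exact Deform.refl _
  | cons z E ih =>
    obtain ⟨rfl, hE⟩ := hE
    obtain ⟨zl, f, zr⟩ := z
    obtain ⟨yl, e, yr⟩ := y
    have h1 := (Move.slide (V := V) (l ++ yl) (yr ++ m ++ zl) (zr ++ r) e f)
    have h2 := ih hE
    have k1 : Deform (l ++ (yl ++ e.top ++ yr) ++ m ++ (zl ++ f.top ++ zr) ++ r)
        (l ++ (yl ++ e.bot ++ yr) ++ m ++ (zl ++ f.bot ++ zr) ++ r) _ _ :=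
      Deform.of_move h1 (by simp [Reads]) (by simp [Reads])
    have r1 : Reads (E.map (Layer.whisker (l ++ (yl ++ e.bot ++ yr) ++ m) r))
        (l ++ (yl ++ e.bot ++ yr) ++ m ++ (zl ++ f.bot ++ zr) ++ r)
        (l ++ (yl ++ e.bot ++ yr) ++ m ++ d ++ r) := hE.whisker _ _
    have k2 := k1.append_right r1
    have r2 : Reads [Layer.whisker (l ++ (yl ++ e.top ++ yr) ++ m) r (⟨zl, f, zr⟩ : Layer V)]
        (l ++ (yl ++ e.top ++ yr) ++ m ++ (zl ++ f.top ++ zr) ++ r)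
        (l ++ (yl ++ e.top ++ yr) ++ m ++ (zl ++ f.bot ++ zr) ++ r) := by
      simp [Reads, Layer.whisker]
    have k3 := h2.append_left r2
    refine ((Deform.of_eq ?_).trans k2).trans ((Deform.of_eq ?_).trans (k3.trans (Deform.of_eq ?_)))
    · simp [Layer.whisker]
    · simp [Layer.whisker]
    · simp [Layer.whisker]

theorem slide_block (l m r : Word L) {D E : List (Layer V)} {a b c d : Word L}
    (hD : Reads D a b) (hE : Reads E c d) :
    Deform (l ++ a ++ m ++ c ++ r) (l ++ b ++ m ++ d ++ r)
      (D.map (Layer.whisker l (m ++ c ++ r)) ++ E.map (Layer.whisker (l ++ b ++ m) r))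
      (E.map (Layer.whisker (l ++ a ++ m) r) ++ D.map (Layer.whisker l (m ++ d ++ r))) := by
  induction D generalizing a with
  | nil =>
    obtain rfl : a = b := hD
    simpa using Deform.refl _
  | cons y D ih =>
    obtain ⟨rfl, hD⟩ := hD
    have k1 := ih hD
    have k2 := slide_layer l m r y hE
    have r1 : Reads [Layer.whisker l (m ++ c ++ r) y]
        (l ++ (y.left ++ y.event.top ++ y.right) ++ m ++ c ++ r)
        (l ++ (y.left ++ y.event.bot ++ y.right) ++ m ++ c ++ r) := by
      simp [Reads, Layer.whisker]
    have r2 : Reads (D.map (Layer.whisker l (m ++ d ++ r)))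
        (l ++ (y.left ++ y.event.bot ++ y.right) ++ m ++ d ++ r) (l ++ b ++ m ++ d ++ r) := by
      simpa using hD.whisker l (m ++ d ++ r)
    refine (Deform.of_eq ?_).trans ((k1.append_left r1).trans ((Deform.of_eq ?_).trans
      ((k2.append_right r2).trans (Deform.of_eq ?_))))
    · simp
    · simp
    · simp

/-- Pulling parallel zigzags straight. -/
theorem zag (l a r : Word L) : Deform (V := V) (l ++ a ++ r) (l ++ a ++ r)
    (caps (l ++ a) a.reverse r ++ cups l a (a ++ r)) [] := by
  induction a generalizing l r with
  | nil => simpa [caps, cups] using Deform.refl _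
  | cons c a ih =>
    have s1 := (slide_block (V := V) (l ++ [c]) [] (a ++ r) (reads_cups [] a [])
      (E := [⟨[], .cap c, []⟩]) (c := []) (d := [c, c]) (by simp [Reads, Event.top, Event.bot])).symm
    have s2 := s1.append_left (a := l ++ c :: a ++ r) (F := caps (l ++ c :: a) a.reverse r)
      (by simpa using reads_caps (V := V) (l ++ c :: a) a.reverse r)
    have s3 := s2.append_right (F := [⟨l, .cup c, c :: (a ++ r)⟩]) (c := l ++ c :: a ++ r)
      (by simp [Reads, Event.top, Event.bot])
    have t1 : Deform (V := V) (l ++ c :: a ++ r) (l ++ c :: a ++ r)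
        (caps (l ++ [c] ++ a) a.reverse r ++ cups (l ++ [c]) a (a ++ r) ++
          [⟨l ++ [c], .cap c, a ++ r⟩, ⟨l, .cup c, c :: (a ++ r)⟩])
        [⟨l ++ [c], .cap c, a ++ r⟩, ⟨l, .cup c, c :: (a ++ r)⟩] := by
      simpa using (ih (l ++ [c]) r).append_right
        (F := [⟨l ++ [c], .cap c, a ++ r⟩, ⟨l, .cup c, c :: (a ++ r)⟩]) (c := l ++ c :: a ++ r)
        (by simp [Reads, Event.top, Event.bot])
    have t2 := Deform.of_move (a := l ++ c :: a ++ r) (b := l ++ c :: a ++ r)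
      (Move.zagzig (V := V) l (a ++ r) c)
      (by simp [Reads, Event.top, Event.bot]) (by simp [Reads])
    refine (Deform.of_eq ?_).trans (s3.trans ((Deform.of_eq ?_).trans (t1.trans t2)))
    · simp [caps_append, cups, caps, cups_whisker, Layer.whisker]
    · simp [cups_whisker, Layer.whisker]

theorem zig (l a r : Word L) : Deform (V := V) (l ++ a ++ r) (l ++ a ++ r)
    (caps l a (a ++ r) ++ cups (l ++ a) a.reverse r) [] := by
  induction a generalizing l r with
  | nil => simpa [caps, cups] using Deform.refl _
  | cons c a ih =>
    have s1 := (slide_block (V := V) (l ++ [c]) [] (a ++ r) (reads_caps [] a [])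
      (E := [⟨[], .cup c, []⟩]) (c := [c, c]) (d := []) (by simp [Reads, Event.top, Event.bot]))
    have s2 := s1.append_left (a := l ++ c :: a ++ r) (F := [⟨l, .cap c, c :: (a ++ r)⟩])
      (by simp [Reads, Event.top, Event.bot])
    have s3 := s2.append_right (F := cups (l ++ c :: a) a.reverse r) (c := l ++ c :: a ++ r)
      (by simpa using reads_cups (V := V) (l ++ c :: a) a.reverse r)
    have t2 := Deform.of_move (a := l ++ c :: a ++ r) (b := l ++ c :: a ++ r)
      (Move.zigzag (V := V) l (a ++ r) c)
      (by simp [Reads, Event.top, Event.bot]) (by simp [Reads])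
    have t1 := t2.append_right
      (F := caps (l ++ [c]) a (a ++ r) ++ cups (l ++ [c] ++ a) a.reverse r) (c := l ++ c :: a ++ r)
      (Reads.append (by simpa using reads_caps (V := V) (l ++ [c]) a (a ++ r))
        (by simpa using reads_cups (V := V) (l ++ [c] ++ a) a.reverse r))
    refine (Deform.of_eq ?_).trans (s3.trans ((Deform.of_eq ?_).trans (t1.trans ?_)))
    · simp [cups_append, cups, caps, caps_whisker, Layer.whisker]
    · simp [caps_whisker, Layer.whisker]
    · simpa using ih (l ++ [c]) r

end PlanarAlg

namespace PlanarAlgebra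

open PlanarAlg

variable {L : Type u} (P : PlanarAlgebra.{u, v} L)

/-- The box space `P_{α → β}`, of elements with `α` on the top and `β` on the bottom. -/
abbrev Mor (α β : Word L) : Type v := P.V (α ++ β.reverse)

/-- Transport along an equality of words. -/
def castV {a b : Word L} (h : a = b) (x : P.V a) : P.V b := h ▸ x

variable {P}

theorem box_castV {a b : Word L} (h : a = b) (x : P.V a) :
    Event.box (V := P.V) b (P.castV h x) = Event.box a x := by subst h; rfl

theorem castV_Z {a b : Word L} (h : a = b) (T : Tangle P.V a) :
    P.castV h (P.Z T) = P.Z ⟨T.layers, h ▸ T.reads⟩ := by subst h; rfl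

theorem castV_castV {a b c : Word L} (h : a = b) (k : b = c) (x : P.V a) :
    P.castV k (P.castV h x) = P.castV (h.trans k) x := by subst h k; rfl

theorem castV_rfl {a : Word L} (h : a = a) (x : P.V a) : P.castV h x = x := rfl

theorem castV_heq {a b : Word L} (h : a = b) (x : P.V a) : P.castV h x ≍ x := by subst h; rfl

/-- Replacing a rectangle filled with the value of a tangle by that tangle. -/
theorem Z_subst {α w : Word L} (S : Tangle P.V α) (T : Tangle P.V w)
    (pre post : List (Layer P.V)) (l r : Word L)
    (h : S.layers = pre ++ [⟨l, .box w (P.Z T), r⟩] ++ post) :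
    ∃ S' : Tangle P.V α, S'.layers = pre ++ T.layers.map (Layer.whisker l r) ++ post ∧
      P.Z S = P.Z S' := by
  have hS := S.reads
  rw [h] at hS
  obtain ⟨m, h1, h2⟩ := reads_append.1 hS
  obtain ⟨n, h0, h1⟩ := reads_append.1 h1
  obtain ⟨rfl, rfl⟩ := h1
  refine ⟨⟨_, (h0.append (T.reads.whisker l r)).append h2⟩, rfl, ?_⟩
  exact P.naturality _ _ T pre post l r h rfl

theorem Z_ext {α : Word L} (S T : Tangle P.V α) (h : S.layers = T.layers) : P.Z S = P.Z T := by
  cases S; cases T; cases h; rfl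

/-- Vertical composition: `x` above `y`. -/
def comp {α β γ : Word L} (x : P.Mor α β) (y : P.Mor β γ) : P.Mor α γ :=
  P.Z (Tangle.glue x y α β γ.reverse rfl rfl rfl)

variable (P) in
/-- The identity of `α`: vertical strings. -/
def one (α : Word L) : P.Mor α α := P.Z (Tangle.through α)

/-- Horizontal juxtaposition. -/
def tensor {α β γ δ : Word L} (x : P.Mor α β) (y : P.Mor γ δ) : P.Mor (α ++ γ) (β ++ δ) :=
  P.Z (Tangle.tensor x y)

/-- Rotation by a half turn. -/
def rotate {α β : Word L} (x : P.Mor α β) : P.Mor β.reverse α.reverse := P.Z (Tangle.rotate x)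

theorem add_comp {α β γ : Word L} (x x' : P.Mor α β) (y : P.Mor β γ) :
    comp (x + x') y = comp x y + comp x' y :=
  P.map_add x x' _ _ _ (caps α β.reverse γ.reverse) [⟨[], .box _ y, []⟩] [] _
    (by simp [Tangle.glue]; rfl) (by simp [Tangle.glue]) (by simp [Tangle.glue])

theorem comp_add {α β γ : Word L} (x : P.Mor α β) (y y' : P.Mor β γ) :
    comp x (y + y') = comp x y + comp x y' :=
  P.map_add y y' _ _ _ (caps α β.reverse γ.reverse ++ [⟨[], .box _ x, _⟩]) [] [] []
    (by simp [Tangle.glue]; rfl) (by simp [Tangle.glue]) (by simp [Tangle.glue])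

theorem smul_comp {α β γ : Word L} (z : ℂ) (x : P.Mor α β) (y : P.Mor β γ) :
    comp (z • x) y = z • comp x y :=
  P.map_smul z x _ _ (caps α β.reverse γ.reverse) [⟨[], .box _ y, []⟩] [] _
    (by simp [Tangle.glue]; rfl) (by simp [Tangle.glue])

theorem comp_smul {α β γ : Word L} (z : ℂ) (x : P.Mor α β) (y : P.Mor β γ) :
    comp x (z • y) = z • comp x y :=
  P.map_smul z y _ _ (caps α β.reverse γ.reverse ++ [⟨[], .box _ x, _⟩]) [] [] []
    (by simp [Tangle.glue]; rfl) (by simp [Tangle.glue])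

theorem comp_assoc {α β γ δ : Word L} (x : P.Mor α β) (y : P.Mor β γ) (z : P.Mor γ δ) :
    comp (comp x y) z = comp x (comp y z) := by
  obtain ⟨S, hS, e1⟩ := Z_subst (Tangle.glue (comp x y) z α γ δ.reverse rfl rfl rfl)
    (Tangle.glue x y α β γ.reverse rfl rfl rfl) (caps α γ.reverse δ.reverse)
    [⟨[], .box _ z, []⟩] [] (γ ++ δ.reverse) (by simp [Tangle.glue]; rfl)
  obtain ⟨T, hT, e2⟩ := Z_subst (Tangle.glue x (comp y z) α β δ.reverse rfl rfl rfl)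
    (Tangle.glue y z β γ δ.reverse rfl rfl rfl)
    (caps α β.reverse δ.reverse ++ [⟨[], .box _ x, β ++ δ.reverse⟩]) [] [] []
    (by simp [Tangle.glue]; rfl)
  refine e1.trans (Eq.trans ?_ e2.symm)
  refine Z_congr P S T ?_
  rw [hS, hT]
  have s1 := slide_block (V := P.V) [] [] δ.reverse
    (D := caps α β.reverse [] ++ [⟨[], .box (α ++ β.reverse) x, β⟩]) (a := α) (b := β)
    (Reads.append (b := α ++ β.reverse ++ β) (by simpa using reads_caps (V := P.V) α β.reverse [])
      (reads_box _ (by simp) (by simp)))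
    (E := caps [] γ.reverse []) (by simpa using reads_caps (V := P.V) [] γ.reverse [])
  have s2 := s1.symm.append_right (F := [⟨[], .box (β ++ γ.reverse) y, γ ++ δ.reverse⟩, ⟨[], .box (γ ++ δ.reverse) z, []⟩])
    (c := []) (by simp [Reads, Event.top, Event.bot])
  refine Deform.trans (Deform.of_eq ?_) ((by simpa using s2 : Deform _ _ _ _).trans (Deform.of_eq ?_))
  · simp [Tangle.glue, caps_whisker, Layer.whisker]
  · simp [Tangle.glue, caps_whisker, Layer.whisker]

theorem one_comp {α β : Word L} (x : P.Mor α β) : comp (P.one α) x = x := by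
  obtain ⟨S, hS, e1⟩ := Z_subst (Tangle.glue (P.one α) x α α β.reverse rfl rfl rfl)
    (Tangle.through α) (caps α α.reverse β.reverse)
    [⟨[], .box _ x, []⟩] [] (α ++ β.reverse) (by simp [Tangle.glue]; rfl)
  refine e1.trans (Eq.trans ?_ (P.Z_single x))
  refine Z_congr P S _ ?_
  rw [hS]
  have s := (zag (V := P.V) [] α β.reverse).append_right (F := [⟨[], .box (α ++ β.reverse) x, []⟩]) (c := [])
    (by simp [Reads, Event.top, Event.bot])
  refine Deform.trans (Deform.of_eq ?_) ((by simpa using s : Deform _ _ _ _).trans (Deform.of_eq ?_))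
  · simp [Tangle.through, cups_whisker]
  · simp [Tangle.single]

theorem comp_one {α β : Word L} (x : P.Mor α β) : comp x (P.one β) = x := by
  obtain ⟨S, hS, e1⟩ := Z_subst (Tangle.glue x (P.one β) α β β.reverse rfl rfl rfl)
    (Tangle.through β) (caps α β.reverse β.reverse ++ [⟨[], .box _ x, β ++ β.reverse⟩])
    [] [] [] (by simp [Tangle.glue]; rfl)
  refine e1.trans (Eq.trans ?_ (P.Z_single x))
  refine Z_congr P S _ ?_
  rw [hS]
  have s1 := slide_block (V := P.V) [] [] [] (D := [⟨[], .box _ x, []⟩])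
    (a := α ++ β.reverse) (b := []) (by simp [Reads, Event.top, Event.bot])
    (E := cups [] β []) (by simpa using reads_cups (V := P.V) [] β [])
  have s2 := s1.append_left (a := α ++ β.reverse) (F := caps α β.reverse β.reverse)
    (by simpa using reads_caps (V := P.V) α β.reverse β.reverse)
  have s3 := (zig (V := P.V) α β.reverse []).append_right (F := [⟨[], .box (α ++ β.reverse) x, []⟩]) (c := [])
    (by simp [Reads, Event.top, Event.bot])
  refine Deform.trans (Deform.of_eq ?_) (s2.trans ((Deform.of_eq ?_).trans
    ((by simpa using s3 : Deform _ _ _ _).trans (Deform.of_eq ?_))))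
  · simp [Tangle.through, cups_whisker, Layer.whisker]
  · simp [cups_whisker, Layer.whisker]
  · simp [Tangle.single]

theorem add_tensor {α β γ δ : Word L} (x x' : P.Mor α β) (y : P.Mor γ δ) :
    tensor (x + x') y = tensor x y + tensor x' y :=
  P.map_add x x' _ _ _ [⟨α, .box _ y, β.reverse⟩] [] [] []
    (by simp [Tangle.tensor]) (by simp [Tangle.tensor]) (by simp [Tangle.tensor])

theorem tensor_add {α β γ δ : Word L} (x : P.Mor α β) (y y' : P.Mor γ δ) :
    tensor x (y + y') = tensor x y + tensor x y' :=
  P.map_add y y' _ _ _ [] [⟨[], .box _ x, []⟩] α β.reverse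
    (by simp [Tangle.tensor]) (by simp [Tangle.tensor]) (by simp [Tangle.tensor])

theorem tensor_comp {α β ε γ δ ζ : Word L} (x : P.Mor α β) (x' : P.Mor β ε) (y : P.Mor γ δ)
    (y' : P.Mor δ ζ) : comp (tensor x y) (tensor x' y') = tensor (comp x x') (comp y y') := by
  obtain ⟨S₁, hS₁, e1⟩ := Z_subst
    (Tangle.glue (tensor x y) (tensor x' y') (α ++ γ) (β ++ δ) (ε ++ ζ).reverse rfl rfl rfl)
    (Tangle.tensor x y) (caps (α ++ γ) (β ++ δ).reverse (ε ++ ζ).reverse)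
    [⟨[], .box _ (tensor x' y'), []⟩] [] (β ++ δ ++ (ε ++ ζ).reverse) (by simp [Tangle.glue]; rfl)
  obtain ⟨S₂, hS₂, e2⟩ := Z_subst S₁ (Tangle.tensor x' y')
    (caps (α ++ γ) (β ++ δ).reverse (ε ++ ζ).reverse ++ (Tangle.tensor x y).layers.map
      (Layer.whisker [] (β ++ δ ++ (ε ++ ζ).reverse))) [] [] [] (by rw [hS₁]; simp; rfl)
  obtain ⟨T₁, hT₁, e3⟩ := Z_subst (Tangle.tensor (comp x x') (comp y y'))
    (Tangle.glue y y' γ δ ζ.reverse rfl rfl rfl) [] [⟨[], .box _ (comp x x'), []⟩] α ε.reverse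
    (by simp [Tangle.tensor]; rfl)
  obtain ⟨T₂, hT₂, e4⟩ := Z_subst T₁ (Tangle.glue x x' α β ε.reverse rfl rfl rfl)
    ((Tangle.glue (V := P.V) y y' γ δ ζ.reverse rfl rfl rfl).layers.map (Layer.whisker α ε.reverse)) []
    [] [] (by rw [hT₁]; simp; rfl)
  refine (e1.trans e2).trans (Eq.trans ?_ (e3.trans e4).symm)
  refine Z_congr P S₂ T₂ ?_
  rw [hS₂, hT₂]
  have s1 := (slide_block (V := P.V) α [] (δ ++ ζ.reverse ++ ε.reverse) (D := [⟨[], .box (γ ++ δ.reverse) y, []⟩])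
    (a := γ ++ δ.reverse) (b := []) (by simp [Reads, Event.top, Event.bot])
    (E := caps [] β.reverse []) (by simpa using reads_caps (V := P.V) [] β.reverse [])).symm
  have s2 := slide_block (V := P.V) [] [] ε.reverse
    (D := caps α β.reverse [] ++ [⟨[], .box (α ++ β.reverse) x, β⟩]) (a := α) (b := β)
    (Reads.append (b := α ++ β.reverse ++ β) (by simpa using reads_caps (V := P.V) α β.reverse [])
      (reads_box _ (by simp) (by simp)))
    (E := [⟨[], .box (δ ++ ζ.reverse) y', []⟩]) (c := δ ++ ζ.reverse) (d := [])
    (by simp [Reads, Event.top, Event.bot])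
  have s1' := (s1.append_left (F := caps (α ++ γ) δ.reverse (ζ.reverse ++ ε.reverse))
    (a := α ++ γ ++ (ζ.reverse ++ ε.reverse))
    (by simpa using reads_caps (V := P.V) (α ++ γ) δ.reverse (ζ.reverse ++ ε.reverse))).append_right
    (F := [⟨[], .box (α ++ β.reverse) x, β ++ δ ++ ζ.reverse ++ ε.reverse⟩,
      ⟨β, .box (δ ++ ζ.reverse) y', ε.reverse⟩, ⟨[], .box (β ++ ε.reverse) x', []⟩]) (c := []) (by simp [Reads, Event.top, Event.bot])
  have s2' := (s2.append_left (F := caps (α ++ γ) δ.reverse (ζ.reverse ++ ε.reverse) ++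
      [⟨α, .box (γ ++ δ.reverse) y, δ ++ ζ.reverse ++ ε.reverse⟩])
    (a := α ++ γ ++ (ζ.reverse ++ ε.reverse))
    (Reads.append (by simpa using reads_caps (V := P.V) (α ++ γ) δ.reverse (ζ.reverse ++ ε.reverse))
      (reads_box _ (by simp) (by simp)))).append_right
    (F := [⟨[], .box (β ++ ε.reverse) x', []⟩]) (c := []) (by simp [Reads, Event.top, Event.bot])
  refine Deform.trans (Deform.of_eq ?_) ((by simpa using s1' : Deform _ _ _ _).trans
    ((Deform.of_eq ?_).trans ((by simpa using s2' : Deform _ _ _ _).trans (Deform.of_eq ?_))))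
  · simp [Tangle.tensor, caps_append, caps_whisker, Layer.whisker]
  · simp [caps_whisker, Layer.whisker]
  · simp [Tangle.glue, caps_whisker, Layer.whisker]

theorem tensor_one (α γ : Word L) : tensor (P.one α) (P.one γ) = P.one (α ++ γ) := by
  obtain ⟨S₁, hS₁, e1⟩ := Z_subst (Tangle.tensor (P.one α) (P.one γ)) (Tangle.through γ)
    [] [⟨[], .box _ (P.one α), []⟩] α α.reverse (by simp [Tangle.tensor]; rfl)
  obtain ⟨S₂, hS₂, e2⟩ := Z_subst S₁ (Tangle.through α)
    ((Tangle.through γ).layers.map (Layer.whisker α α.reverse)) [] [] []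
    (by rw [hS₁]; simp; rfl)
  refine (e1.trans e2).trans (Z_ext _ _ ?_)
  rw [hS₂]
  simp [Tangle.through, cups_whisker, cups_append]

theorem rotate_add {α β : Word L} (x y : P.Mor α β) : rotate (x + y) = rotate x + rotate y :=
  P.map_add x y _ _ _ (caps (β.reverse ++ α) β.reverse []) (cups [] β.reverse []) β.reverse β
    (by simp [Tangle.rotate]) (by simp [Tangle.rotate]) (by simp [Tangle.rotate])

theorem rotate_comp {α β γ : Word L} (x : P.Mor α β) (y : P.Mor β γ) :
    rotate (comp x y) = comp (rotate y) (rotate x) := by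
  obtain ⟨S, hS, e1⟩ := Z_subst (Tangle.rotate (comp x y)) (Tangle.glue x y α β γ.reverse rfl rfl rfl)
    (caps (γ.reverse ++ α) γ.reverse []) (cups [] γ.reverse []) γ.reverse γ
    (by simp [Tangle.rotate]; rfl)
  obtain ⟨T₁, hT₁, e2⟩ := Z_subst
    (Tangle.glue (rotate y) (rotate x) γ.reverse β.reverse α.reverse.reverse rfl rfl rfl)
    (Tangle.rotate y) (caps γ.reverse β.reverse.reverse α.reverse.reverse)
    [⟨[], .box _ (rotate x), []⟩] [] (β.reverse ++ α.reverse.reverse) (by simp [Tangle.glue]; rfl)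
  obtain ⟨T₂, hT₂, e3⟩ := Z_subst T₁ (Tangle.rotate x)
    (caps γ.reverse β.reverse.reverse α.reverse.reverse ++ (Tangle.rotate y).layers.map
      (Layer.whisker [] (β.reverse ++ α.reverse.reverse))) [] [] [] (by rw [hT₁]; simp; rfl)
  refine e1.trans (Eq.trans ?_ (e2.trans e3).symm)
  refine Z_congr P S T₂ (Deform.symm ?_)
  rw [hS, hT₂]
  have hU : Reads (V := P.V) (caps (γ.reverse ++ β) γ.reverse [] ++ [⟨γ.reverse, .box (β ++ γ.reverse) y, γ⟩] ++
      cups [] γ.reverse []) (γ.reverse ++ β) [] := by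
    simpa [Tangle.rotate] using (Tangle.rotate y).reads
  have hW : Reads (V := P.V) (caps (β.reverse ++ α) β.reverse [] ++ [⟨β.reverse, .box (α ++ β.reverse) x, β⟩])
      (β.reverse ++ α) (β.reverse ++ β) :=
    Reads.append (b := β.reverse ++ (α ++ β.reverse) ++ β)
      (by simpa using reads_caps (V := P.V) (β.reverse ++ α) β.reverse [])
      (reads_box _ rfl (by simp))
  have hW' : Reads (V := P.V) (caps α β.reverse [] ++ [⟨[], .box (α ++ β.reverse) x, β⟩]) α β :=
    Reads.append (b := α ++ β.reverse ++ β) (by simpa using reads_caps (V := P.V) α β.reverse [])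
      (reads_box _ (by simp) (by simp))
  have hB : Reads (V := P.V) (cups [] β.reverse []) (β.reverse ++ β) [] := by
    simpa using reads_cups (V := P.V) [] β.reverse []
  have hC : Reads (V := P.V) (caps [] β []) [] (β ++ β.reverse) := by
    simpa using reads_caps (V := P.V) [] β []
  have hG : Reads (V := P.V) (caps [] γ.reverse []) [] (γ.reverse ++ γ) := by
    simpa using reads_caps (V := P.V) [] γ.reverse []
  have hC' : Reads (V := P.V) (caps γ.reverse β α) (γ.reverse ++ α)
      (γ.reverse ++ β ++ β.reverse ++ α) := by simpa using reads_caps (V := P.V) γ.reverse β α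
  have s1 := ((slide_block (V := P.V) [] [] [] hU hW).append_left (a := γ.reverse ++ α)
    (F := caps γ.reverse β α) (by simpa using hC')).append_right (c := [])
    (F := cups [] β.reverse []) (by simpa using hB)
  have s2 := (slide_block (V := P.V) [] [] [] hU hB).append_left (a := γ.reverse ++ α)
    (F := caps γ.reverse β α ++ (caps (V := P.V) (β.reverse ++ α) β.reverse [] ++
      [(⟨β.reverse, .box (α ++ β.reverse) x, β⟩ : Layer P.V)]).map (Layer.whisker (γ.reverse ++ β) []))
    (hC'.append (by simpa using hW.whisker (γ.reverse ++ β) []))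
  have hB' : Reads (V := P.V) (cups (γ.reverse ++ β) β.reverse [])
      (γ.reverse ++ β ++ β.reverse ++ β) (γ.reverse ++ β) := by
    simpa using reads_cups (V := P.V) (γ.reverse ++ β) β.reverse []
  have s3 := (slide_block (V := P.V) γ.reverse [] [] hC hW').append_right (c := [])
    (F := cups (γ.reverse ++ β) β.reverse [] ++ (caps (γ.reverse ++ β) γ.reverse [] ++
      [⟨γ.reverse, .box (β ++ γ.reverse) y, γ⟩] ++ cups [] γ.reverse []))
    (Reads.append (b := γ.reverse ++ β) (by simpa using hB') hU)
  have s4 := ((zig (V := P.V) γ.reverse β []).append_right (c := [])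
    (F := caps (γ.reverse ++ β) γ.reverse [] ++ [⟨γ.reverse, .box (β ++ γ.reverse) y, γ⟩] ++
      cups [] γ.reverse []) (by simpa using hU)).append_left (a := γ.reverse ++ α)
    (F := (caps (V := P.V) α β.reverse [] ++ [(⟨[], .box (α ++ β.reverse) x, β⟩ : Layer P.V)]).map
      (Layer.whisker γ.reverse [])) (by simpa using hW'.whisker γ.reverse [])
  have s5 := (slide_block (V := P.V) γ.reverse [] [] hW' hG).append_right (c := [])
    (F := [⟨γ.reverse, .box (β ++ γ.reverse) y, γ⟩] ++ cups [] γ.reverse [])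
    (Reads.append (b := γ.reverse ++ γ) (reads_box _ (by simp) (by simp))
      (by simpa using reads_cups (V := P.V) [] γ.reverse []))
  refine Deform.trans (Deform.of_eq ?_) (Deform.trans (by simpa using s1 : Deform _ _ _ _)
    (Deform.trans (Deform.of_eq ?_) (Deform.trans (by simpa using s2 : Deform _ _ _ _)
    (Deform.trans (Deform.of_eq ?_) (Deform.trans (by simpa using s3 : Deform _ _ _ _)
    (Deform.trans (Deform.of_eq ?_) (Deform.trans (by simpa using s4 : Deform _ _ _ _)
    (Deform.trans (Deform.of_eq ?_) (Deform.trans (by simpa using s5 : Deform _ _ _ _)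
    (Deform.of_eq ?_))))))))))
  all_goals simp [Tangle.rotate, Tangle.glue, caps_whisker, cups_whisker, Layer.whisker]

end PlanarAlgebra

namespace FactorPlanarAlgebra

open PlanarAlg PlanarAlgebra

variable {L : Type u} {P : FactorPlanarAlgebra.{u, v} L}

/-- The adjoint: reflection of the boxes which exchanges top and bottom. -/
def adj {α β : Word L} (x : P.Mor α β) : P.Mor β α := P.castV (by simp) (P.st x)

theorem box_adj {α β : Word L} (x : P.Mor α β) :
    Event.box (V := P.V) (β ++ α.reverse) (adj x) = Event.box _ (P.st x) := box_castV (P := P.toPlanarAlgebra) _ _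

theorem adj_Z {α β : Word L} (T : Tangle P.V (α ++ β.reverse)) :
    adj (P.Z T) = P.Z ⟨T.layers.map (Layer.mirror (V := P.V) fun _ => P.st), by
      simpa using Reads.mirror (V := P.V) (fun _ => P.st) T.reads⟩ := by
  rw [adj, P.st_Z, castV_Z]; rfl

theorem castV_add {a b : Word L} (h : a = b) (x y : P.V a) :
    P.castV h (x + y) = P.castV h x + P.castV h y := by subst h; rfl

theorem adj_add {α β : Word L} (x y : P.Mor α β) : adj (x + y) = adj x + adj y := by
  rw [adj, P.st_add, castV_add]; rfl

theorem adj_adj {α β : Word L} (x : P.Mor α β) : adj (adj x) = x := by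
  have key : ∀ {a b c : Word L} (h : a.reverse = b) (k : b.reverse = c) (e : a = c) (x : P.V a),
      P.castV k (P.st (P.castV h (P.st x))) = P.castV e x := by
    intro a b c h k e x
    subst h
    subst e
    exact eq_of_heq ((castV_heq _ _).trans (P.st_st x))
  exact key _ _ rfl x

theorem adj_comp {α β γ : Word L} (x : P.Mor α β) (y : P.Mor β γ) :
    adj (comp x y) = comp (adj y) (adj x) := by
  rw [comp, adj_Z]
  refine Z_congr P.toPlanarAlgebra _ _ ?_
  have s := (slide_block (V := P.V) [] [] [] (D := [⟨[], .box _ (P.st y), []⟩])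
    (a := γ ++ β.reverse) (b := []) (reads_box _ (by simp) (by simp))
    (E := [⟨[], .box _ (P.st x), []⟩])
    (c := β ++ α.reverse) (d := []) (reads_box _ (by simp) (by simp))).append_left
    (F := caps γ β.reverse α.reverse) (a := γ ++ α.reverse) (by simpa using reads_caps γ β.reverse α.reverse)
  refine Deform.trans (Deform.of_eq ?_) (Deform.trans (by simpa using s.symm : Deform _ _ _ _)
    (Deform.of_eq ?_))
  · simp [Tangle.glue, caps_mirror, Layer.mirror, Event.mirror, Layer.whisker]
  · simp [Tangle.glue, Layer.whisker, box_adj]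

theorem adj_one (α : Word L) : adj (P.one α) = P.one α := by
  rw [PlanarAlgebra.one, adj_Z]
  exact Z_ext _ _ (by simp [Tangle.through, cups_mirror])

theorem adj_tensor {α β γ δ : Word L} (x : P.Mor α β) (y : P.Mor γ δ) :
    adj (tensor x y) = tensor (adj x) (adj y) := by
  rw [PlanarAlgebra.tensor, adj_Z]
  refine Z_congr P.toPlanarAlgebra _ _ ?_
  exact Deform.of_eq (by simp [Tangle.tensor, Layer.mirror, Event.mirror, box_adj])

theorem rotate_adj {α β : Word L} (x : P.Mor α β) : rotate (adj x) = adj (rotate x) := by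
  rw [PlanarAlgebra.rotate, PlanarAlgebra.rotate, adj_Z]
  refine Z_congr P.toPlanarAlgebra _ _ ?_
  have h1 := (Tangle.rotate (V := P.V) (adj x)).reads
  have h2 : Reads (V := P.V) (caps [] β.reverse (α.reverse ++ β)) (α.reverse ++ β)
      (β.reverse ++ (β ++ α.reverse) ++ β) := by
    simpa using reads_caps (V := P.V) [] β.reverse (α.reverse ++ β)
  have h3 := h2.append (reads_box (V := P.V) (adj x) rfl rfl)
  have h4 := h3.append (c := []) (by simpa using reads_cups (V := P.V) [] β.reverse [])
  have s := Deform.of_move (a := α.reverse ++ β) (b := [])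
    (Move.turn (V := P.V) [] [] β α.reverse (adj x)) (by simpa [Tangle.rotate] using h1)
    (by simpa using h4)
  refine Deform.trans (Deform.of_eq ?_) (Deform.trans (by simpa using s) (Deform.of_eq ?_))
  · simp [Tangle.rotate]
  · simp [Tangle.rotate, caps_mirror, cups_mirror, Layer.mirror, Event.mirror, box_adj]

end FactorPlanarAlgebra

namespace PlanarAlgebra

open PlanarAlg

variable {L : Type u} {P : PlanarAlgebra.{u, v} L}

theorem castV_smul {a b : Word L} (h : a = b) (z : ℂ) (x : P.V a) :
    P.castV h (z • x) = z • P.castV h x := by subst h; rfl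

theorem tensor_assoc {α β γ δ ε ζ : Word L} (x : P.Mor α β) (y : P.Mor γ δ) (z : P.Mor ε ζ) :
    P.castV (by simp) (tensor (tensor x y) z) = tensor x (tensor y z) := by
  obtain ⟨S, hS, e1⟩ := Z_subst (Tangle.tensor (tensor x y) z) (Tangle.tensor x y)
    [⟨α ++ γ, .box _ z, (β ++ δ).reverse⟩] [] [] [] (by simp [Tangle.tensor]; rfl)
  obtain ⟨T, hT, e2⟩ := Z_subst (Tangle.tensor x (tensor y z)) (Tangle.tensor y z)
    [] [⟨[], .box _ x, []⟩] α β.reverse (by simp [Tangle.tensor]; rfl)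
  refine (congrArg _ e1).trans (Eq.trans ?_ e2.symm)
  rw [castV_Z]
  refine Z_ext _ _ ?_
  simp only [hS, hT]
  simp [Tangle.tensor, Layer.whisker]

theorem one_tensor {α β : Word L} (x : P.Mor α β) :
    P.castV (by simp) (tensor (P.one []) x) = x := by
  obtain ⟨S, hS, e1⟩ := Z_subst (Tangle.tensor (P.one []) x) (Tangle.through [])
    [⟨[], .box _ x, []⟩] [] [] [] (by simp [Tangle.tensor]; rfl)
  refine (congrArg _ e1).trans ?_
  rw [castV_Z]
  refine Eq.trans (Z_ext _ (Tangle.single x) ?_) (P.Z_single x)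
  simp only [hS]
  simp [Tangle.through, cups, Tangle.single]

theorem tensor_one_nil {α β : Word L} (x : P.Mor α β) :
    P.castV (by simp) (tensor x (P.one [])) = x := by
  obtain ⟨S, hS, e1⟩ := Z_subst (Tangle.tensor x (P.one [])) (Tangle.through [])
    [] [⟨[], .box _ x, []⟩] α β.reverse (by simp [Tangle.tensor]; rfl)
  refine (congrArg _ e1).trans ?_
  rw [castV_Z]
  refine Eq.trans (Z_ext _ (Tangle.single x) ?_) (P.Z_single x)
  simp only [hS]
  simp [Tangle.through, cups, Tangle.single]

variable (P) in
/-- Nested strings joining `α.reverse` to `α`, both on the top. -/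
def cup (α : Word L) : P.Mor (α.reverse ++ α) [] :=
  P.Z ⟨cups [] α.reverse [], by simpa using reads_cups (V := P.V) [] α.reverse []⟩

variable (P) in
/-- Nested strings joining `α` to `α.reverse`, both on the bottom. -/
def cap (α : Word L) : P.Mor [] (α ++ α.reverse) :=
  P.Z ⟨cups [] α [], by simpa using reads_cups (V := P.V) [] α []⟩

end PlanarAlgebra

/-- A projection `p ∈ P_{α → α}`. -/
structure Projection {L : Type u} (P : FactorPlanarAlgebra.{u, v} L) where
  word : PlanarAlg.Word L
  elt : P.Mor word word
  idem : PlanarAlgebra.comp elt elt = elt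
  selfAdj : FactorPlanarAlgebra.adj elt = elt

namespace Projection

open PlanarAlg PlanarAlgebra FactorPlanarAlgebra

variable {L : Type u} {P : FactorPlanarAlgebra.{u, v} L}

theorem ext_castV {p q : Projection P} (h : p.word = q.word)
    (e : P.castV (by rw [h]) p.elt = q.elt) : p = q := by
  obtain ⟨α, x, _, _⟩ := p
  obtain ⟨β, y, _, _⟩ := q
  obtain rfl : α = β := h
  obtain rfl : x = y := e
  rfl

/-- Juxtaposition of projections. -/
def tensor (p q : Projection P) : Projection P where
  word := p.word ++ q.word
  elt := PlanarAlgebra.tensor p.elt q.elt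
  idem := by rw [tensor_comp, p.idem, q.idem]
  selfAdj := by rw [adj_tensor, p.selfAdj, q.selfAdj]

variable (P) in
/-- The empty diagram. -/
def unit : Projection P where
  word := []
  elt := P.one []
  idem := one_comp _
  selfAdj := adj_one _

/-- Rotation of a projection by a half turn. -/
def dual (p : Projection P) : Projection P where
  word := p.word.reverse
  elt := rotate p.elt
  idem := by rw [← rotate_comp, p.idem]
  selfAdj := by rw [← rotate_adj, p.selfAdj]

theorem tensor_assoc (p q r : Projection P) : (p.tensor q).tensor r = p.tensor (q.tensor r) :=
  ext_castV (List.append_assoc _ _ _) (PlanarAlgebra.tensor_assoc p.elt q.elt r.elt)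

theorem unit_tensor (p : Projection P) : (unit P).tensor p = p :=
  ext_castV rfl (one_tensor p.elt)

theorem tensor_unit (p : Projection P) : p.tensor (unit P) = p :=
  ext_castV (List.append_nil _) (tensor_one_nil p.elt)

/-- The morphisms `q P_{α → β} p`. -/
def homs (p q : Projection P) : Submodule ℂ (P.Mor p.word q.word) where
  carrier := {x | comp (comp p.elt x) q.elt = x}
  add_mem' := by
    intro x y hx hy
    simp only [Set.mem_ofPred_eq] at *
    rw [comp_add, add_comp, hx, hy]
  zero_mem' := by
    have h := smul_comp (P := P.toPlanarAlgebra) 0 (comp p.elt (0 : P.Mor p.word q.word)) q.elt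
    have h' := comp_smul (P := P.toPlanarAlgebra) 0 p.elt (0 : P.Mor p.word q.word)
    simp only [zero_smul] at h h'
    simp [h', h]
  smul_mem' := by
    intro z x hx
    simp only [Set.mem_ofPred_eq] at *
    rw [comp_smul, smul_comp, hx]

theorem comp_left {p q : Projection P} (x : homs p q) : comp p.elt (x : P.Mor p.word q.word) = x := by
  conv_lhs => rw [← x.2]
  rw [← comp_assoc, ← comp_assoc, p.idem, x.2]

theorem comp_right {p q : Projection P} (x : homs p q) :
    comp (x : P.Mor p.word q.word) q.elt = x := by
  conv_lhs => rw [← x.2]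
  rw [comp_assoc, q.idem, x.2]

theorem mem_homs {p q : Projection P} (x : P.Mor p.word q.word) (h : comp p.elt x = x)
    (k : comp x q.elt = x) : x ∈ homs p q := by
  change comp (comp p.elt x) q.elt = x
  rw [h, k]

instance : Category (Projection P) where
  Hom p q := homs p q
  id p := ⟨p.elt, mem_homs _ p.idem p.idem⟩
  comp x y := ⟨comp x.1 y.1, mem_homs _ (by rw [← comp_assoc, comp_left])
    (by rw [comp_assoc, comp_right])⟩
  id_comp x := Subtype.ext (comp_left x)
  comp_id x := Subtype.ext (comp_right x)
  assoc x y z := Subtype.ext (comp_assoc x.1 y.1 z.1)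

instance : Preadditive (Projection P) where
  homGroup p q := inferInstanceAs (AddCommGroup (homs p q))
  add_comp _ _ _ x y z := Subtype.ext (PlanarAlgebra.add_comp x.1 y.1 z.1)
  comp_add _ _ _ x y z := Subtype.ext (PlanarAlgebra.comp_add x.1 y.1 z.1)

instance : Linear ℂ (Projection P) where
  homModule p q := inferInstanceAs (Module ℂ (homs p q))
  smul_comp _ _ _ z x y := Subtype.ext (PlanarAlgebra.smul_comp z x.1 y.1)
  comp_smul _ _ _ x z y := Subtype.ext (PlanarAlgebra.comp_smul z x.1 y.1)

/-- Juxtaposition of morphisms. -/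
def tensorMor {p q r s : Projection P} (x : p ⟶ q) (y : r ⟶ s) : p.tensor r ⟶ q.tensor s :=
  ⟨PlanarAlgebra.tensor x.1 y.1, mem_homs _
    (by simp only [tensor]; rw [tensor_comp, comp_left, comp_left])
    (by simp only [tensor]; rw [tensor_comp, comp_right, comp_right])⟩

/-- The tensor product of projections is strictly associative and unital; the coherence isomorphisms
are the identities. -/
instance : MonoidalCategoryStruct (Projection P) where
  tensorObj := tensor
  tensorUnit := unit P
  tensorHom x y := tensorMor x y
  whiskerLeft p _ _ x := tensorMor (𝟙 p) x
  whiskerRight x p := tensorMor x (𝟙 p)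
  associator p q r := eqToIso (tensor_assoc p q r)
  leftUnitor p := eqToIso (unit_tensor p)
  rightUnitor p := eqToIso (tensor_unit p)

end Projection

/-- Duals, evaluations, coevaluations and adjoints, as bare data. -/
class DualStarStruct (C : Type*) [Category C] [MonoidalCategoryStruct C] where
  dual : C → C
  dualHom : ∀ {X Y : C}, (X ⟶ Y) → (dual Y ⟶ dual X)
  ev : ∀ X : C, dual X ⊗ X ⟶ 𝟙_ C
  coev : ∀ X : C, 𝟙_ C ⟶ X ⊗ dual X
  adj : ∀ {X Y : C}, (X ⟶ Y) → (Y ⟶ X)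

namespace Projection

open PlanarAlg PlanarAlgebra FactorPlanarAlgebra

variable {L : Type u} {P : FactorPlanarAlgebra.{u, v} L}

/-- The cup of `p.word`, with the projections `p.dual` and `p` on top. -/
def evMor (p : Projection P) : p.dual.tensor p ⟶ unit P :=
  ⟨comp (PlanarAlgebra.tensor p.dual.elt p.elt) (P.cup p.word), mem_homs _
    ((comp_assoc _ _ _).symm.trans (congrArg (fun x => comp x _) (p.dual.tensor p).idem))
    (comp_one _)⟩

/-- The cap of `p.word`, with the projections `p` and `p.dual` underneath. -/
def coevMor (p : Projection P) : unit P ⟶ p.tensor p.dual :=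
  ⟨comp (P.cap p.word) (PlanarAlgebra.tensor p.elt p.dual.elt), mem_homs _ (one_comp _)
    ((comp_assoc _ _ _).trans (congrArg (fun x => comp _ x) (p.tensor p.dual).idem))⟩

instance : DualStarStruct (Projection P) where
  dual := dual
  dualHom x := ⟨rotate x.1, mem_homs _
    (by simp only [dual]; rw [← rotate_comp, comp_right])
    (by simp only [dual]; rw [← rotate_comp, comp_left])⟩
  ev := evMor
  coev := coevMor
  adj x := ⟨FactorPlanarAlgebra.adj x.1, mem_homs _
    (by rw [← comp_right x, adj_comp, ← comp_assoc, Projection.selfAdj, Projection.idem])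
    (by rw [← comp_left x, adj_comp, comp_assoc, Projection.selfAdj, Projection.idem])⟩

end Projection

/-! ### Finite direct sums: objects are finite families, morphisms are matrices -/

namespace MatSum

universe w z

variable {C : Type w} [Category.{z} C] [Preadditive C]

section Linear

variable [Linear ℂ C]

instance (X Y : Mat_ C) : Module ℂ (X ⟶ Y) :=
  inferInstanceAs <| Module ℂ (∀ i j, X.X i ⟶ Y.X j)

theorem smul_apply {X Y : Mat_ C} (a : ℂ) (f : X ⟶ Y) (i : X.ι) (j : Y.ι) :
    (a • f) i j = a • f i j := rfl

instance : Linear ℂ (Mat_ C) where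
  smul_comp X Y Z a f g := by
    ext i k
    simp only [Mat_.comp_apply, smul_apply, Linear.smul_comp, Finset.smul_sum]
  comp_smul X Y Z f a g := by
    ext i k
    simp only [Mat_.comp_apply, smul_apply, Linear.comp_smul, Finset.smul_sum]

end Linear

open Classical in
/-- The isomorphism of direct sums given by a bijection of the index sets and isomorphisms of the
corresponding summands. -/
def reindex {X Y : Mat_ C} (e : X.ι ≃ Y.ι) (f : ∀ i, X.X i ≅ Y.X (e i)) : X ≅ Y where
  hom := fun i j => if h : e i = j then (f i).hom ≫ eqToHom (congrArg Y.X h) else 0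
  inv := fun j i => if h : e i = j then eqToHom (congrArg Y.X h.symm) ≫ (f i).inv else 0
  hom_inv_id := by
    ext i k
    refine (Finset.sum_eq_single (e i) (fun j _ hj => ?_) (by simp)).trans ?_
    · exact (congrArg (fun x => x ≫ _) (dif_neg hj.symm)).trans Limits.zero_comp
    · by_cases h : i = k
      · subst h; simp
      · simp [h, Ne.symm h]
  inv_hom_id := by
    ext j l
    obtain ⟨k, rfl⟩ := e.surjective j
    obtain ⟨m, rfl⟩ := e.surjective l
    refine (Finset.sum_eq_single k (fun i _ hi => ?_) (by simp)).trans ?_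
    · exact (congrArg (fun x => x ≫ _) (dif_neg (by simpa using hi))).trans Limits.zero_comp
    · by_cases h : k = m
      · subst h; simp
      · simp [h]

variable [MonoidalCategoryStruct C]

/-- The tensor product, extended to direct sums and to matrices. -/
instance : MonoidalCategoryStruct (Mat_ C) where
  tensorObj X Y := ⟨X.ι × Y.ι, fun i => X.X i.1 ⊗ Y.X i.2⟩
  tensorUnit := ⟨Unit, fun _ => 𝟙_ C⟩
  tensorHom f g := fun i j => f i.1 j.1 ⊗ₘ g i.2 j.2
  whiskerLeft X _ _ g := fun i j => (𝟙 X : X ⟶ X) i.1 j.1 ⊗ₘ g i.2 j.2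
  whiskerRight f Y := fun i j => f i.1 j.1 ⊗ₘ (𝟙 Y : Y ⟶ Y) i.2 j.2
  associator X Y Z := reindex (Equiv.prodAssoc X.ι Y.ι Z.ι) fun i => α_ (X.X i.1.1) (Y.X i.1.2) (Z.X i.2)
  leftUnitor X := reindex (Equiv.punitProd X.ι) fun i => λ_ (X.X i.2)
  rightUnitor X := reindex (Equiv.prodPUnit X.ι) fun i => ρ_ (X.X i.1)

open Classical in
/-- Duality and adjoints, extended to direct sums and to matrices. -/
instance [DualStarStruct C] : DualStarStruct (Mat_ C) where
  dual X := ⟨X.ι, fun i => DualStarStruct.dual (X.X i)⟩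
  dualHom f := fun j i => DualStarStruct.dualHom (f i j)
  ev X := fun i _ => if h : i.1 = i.2 then
    eqToHom (congrArg (fun k => DualStarStruct.dual (X.X k) ⊗ X.X i.2) h) ≫
      DualStarStruct.ev (X.X i.2) else 0
  coev X := fun _ i => if h : i.2 = i.1 then
    DualStarStruct.coev (X.X i.1) ≫
      eqToHom (congrArg (fun k => X.X i.1 ⊗ DualStarStruct.dual (X.X k)) h.symm) else 0
  adj f := fun j i => DualStarStruct.adj (f i j)

end MatSum

/-- The category `Pro` of a factor planar algebra: objects are the finite formal direct sums of
projections, morphisms are matrices of elements of the spaces `q P_{α → β} p`. -/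
abbrev Pro {L : Type u} (P : FactorPlanarAlgebra.{u, v} L) := Mat_ (Projection P)
/-! ### Hilbert spaces -/

namespace FactorPlanarAlgebra

open PlanarAlg PlanarAlgebra

variable {L : Type u} {P : FactorPlanarAlgebra.{u, v} L}

/-- The number represented by a closed diagram. -/
def scalar (x : P.V []) : ℂ := (P.evaluable x).choose

theorem scalar_spec (x : P.V []) : x = scalar x • P.Z Tangle.empty :=
  (P.evaluable x).choose_spec.1

theorem scalar_eq {x : P.V []} {z : ℂ} (h : x = z • P.Z Tangle.empty) : scalar x = z :=
  ((P.evaluable x).choose_spec.2 z h).symm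

theorem scalar_add (x y : P.V []) : scalar (x + y) = scalar x + scalar y :=
  scalar_eq (by rw [add_smul, ← scalar_spec, ← scalar_spec])

theorem scalar_smul (z : ℂ) (x : P.V []) : scalar (z • x) = z * scalar x :=
  scalar_eq (by rw [mul_smul, ← scalar_spec])

theorem st_empty : P.st (P.Z Tangle.empty) = P.Z (Tangle.empty (V := P.V)) := P.st_Z _

/-- The inner product of the box space of `α`: all strings of `y` are joined to the reflection of
`x`. -/
def innerV {α : Word L} (x y : P.V α) : ℂ := scalar (P.Z (Tangle.pair y (P.st x)))

theorem pair_add_left {α : Word L} (x x' : P.V α) (y : P.V α.reverse) :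
    P.Z (Tangle.pair (x + x') y) = P.Z (Tangle.pair x y) + P.Z (Tangle.pair x' y) :=
  P.map_add x x' _ _ _ (caps [] α.reverse.reverse []) [⟨[], .box _ y, []⟩] [] _
    (by simp [Tangle.pair, Tangle.glue]; rfl) (by simp [Tangle.pair, Tangle.glue])
    (by simp [Tangle.pair, Tangle.glue])

theorem pair_add_right {α : Word L} (x : P.V α) (y y' : P.V α.reverse) :
    P.Z (Tangle.pair x (y + y')) = P.Z (Tangle.pair x y) + P.Z (Tangle.pair x y') :=
  P.map_add y y' _ _ _ (caps [] α.reverse.reverse [] ++ [⟨[], .box _ x, _⟩]) [] [] []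
    (by simp [Tangle.pair, Tangle.glue]; rfl) (by simp [Tangle.pair, Tangle.glue])
    (by simp [Tangle.pair, Tangle.glue])

theorem pair_smul_right {α : Word L} (z : ℂ) (x : P.V α) (y : P.V α.reverse) :
    P.Z (Tangle.pair x (z • y)) = z • P.Z (Tangle.pair x y) :=
  P.map_smul z y _ _ (caps [] α.reverse.reverse [] ++ [⟨[], .box _ x, _⟩]) [] [] []
    (by simp [Tangle.pair, Tangle.glue]; rfl) (by simp [Tangle.pair, Tangle.glue])

theorem st_pair {α : Word L} (x y : P.V α) :
    P.st (P.Z (Tangle.pair x (P.st y))) = P.Z (Tangle.pair y (P.st x)) := by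
  have hb : Event.box (V := P.V) _ (P.st (P.st y)) = Event.box α y := by
    have h := P.st_st y
    revert h
    generalize P.st (P.st y) = w
    revert w
    rw [List.reverse_reverse]
    rintro w rfl
    rfl
  rw [P.st_Z]
  refine Z_congr P.toPlanarAlgebra _ _ ?_
  have s := (slide_block (V := P.V) [] [] [] (D := [⟨[], .box _ y, []⟩])
    (a := α) (b := []) (reads_box _ (by simp) (by simp))
    (E := [⟨[], .box _ (P.st x), []⟩])
    (c := α.reverse) (d := []) (reads_box _ (by simp) (by simp))).append_left
    (F := caps [] α []) (a := []) (by simpa using reads_caps [] α [])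
  refine Deform.trans (Deform.of_eq ?_) (Deform.trans (by simpa using s.symm : Deform _ _ _ _)
    (Deform.of_eq ?_))
  · simp only [Tangle.pair, Tangle.mirror, Tangle.glue, List.map_append, List.map_cons, Layer.mirror,
      Event.mirror, hb, caps_mirror]
    simp [Layer.whisker]
  · simp [Tangle.pair, Tangle.glue, Layer.whisker]

theorem innerV_self {α : Word L} (x : P.V α) (h : x ≠ 0) : ∃ t : ℝ, 0 < t ∧ innerV x x = t := by
  obtain ⟨t, ht, e⟩ := P.positive x h
  exact ⟨t, ht, scalar_eq e⟩

theorem innerV_add_left {α : Word L} (x y z : P.V α) : innerV (x + y) z = innerV x z + innerV y z := by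
  rw [innerV, P.st_add, pair_add_right, scalar_add]; rfl

theorem innerV_smul_left {α : Word L} (x y : P.V α) (r : ℂ) :
    innerV (r • x) y = (starRingEnd ℂ) r * innerV x y := by
  rw [innerV, P.st_smul, pair_smul_right, scalar_smul]; rfl

theorem innerV_zero_left {α : Word L} (x : P.V α) : innerV 0 x = 0 := by
  simpa using innerV_smul_left (0 : P.V α) x 0

/-- The positive definite inner product of a box space. -/
abbrev core (P : FactorPlanarAlgebra.{u, v} L) (α : Word L) : InnerProductSpace.Core ℂ (P.V α) where
  inner x y := innerV x y
  conj_inner_symm x y := by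
    refine (scalar_eq ?_).symm
    rw [← st_pair]
    conv_lhs => rw [scalar_spec (P.Z (Tangle.pair x (P.st y))), P.st_smul, st_empty]
    rfl
  re_inner_nonneg x := by
    by_cases h : x = 0
    · rw [h, innerV_zero_left]; simp
    · obtain ⟨t, ht, e⟩ := innerV_self x h
      rw [e]; exact ht.le
  add_left := innerV_add_left
  smul_left := innerV_smul_left
  definite x hx := by
    by_contra h
    obtain ⟨t, ht, e⟩ := innerV_self x h
    exact ht.ne' (by exact_mod_cast e.symm.trans hx)

instance (α : Word L) : NormedAddCommGroup (P.V α) :=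
  @InnerProductSpace.Core.toNormedAddCommGroup ℂ (P.V α) _ _ _ (P.core α)

instance (α : Word L) : InnerProductSpace ℂ (P.V α) := InnerProductSpace.ofCore (P.core α).toCore

instance (α : Word L) : FiniteDimensional ℂ (P.V α) := P.finiteDimensional α

end FactorPlanarAlgebra

namespace Projection

open PlanarAlg PlanarAlgebra FactorPlanarAlgebra

variable {L : Type u} {P : FactorPlanarAlgebra.{u, v} L}

/-- The part of degree `γ` of the bimodule of `p`: the elements `ξ ∈ P_{γ → α}` with `p` on the bottom
absorbed. -/
def fibre (p : Projection P) (γ : Word L) : Submodule ℂ (P.V (γ ++ p.word.reverse)) where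
  carrier := {ξ | comp (α := γ) ξ p.elt = ξ}
  add_mem' := by
    intro x y hx hy
    simp only [Set.mem_ofPred_eq] at *
    exact (PlanarAlgebra.add_comp _ _ _).trans (by rw [hx, hy])
  zero_mem' := by
    have h := PlanarAlgebra.smul_comp (P := P.toPlanarAlgebra) (α := γ) 0 0 p.elt
    simp only [zero_smul] at h
    exact h
  smul_mem' := by
    intro z x hx
    simp only [Set.mem_ofPred_eq] at *
    exact (PlanarAlgebra.smul_comp _ _ _).trans (by rw [hx])

instance (p : Projection P) (γ : Word L) : CompleteSpace (p.fibre γ) := FiniteDimensional.complete ℂ _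

/-- The Hilbert space `H_p`, the orthogonal sum of its parts of degree `γ` over all words `γ`. -/
abbrev H (p : Projection P) : Type (max u v) := lp (fun γ => p.fibre γ) 2

end Projection

namespace FactorPlanarAlgebra

open PlanarAlg PlanarAlgebra Projection

variable {L : Type u} {P : FactorPlanarAlgebra.{u, v} L}

/-- The word obtained from `a ++ b` by cancelling `k` letters between `a` and `b`. -/
def cancel (k : ℕ) (a b : Word L) : Word L := a.take (a.length - k) ++ b.drop k

/-- `k` letters can be cancelled between `a` and `b`. -/
def Cancels (k : ℕ) (a b : Word L) : Prop :=
  k ≤ b.length ∧ a = a.take (a.length - k) ++ (b.take k).reverse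

open Classical in
/-- The component in degree `τ` of the product `x ⋆ ξ`: `x` stands to the left of `ξ`, and the last
`k` of its strings are joined to the first `k` of the strings `γ` of `ξ`, for all possible `k`. -/
def leftMul {σ γ t : Word L} (x : P.V σ) (ξ : P.V (γ ++ t)) (τ : Word L) : P.V (τ ++ t) :=
  ∑ k ∈ Finset.range (γ.length + 1), if h : Cancels k σ γ ∧ τ = cancel k σ γ then
    P.Z (Tangle.glue x ξ (σ.take (σ.length - k)) (γ.take k) (γ.drop k ++ t) h.1.2
      (by rw [← List.append_assoc, List.take_append_drop])
      (by rw [h.2, cancel, List.append_assoc])) else 0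

open Classical in
/-- The component in degree `τ` of the product `ξ ⋆ x`: `x` stands to the right of the strings `γ` of
`ξ`, and its first `k` strings are joined to the last `k` of them, for all possible `k`. -/
def rightMul {γ t σ : Word L} (ξ : P.V (γ ++ t)) (x : P.V σ) (τ : Word L) : P.V (τ ++ t) :=
  ∑ k ∈ Finset.range (σ.length + 1), if h : Cancels k γ σ ∧ τ = cancel k γ σ then
    P.Z (Tangle.insert ξ x (γ.take (γ.length - k)) (σ.take k).reverse (σ.drop k) t
      (congrArg (· ++ t) h.1.2) (by rw [List.reverse_reverse, List.take_append_drop])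
      (by rw [h.2, cancel])) else 0

open Classical in
/-- The vector of the fibre of degree `γ`, as an element of `H_p`. -/
def vec (p : Projection P) {γ : Word L} (ξ : p.fibre γ) : p.H := lp.single 2 γ ξ

/-- `T` is the bounded operator of left multiplication by `x` on `H_p`. -/
def IsLeftMul (p : Projection P) {σ : Word L} (x : P.V σ) (T : p.H →L[ℂ] p.H) : Prop :=
  ∀ (γ : Word L) (ξ : p.fibre γ) (τ : Word L),
    (T (vec p ξ) τ : P.V (τ ++ p.word.reverse)) = leftMul x (ξ : P.V (γ ++ p.word.reverse)) τ

/-- `T` is the bounded operator of right multiplication by `x` on `H_p`. -/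
def IsRightMul (p : Projection P) {σ : Word L} (x : P.V σ) (T : p.H →L[ℂ] p.H) : Prop :=
  ∀ (γ : Word L) (ξ : p.fibre γ) (τ : Word L),
    (T (vec p ξ) τ : P.V (τ ++ p.word.reverse)) = rightMul (ξ : P.V (γ ++ p.word.reverse)) x τ

/-- The Hilbert space `L²(M) = H_∅`. -/
abbrev L2 (P : FactorPlanarAlgebra.{u, v} L) : Type (max u v) := (Projection.unit P).H

/-- The vacuum vector: the empty diagram. -/
def vacuum (P : FactorPlanarAlgebra.{u, v} L) : P.L2 :=
  vec (Projection.unit P) (γ := []) ⟨P.one [], one_comp _⟩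

/-- The von Neumann algebra `M` generated by the operators of left multiplication on `L²(M)`. -/
def M (P : FactorPlanarAlgebra.{u, v} L) : VonNeumannAlgebra P.L2 where
  toStarSubalgebra := StarSubalgebra.centralizer ℂ (StarSubalgebra.centralizer ℂ
    {T : P.L2 →L[ℂ] P.L2 | ∃ (σ : Word L) (x : P.V σ), IsLeftMul (Projection.unit P) x T} :
      Set (P.L2 →L[ℂ] P.L2))
  centralizer_centralizer' := by
    change Set.centralizer (Set.centralizer (Set.centralizer _)) = Set.centralizer _
    exact Set.centralizer_centralizer_centralizer _

/-- Bounded operators `L²(M) → H_p` commuting with left multiplications. -/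
def IsLeftModuleMap (p : Projection P) (R : P.L2 →L[ℂ] p.H) : Prop :=
  ∀ (σ : Word L) (x : P.V σ) (S : P.L2 →L[ℂ] P.L2) (T : p.H →L[ℂ] p.H),
    IsLeftMul (Projection.unit P) x S → IsLeftMul p x T → R ∘L S = T ∘L R

/-- Bounded operators `L²(M) → H_p` commuting with right multiplications. -/
def IsRightModuleMap (p : Projection P) (R : P.L2 →L[ℂ] p.H) : Prop :=
  ∀ (σ : Word L) (x : P.V σ) (S : P.L2 →L[ℂ] P.L2) (T : p.H →L[ℂ] p.H),
    IsRightMul (Projection.unit P) x S → IsRightMul p x T → R ∘L S = T ∘L R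

open Classical in
/-- The left action of `m ∈ M` on `H_p`: it sends a left bounded vector `R Ω` to `R (m Ω)`.  On
left multiplications it is left multiplication. -/
def leftAction (p : Projection P) (m : P.M) : p.H →L[ℂ] p.H :=
  if h : ∃ T : p.H →L[ℂ] p.H, ∀ R : P.L2 →L[ℂ] p.H, IsLeftModuleMap p R →
    T (R P.vacuum) = R ((m : P.L2 →L[ℂ] P.L2) P.vacuum) then h.choose else 0

open Classical in
/-- The right action of `m ∈ M` on `H_p`: it sends a right bounded vector `R Ω` to `R (m Ω)`. -/
def rightAction (p : Projection P) (m : P.M) : p.H →L[ℂ] p.H :=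
  if h : ∃ T : p.H →L[ℂ] p.H, ∀ R : P.L2 →L[ℂ] p.H, IsRightModuleMap p R →
    T (R P.vacuum) = R ((m : P.L2 →L[ℂ] P.L2) P.vacuum) then h.choose else 0

end FactorPlanarAlgebra

/-- A Hilbert space with operators indexed by `M`, as bare data. -/
structure PreBimodule {L : Type u} (P : FactorPlanarAlgebra.{u, v} L) where
  carrier : Type (max u v)
  [normedAddCommGroup : NormedAddCommGroup carrier]
  [innerProductSpace : InnerProductSpace ℂ carrier]
  [completeSpace : CompleteSpace carrier]
  left : P.M → carrier →L[ℂ] carrier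
  right : P.M → carrier →L[ℂ] carrier

attribute [instance] PreBimodule.normedAddCommGroup PreBimodule.innerProductSpace
  PreBimodule.completeSpace

open scoped Topology in
/-- The laws of an `M`-`M` bimodule: commuting normal unital `*`-representations of `M` and of the
opposite algebra of `M`. -/
structure PreBimodule.IsBimodule {L : Type u} {P : FactorPlanarAlgebra.{u, v} L}
    (B : PreBimodule P) : Prop where
  left_one : B.left 1 = 1
  left_mul : ∀ m n, B.left (m * n) = B.left m * B.left n
  left_add : ∀ m n, B.left (m + n) = B.left m + B.left n
  left_smul : ∀ (z : ℂ) (m n : P.M), (n : P.L2 →L[ℂ] P.L2) = z • (m : P.L2 →L[ℂ] P.L2) →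
    B.left n = z • B.left m
  left_star : ∀ m, B.left (star m) = star (B.left m)
  right_one : B.right 1 = 1
  right_mul : ∀ m n, B.right (m * n) = B.right n * B.right m
  right_add : ∀ m n, B.right (m + n) = B.right m + B.right n
  right_smul : ∀ (z : ℂ) (m n : P.M), (n : P.L2 →L[ℂ] P.L2) = z • (m : P.L2 →L[ℂ] P.L2) →
    B.right n = z • B.right m
  right_star : ∀ m, B.right (star m) = star (B.right m)
  commute : ∀ m n, B.left m * B.right n = B.right n * B.left m
  /-- On bounded sets both actions are continuous for the weak operator topologies. -/
  normal : ∀ (l : Filter P.M) (m : P.M),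
    (∀ᶠ n : P.M in l, ‖(n : P.L2 →L[ℂ] P.L2)‖ ≤ 1) →
    (∀ ξ η : P.L2, Filter.Tendsto (fun n : P.M => inner ℂ ξ ((n : P.L2 →L[ℂ] P.L2) η)) l
      (𝓝 (inner ℂ ξ ((m : P.L2 →L[ℂ] P.L2) η)))) →
    ∀ ξ η : B.carrier,
      Filter.Tendsto (fun n : P.M => inner ℂ ξ (B.left n η)) l (𝓝 (inner ℂ ξ (B.left m η))) ∧
      Filter.Tendsto (fun n : P.M => inner ℂ ξ (B.right n η)) l (𝓝 (inner ℂ ξ (B.right m η)))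

/-- The bimodule `H_p`. -/
def Projection.bimodule {L : Type u} {P : FactorPlanarAlgebra.{u, v} L} (p : Projection P) :
    PreBimodule P where
  carrier := p.H
  left := FactorPlanarAlgebra.leftAction p
  right := FactorPlanarAlgebra.rightAction p

/-- The orthogonal direct sum of finitely many bimodules, with the diagonal actions. -/
def PreBimodule.directSum {L : Type u} {P : FactorPlanarAlgebra.{u, v} L} {ι : Type} [Fintype ι]
    (B : ι → PreBimodule P) : PreBimodule P where
  carrier := PiLp 2 fun i => (B i).carrier
  left m := (PiLp.continuousLinearEquiv 2 ℂ fun i => (B i).carrier).symm.toContinuousLinearMap ∘L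
    ContinuousLinearMap.piMap (fun i => (B i).left m) ∘L
      (PiLp.continuousLinearEquiv 2 ℂ fun i => (B i).carrier).toContinuousLinearMap
  right m := (PiLp.continuousLinearEquiv 2 ℂ fun i => (B i).carrier).symm.toContinuousLinearMap ∘L
    ContinuousLinearMap.piMap (fun i => (B i).right m) ∘L
      (PiLp.continuousLinearEquiv 2 ℂ fun i => (B i).carrier).toContinuousLinearMap

/-- A bimodule of the form `H_p`, with the projection `p`. -/
structure ProjectionBimodule {L : Type u} (P : FactorPlanarAlgebra.{u, v} L) where
  bimodule : PreBimodule P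
  proj : Projection P
  eq : bimodule = proj.bimodule

namespace ProjectionBimodule

variable {L : Type u} {P : FactorPlanarAlgebra.{u, v} L}

/-- The bimodule `H_p`. -/
def of (p : Projection P) : ProjectionBimodule P := ⟨p.bimodule, p, rfl⟩

theorem ext_proj {X Y : ProjectionBimodule P} (h : X.proj = Y.proj) : X = Y := by
  obtain ⟨_, p, rfl⟩ := X
  obtain ⟨_, q, rfl⟩ := Y
  obtain rfl : p = q := h
  rfl

/-- The morphisms `H_p → H_q` are the elements of `q P_{α → β} p`. -/
instance : Category (ProjectionBimodule P) where
  Hom X Y := X.proj ⟶ Y.proj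
  id X := 𝟙 X.proj
  comp x y := CategoryStruct.comp (obj := Projection P) x y
  id_comp x := Category.id_comp (obj := Projection P) x
  comp_id x := Category.comp_id (obj := Projection P) x
  assoc x y z := Category.assoc (obj := Projection P) x y z

instance : Preadditive (ProjectionBimodule P) where
  homGroup X Y := inferInstanceAs (AddCommGroup (X.proj ⟶ Y.proj))
  add_comp X Y Z := Preadditive.add_comp X.proj Y.proj Z.proj
  comp_add X Y Z := Preadditive.comp_add X.proj Y.proj Z.proj

instance : Linear ℂ (ProjectionBimodule P) where
  homModule X Y := inferInstanceAs (Module ℂ (X.proj ⟶ Y.proj))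
  smul_comp X Y Z := Linear.smul_comp X.proj Y.proj Z.proj
  comp_smul X Y Z := Linear.comp_smul X.proj Y.proj Z.proj

/-- `H_p ⊗ H_q = H_{p ⊗ q}`, which is strictly associative and unital. -/
instance : MonoidalCategoryStruct (ProjectionBimodule P) where
  tensorObj X Y := of (X.proj.tensor Y.proj)
  tensorUnit := of (Projection.unit P)
  tensorHom x y := Projection.tensorMor x y
  whiskerLeft X _ _ x := Projection.tensorMor (𝟙 X.proj) x
  whiskerRight x X := Projection.tensorMor x (𝟙 X.proj)
  associator X Y Z := eqToIso (ext_proj (Projection.tensor_assoc X.proj Y.proj Z.proj))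
  leftUnitor X := eqToIso (ext_proj (Projection.unit_tensor X.proj))
  rightUnitor X := eqToIso (ext_proj (Projection.tensor_unit X.proj))

/-- The dual of `H_p` is `H_q` for `q = p.dual`. -/
instance : DualStarStruct (ProjectionBimodule P) where
  dual X := of X.proj.dual
  dualHom {X Y} x := DualStarStruct.dualHom (C := Projection P) (X := X.proj) (Y := Y.proj) x
  ev X := X.proj.evMor
  coev X := X.proj.coevMor
  adj {X Y} x := DualStarStruct.adj (C := Projection P) (X := X.proj) (Y := Y.proj) x

end ProjectionBimodule

/-- The category `Bim` of a factor planar algebra: objects are the finite direct sums of the bimodules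
`H_p`, morphisms are matrices of elements of the spaces `q P_{α → β} p`. -/
abbrev Bim {L : Type u} (P : FactorPlanarAlgebra.{u, v} L) := Mat_ (ProjectionBimodule P)

/-- The underlying bimodule of an object of `Bim`. -/
def Bim.bimodule {L : Type u} {P : FactorPlanarAlgebra.{u, v} L} (X : Bim P) : PreBimodule P :=
  PreBimodule.directSum fun i => (X.X i).bimodule

/-- `p ↦ H_p`, the identity on morphisms. -/
def projectionToBimodule {L : Type u} (P : FactorPlanarAlgebra.{u, v} L) :
    Projection P ⥤ ProjectionBimodule P where
  obj p := ProjectionBimodule.of p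
  map x := x

instance {L : Type u} (P : FactorPlanarAlgebra.{u, v} L) : (projectionToBimodule P).Additive where

/-- The functor from `Pro` to `Bim` given by `p ↦ H_p`, extended to direct sums, and by the identity on
morphisms. -/
def proToBim {L : Type u} (P : FactorPlanarAlgebra.{u, v} L) : Pro P ⥤ Bim P :=
  (projectionToBimodule P).mapMat_
/-! ### Rigid C*-tensor categories and their equivalences -/

open DualStarStruct in
/-- A morphism `u` with `u* u = 1` and `u u* = 1`. -/
def IsUnitary {C : Type*} [Category C] [MonoidalCategoryStruct C] [DualStarStruct C] {X Y : C}
    (u : X ⟶ Y) : Prop := u ≫ adj u = 𝟙 X ∧ adj u ≫ u = 𝟙 Y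

open DualStarStruct in
/-- The axioms of a rigid C*-tensor category: a pivotal, spherical, unitary, rigid, semisimple,
abelian, linear monoidal category with simple unit object. -/
structure IsRigidCStarTensorCategory (C : Type*) [Category C] [Preadditive C] [Linear ℂ C]
    [MonoidalCategoryStruct C] [DualStarStruct C] : Prop where
  monoidal : ∃ M : MonoidalCategory C,
    M.toMonoidalCategoryStruct = (inferInstance : MonoidalCategoryStruct C)
  abelian : ∃ A : Abelian C, A.toPreadditive = (inferInstance : Preadditive C)
  finiteDimensional : ∀ X Y : C, FiniteDimensional ℂ (X ⟶ Y)
  add_tensor : ∀ {W X Y Z : C} (f f' : W ⟶ X) (g : Y ⟶ Z), (f + f') ⊗ₘ g = f ⊗ₘ g + f' ⊗ₘ g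
  tensor_add : ∀ {W X Y Z : C} (f : W ⟶ X) (g g' : Y ⟶ Z), f ⊗ₘ (g + g') = f ⊗ₘ g + f ⊗ₘ g'
  smul_tensor : ∀ {W X Y Z : C} (z : ℂ) (f : W ⟶ X) (g : Y ⟶ Z), (z • f) ⊗ₘ g = z • (f ⊗ₘ g)
  tensor_smul : ∀ {W X Y Z : C} (z : ℂ) (f : W ⟶ X) (g : Y ⟶ Z), f ⊗ₘ (z • g) = z • (f ⊗ₘ g)
  /-- `End 1 ≅ ℂ`. -/
  end_unit : ∀ f : 𝟙_ C ⟶ 𝟙_ C, ∃! z : ℂ, f = z • 𝟙 (𝟙_ C)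
  /-- Every object is a finite orthogonal direct sum of simple objects. -/
  semisimple : ∀ X : C, ∃ (n : ℕ) (S : Fin n → C) (i : ∀ k, S k ⟶ X),
    (∀ k, Module.finrank ℂ (S k ⟶ S k) = 1) ∧ (∀ k, i k ≫ adj (i k) = 𝟙 (S k)) ∧
      (∀ k l, k ≠ l → i k ≫ adj (i l) = 0) ∧ ∑ k, adj (i k) ≫ i k = 𝟙 X
  adj_add : ∀ {X Y : C} (f g : X ⟶ Y), adj (f + g) = adj f + adj g
  adj_smul : ∀ {X Y : C} (z : ℂ) (f : X ⟶ Y), adj (z • f) = (starRingEnd ℂ) z • adj f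
  adj_adj : ∀ {X Y : C} (f : X ⟶ Y), adj (adj f) = f
  adj_id : ∀ X : C, adj (𝟙 X) = 𝟙 X
  adj_comp : ∀ {X Y Z : C} (f : X ⟶ Y) (g : Y ⟶ Z), adj (f ≫ g) = adj g ≫ adj f
  positive : ∀ {X Y : C} (f : X ⟶ Y), f ≫ adj f = 0 → f = 0
  adj_tensor : ∀ {W X Y Z : C} (f : W ⟶ X) (g : Y ⟶ Z), adj (f ⊗ₘ g) = adj f ⊗ₘ adj g
  associator_unitary : ∀ X Y Z : C, IsUnitary (α_ X Y Z).hom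
  leftUnitor_unitary : ∀ X : C, IsUnitary (λ_ X).hom
  rightUnitor_unitary : ∀ X : C, IsUnitary (ρ_ X).hom
  zigzag : ∀ X : C, coev X ▷ X ≫ (α_ X (dual X) X).hom ≫ X ◁ ev X = (λ_ X).hom ≫ (ρ_ X).inv
  zagzig : ∀ X : C, dual X ◁ coev X ≫ (α_ (dual X) X (dual X)).inv ≫ ev X ▷ dual X =
    (ρ_ (dual X)).hom ≫ (λ_ (dual X)).inv
  /-- Pivotality: both rotations of a morphism by a half turn are the dual morphism. -/
  dualHom_eq : ∀ {X Y : C} (f : X ⟶ Y), dualHom f =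
    (ρ_ (dual Y)).inv ≫ dual Y ◁ coev X ≫ dual Y ◁ (f ▷ dual X) ≫
      (α_ (dual Y) Y (dual X)).inv ≫ ev Y ▷ dual X ≫ (λ_ (dual X)).hom
  dualHom_eq_left : ∀ {X Y : C} (f : X ⟶ Y), dualHom f =
    (λ_ (dual Y)).inv ≫ adj (ev X) ▷ dual Y ≫ (α_ (dual X) X (dual Y)).hom ≫
      dual X ◁ (f ▷ dual Y) ≫ dual X ◁ adj (coev Y) ≫ (ρ_ (dual X)).hom
  adj_dualHom : ∀ {X Y : C} (f : X ⟶ Y), adj (dualHom f) = dualHom (adj f)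
  /-- The dual of a tensor product. -/
  dual_tensor : ∀ X Y : C, ∃ ν : dual (X ⊗ Y) ⟶ dual Y ⊗ dual X, IsUnitary ν ∧
    ev (X ⊗ Y) = ν ▷ (X ⊗ Y) ≫ (α_ (dual Y) (dual X) (X ⊗ Y)).hom ≫
      dual Y ◁ ((α_ (dual X) X Y).inv ≫ ev X ▷ Y ≫ (λ_ Y).hom) ≫ ev Y ∧
    coev (X ⊗ Y) ≫ (X ⊗ Y) ◁ ν = coev X ≫
      ((ρ_ X).inv ≫ X ◁ coev Y ≫ (α_ X Y (dual Y)).inv) ▷ dual X ≫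
        (α_ (X ⊗ Y) (dual Y) (dual X)).hom
  /-- The natural isomorphism with the double dual, and `coev = ev*`. -/
  double_dual : ∃ φ : ∀ X : C, X ⟶ dual (dual X), (∀ X, IsUnitary (φ X)) ∧
    (∀ {X Y : C} (f : X ⟶ Y), f ≫ φ Y = φ X ≫ dualHom (dualHom f)) ∧
    ∀ X, coev X ≫ φ X ▷ dual X = adj (ev (dual X))
  /-- The left trace and the right trace agree. -/
  spherical : ∀ {X : C} (f : X ⟶ X),
    adj (ev X) ≫ dual X ◁ f ≫ ev X = coev X ≫ f ▷ dual X ≫ adj (coev X)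

open DualStarStruct in
/-- An equivalence of rigid C*-tensor categories: an additive, linear, monoidal, dual-preserving and
`*`-preserving functor which is fully faithful and essentially surjective. -/
structure IsRigidCStarTensorEquivalence {C D : Type*} [Category C] [Preadditive C] [Linear ℂ C]
    [MonoidalCategoryStruct C] [DualStarStruct C] [Category D] [Preadditive D] [Linear ℂ D]
    [MonoidalCategoryStruct D] [DualStarStruct D] (F : C ⥤ D) : Prop where
  isEquivalence : F.IsEquivalence
  map_add : ∀ {X Y : C} (f g : X ⟶ Y), F.map (f + g) = F.map f + F.map g
  map_smul : ∀ {X Y : C} (z : ℂ) (f : X ⟶ Y), F.map (z • f) = z • F.map f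
  map_adj : ∀ {X Y : C} (f : X ⟶ Y), F.map (adj f) = adj (F.map f)
  /-- Unitary comparison isomorphisms with units, tensor products and duals. -/
  coherence : ∃ (ε : 𝟙_ D ≅ F.obj (𝟙_ C)) (μ : ∀ X Y : C, F.obj X ⊗ F.obj Y ≅ F.obj (X ⊗ Y))
      (δ : ∀ X : C, F.obj (dual X) ≅ dual (F.obj X)),
    IsUnitary ε.hom ∧ (∀ X Y, IsUnitary (μ X Y).hom) ∧ (∀ X, IsUnitary (δ X).hom) ∧
    (∀ {W X Y Z : C} (f : W ⟶ X) (g : Y ⟶ Z),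
      (F.map f ⊗ₘ F.map g) ≫ (μ X Z).hom = (μ W Y).hom ≫ F.map (f ⊗ₘ g)) ∧
    (∀ X Y Z : C, (μ X Y).hom ▷ F.obj Z ≫ (μ (X ⊗ Y) Z).hom ≫ F.map (α_ X Y Z).hom =
      (α_ (F.obj X) (F.obj Y) (F.obj Z)).hom ≫ F.obj X ◁ (μ Y Z).hom ≫ (μ X (Y ⊗ Z)).hom) ∧
    (∀ X : C, (λ_ (F.obj X)).hom = ε.hom ▷ F.obj X ≫ (μ (𝟙_ C) X).hom ≫ F.map (λ_ X).hom) ∧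
    (∀ X : C, (ρ_ (F.obj X)).hom = F.obj X ◁ ε.hom ≫ (μ X (𝟙_ C)).hom ≫ F.map (ρ_ X).hom) ∧
    (∀ {X Y : C} (f : X ⟶ Y), F.map (dualHom f) ≫ (δ X).hom = (δ Y).hom ≫ dualHom (F.map f)) ∧
    (∀ X : C, (μ (dual X) X).hom ≫ F.map (ev X) = (δ X).hom ▷ F.obj X ≫ ev (F.obj X) ≫ ε.hom) ∧
    (∀ X : C, ε.hom ≫ F.map (coev X) =
      coev (F.obj X) ≫ F.obj X ◁ (δ X).inv ≫ (μ X (dual X)).hom)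

/-- The loop parameter `δ_c`: a closed loop labelled `c` may be replaced by the factor `δ_c`. -/
def FactorPlanarAlgebra.loopParameter {L : Type u} (P : FactorPlanarAlgebra.{u, v} L) (c : L) : ℂ :=
  FactorPlanarAlgebra.scalar (P.Z (PlanarAlg.Tangle.loop c))

end

/-! The proof has two independent halves, one categorical and one analytic.

Categorical half. An element of `P_{α → β}` is the same thing as a diagram from `α` to `β`, up to
the relation `Eqv` of having the same value in every closed context: `dg` draws an element, `dg_Z`
realises every diagram, and `dg_inj` says that no information is lost. In this calculus all laws are
pictures. The basic move is that a box slides along a cup or cap while making a half turn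
(`rotate_cup`, `rotate_cap` and their mirror forms); the zigzag, pivotal and double dual laws, and
the duals of tensor products, follow by straightening strings, and sphericality of `P` gives
equality of traces. Tensor product and duals of projections are strict, so every coherence
isomorphism is a transport along an equality, which a diagram does not see.

Projections alone have no direct sums, so their properties are collected in `IsRigidStarCategory`,
with positivity stated for finite families. Positivity and finite dimension give each morphism a
support projection (`IsStarCategory.exists_support`); together with splitting of projections this
yields kernels, cokernels and an abelian category. For direct sums, splitting is obtained by peeling
off simple summands (`exists_simples`), and each tensor or duality law reduces, entry by entry, to
the law for single objects, because coherence maps are permutation matrices and evaluations are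
diagonal. Since morphisms `H_p → H_q` are by definition morphisms `p → q`, the same argument serves
`Bim`, and the functor is strict, fully faithful and bijective on projections.

Analytic half. Here the point is that `H_p` really is an `M`-`M` bimodule. Multiplication by a fixed
element is bounded: composition with `x* x` is annihilated by a polynomial which does not depend on
the remaining strings, because `P_{α → α}` is finite dimensional, and the norm of a self-adjoint
operator is bounded by the roots (`exists_norm_comp_le`). For a fixed number `k` of joined strings
the change of degree is injective, so the pieces add up orthogonally (`lp.exists_map_single`). The
product is associative by matching the terms of both bracketings (`sum_mulAt_mulAt`); hence left and
right multiplications commute, and `star_leftMulOp` shows that they are closed under adjoints.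

The actions of `M` come from a general extension principle. If bounded maps `R i : H₀ → H` have
total range and `a` commutes with all `R j† R i`, then `R i v ↦ R i (a v)` extends to a bounded
operator of norm at most `‖a‖` (`norm_ev_diag_le`, using the square root of `‖a‖² - a* a`). For left
module maps `R`, `R'` the operator `R'† R` commutes with left multiplications, so every `m ∈ M`
qualifies. For the right action one uses `J m* J`, where `J` is the conjugation of `L²(M)`: it
exchanges left and right multiplications, and `J m* J Ω = m Ω`. Commutation, adjoints and normality
then pass from `L²(M)` to `H_p`, and finally to direct sums component by component. -/

noncomputable section

open CategoryTheory MonoidalCategory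

/-! ### Local equivalence of diagrams -/

namespace PlanarAlg

variable {L : Type u} {V : Word L → Type v}

theorem Reads.unique {D : List (Layer V)} {a b c : Word L} (h : Reads D a b) (k : Reads D a c) :
    b = c := by
  induction D generalizing a with
  | nil => exact h.symm.trans k
  | cons y D ih => exact ih h.2 k.2

@[simp]
theorem Layer.whisker_comp_whisker (l r l' r' : Word L) :
    Layer.whisker (V := V) l' r' ∘ Layer.whisker l r = Layer.whisker (l' ++ l) (r ++ r') := by
  funext y
  simp [Layer.whisker]

@[simp]
theorem Layer.whisker_mk (l r l' r' : Word L) (e : Event V) :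
    Layer.whisker l r ⟨l', e, r'⟩ = ⟨l ++ l', e, r' ++ r⟩ := rfl

@[simp]
theorem Layer.whisker_nil : Layer.whisker (V := V) [] [] = id := by
  funext y
  simp [Layer.whisker]

attribute [simp] caps_whisker cups_whisker

theorem map_whisker_whisker (l r l' r' : Word L) (D : List (Layer V)) :
    (D.map (Layer.whisker l r)).map (Layer.whisker l' r') =
      D.map (Layer.whisker (l' ++ l) (r ++ r')) := by simp

theorem Move.whisker {D E : List (Layer V)} (h : Move D E) (p q : Word L) :
    Move (D.map (Layer.whisker p q)) (E.map (Layer.whisker p q)) := by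
  cases h with
  | slide l m r e f => simpa [Layer.whisker] using Move.slide (p ++ l) m (r ++ q) e f
  | zigzag l r c => simpa [Layer.whisker] using Move.zigzag (V := V) (p ++ l) (r ++ q) c
  | zagzig l r c => simpa [Layer.whisker] using Move.zagzig (V := V) (p ++ l) (r ++ q) c
  | turn l r a b x =>
    simpa  using Move.turn (p ++ l) (r ++ q) a b x

theorem Deform.whisker {a b : Word L} {D E : List (Layer V)} (h : Deform a b D E) (p q : Word L) :
    Deform (p ++ a ++ q) (p ++ b ++ q) (D.map (Layer.whisker p q)) (E.map (Layer.whisker p q)) := by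
  induction h with
  | rel D E h =>
    obtain ⟨h1, h2, pre, X, Y, post, hm, rfl, rfl⟩ := h
    exact Relation.EqvGen.rel _ _ ⟨h1.whisker p q, h2.whisker p q, pre.map (Layer.whisker p q), _, _,
      post.map (Layer.whisker p q), hm.whisker p q, by simp, by simp⟩
  | refl D => exact .refl _
  | symm D E _ ih => exact ih.symm
  | trans D E F _ _ ih1 ih2 => exact ih1.trans ih2

/-- Two diagrams with top `a` and bottom `b` have the same value in every closed context. -/
structure Eqv (P : PlanarAlgebra.{u, v} L) (a b : Word L) (D E : List (Layer P.V)) : Prop where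
  left : Reads D a b
  right : Reads E a b
  eq : ∀ {α : Word L} (S T : Tangle P.V α) (pre post : List (Layer P.V)) (l r : Word L),
    Reads pre α (l ++ a ++ r) → Reads post (l ++ b ++ r) [] →
    S.layers = pre ++ D.map (Layer.whisker l r) ++ post →
    T.layers = pre ++ E.map (Layer.whisker l r) ++ post → P.Z S = P.Z T

namespace Eqv

variable {P : PlanarAlgebra.{u, v} L} {a b c d : Word L} {D E F G : List (Layer P.V)}

theorem refl (h : Reads D a b) : Eqv P a b D D :=
  ⟨h, h, fun _ _ _ _ _ _ _ _ h1 h2 => PlanarAlgebra.Z_ext _ _ (h1.trans h2.symm)⟩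

theorem symm (h : Eqv P a b D E) : Eqv P a b E D :=
  ⟨h.right, h.left, fun _ _ _ _ _ _ h1 h2 h3 h4 => (h.eq _ _ _ _ _ _ h1 h2 h4 h3).symm⟩

theorem trans (h : Eqv P a b D E) (k : Eqv P a b E F) : Eqv P a b D F :=
  ⟨h.left, k.right, fun _ _ pre post l r h1 h2 h3 h4 =>
    (h.eq _ ⟨pre ++ E.map (Layer.whisker l r) ++ post, (h1.append (h.right.whisker l r)).append h2⟩
      _ _ _ _ h1 h2 h3 rfl).trans (k.eq _ _ _ _ _ _ h1 h2 rfl h4)⟩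

theorem of_deform (h : Deform a b D E) (hD : Reads D a b) : Eqv P a b D E := by
  refine ⟨hD, h.reads_iff.1 hD, fun S T pre post l r h1 h2 h3 h4 => ?_⟩
  refine Z_congr P S T ?_
  rw [h3, h4]
  exact ((h.whisker l r).append_left h1).append_right h2

theorem whisker (h : Eqv P a b D E) (l r : Word L) :
    Eqv P (l ++ a ++ r) (l ++ b ++ r) (D.map (Layer.whisker l r)) (E.map (Layer.whisker l r)) := by
  refine ⟨h.left.whisker l r, h.right.whisker l r, fun S T pre post l' r' h1 h2 h3 h4 => ?_⟩
  rw [map_whisker_whisker] at h3 h4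
  exact h.eq S T pre post _ _ (by simpa using h1) (by simpa using h2) h3 h4

theorem append_left (hF : Reads F a b) (h : Eqv P b c D E) : Eqv P a c (F ++ D) (F ++ E) := by
  refine ⟨hF.append h.left, hF.append h.right, fun S T pre post l r h1 h2 h3 h4 => ?_⟩
  refine h.eq S T (pre ++ F.map (Layer.whisker l r)) post l r (h1.append (hF.whisker l r)) h2 ?_ ?_
  · rw [h3]; simp
  · rw [h4]; simp

theorem append_right (hF : Reads F b c) (h : Eqv P a b D E) : Eqv P a c (D ++ F) (E ++ F) := by
  refine ⟨h.left.append hF, h.right.append hF, fun S T pre post l r h1 h2 h3 h4 => ?_⟩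
  refine h.eq S T pre (F.map (Layer.whisker l r) ++ post) l r h1 ((hF.whisker l r).append h2) ?_ ?_
  · rw [h3]; simp
  · rw [h4]; simp

theorem append (h : Eqv P a b D E) (k : Eqv P b c F G) : Eqv P a c (D ++ F) (E ++ G) :=
  (h.append_right k.left).trans (k.append_left h.right)

/-- Replacing a part of a diagram by an equivalent one. -/
theorem part (pre post : List (Layer P.V)) (l r : Word L) {X Y : List (Layer P.V)}
    (h : Eqv P c d X Y) (hD : Reads D a b) (h1 : Reads pre a (l ++ c ++ r))
    (eD : D = pre ++ X.map (Layer.whisker l r) ++ post)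
    (eE : E = pre ++ Y.map (Layer.whisker l r) ++ post) : Eqv P a b D E := by
  subst eD eE
  obtain ⟨m, k1, k2⟩ := reads_append.1 hD
  obtain rfl := (h1.append (h.left.whisker l r)).unique k1
  exact ((h.whisker l r).append_left h1).append_right k2

theorem Z_eq {α : Word L} {S T : Tangle P.V α} (h : Eqv P α [] S.layers T.layers) : P.Z S = P.Z T :=
  h.eq S T [] [] [] [] (by simp [Reads]) (by simp [Reads]) (by simp)
    (by simp)

/-- Put a rectangle labelled by the common value into the context and expand it by naturality in two
ways. This turns axioms about values, such as sphericality, into local moves. -/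
theorem of_Z {α : Word L} {S T : Tangle P.V α} (h : P.Z S = P.Z T) :
    Eqv P α [] S.layers T.layers := by
  refine ⟨S.reads, T.reads, fun S' T' pre post l r h1 h2 h3 h4 => ?_⟩
  let U : Tangle P.V _ := ⟨pre ++ [⟨l, .box _ (P.Z S), r⟩] ++ post,
    (h1.append (reads_box _ rfl rfl)).append (by simpa using h2)⟩
  exact (P.naturality U S' S pre post l r rfl h3).symm.trans
    (P.naturality U T' T pre post l r (by simp only [U]; rw [h]) h4)

theorem box_Z {α : Word L} (T : Tangle P.V α) : Eqv P α [] [⟨[], .box α (P.Z T), []⟩] T.layers :=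
  of_Z (S := Tangle.single (P.Z T)) (P.Z_single _)

theorem slide (l m r : Word L) (hD : Reads D a b) (hE : Reads E c d) :
    Eqv P (l ++ a ++ m ++ c ++ r) (l ++ b ++ m ++ d ++ r)
      (D.map (Layer.whisker l (m ++ c ++ r)) ++ E.map (Layer.whisker (l ++ b ++ m) r))
      (E.map (Layer.whisker (l ++ a ++ m) r) ++ D.map (Layer.whisker l (m ++ d ++ r))) :=
  of_deform (slide_block l m r hD hE)
    (Reads.append (b := l ++ b ++ m ++ c ++ r) (by simpa using hD.whisker l (m ++ c ++ r))
      (by simpa using hE.whisker (l ++ b ++ m) r))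

theorem interchange (hD : Reads D a b) (hE : Reads E c d) :
    Eqv P (a ++ c) (b ++ d)
      (D.map (Layer.whisker [] c) ++ E.map (Layer.whisker b []))
      (E.map (Layer.whisker a []) ++ D.map (Layer.whisker [] d)) := by
  simpa using slide (P := P) [] [] [] hD hE

theorem zag (a : Word L) : Eqv P a a (caps a a.reverse [] ++ cups [] a a) [] := by
  have h := PlanarAlg.zag (V := P.V) [] a []
  simp only [List.nil_append, List.append_nil] at h
  refine of_deform h (Reads.append (b := a ++ a.reverse ++ a) ?_ ?_)
  · simpa using reads_caps (V := P.V) a a.reverse []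
  · simpa using reads_cups (V := P.V) [] a a

theorem zig (a : Word L) : Eqv P a a (caps [] a a ++ cups a a.reverse []) [] := by
  have h := PlanarAlg.zig (V := P.V) [] a []
  simp only [List.nil_append, List.append_nil] at h
  refine of_deform h (Reads.append (b := a ++ a.reverse ++ a) ?_ ?_)
  · simpa using reads_caps (V := P.V) [] a a
  · simpa using reads_cups (V := P.V) a a.reverse []

end Eqv

end PlanarAlg

/-! ### Elements of box spaces as diagrams -/

namespace PlanarAlgebra

open PlanarAlg

variable {L : Type u} {P : PlanarAlgebra.{u, v} L} {a b c d : Word L}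

/-- The diagram of an element with `a` on the top and `b` on the bottom. -/
def dg (x : P.Mor a b) : List (Layer P.V) := caps a b.reverse [] ++ [⟨[], .box _ x, b⟩]

theorem reads_dg (x : P.Mor a b) : Reads (dg x) a b :=
  Reads.append (b := a ++ b.reverse ++ b) (by simpa using reads_caps (V := P.V) a b.reverse [])
    (reads_box _ (by simp) (by simp))

/-- Bending the bottom strands of a diagram up around its right side. -/
def bend (b : Word L) (D : List (Layer P.V)) : List (Layer P.V) :=
  D.map (Layer.whisker [] b.reverse) ++ cups [] b []

theorem reads_bend {D : List (Layer P.V)} (h : Reads D a b) : Reads (bend b D) (a ++ b.reverse) [] :=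
  Reads.append (by simpa using h.whisker [] b.reverse) (by simpa using reads_cups (V := P.V) [] b [])

/-- The caps for `b` slide below `D`, where they form zigzags with the cups and are pulled straight.
-/
theorem unbend {D : List (Layer P.V)} (h : Reads D a b) :
    Eqv P a b (caps a b.reverse [] ++ (bend b D).map (Layer.whisker [] b)) D := by
  have s := ((Eqv.interchange (P := P) h (D := D) (E := caps [] b.reverse []) (c := []) (d := b.reverse ++ b)
    (by simpa using reads_caps (V := P.V) [] b.reverse [])).symm).append_right
    (F := cups [] b b) (c := b) (by simpa using reads_cups (V := P.V) [] b b)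
  have s' : Eqv P a b (caps a b.reverse [] ++ (bend b D).map (Layer.whisker [] b))
      (D ++ (caps b b.reverse [] ++ cups [] b b)) := by
    simpa [bend] using s
  simpa using s'.trans ((Eqv.zag b).append_left h)

/-- Expand the rectangle labelled by the value of the bent diagram, then unbend. Together with
`dg_inj` this identifies `P_{a → b}` with diagrams up to equivalence, so that identities between
elements can be proved by drawing. -/
theorem dg_Z {D : List (Layer P.V)} (h : Reads D a b) :
    Eqv P a b (dg (P.Z ⟨bend b D, reads_bend h⟩)) D := by
  refine Eqv.trans ?_ (unbend h)
  have s := ((Eqv.box_Z (P := P) ⟨bend b D, reads_bend h⟩).whisker [] b).append_left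
    (F := caps a b.reverse []) (a := a) (by simpa using reads_caps (V := P.V) a b.reverse [])
  simpa [dg] using s

/-- The box slides below the cups, and the zigzag that remains above it is straightened. -/
theorem bend_dg (x : P.Mor a b) : Eqv P (a ++ b.reverse) [] (bend b (dg x)) [⟨[], .box _ x, []⟩] := by
  have s := (((Eqv.interchange (P := P) (D := [⟨[], .box _ x, []⟩]) (a := a ++ b.reverse) (b := [])
    (reads_box _ (by simp) (by simp)) (E := cups [] b []) (c := b ++ b.reverse) (d := [])
    (by simpa using reads_cups (V := P.V) [] b [])).append_left
    (F := caps a b.reverse b.reverse) (a := a ++ b.reverse)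
    (by simpa using reads_caps (V := P.V) a b.reverse b.reverse)))
  have t := ((Eqv.zig (P := P) b.reverse).whisker a []).append_right
    (F := [⟨[], .box _ x, []⟩]) (c := []) (by simpa using reads_box (V := P.V) (r := []) (l := []) x rfl rfl)
  refine Eqv.trans ?_ (Eqv.trans s ?_)
  · simpa [bend, dg] using Eqv.refl s.left
  · simpa using t

/-- Bending the bottom strands up again recovers the single labelled rectangle, whose value is its
label. -/
theorem dg_inj {x y : P.Mor a b} (h : Eqv P a b (dg x) (dg y)) : x = y := by
  have s := (((bend_dg x).symm.trans (b := []) (E := bend b (dg x)) ?_)).trans (bend_dg y)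
  · rw [← P.Z_single x, ← P.Z_single y]
    exact Eqv.Z_eq s
  · simpa [bend] using (h.whisker [] b.reverse).append_right (F := cups [] b []) (c := [])
      (by simpa using reads_cups (V := P.V) [] b [])

theorem ext_dg {x y : P.Mor a b} {D : List (Layer P.V)} (h : Eqv P a b (dg x) D)
    (k : Eqv P a b (dg y) D) : x = y := dg_inj (h.trans k.symm)

/-- The diagrams of named elements are found this way: it is enough to compare the defining tangle
with the bent-up candidate. -/
theorem dg_of_eq {D : List (Layer P.V)} (T : Tangle P.V (a ++ b.reverse)) (h : Reads D a b)
    (e : Eqv P (a ++ b.reverse) [] T.layers (bend b D)) : Eqv P a b (dg (P.Z T)) D := by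
  have : P.Z T = P.Z ⟨bend b D, reads_bend h⟩ := Eqv.Z_eq e
  rw [this]
  exact dg_Z h

/-- Diagrams are plain lists of slices, so transport along equalities of words is invisible to them.
This disposes of the casts in the strict laws for tensor products and duals. -/
theorem dg_castV {a' b' : Word L} (ha : a = a') (hb : b = b') (x : P.Mor a b)
    (h : a ++ b.reverse = a' ++ b'.reverse) :
    dg (a := a') (b := b') (P.castV h x) = dg x := by
  subst ha hb; rfl

theorem dg_comp (x : P.Mor a b) (y : P.Mor b c) : Eqv P a c (dg (comp x y)) (dg x ++ dg y) := by
  have hx := reads_dg x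
  have hy := reads_dg y
  have s0 := ((Eqv.box_Z (P := P) (Tangle.glue x y a b c.reverse rfl rfl rfl)).whisker [] c).append_left
    (F := caps a c.reverse []) (a := a) (by simpa using reads_caps (V := P.V) a c.reverse [])
  have s := (Eqv.interchange (P := P) hx (E := caps [] c.reverse []) (c := []) (d := c.reverse ++ c)
    (by simpa using reads_caps (V := P.V) [] c.reverse [])).symm.append_right
    (F := [⟨[], .box _ y, c⟩]) (c := c) (reads_box _ (by simp) (by simp))
  refine Eqv.trans (b := c) (E := _) (by simpa [dg, comp] using s0) ?_
  simpa [dg, Tangle.glue] using s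

theorem dg_one (a : Word L) : Eqv P a a (dg (P.one a)) [] :=
  dg_of_eq (Tangle.through a) rfl (by simpa [bend, Tangle.through] using Eqv.refl (P := P) (Tangle.through (V := P.V) a).reads)

theorem dg_tensor (x : P.Mor a b) (y : P.Mor c d) : Eqv P (a ++ c) (b ++ d) (dg (tensor x y))
    ((dg x).map (Layer.whisker [] c) ++ (dg y).map (Layer.whisker b [])) := by
  have hx := reads_dg x
  have hy := reads_dg y
  refine dg_of_eq (Tangle.tensor x y) ?_ ?_
  · exact Reads.append (by simpa using hx.whisker [] c) (by simpa using hy.whisker b [])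
  · have t := ((bend_dg y).whisker a b.reverse).append_right (c := []) (F := [⟨[], .box _ x, []⟩])
      (by simpa using reads_box (V := P.V) (r := []) (l := []) x rfl rfl)
    have t' := (bend_dg x).append_left (F := (bend d (dg y)).map (Layer.whisker a b.reverse))
      (a := a ++ c ++ (b ++ d).reverse) (by simpa using (reads_bend hy).whisker a b.reverse)
    have s := (Eqv.interchange (P := P) hx (reads_bend hy)).symm.whisker [] b.reverse
    have s' := s.append_right (c := []) (F := cups [] b []) (by simpa using reads_cups (V := P.V) [] b [])
    refine Eqv.trans (b := []) (E := (bend d (dg y)).map (Layer.whisker a b.reverse) ++ bend b (dg x))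
      ?_ ?_
    · exact Eqv.trans (by simpa [Tangle.tensor] using t.symm)
        (by simpa using t'.symm)
    · simpa [bend, cups_append] using s'

end PlanarAlgebra

end

/-! ### Half turns, cups and caps -/

noncomputable section

open CategoryTheory MonoidalCategory

namespace PlanarAlgebra

open PlanarAlg

variable {L : Type u} {P : PlanarAlgebra.{u, v} L} {a b c d : Word L}

/-- The end words are left free so that re-bracketing of concatenations can be discharged by `simp`;
likewise for `rd_caps` and `rd_wh`. -/
theorem rd_cups (l a r : Word L) {x y : Word L} (hx : x = l ++ a ++ a.reverse ++ r)
    (hy : y = l ++ r) : Reads (cups (V := P.V) l a r) x y := by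
  subst hx hy; exact reads_cups l a r

theorem rd_caps (l a r : Word L) {x y : Word L} (hy : y = l ++ a ++ a.reverse ++ r)
    (hx : x = l ++ r) : Reads (caps (V := P.V) l a r) x y := by
  subst hx hy; exact reads_caps l a r

theorem rd_wh {D : List (Layer P.V)} (l r : Word L) {x y : Word L} (h : Reads D a b)
    (hx : x = l ++ a ++ r) (hy : y = l ++ b ++ r) : Reads (D.map (Layer.whisker l r)) x y := by
  subst hx hy; exact h.whisker l r

theorem dg_cup (a : Word L) : Eqv P (a.reverse ++ a) [] (dg (P.cup a)) (cups [] a.reverse []) :=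
  dg_of_eq _ (rd_cups _ _ _ (by simp) (by simp))
    (by simpa [bend, cups] using Eqv.refl (rd_cups (P := P) [] a.reverse [] (by simp) rfl))

theorem dg_cap (a : Word L) : Eqv P [] (a ++ a.reverse) (dg (P.cap a)) (caps [] a []) := by
  refine dg_of_eq _ (rd_caps _ _ _ (by simp) (by simp)) ?_
  have h := (((Eqv.zig (P := P) a).whisker [] a.reverse).append_right (F := cups [] a []) (c := [])
    (rd_cups _ _ _ (by simp) (by simp))).symm
  simpa [bend, cups_append] using h

/-- The half turn, with the top strands bent around the right side. -/
theorem dg_rotate (x : P.Mor a b) : Eqv P b.reverse a.reverse (dg (rotate x))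
    (caps b.reverse a [] ++ (dg x).map (Layer.whisker b.reverse a.reverse) ++
      cups [] b.reverse a.reverse) := by
  have hx := reads_dg x
  have h : Reads ((dg x).map (Layer.whisker b.reverse []) ++ cups [] b.reverse [])
      (b.reverse ++ a) [] :=
    (rd_wh b.reverse [] hx (by simp) rfl).append (rd_cups _ _ _ (by simp) rfl)
  refine dg_of_eq _ (((rd_caps _ _ _ rfl (by simp)).append (rd_wh _ _ hx (by simp) rfl)).append
    (rd_cups _ _ _ (by simp) rfl)) ?_
  have s := (Eqv.interchange (P := P) h (E := cups [] a.reverse []) (c := a.reverse ++ a) (d := [])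
    (rd_cups _ _ _ (by simp) rfl)).append_left (F := caps b.reverse a a) (a := b.reverse ++ a)
      (rd_caps _ _ _ (by simp) rfl)
  have t := ((Eqv.zig (P := P) a).whisker b.reverse []).append_right (c := [])
    (F := (dg x).map (Layer.whisker b.reverse []) ++ cups [] b.reverse []) (by simpa using h)
  have s' := s.trans (by simpa using t)
  simpa [bend, Tangle.rotate, dg] using s'.symm

/-- Bending up the rotated box leaves its defining tangle, which is the original box on the other
leg of the cup. Sliding a box along a cup or cap at the price of a half turn, here and in the three
mirror forms below, carries all duality arguments. -/
theorem rotate_cup (x : P.Mor a b) : Eqv P (b.reverse ++ a) []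
    ((dg (rotate x)).map (Layer.whisker [] a) ++ cups [] a.reverse [])
    ((dg x).map (Layer.whisker b.reverse []) ++ cups [] b.reverse []) := by
  have h := (bend_dg (rotate x)).trans (by simpa [rotate] using Eqv.box_Z (P := P) (Tangle.rotate x))
  simpa [bend, Tangle.rotate, dg] using h

theorem rotate_cap (x : P.Mor a b) : Eqv P [] (b ++ a.reverse)
    (caps [] a [] ++ (dg x).map (Layer.whisker [] a.reverse))
    (caps [] b [] ++ (dg (rotate x)).map (Layer.whisker b [])) := by
  have hx := reads_dg x
  have h : Reads (caps [] a [] ++ (dg x).map (Layer.whisker [] a.reverse)) [] (b ++ a.reverse) :=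
    (rd_caps _ _ _ rfl rfl).append (rd_wh _ _ hx (by simp) rfl)
  have t := ((dg_rotate x).whisker b []).append_left (F := caps [] b []) (a := [])
    (rd_caps _ _ _ (by simp) rfl)
  have s := (Eqv.interchange (P := P) (D := caps [] b []) (a := []) (b := b ++ b.reverse)
    (rd_caps _ _ _ (by simp) rfl) h).append_right (F := cups b b.reverse a.reverse)
    (c := b ++ a.reverse) (rd_cups _ _ _ (by simp) rfl)
  have z := ((Eqv.zig (P := P) b).whisker [] a.reverse).append_left (by simpa using h)
  refine Eqv.symm ((by simpa using t : Eqv _ _ _ _ _).trans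
    ((by simpa using s : Eqv _ _ _ _ _).trans (by simpa using z)))

/-- The half turn, with the top strands bent around the left side. -/
theorem dg_rotate' (x : P.Mor a b) : Eqv P b.reverse a.reverse (dg (rotate x))
    (caps [] a.reverse b.reverse ++ (dg x).map (Layer.whisker a.reverse b.reverse) ++
      cups a.reverse b []) := by
  have hx := reads_dg x
  have r1 : Reads (V := P.V) (caps [] a.reverse (b.reverse ++ a) ++
      [⟨a.reverse, .box (a ++ b.reverse) x, a⟩] ++
      cups [] a.reverse []) (b.reverse ++ a) [] :=
    (Reads.append (b := a.reverse ++ (a ++ b.reverse) ++ a)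
      (rd_caps [] a.reverse (b.reverse ++ a) (by simp) rfl) (reads_box _ rfl rfl)).append
      (rd_cups [] a.reverse [] (by simp) rfl)
  refine dg_of_eq _ (((rd_caps [] a.reverse b.reverse rfl (by simp)).append
    (rd_wh a.reverse b.reverse hx (by simp) rfl)).append
    (rd_cups a.reverse b [] (by simp) (by simp))) ?_
  -- Isotopy invariance under turning a rectangle enters here: the defining tangle bends the strings
  -- `b.reverse` around the right side, the move `turn` replaces this by bending the strings `a`
  -- around the left side.
  have s := Eqv.of_deform (P := P) (Deform.of_move (a := b.reverse ++ a) (b := [])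
    (Move.turn [] [] a b.reverse x) (by simpa [Tangle.rotate] using (Tangle.rotate x).reads)
    (by simpa using r1)) (by simpa [Tangle.rotate] using (Tangle.rotate x).reads)
  have t := ((((bend_dg x).whisker a.reverse a).append_left (a := b.reverse ++ a)
    (F := caps [] a.reverse (b.reverse ++ a)) (rd_caps _ _ _ (by simp) rfl)).append_right (c := [])
    (F := cups [] a.reverse []) (rd_cups _ _ _ (by simp) rfl)).symm
  have s' : Eqv P (b.reverse ++ a) [] (Tangle.rotate x).layers _ :=
    (by simpa [Tangle.rotate] using s : Eqv P (b.reverse ++ a) [] (Tangle.rotate x).layers _).trans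
      (by simpa using t)
  simpa [bend] using s'

theorem rotate_cup' (x : P.Mor a b) : Eqv P (a ++ b.reverse) []
    ((dg (rotate x)).map (Layer.whisker a []) ++ cups [] a [])
    ((dg x).map (Layer.whisker [] b.reverse) ++ cups [] b []) := by
  have hx := reads_dg x
  have h : Reads ((dg x).map (Layer.whisker [] b.reverse) ++ cups [] b []) (a ++ b.reverse) [] :=
    (rd_wh _ _ hx (by simp) rfl).append (rd_cups _ _ _ (by simp) rfl)
  have t := ((dg_rotate' x).whisker a []).append_right (F := cups [] a []) (c := [])
    (rd_cups _ _ _ (by simp) rfl)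
  have s := (Eqv.interchange (P := P) (D := cups [] a []) (a := a ++ a.reverse) (b := [])
    (rd_cups _ _ _ (by simp) rfl) h).symm.append_left (F := caps a a.reverse b.reverse)
    (a := a ++ b.reverse) (rd_caps _ _ _ (by simp) rfl)
  have z := ((Eqv.zag (P := P) a).whisker [] b.reverse).append_right (by simpa using h)
  exact (by simpa using t : Eqv _ _ _ _ _).trans
    ((by simpa using s : Eqv _ _ _ _ _).trans (by simpa using z))

theorem rotate_cap' (x : P.Mor a b) : Eqv P [] (a.reverse ++ b)
    (caps [] a.reverse [] ++ (dg x).map (Layer.whisker a.reverse []))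
    (caps [] b.reverse [] ++ (dg (rotate x)).map (Layer.whisker [] b)) := by
  have hx := reads_dg x
  have h : Reads (caps [] a.reverse [] ++ (dg x).map (Layer.whisker a.reverse [])) []
      (a.reverse ++ b) :=
    (rd_caps _ _ _ rfl rfl).append (rd_wh _ _ hx (by simp) (by simp))
  have t := ((dg_rotate' x).whisker [] b).append_left (F := caps [] b.reverse []) (a := [])
    (rd_caps _ _ _ (by simp) rfl)
  have s := (Eqv.interchange (P := P) h (E := caps [] b.reverse []) (c := [])
    (d := b.reverse ++ b) (rd_caps _ _ _ (by simp) rfl)).symm.append_right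
    (F := cups a.reverse b b) (c := a.reverse ++ b) (rd_cups _ _ _ (by simp) (by simp))
  have z := ((Eqv.zag (P := P) b).whisker a.reverse []).append_left (by simpa using h)
  refine Eqv.symm ((by simpa using t : Eqv _ _ _ _ _).trans
    ((by simpa using s : Eqv _ _ _ _ _).trans (by simpa using z)))

/-- The outer half turn is drawn with strings around the right, the inner one is slid over a cup in
the form obtained from bending around the left. The bends cancel in zigzags. -/
theorem dg_rotate_rotate (x : P.Mor a b) : Eqv P a b (dg (rotate (rotate x))) (dg x) := by
  have h1 := dg_rotate (rotate x)
  have h2 := ((rotate_cup' x).whisker [] b).append_left (F := caps a b.reverse []) (a := a)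
    (rd_caps _ _ _ (by simp) (by simp))
  have h3 := unbend (reads_dg x)
  refine (by simpa using h1 : Eqv _ _ _ _ _).trans ((by simpa using h2 : Eqv _ _ _ _ _).trans ?_)
  simpa [bend] using h3

theorem rotate_rotate (x : P.Mor a b) : P.castV (by simp) (rotate (rotate x)) = x := by
  refine dg_inj ?_
  rw [dg_castV (by simp) (by simp)]
  exact dg_rotate_rotate x

/-- A diagram is determined by its composite with the cup of its bottom. -/
theorem eqv_of_cup {D E : List (Layer P.V)} (hD : Reads D a b.reverse) (hE : Reads E a b.reverse)
    (h : Eqv P (a ++ b) [] (D.map (Layer.whisker [] b) ++ cups [] b.reverse [])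
      (E.map (Layer.whisker [] b) ++ cups [] b.reverse [])) : Eqv P a b.reverse D E := by
  refine (unbend hD).symm.trans (Eqv.trans ?_ (unbend hE))
  have := (h.whisker [] b.reverse).append_left (F := caps a b []) (a := a)
    (rd_caps _ _ _ (by simp) (by simp))
  simpa [bend] using this

/-- Both sides are compared after closing their bottoms by nested cups. There each box slides to the
other leg of its own cup, and the nesting accounts for the reversed order of the factors. -/
theorem dg_rotate_tensor (x : P.Mor a b) (y : P.Mor c d) :
    Eqv P (d.reverse ++ b.reverse) (c.reverse ++ a.reverse) (dg (rotate (tensor x y)))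
      ((dg (rotate y)).map (Layer.whisker [] b.reverse) ++
        (dg (rotate x)).map (Layer.whisker c.reverse [])) := by
  have hx := reads_dg x
  have hy := reads_dg y
  have hy' := reads_dg (rotate y)
  have hx' := reads_dg (rotate x)
  have hF : Reads ((dg x).map (Layer.whisker b.reverse []) ++ cups [] b.reverse [])
      (b.reverse ++ a) [] := (rd_wh _ _ hx (by simp) rfl).append (rd_cups _ _ _ (by simp) rfl)
  have h1 := rotate_cup (tensor x y)
  have h2 := ((dg_tensor x y).whisker (b ++ d).reverse []).append_right
    (F := cups [] (b ++ d).reverse []) (c := []) (rd_cups _ _ _ (by simp) rfl)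
  have h3 := (((Eqv.interchange (P := P) (D := cups [] b.reverse []) (a := b.reverse ++ b) (b := [])
    (rd_cups _ _ _ (by simp) rfl) hy).symm.whisker d.reverse []).append_left
    (a := d.reverse ++ b.reverse ++ a ++ c)
    (F := (dg x).map (Layer.whisker (d.reverse ++ b.reverse) c))
    (rd_wh _ _ hx (by simp) (by simp))).append_right (c := []) (F := cups [] d.reverse [])
    (rd_cups _ _ _ (by simp) rfl)
  have h4 := ((rotate_cup y).append_left (a := d.reverse ++ b.reverse ++ a ++ c)
    (F := ((dg x).map (Layer.whisker b.reverse []) ++ cups [] b.reverse []).map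
      (Layer.whisker d.reverse c)) (rd_wh _ _ hF (by simp) (by simp))).symm
  have h5 := ((Eqv.interchange (P := P) hy' hF).whisker [] c).symm.append_right (c := [])
    (F := cups [] c.reverse []) (rd_cups _ _ _ (by simp) rfl)
  have h6 := ((((rotate_cup x).whisker c.reverse c).append_left
    (F := (dg (rotate y)).map (Layer.whisker [] (b.reverse ++ a ++ c)))
    (a := d.reverse ++ b.reverse ++ a ++ c) (rd_wh _ _ hy' (by simp) (by simp))).append_right
    (c := []) (F := cups [] c.reverse []) (rd_cups _ _ _ (by simp) rfl)).symm
  have key := (by simpa using h1 : Eqv _ _ _ _ _).trans ((by simpa using h2 : Eqv _ _ _ _ _).trans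
    ((by simpa [cups_append] using h3 : Eqv _ _ _ _ _).trans ((by simpa using h4 : Eqv _ _ _ _ _).trans
    ((by simpa using h5 : Eqv _ _ _ _ _).trans (by simpa using h6)))))
  have := eqv_of_cup (P := P) (b := a ++ c) (a := d.reverse ++ b.reverse) (E :=
    (dg (rotate y)).map (Layer.whisker [] b.reverse) ++
        (dg (rotate x)).map (Layer.whisker c.reverse [])) (by simpa using reads_dg (rotate (tensor x y)))
    ((rd_wh _ _ hy' (by simp) rfl).append (rd_wh _ _ hx' (by simp) (by simp)))
    (by simpa [cups_append] using key)
  simpa using this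

theorem rotate_tensor (x : P.Mor a b) (y : P.Mor c d) :
    P.castV (by simp) (rotate (tensor x y)) = tensor (rotate y) (rotate x) := by
  refine ext_dg ?_ (dg_tensor (rotate y) (rotate x))
  rw [dg_castV (by simp) (by simp)]
  simpa using dg_rotate_tensor x y

end PlanarAlgebra

namespace FactorPlanarAlgebra

open PlanarAlg PlanarAlgebra

variable {L : Type u} {P : FactorPlanarAlgebra.{u, v} L} {a b : Word L}

theorem closeRight_eqv (x : P.Mor a a) : Eqv P.toPlanarAlgebra [] [] (Tangle.closeRight x).layers
    (caps [] a [] ++ (dg x).map (Layer.whisker [] a.reverse) ++ cups [] a []) := by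
  have h := ((bend_dg x).append_left (F := caps [] a []) (a := []) (rd_caps _ _ _ (by simp) rfl)).symm
  simpa [bend, Tangle.closeRight] using h

theorem closeLeft_layers (x : P.Mor a a) : (Tangle.closeLeft x).layers =
    caps [] a.reverse [] ++ (dg x).map (Layer.whisker a.reverse []) ++ cups [] a.reverse [] := by
  simp [Tangle.closeLeft, dg]

/-- The spherical axiom is an equality of two values in `P_∅`, which `Eqv.of_Z` makes available
inside larger diagrams. -/
theorem sphere (x : P.Mor a a) : Eqv P.toPlanarAlgebra [] []
    (caps [] a [] ++ (dg x).map (Layer.whisker [] a.reverse) ++ cups [] a [])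
    (caps [] a.reverse [] ++ (dg x).map (Layer.whisker a.reverse []) ++ cups [] a.reverse []) := by
  refine (closeRight_eqv x).symm.trans ?_
  rw [← closeLeft_layers]
  exact Eqv.of_Z (P.spherical x)

/-- Nested minima are mirrored to the same list of slices; only the splitting of the boundary word
into top and bottom changes. -/
theorem dg_adj_cup (a : Word L) :
    Eqv P.toPlanarAlgebra [] (a.reverse ++ a) (dg (adj (P.cup a))) (caps [] a.reverse []) := by
  have e : adj (P.cup a) = P.castV (by simp) (P.cap a.reverse) := by
    rw [cup, adj_Z, cap, castV_Z]
    exact Z_ext _ _ (by simp [cups_mirror])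
  rw [e, dg_castV rfl (by simp)]
  simpa using dg_cap (P := P.toPlanarAlgebra) a.reverse

theorem dg_adj_cap (a : Word L) :
    Eqv P.toPlanarAlgebra (a ++ a.reverse) [] (dg (adj (P.cap a))) (cups [] a []) := by
  have e : adj (P.cap a) = P.castV (by simp) (P.cup a.reverse) := by
    rw [cap, adj_Z, cup, castV_Z]
    exact Z_ext _ _ (by simp [cups_mirror])
  rw [e, dg_castV (by simp) rfl]
  simpa using dg_cup (P := P.toPlanarAlgebra) a.reverse

end FactorPlanarAlgebra
end

/-! ### The trace, and the monoidal category of projections -/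

noncomputable section

open CategoryTheory MonoidalCategory

namespace PlanarAlgebra

open PlanarAlg

variable {L : Type u} {P : PlanarAlgebra.{u, v} L}

theorem smul_tensor {α β γ δ : Word L} (z : ℂ) (x : P.Mor α β) (y : P.Mor γ δ) :
    tensor (z • x) y = z • tensor x y :=
  P.map_smul z x _ _ [⟨α, .box _ y, β.reverse⟩] [] [] []
    (by simp [Tangle.tensor]) (by simp [Tangle.tensor])

theorem tensor_smul {α β γ δ : Word L} (z : ℂ) (x : P.Mor α β) (y : P.Mor γ δ) :
    tensor x (z • y) = z • tensor x y :=
  P.map_smul z y _ _ [] [⟨[], .box _ x, []⟩] α β.reverse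
    (by simp [Tangle.tensor]) (by simp [Tangle.tensor])

theorem closeRight_add {α : Word L} (x y : P.Mor α α) :
    P.Z (Tangle.closeRight (x + y)) = P.Z (Tangle.closeRight x) + P.Z (Tangle.closeRight y) :=
  P.map_add x y _ _ _ (caps [] α []) [] [] [] (by simp [Tangle.closeRight])
    (by simp [Tangle.closeRight]) (by simp [Tangle.closeRight])

theorem closeRight_smul {α : Word L} (z : ℂ) (x : P.Mor α α) :
    P.Z (Tangle.closeRight (z • x)) = z • P.Z (Tangle.closeRight x) :=
  P.map_smul z x _ _ (caps [] α []) [] [] [] (by simp [Tangle.closeRight])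
    (by simp [Tangle.closeRight])

end PlanarAlgebra

namespace PlanarAlg.Eqv

variable {L : Type u} {P : PlanarAlgebra.{u, v} L} {a b c d : Word L} {D D' E E' : List (Layer P.V)}

theorem tensor (h : Eqv P a b D D') (k : Eqv P c d E E') :
    Eqv P (a ++ c) (b ++ d) (D.map (Layer.whisker [] c) ++ E.map (Layer.whisker b []))
      (D'.map (Layer.whisker [] c) ++ E'.map (Layer.whisker b [])) :=
  (by simpa using h.whisker [] c : Eqv P (a ++ c) (b ++ c) _ _).append
    (by simpa using k.whisker b [])

end PlanarAlg.Eqv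

namespace FactorPlanarAlgebra

open PlanarAlg PlanarAlgebra

variable {L : Type u} {P : FactorPlanarAlgebra.{u, v} L}

/-- The trace of the endomorphisms of a word. -/
def tr {α : Word L} : P.Mor α α →ₗ[ℂ] ℂ where
  toFun x := scalar (P.Z (Tangle.closeRight x))
  map_add' x y := by rw [closeRight_add, scalar_add]
  map_smul' z x := by rw [closeRight_smul, scalar_smul]; rfl

/-- Once the composite is expanded both sides consist of the same slices. This expresses the inner
product through the trace, which is how adjoints of composition operators are computed later. -/
theorem closeRight_comp_adj {α β : Word L} (x y : P.Mor α β) :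
    P.Z (Tangle.closeRight (comp x (adj y))) = P.Z (Tangle.pair x (P.st y)) := by
  obtain ⟨S, hS, e⟩ := Z_subst (P := P.toPlanarAlgebra) (Tangle.closeRight (comp x (adj y)))
    (Tangle.glue x (adj y) α β α.reverse rfl rfl rfl) (caps [] α []) [] [] []
    (by simp [Tangle.closeRight]; rfl)
  refine e.trans (Z_ext _ _ ?_)
  rw [hS]
  simp [Tangle.glue, Tangle.pair, caps_append, box_adj]

theorem innerV_eq_tr {α β : Word L} (x y : P.Mor α β) : innerV x y = tr (comp y (adj x)) := by
  rw [innerV, ← closeRight_comp_adj]; rfl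

end FactorPlanarAlgebra

namespace Projection

open PlanarAlg PlanarAlgebra FactorPlanarAlgebra

variable {L : Type u} {P : FactorPlanarAlgebra.{u, v} L} {p q r s : Projection P}

/-- The diagram of a morphism. -/
def diag (f : p ⟶ q) : List (Layer P.V) := dg (P := P.toPlanarAlgebra) f.1

theorem reads_diag (f : p ⟶ q) : Reads (diag f) p.word q.word := reads_dg (P := P.toPlanarAlgebra) f.1

theorem diag_inj {f g : p ⟶ q} (h : Eqv P.toPlanarAlgebra p.word q.word (diag f) (diag g)) : f = g :=
  Subtype.ext (dg_inj h)

theorem diag_comp (f : p ⟶ q) (g : q ⟶ r) :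
    Eqv P.toPlanarAlgebra p.word r.word (diag (f ≫ g)) (diag f ++ diag g) := dg_comp _ _

theorem diag_tensor (f : p ⟶ q) (g : r ⟶ s) :
    Eqv P.toPlanarAlgebra (p.word ++ r.word) (q.word ++ s.word) (diag (f ⊗ₘ g))
      ((diag f).map (Layer.whisker [] r.word) ++ (diag g).map (Layer.whisker q.word [])) :=
  dg_tensor _ _

/-- Coherence isomorphisms are transports along equalities of projections, and a list of slices is
unchanged by a transport. Hence coherence laws can be checked on diagrams without casts. -/
theorem diag_comp_eqToHom (f : p ⟶ q) (h : q = r) : diag (f ≫ eqToHom h) = diag f := by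
  subst h; simp

theorem diag_eqToHom_comp (h : p = q) (f : q ⟶ r) : diag (eqToHom h ≫ f) = diag f := by
  subst h; simp

theorem diag_eqToHom (h : p = q) : diag (eqToHom h) = diag (𝟙 p) := by
  subst h; rfl

/-- The identity of `p` is drawn as a rectangle filled with `p`, not as bare strings, so such
rectangles have to be absorbed into neighbouring morphisms. -/
theorem id_diag (f : p ⟶ q) : Eqv P.toPlanarAlgebra p.word q.word (diag (𝟙 p) ++ diag f) (diag f) := by
  simpa using (diag_comp (𝟙 p) f).symm

theorem diag_id (f : p ⟶ q) : Eqv P.toPlanarAlgebra p.word q.word (diag f ++ diag (𝟙 q)) (diag f) := by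
  simpa using (diag_comp f (𝟙 q)).symm

theorem tensor_assoc' (p q r : Projection P) : (p ⊗ q) ⊗ r = p ⊗ (q ⊗ r) := tensor_assoc p q r

theorem associator_hom (p q r : Projection P) : (α_ p q r).hom = eqToHom (tensor_assoc' p q r) := rfl

theorem associator_inv (p q r : Projection P) :
    (α_ p q r).inv = eqToHom (tensor_assoc' p q r).symm := rfl

theorem unit_tensor' (p : Projection P) : 𝟙_ (Projection P) ⊗ p = p := unit_tensor p

theorem tensor_unit' (p : Projection P) : p ⊗ 𝟙_ (Projection P) = p := tensor_unit p

theorem leftUnitor_hom (p : Projection P) : (λ_ p).hom = eqToHom (unit_tensor' p) := rfl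

theorem leftUnitor_inv (p : Projection P) : (λ_ p).inv = eqToHom (unit_tensor' p).symm := rfl

theorem rightUnitor_hom (p : Projection P) : (ρ_ p).hom = eqToHom (tensor_unit' p) := rfl

theorem rightUnitor_inv (p : Projection P) : (ρ_ p).inv = eqToHom (tensor_unit' p).symm := rfl

theorem whiskerLeft_eq (p : Projection P) (f : q ⟶ r) : p ◁ f = 𝟙 p ⊗ₘ f := rfl

theorem whiskerRight_eq (p : Projection P) (f : q ⟶ r) : f ▷ p = f ⊗ₘ 𝟙 p := rfl

theorem tensorHom_id_id (p q : Projection P) : 𝟙 p ⊗ₘ 𝟙 q = 𝟙 (p ⊗ q) := rfl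

theorem eqToHom_tensor_id (h : p = q) :
    eqToHom h ⊗ₘ 𝟙 r = eqToHom (congrArg (fun p => p ⊗ r) h) := by
  subst h; rfl

theorem id_tensor_eqToHom (h : p = q) :
    𝟙 r ⊗ₘ eqToHom h = eqToHom (congrArg (fun p => r ⊗ p) h) := by
  subst h; rfl

theorem tensor_comp_tensor {p' q' r' : Projection P} (f : p ⟶ q) (g : q ⟶ r) (f' : p' ⟶ q')
    (g' : q' ⟶ r') : (f ⊗ₘ f') ≫ (g ⊗ₘ g') = (f ≫ g) ⊗ₘ (f' ≫ g') :=
  Subtype.ext (PlanarAlgebra.tensor_comp f.1 g.1 f'.1 g'.1)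

@[simp]
theorem word_tensor (p q : Projection P) : (p ⊗ q).word = p.word ++ q.word := rfl

@[simp]
theorem word_unit : (𝟙_ (Projection P)).word = [] := rfl

theorem diag_id_unit : Eqv P.toPlanarAlgebra [] [] (diag (𝟙 (𝟙_ (Projection P)))) [] :=
  dg_one (P := P.toPlanarAlgebra) []

instance : MonoidalCategory (Projection P) where
  tensorHom_def f g := by
    rw [whiskerLeft_eq, whiskerRight_eq, tensor_comp_tensor, Category.comp_id, Category.id_comp]
  id_tensorHom_id p q := rfl
  tensorHom_comp_tensorHom f g h k := tensor_comp_tensor f h g k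
  whiskerLeft_id p q := rfl
  id_whiskerRight p q := rfl
  associator_naturality {X₁ X₂ X₃ Y₁ Y₂ Y₃} f g h := by
    refine diag_inj ?_
    rw [associator_hom, associator_hom, diag_comp_eqToHom, diag_eqToHom_comp]
    have h1 := (diag_tensor (f ⊗ₘ g) h).trans ((diag_tensor f g).tensor (.refl (reads_diag h)))
    have h2 := ((diag_tensor f (g ⊗ₘ h)).trans
      ((Eqv.refl (reads_diag f)).tensor (diag_tensor g h))).symm
    exact Eqv.trans (by simpa [word_tensor] using h1) (by simpa [word_tensor] using h2)
  leftUnitor_naturality f := by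
    refine diag_inj ?_
    rw [leftUnitor_hom, leftUnitor_hom, diag_comp_eqToHom, diag_eqToHom_comp]
    have h1 := (diag_tensor (𝟙 (𝟙_ (Projection P))) f).trans
      (Eqv.tensor diag_id_unit (.refl (reads_diag f)))
    simpa [word_tensor, word_unit, whiskerLeft_eq] using h1
  rightUnitor_naturality {X Y} f := by
    refine diag_inj ?_
    rw [rightUnitor_hom, rightUnitor_hom, diag_comp_eqToHom, diag_eqToHom_comp]
    have h1 := (diag_tensor f (𝟙 (𝟙_ (Projection P)))).trans
      (Eqv.tensor (.refl (reads_diag f)) diag_id_unit)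
    simpa [word_tensor, word_unit, whiskerRight_eq] using h1
  pentagon W X Y Z := by
    simp only [associator_hom, whiskerLeft_eq, whiskerRight_eq, eqToHom_tensor_id,
      id_tensor_eqToHom, eqToHom_trans]
  triangle X Y := by
    simp only [associator_hom, leftUnitor_hom, rightUnitor_hom, whiskerLeft_eq, whiskerRight_eq,
      eqToHom_tensor_id, id_tensor_eqToHom, eqToHom_trans]

end Projection
end

/-! ### Absorbing identities; diagrams of evaluation and coevaluation -/

noncomputable section

open CategoryTheory MonoidalCategory

namespace Projection

open PlanarAlg PlanarAlgebra FactorPlanarAlgebra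

variable {L : Type u} {P : FactorPlanarAlgebra.{u, v} L} {p q r s t : Projection P}

@[simp]
theorem word_dual (p : Projection P) : (DualStarStruct.dual p).word = p.word.reverse := rfl

/-- The identity of a tensor product is absorbed on the left in each factor. -/
theorem id_left_diag (h : p ⊗ q ⟶ r) : Eqv P.toPlanarAlgebra (p.word ++ q.word) r.word
    ((diag (𝟙 p)).map (Layer.whisker [] q.word) ++ diag h) (diag h) := by
  -- Both identities together are absorbed by `h`. Insert them, merge the given copy of `𝟙 p` with
  -- the new one by idempotency, and absorb them again.
  have h1 := ((diag_tensor (𝟙 p) (𝟙 q)).append_right (reads_diag h)).symm.trans (id_diag h)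
  have h2 := h1.symm.append_left (F := (diag (𝟙 p)).map (Layer.whisker [] q.word))
    (rd_wh _ _ (reads_diag (𝟙 p)) rfl rfl)
  have h3 := (((id_diag (𝟙 p)).whisker [] q.word).append_right
    (rd_wh p.word [] (reads_diag (𝟙 q)) (by simp) rfl)).append_right (by simpa using reads_diag h)
  exact h2.trans ((by simpa using h3 : Eqv _ _ _ _ _).trans (by simpa using h1))

theorem id_right_diag (h : p ⊗ q ⟶ r) : Eqv P.toPlanarAlgebra (p.word ++ q.word) r.word
    ((diag (𝟙 q)).map (Layer.whisker p.word []) ++ diag h) (diag h) := by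
  have h1 := ((diag_tensor (𝟙 p) (𝟙 q)).append_right (reads_diag h)).symm.trans (id_diag h)
  have h0 := (Eqv.interchange (P := P.toPlanarAlgebra) (reads_diag (𝟙 p)) (reads_diag (𝟙 q))).append_right
    (reads_diag h)
  have h1' := h0.symm.trans h1
  have h2 := h1'.symm.append_left (F := (diag (𝟙 q)).map (Layer.whisker p.word []))
    (a := p.word ++ q.word)
    (rd_wh _ _ (reads_diag (𝟙 q)) (by simp) (by simp))
  have h3 := (((id_diag (𝟙 q)).whisker p.word []).append_right
    (rd_wh [] q.word (reads_diag (𝟙 p)) (by simp) rfl) (c := p.word ++ q.word)).append_right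
    (by simpa using reads_diag h)
  exact h2.trans ((by simpa using h3 : Eqv _ _ _ _ _).trans (by simpa using h1'))

theorem diag_id_left (h : r ⟶ p ⊗ q) : Eqv P.toPlanarAlgebra r.word (p.word ++ q.word)
    (diag h ++ (diag (𝟙 p)).map (Layer.whisker [] q.word)) (diag h) := by
  have h0 := (diag_tensor (𝟙 p) (𝟙 q)).trans
    (Eqv.interchange (P := P.toPlanarAlgebra) (reads_diag (𝟙 p)) (reads_diag (𝟙 q)))
  have h1 := (h0.append_left (reads_diag h)).symm.trans (diag_id h)
  have h2 := h1.symm.append_right (F := (diag (𝟙 p)).map (Layer.whisker [] q.word))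
    (rd_wh _ _ (reads_diag (𝟙 p)) rfl rfl)
  have h3 := (((id_diag (𝟙 p)).whisker [] q.word).append_left
    (rd_wh p.word [] (reads_diag (𝟙 q)) (by simp) (by simp)) (a := p.word ++ q.word)).append_left
    (a := r.word) (by simpa using reads_diag h)
  exact h2.trans ((by simpa using h3 : Eqv _ _ _ _ _).trans (by simpa using h1))

theorem diag_id_right (h : r ⟶ p ⊗ q) : Eqv P.toPlanarAlgebra r.word (p.word ++ q.word)
    (diag h ++ (diag (𝟙 q)).map (Layer.whisker p.word [])) (diag h) := by
  have h1 := ((diag_tensor (𝟙 p) (𝟙 q)).append_left (reads_diag h)).symm.trans (diag_id h)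
  have h2 := h1.symm.append_right (F := (diag (𝟙 q)).map (Layer.whisker p.word []))
    (c := p.word ++ q.word)
    (rd_wh _ _ (reads_diag (𝟙 q)) (by simp) (by simp))
  have h3 := (((id_diag (𝟙 q)).whisker p.word []).append_left
    (rd_wh [] q.word (reads_diag (𝟙 p)) (by simp) (by simp)) (a := p.word ++ q.word)).append_left
    (a := r.word) (by simpa using reads_diag h)
  exact h2.trans ((by simpa using h3 : Eqv _ _ _ _ _).trans (by simpa using h1))

/-- The rectangle of the whiskering object `r` is absorbed by `h`, so next to another morphism a
whiskering may be drawn with bare strings. The three variants below serve the same purpose. -/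
theorem diag_whiskerLeft_comp (f : p ⟶ q) (h : r ⊗ q ⟶ s) :
    Eqv P.toPlanarAlgebra (r.word ++ p.word) s.word (diag (r ◁ f ≫ h))
      ((diag f).map (Layer.whisker r.word []) ++ diag h) := by
  have h1 := ((diag_comp (r ◁ f) h).trans ((diag_tensor (𝟙 r) f).append_right (reads_diag h))).trans
    ((Eqv.interchange (P := P.toPlanarAlgebra) (reads_diag (𝟙 r)) (reads_diag f)).append_right
      (reads_diag h))
  have h2 := (id_left_diag h).append_left (F := (diag f).map (Layer.whisker r.word []))
    (a := r.word ++ p.word) (rd_wh _ _ (reads_diag f) (by simp) (by simp))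
  exact h1.trans (by simpa using h2)

theorem diag_whiskerRight_comp (f : p ⟶ q) (h : q ⊗ r ⟶ s) :
    Eqv P.toPlanarAlgebra (p.word ++ r.word) s.word (diag (f ▷ r ≫ h))
      ((diag f).map (Layer.whisker [] r.word) ++ diag h) := by
  have h1 := (diag_comp (f ▷ r) h).trans ((diag_tensor f (𝟙 r)).append_right (reads_diag h))
  have h2 := (id_right_diag h).append_left (F := (diag f).map (Layer.whisker [] r.word))
    (a := p.word ++ r.word) (rd_wh _ _ (reads_diag f) (by simp) (by simp))
  exact h1.trans (by simpa using h2)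

theorem diag_comp_whiskerLeft (f : p ⟶ q) (h : s ⟶ r ⊗ p) :
    Eqv P.toPlanarAlgebra s.word (r.word ++ q.word) (diag (h ≫ r ◁ f))
      (diag h ++ (diag f).map (Layer.whisker r.word [])) := by
  have h1 := (diag_comp h (r ◁ f)).trans ((diag_tensor (𝟙 r) f).append_left (reads_diag h))
  have h2 := (diag_id_left h).append_right (F := (diag f).map (Layer.whisker r.word []))
    (c := r.word ++ q.word) (rd_wh _ _ (reads_diag f) (by simp) (by simp))
  exact h1.trans (by simpa using h2)

theorem diag_comp_whiskerRight (f : p ⟶ q) (h : s ⟶ p ⊗ r) :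
    Eqv P.toPlanarAlgebra s.word (q.word ++ r.word) (diag (h ≫ f ▷ r))
      (diag h ++ (diag f).map (Layer.whisker [] r.word)) := by
  have h1 := ((diag_comp h (f ▷ r)).trans ((diag_tensor f (𝟙 r)).append_left (reads_diag h))).trans
    ((Eqv.interchange (P := P.toPlanarAlgebra) (reads_diag f) (reads_diag (𝟙 r))).append_left
      (reads_diag h))
  have h2 := (diag_id_right h).append_right (F := (diag f).map (Layer.whisker [] r.word))
    (c := q.word ++ r.word) (rd_wh _ _ (reads_diag f) (by simp) (by simp))
  exact h1.trans (by simpa using h2)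

open DualStarStruct

theorem dualHom_cup (f : p ⟶ q) : Eqv P.toPlanarAlgebra (q.word.reverse ++ p.word) []
    ((diag (dualHom f)).map (Layer.whisker [] p.word) ++ cups [] p.word.reverse [])
    ((diag f).map (Layer.whisker q.word.reverse []) ++ cups [] q.word.reverse []) :=
  rotate_cup (P := P.toPlanarAlgebra) f.1

theorem dualHom_cap (f : p ⟶ q) : Eqv P.toPlanarAlgebra [] (q.word ++ p.word.reverse)
    (caps [] p.word [] ++ (diag f).map (Layer.whisker [] p.word.reverse))
    (caps [] q.word [] ++ (diag (dualHom f)).map (Layer.whisker q.word [])) :=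
  rotate_cap (P := P.toPlanarAlgebra) f.1

theorem dualHom_cup' (f : p ⟶ q) : Eqv P.toPlanarAlgebra (p.word ++ q.word.reverse) []
    ((diag (dualHom f)).map (Layer.whisker p.word []) ++ cups [] p.word [])
    ((diag f).map (Layer.whisker [] q.word.reverse) ++ cups [] q.word []) :=
  rotate_cup' (P := P.toPlanarAlgebra) f.1

theorem dualHom_cap' (f : p ⟶ q) : Eqv P.toPlanarAlgebra [] (p.word.reverse ++ q.word)
    (caps [] p.word.reverse [] ++ (diag f).map (Layer.whisker p.word.reverse []))
    (caps [] q.word.reverse [] ++ (diag (dualHom f)).map (Layer.whisker [] q.word)) :=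
  rotate_cap' (P := P.toPlanarAlgebra) f.1

theorem dualHom_id (p : Projection P) : dualHom (𝟙 p) = 𝟙 (DualStarStruct.dual p) := rfl

/-- The projections on the two legs of the cup are brought onto one leg by sliding, where they
merge; a single copy remains. The same argument applies to the three lemmas that follow. -/
theorem diag_ev (p : Projection P) : Eqv P.toPlanarAlgebra (p.word.reverse ++ p.word) [] (diag (ev p))
    ((diag (𝟙 p)).map (Layer.whisker p.word.reverse []) ++ cups [] p.word.reverse []) := by
  have h1 : Eqv P.toPlanarAlgebra (p.word.reverse ++ p.word) [] (diag (ev p))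
      (diag (𝟙 (DualStarStruct.dual p ⊗ p)) ++ cups [] p.word.reverse []) :=
    (dg_comp _ _).trans ((dg_cup (P := P.toPlanarAlgebra) p.word).append_left
      (reads_diag (𝟙 (DualStarStruct.dual p ⊗ p))))
  have h2 := (diag_tensor (𝟙 (DualStarStruct.dual p)) (𝟙 p)).append_right
    (rd_cups (P := P.toPlanarAlgebra) [] p.word.reverse [] (by simp) rfl)
  have h3 := (dualHom_cup (𝟙 p)).symm.append_left
    (F := (diag (𝟙 (DualStarStruct.dual p))).map (Layer.whisker [] p.word))
    (a := p.word.reverse ++ p.word)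
    (rd_wh [] p.word (reads_diag (𝟙 (DualStarStruct.dual p))) (by simp) (by simp))
  have h4 := ((id_diag (𝟙 (DualStarStruct.dual p))).whisker [] p.word).append_right
    (rd_cups (P := P.toPlanarAlgebra) [] p.word.reverse [] (by simp) rfl)
  have h5 := dualHom_cup (𝟙 p)
  refine h1.trans (Eqv.trans (by simpa [dualHom_id] using h2) (Eqv.trans (by simpa [dualHom_id] using h3)
    (Eqv.trans (by simpa [dualHom_id] using h4) (by simpa [dualHom_id] using h5))))

theorem diag_coev (p : Projection P) : Eqv P.toPlanarAlgebra [] (p.word ++ p.word.reverse) (diag (coev p))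
    (caps [] p.word [] ++ (diag (𝟙 p)).map (Layer.whisker [] p.word.reverse)) := by
  have h1 : Eqv P.toPlanarAlgebra [] (p.word ++ p.word.reverse) (diag (coev p))
      (caps [] p.word [] ++ diag (𝟙 (p ⊗ DualStarStruct.dual p))) :=
    (dg_comp _ _).trans ((dg_cap (P := P.toPlanarAlgebra) p.word).append_right
      (reads_diag (𝟙 (p ⊗ DualStarStruct.dual p))))
  have h2 := ((diag_tensor (𝟙 p) (𝟙 (DualStarStruct.dual p))).trans
    (Eqv.interchange (P := P.toPlanarAlgebra) (reads_diag (𝟙 p))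
      (reads_diag (𝟙 (DualStarStruct.dual p))))).append_left
    (rd_caps (P := P.toPlanarAlgebra) [] p.word [] (by simp) rfl)
  have h3 := (dualHom_cap (𝟙 p)).symm.append_right
    (F := (diag (𝟙 p)).map (Layer.whisker [] p.word.reverse))
    (c := p.word ++ p.word.reverse)
    (rd_wh [] p.word.reverse (reads_diag (𝟙 p)) (by simp) (by simp))
  have h4 := ((id_diag (𝟙 p)).whisker [] p.word.reverse).append_left (a := [])
    (rd_caps (P := P.toPlanarAlgebra) [] p.word [] (by simp) rfl)
  refine h1.trans (Eqv.trans (by simpa [dualHom_id] using h2)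
    (Eqv.trans (by simpa [dualHom_id] using h3) (by simpa [dualHom_id] using h4)))

theorem diag_adj_ev (p : Projection P) :
    Eqv P.toPlanarAlgebra [] (p.word.reverse ++ p.word) (diag (DualStarStruct.adj (ev p)))
    (caps [] p.word.reverse [] ++ (diag (𝟙 p)).map (Layer.whisker p.word.reverse [])) := by
  have h1 : Eqv P.toPlanarAlgebra [] (p.word.reverse ++ p.word) (diag (DualStarStruct.adj (ev p)))
      (caps [] p.word.reverse [] ++ diag (𝟙 (DualStarStruct.dual p ⊗ p))) := by
    have e : (DualStarStruct.adj (ev p)).1 = comp (FactorPlanarAlgebra.adj (P.cup p.word))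
        (p.dual.tensor p).elt := by
      change FactorPlanarAlgebra.adj (comp _ _) = _
      exact (adj_comp (α := p.dual.word ++ p.word) (β := p.dual.word ++ p.word) (γ := []) _ _).trans
        (congrArg _ (p.dual.tensor p).selfAdj)
    rw [diag, e]
    exact (dg_comp _ _).trans ((dg_adj_cup p.word).append_right
      (reads_diag (𝟙 (DualStarStruct.dual p ⊗ p))))
  have h2 := (diag_tensor (𝟙 (DualStarStruct.dual p)) (𝟙 p)).append_left
    (rd_caps (P := P.toPlanarAlgebra) [] p.word.reverse [] (by simp) rfl)
  have h3 := (dualHom_cap' (𝟙 p)).symm.append_right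
    (F := (diag (𝟙 p)).map (Layer.whisker p.word.reverse []))
    (c := p.word.reverse ++ p.word)
    (rd_wh p.word.reverse [] (reads_diag (𝟙 p)) (by simp) (by simp))
  have h4 := ((id_diag (𝟙 p)).whisker p.word.reverse []).append_left (a := [])
    (rd_caps (P := P.toPlanarAlgebra) [] p.word.reverse [] (by simp) rfl)
  refine h1.trans (Eqv.trans (by simpa [dualHom_id] using h2)
    (Eqv.trans (by simpa [dualHom_id] using h3) (by simpa [dualHom_id] using h4)))

theorem diag_adj_coev (p : Projection P) :
    Eqv P.toPlanarAlgebra (p.word ++ p.word.reverse) [] (diag (DualStarStruct.adj (coev p)))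
    ((diag (𝟙 p)).map (Layer.whisker [] p.word.reverse) ++ cups [] p.word []) := by
  have h1 : Eqv P.toPlanarAlgebra (p.word ++ p.word.reverse) [] (diag (DualStarStruct.adj (coev p)))
      (diag (𝟙 (p ⊗ DualStarStruct.dual p)) ++ cups [] p.word []) := by
    have e : (DualStarStruct.adj (coev p)).1 = comp (p.tensor p.dual).elt
        (FactorPlanarAlgebra.adj (P.cap p.word)) := by
      change FactorPlanarAlgebra.adj (comp _ _) = _
      exact (adj_comp (α := []) (β := p.word ++ p.dual.word) (γ := p.word ++ p.dual.word) _ _).trans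
        (congrArg (fun x => comp x _) (p.tensor p.dual).selfAdj)
    rw [diag, e]
    exact (dg_comp _ _).trans ((dg_adj_cap p.word).append_left
      (reads_diag (𝟙 (p ⊗ DualStarStruct.dual p))))
  have h2 := (diag_tensor (𝟙 p) (𝟙 (DualStarStruct.dual p))).append_right
    (rd_cups (P := P.toPlanarAlgebra) [] p.word [] (by simp) rfl)
  have h3 := (dualHom_cup' (𝟙 p)).append_left
    (F := (diag (𝟙 p)).map (Layer.whisker [] p.word.reverse))
    (a := p.word ++ p.word.reverse)
    (rd_wh [] p.word.reverse (reads_diag (𝟙 p)) (by simp) (by simp))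
  have h4 := ((id_diag (𝟙 p)).whisker [] p.word.reverse).append_right (c := [])
    (rd_cups (P := P.toPlanarAlgebra) [] p.word [] (by simp) rfl)
  refine h1.trans (Eqv.trans (by simpa [dualHom_id] using h2)
    (Eqv.trans (by simpa [dualHom_id] using h3) (by simpa [dualHom_id] using h4)))

end Projection
end

/-! ### Zigzag, pivotal and spherical laws for projections -/

noncomputable section

open CategoryTheory MonoidalCategory

namespace Projection

open PlanarAlg PlanarAlgebra FactorPlanarAlgebra DualStarStruct

variable {L : Type u} {P : FactorPlanarAlgebra.{u, v} L} {p q r s t : Projection P}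

theorem diag_ev_diag (p : Projection P) : Eqv P.toPlanarAlgebra (p.word.reverse ++ p.word) []
    ((diag (𝟙 p)).map (Layer.whisker p.word.reverse []) ++ diag (ev p)) (diag (ev p)) := by
  simpa using id_right_diag (ev p)

/-- A strand labelled by a projection, pulled straight. -/
theorem zigzag_aux (p : Projection P) : Eqv P.toPlanarAlgebra p.word p.word
    ((diag (coev p)).map (Layer.whisker [] p.word) ++ (diag (ev p)).map (Layer.whisker p.word []))
    (diag (𝟙 p)) := by
  have hp := reads_diag (𝟙 p)
  have h1 := Eqv.append (b := p.word ++ p.word.reverse ++ p.word)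
    (by simpa using (diag_coev p).whisker [] p.word) (by simpa using (diag_ev p).whisker p.word [])
  have h2 := (((Eqv.interchange (P := P.toPlanarAlgebra) (rd_caps (P := P.toPlanarAlgebra) [] p.word []
    (y := p.word ++ p.word.reverse) (by simp) rfl) hp).append_right (c := p.word)
    (F := (diag (𝟙 p)).map (Layer.whisker [] (p.word.reverse ++ p.word)) ++
      cups p.word p.word.reverse []) (Reads.append (b := p.word ++ p.word.reverse ++ p.word)
        (rd_wh _ _ hp (by simp) (by simp)) (rd_cups _ _ _ (by simp) (by simp)))))
  have h3 := ((Eqv.interchange (P := P.toPlanarAlgebra) hp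
    (rd_cups (P := P.toPlanarAlgebra) [] p.word.reverse [] (x := p.word.reverse ++ p.word)
      (by simp) rfl))).append_left (F := diag (𝟙 p) ++ caps [] p.word p.word) (a := p.word)
    (hp.append (rd_caps _ _ _ (by simp) rfl))
  have h4 := ((Eqv.zig (P := P.toPlanarAlgebra) p.word).append_left hp).append_right hp
  have h6 := ((Eqv.slide (P := P.toPlanarAlgebra) [] p.word.reverse [] hp hp).append_left
    (F := caps [] p.word p.word) (a := p.word) (rd_caps _ _ _ (by simp) rfl)).append_right
    (F := cups p.word p.word.reverse []) (c := p.word) (rd_cups _ _ _ (by simp) (by simp))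
  -- The copies of `p` on the cap and on the cup are moved apart until a bare zigzag lies between
  -- two of them; after straightening, the copies merge.
  refine (by simpa using h1 : Eqv _ _ _ _ _).trans ((by simpa using h6 : Eqv _ _ _ _ _).trans
    ((by simpa using h2 : Eqv _ _ _ _ _).trans ((by simpa using h3 : Eqv _ _ _ _ _).trans
    ((by simpa using h4 : Eqv _ _ _ _ _).trans (by simpa using id_diag (𝟙 p))))))

theorem diag_eqToHom' (h : p = q) : diag (eqToHom h) = diag (𝟙 q) := by
  subst h; rfl

theorem id_diag_id (p : Projection P) :
    Eqv P.toPlanarAlgebra p.word p.word (diag (𝟙 p) ++ diag (𝟙 p)) (diag (𝟙 p)) := id_diag _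

theorem diag_dualHom (f : p ⟶ q) : Eqv P.toPlanarAlgebra q.word.reverse p.word.reverse
    (diag (dualHom f)) (caps q.word.reverse p.word [] ++
      (diag f).map (Layer.whisker q.word.reverse p.word.reverse) ++
      cups [] q.word.reverse p.word.reverse) := dg_rotate (P := P.toPlanarAlgebra) f.1

theorem diag_dualHom' (f : p ⟶ q) : Eqv P.toPlanarAlgebra q.word.reverse p.word.reverse
    (diag (dualHom f)) (caps [] p.word.reverse q.word.reverse ++
      (diag f).map (Layer.whisker p.word.reverse q.word.reverse) ++
      cups p.word.reverse q.word []) := dg_rotate' (P := P.toPlanarAlgebra) f.1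

theorem id_diag_id_comp (f : p ⟶ q) : Eqv P.toPlanarAlgebra p.word q.word
    (diag (𝟙 p) ++ (diag f ++ diag (𝟙 q))) (diag f) :=
  ((diag_id f).append_left (reads_diag (𝟙 p))).trans (id_diag f)

/-- The projections contained in `coev p` and `ev q` are absorbed by `f`, and what remains is the
picture `diag_dualHom` of the half turn. -/
theorem rotate_aux (f : p ⟶ q) : Eqv P.toPlanarAlgebra q.word.reverse p.word.reverse
    ((diag (coev p)).map (Layer.whisker q.word.reverse []) ++
      (diag f).map (Layer.whisker q.word.reverse p.word.reverse) ++
      (diag (ev q)).map (Layer.whisker [] p.word.reverse)) (diag (dualHom f)) := by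
  have h1 := (((diag_coev p).whisker q.word.reverse []).append_right
    (F := (diag f).map (Layer.whisker q.word.reverse p.word.reverse))
    (c := q.word.reverse ++ q.word ++ p.word.reverse)
    (rd_wh _ _ (reads_diag f) (by simp) (by simp))).append (c := p.word.reverse)
    (by simpa using (diag_ev q).whisker [] p.word.reverse)
  have h2 := (((id_diag_id_comp f).whisker q.word.reverse p.word.reverse).append_left
    (F := caps q.word.reverse p.word []) (a := q.word.reverse)
    (rd_caps _ _ _ (by simp) (by simp))).append_right (c := p.word.reverse)
    (F := cups [] q.word.reverse p.word.reverse) (rd_cups _ _ _ (by simp) (by simp))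
  have h3 := (diag_dualHom f).symm
  exact (by simpa using h1 : Eqv _ _ _ _ _).trans ((by simpa using h2 : Eqv _ _ _ _ _).trans
    (by simpa using h3))

/-- The counterpart of `rotate_aux` around the other side, where `diag_dualHom'` is the matching
picture; invariance under turning a rectangle makes both give the same dual. -/
theorem rotate_aux' (f : p ⟶ q) : Eqv P.toPlanarAlgebra q.word.reverse p.word.reverse
    ((diag (DualStarStruct.adj (ev p))).map (Layer.whisker [] q.word.reverse) ++
      (diag f).map (Layer.whisker p.word.reverse q.word.reverse) ++
      (diag (DualStarStruct.adj (coev q))).map (Layer.whisker p.word.reverse [])) (diag (dualHom f)) := by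
  have h1 := (((diag_adj_ev p).whisker [] q.word.reverse).append_right
    (F := (diag f).map (Layer.whisker p.word.reverse q.word.reverse))
    (c := p.word.reverse ++ q.word ++ q.word.reverse)
    (rd_wh _ _ (reads_diag f) (by simp) (by simp))).append (c := p.word.reverse)
    (by simpa using (diag_adj_coev q).whisker p.word.reverse [])
  have h2 := (((id_diag_id_comp f).whisker p.word.reverse q.word.reverse).append_left
    (F := caps [] p.word.reverse q.word.reverse) (a := q.word.reverse)
    (rd_caps _ _ _ (by simp) (by simp))).append_right (c := p.word.reverse)
    (F := cups p.word.reverse q.word []) (rd_cups _ _ _ (by simp) (by simp))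
  have h3 := (diag_dualHom' f).symm
  exact (by simpa using h1 : Eqv _ _ _ _ _).trans ((by simpa using h2 : Eqv _ _ _ _ _).trans
    (by simpa using h3))

theorem diag_id_tensor_unit (p : Projection P) : diag (𝟙 (p ⊗ 𝟙_ (Projection P))) = diag (𝟙 p) :=
  (diag_eqToHom (tensor_unit' p)).symm.trans (diag_eqToHom' _)

theorem diag_id_unit_tensor (p : Projection P) : diag (𝟙 (𝟙_ (Projection P) ⊗ p)) = diag (𝟙 p) :=
  (diag_eqToHom (unit_tensor' p)).symm.trans (diag_eqToHom' _)

theorem zigzag (p : Projection P) : coev p ▷ p ≫ (α_ p (DualStarStruct.dual p) p).hom ≫ p ◁ ev p =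
    (λ_ p).hom ≫ (ρ_ p).inv := by
  refine diag_inj ?_
  -- A trailing identity is added so that the lemmas on a whiskering followed by a morphism apply.
  rw [leftUnitor_hom, rightUnitor_inv, eqToHom_trans, diag_eqToHom', diag_id_tensor_unit, associator_hom,
    ← Category.comp_id (p ◁ ev p)]
  have h1 := diag_whiskerRight_comp (coev p) (eqToHom (tensor_assoc' p (DualStarStruct.dual p) p) ≫ p ◁ ev p ≫ 𝟙 _)
  rw [diag_eqToHom_comp] at h1
  have h2 := (diag_whiskerLeft_comp (ev p) (𝟙 (p ⊗ 𝟙_ _))).append_left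
    (F := (diag (coev p)).map (Layer.whisker [] p.word)) (a := p.word)
    (rd_wh _ _ (reads_diag _) rfl (by simp))
  rw [diag_id_tensor_unit] at h2
  have h3 := (zigzag_aux p).append_right (reads_diag (𝟙 p))
  exact (by simpa using h1 : Eqv _ _ _ _ _).trans ((by simpa using h2 : Eqv _ _ _ _ _).trans
    ((by simpa using h3 : Eqv _ _ _ _ _).trans (by simpa using id_diag_id p)))

theorem zagzig (p : Projection P) : DualStarStruct.dual p ◁ coev p ≫
    (α_ (DualStarStruct.dual p) p (DualStarStruct.dual p)).inv ≫ ev p ▷ DualStarStruct.dual p =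
    (ρ_ (DualStarStruct.dual p)).hom ≫ (λ_ (DualStarStruct.dual p)).inv := by
  refine diag_inj ?_
  rw [rightUnitor_hom, leftUnitor_inv, eqToHom_trans, diag_eqToHom', diag_id_unit_tensor, associator_inv,
    ← Category.comp_id (ev p ▷ DualStarStruct.dual p)]
  have h1 := diag_whiskerLeft_comp (coev p) (eqToHom (tensor_assoc' _ _ _).symm ≫
    ev p ▷ DualStarStruct.dual p ≫ 𝟙 _)
  rw [diag_eqToHom_comp] at h1
  have h2 := (diag_whiskerRight_comp (ev p) (𝟙 (𝟙_ _ ⊗ DualStarStruct.dual p))).append_left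
    (F := (diag (coev p)).map (Layer.whisker p.word.reverse [])) (a := p.word.reverse)
    (rd_wh _ _ (reads_diag _) (by simp) (by simp))
  rw [diag_id_unit_tensor] at h2
  have h3 := (((diag_ev_diag p).whisker [] p.word.reverse).append_left
    (F := (diag (coev p)).map (Layer.whisker p.word.reverse [])) (a := p.word.reverse)
    (rd_wh _ _ (reads_diag _) (by simp) (by simp))).symm.trans
    (by simpa [dualHom_id] using rotate_aux (𝟙 p))
  have h4 := h3.append_right (reads_diag (𝟙 (DualStarStruct.dual p)))
  exact (by simpa using h1 : Eqv _ _ _ _ _).trans ((by simpa using h2 : Eqv _ _ _ _ _).trans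
    ((by simpa using h4 : Eqv _ _ _ _ _).trans (by simpa using id_diag_id (DualStarStruct.dual p))))

theorem dualHom_eq (f : p ⟶ q) : dualHom f =
    (ρ_ (DualStarStruct.dual q)).inv ≫ DualStarStruct.dual q ◁ coev p ≫
      DualStarStruct.dual q ◁ (f ▷ DualStarStruct.dual p) ≫
      (α_ (DualStarStruct.dual q) q (DualStarStruct.dual p)).inv ≫ ev q ▷ DualStarStruct.dual p ≫
        (λ_ (DualStarStruct.dual p)).hom := by
  refine diag_inj ?_
  rw [rightUnitor_inv, associator_inv, leftUnitor_hom, diag_eqToHom_comp,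
    ← MonoidalCategory.whiskerLeft_comp_assoc]
  refine Eqv.symm ?_
  have h1 := diag_whiskerLeft_comp (coev p ≫ f ▷ DualStarStruct.dual p)
    (eqToHom (tensor_assoc' _ _ _).symm ≫ ev q ▷ DualStarStruct.dual p ≫
      eqToHom (unit_tensor' (DualStarStruct.dual p)))
  rw [diag_eqToHom_comp] at h1
  have h2 := Eqv.append (b := q.word.reverse ++ q.word ++ p.word.reverse)
    (by simpa using (diag_comp_whiskerRight f (coev p)).whisker q.word.reverse [])
    (diag_whiskerRight_comp (ev q) (eqToHom (unit_tensor' (DualStarStruct.dual p))))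
  rw [diag_eqToHom'] at h2
  have h3 := (rotate_aux f).append_right (reads_diag (𝟙 (DualStarStruct.dual p)))
  exact (by simpa using h1 : Eqv _ _ _ _ _).trans ((by simpa using h2 : Eqv _ _ _ _ _).trans
    ((by simpa using h3 : Eqv _ _ _ _ _).trans (by simpa using diag_id (dualHom f))))

theorem dualHom_eq_left (f : p ⟶ q) : dualHom f =
    (λ_ (DualStarStruct.dual q)).inv ≫ DualStarStruct.adj (ev p) ▷ DualStarStruct.dual q ≫
      (α_ (DualStarStruct.dual p) p (DualStarStruct.dual q)).hom ≫
      DualStarStruct.dual p ◁ (f ▷ DualStarStruct.dual q) ≫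
        DualStarStruct.dual p ◁ DualStarStruct.adj (coev q) ≫ (ρ_ (DualStarStruct.dual p)).hom := by
  refine diag_inj ?_
  rw [leftUnitor_inv, associator_hom, rightUnitor_hom, diag_eqToHom_comp,
    ← MonoidalCategory.whiskerLeft_comp_assoc]
  refine Eqv.symm ?_
  have h1 := diag_whiskerRight_comp (DualStarStruct.adj (ev p)) (eqToHom (tensor_assoc' _ _ _) ≫
    DualStarStruct.dual p ◁ (f ▷ DualStarStruct.dual q ≫ DualStarStruct.adj (coev q)) ≫
      eqToHom (tensor_unit' (DualStarStruct.dual p)))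
  rw [diag_eqToHom_comp] at h1
  have h2 := (diag_whiskerLeft_comp (f ▷ DualStarStruct.dual q ≫ DualStarStruct.adj (coev q))
    (eqToHom (tensor_unit' (DualStarStruct.dual p)))).append_left
    (F := (diag (DualStarStruct.adj (ev p))).map (Layer.whisker [] q.word.reverse))
    (a := q.word.reverse) (rd_wh _ _ (reads_diag _) (by simp) (by simp))
  rw [diag_eqToHom'] at h2
  have h3 := (((diag_whiskerRight_comp f (DualStarStruct.adj (coev q))).whisker p.word.reverse []).append_left
    (F := (diag (DualStarStruct.adj (ev p))).map (Layer.whisker [] q.word.reverse))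
    (a := q.word.reverse) (rd_wh _ _ (reads_diag _) (by simp) (by simp))).append_right
    (F := diag (𝟙 (DualStarStruct.dual p))) (c := p.word.reverse)
    (by simpa using reads_diag (𝟙 (DualStarStruct.dual p)))
  have h4 := (rotate_aux' f).append_right (reads_diag (𝟙 (DualStarStruct.dual p)))
  exact (by simpa using h1 : Eqv _ _ _ _ _).trans ((by simpa using h2 : Eqv _ _ _ _ _).trans
    ((by simpa using h3 : Eqv _ _ _ _ _).trans ((by simpa using h4 : Eqv _ _ _ _ _).trans
      (by simpa using diag_id (dualHom f)))))

/-- Once all projections are absorbed, the two sides are the left and the right closure of `f`, and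
`sphere` applies. -/
theorem spherical' (f : p ⟶ p) : DualStarStruct.adj (ev p) ≫ DualStarStruct.dual p ◁ f ≫ ev p =
    coev p ≫ f ▷ DualStarStruct.dual p ≫ DualStarStruct.adj (coev p) := by
  refine diag_inj ?_
  have h1 := (diag_comp (DualStarStruct.adj (ev p)) (DualStarStruct.dual p ◁ f ≫ ev p)).trans
    ((diag_adj_ev p).append ((diag_whiskerLeft_comp f (ev p)).trans ((diag_ev p).append_left
      (a := p.word.reverse ++ p.word)
      (rd_wh p.word.reverse [] (reads_diag f) (by simp) (by simp)))))
  have h2 := (diag_comp (coev p) (f ▷ DualStarStruct.dual p ≫ DualStarStruct.adj (coev p))).trans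
    ((diag_coev p).append ((diag_whiskerRight_comp f (DualStarStruct.adj (coev p))).trans
      ((diag_adj_coev p).append_left (a := p.word ++ p.word.reverse)
      (rd_wh [] p.word.reverse (reads_diag f) (by simp) (by simp)))))
  have h3 := (((id_diag_id_comp f).whisker p.word.reverse []).append_left (a := [])
    (rd_caps (P := P.toPlanarAlgebra) [] p.word.reverse [] (by simp) (by simp))).append_right (c := [])
    (rd_cups (P := P.toPlanarAlgebra) [] p.word.reverse [] (by simp) (by simp))
  have h4 := (((id_diag_id_comp f).whisker [] p.word.reverse).append_left (a := [])
    (rd_caps (P := P.toPlanarAlgebra) [] p.word [] (by simp) (by simp))).append_right (c := [])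
    (rd_cups (P := P.toPlanarAlgebra) [] p.word [] (by simp) (by simp))
  have h5 := (sphere f.1).symm
  have k1 := (by simpa using h1 : Eqv _ _ _ _ _).trans ((by simpa using h3 : Eqv _ _ _ _ _))
  have k2 := (by simpa using h2 : Eqv _ _ _ _ _).trans ((by simpa using h4 : Eqv _ _ _ _ _))
  exact k1.trans (Eqv.trans (by simpa [diag] using h5) k2.symm)

/-- Two half turns of a rectangle cancel, so this is an equality on the nose, and the isomorphism
with the double dual is a transport. -/
theorem dual_dual (p : Projection P) : DualStarStruct.dual (DualStarStruct.dual p) = p :=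
  ext_castV (List.reverse_reverse _) (rotate_rotate p.elt)

theorem dual_tensor' (p q : Projection P) :
    DualStarStruct.dual (p ⊗ q) = DualStarStruct.dual q ⊗ DualStarStruct.dual p :=
  ext_castV (List.reverse_append) (rotate_tensor p.elt q.elt)

theorem adj_eqToHom (h : p = q) : DualStarStruct.adj (eqToHom h) = eqToHom h.symm := by
  subst h
  exact Subtype.ext p.selfAdj

theorem isUnitary_eqToHom (h : p = q) : IsUnitary (eqToHom h) := by
  rw [IsUnitary, adj_eqToHom, eqToHom_trans, eqToHom_trans]
  exact ⟨rfl, rfl⟩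

theorem dualHom_dualHom (f : p ⟶ q) :
    f ≫ eqToHom (dual_dual q).symm = eqToHom (dual_dual p).symm ≫ dualHom (dualHom f) := by
  refine diag_inj ?_
  rw [diag_comp_eqToHom, diag_eqToHom_comp]
  have h : Eqv P.toPlanarAlgebra p.word q.word (diag (dualHom (dualHom f))) (diag f) :=
    dg_rotate_rotate (P := P.toPlanarAlgebra) f.1
  simpa using h.symm

/-- The two sides are one and the same cap with the projection on different legs, and sliding along
the cap identifies them. -/
theorem coev_dual_dual (p : Projection P) :
    coev p ≫ eqToHom (dual_dual p).symm ▷ DualStarStruct.dual p =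
      DualStarStruct.adj (ev (DualStarStruct.dual p)) := by
  refine diag_inj ?_
  have h1 := diag_comp_whiskerRight (eqToHom (dual_dual p).symm) (coev p)
  rw [diag_eqToHom] at h1
  have h2 := diag_id_left (coev p)
  have h3 := diag_coev p
  have h4 := (diag_adj_ev (DualStarStruct.dual p)).symm
  have h5 := dualHom_cap (𝟙 p)
  refine (by simpa using h1 : Eqv _ _ _ _ _).trans ((by simpa using h2 : Eqv _ _ _ _ _).trans
    ((by simpa using h3 : Eqv _ _ _ _ _).trans ((by simpa [dualHom_id] using h5 : Eqv _ _ _ _ _).trans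
    (by simpa using h4))))

end Projection
end

/-! ### Axioms not requiring direct sums, and their proof for projections -/

noncomputable section

open CategoryTheory MonoidalCategory

open DualStarStruct in
/-- A rigid `*`-category in which self-adjoint projections split, not assumed to have direct sums;
positivity is required for finite families. -/
structure IsRigidStarCategory (C : Type*) [Category C] [Preadditive C] [Linear ℂ C]
    [MonoidalCategoryStruct C] [DualStarStruct C] : Prop where
  monoidal : ∃ M : MonoidalCategory C,
    M.toMonoidalCategoryStruct = (inferInstance : MonoidalCategoryStruct C)
  finiteDimensional : ∀ X Y : C, FiniteDimensional ℂ (X ⟶ Y)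
  add_tensor : ∀ {W X Y Z : C} (f f' : W ⟶ X) (g : Y ⟶ Z), (f + f') ⊗ₘ g = f ⊗ₘ g + f' ⊗ₘ g
  tensor_add : ∀ {W X Y Z : C} (f : W ⟶ X) (g g' : Y ⟶ Z), f ⊗ₘ (g + g') = f ⊗ₘ g + f ⊗ₘ g'
  smul_tensor : ∀ {W X Y Z : C} (z : ℂ) (f : W ⟶ X) (g : Y ⟶ Z), (z • f) ⊗ₘ g = z • (f ⊗ₘ g)
  tensor_smul : ∀ {W X Y Z : C} (z : ℂ) (f : W ⟶ X) (g : Y ⟶ Z), f ⊗ₘ (z • g) = z • (f ⊗ₘ g)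
  end_unit : ∀ f : 𝟙_ C ⟶ 𝟙_ C, ∃! z : ℂ, f = z • 𝟙 (𝟙_ C)
  split : ∀ {X : C} (e : X ⟶ X), e ≫ e = e → adj e = e →
    ∃ (S : C) (i : S ⟶ X), i ≫ adj i = 𝟙 S ∧ adj i ≫ i = e
  adj_add : ∀ {X Y : C} (f g : X ⟶ Y), adj (f + g) = adj f + adj g
  adj_smul : ∀ {X Y : C} (z : ℂ) (f : X ⟶ Y), adj (z • f) = (starRingEnd ℂ) z • adj f
  adj_adj : ∀ {X Y : C} (f : X ⟶ Y), adj (adj f) = f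
  adj_id : ∀ X : C, adj (𝟙 X) = 𝟙 X
  adj_comp : ∀ {X Y Z : C} (f : X ⟶ Y) (g : Y ⟶ Z), adj (f ≫ g) = adj g ≫ adj f
  positive : ∀ {ι : Type} [Fintype ι] {X : C} {Y : ι → C} (f : ∀ i, X ⟶ Y i),
    ∑ i, f i ≫ adj (f i) = 0 → ∀ i, f i = 0
  adj_tensor : ∀ {W X Y Z : C} (f : W ⟶ X) (g : Y ⟶ Z), adj (f ⊗ₘ g) = adj f ⊗ₘ adj g
  associator_unitary : ∀ X Y Z : C, IsUnitary (α_ X Y Z).hom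
  leftUnitor_unitary : ∀ X : C, IsUnitary (λ_ X).hom
  rightUnitor_unitary : ∀ X : C, IsUnitary (ρ_ X).hom
  zigzag : ∀ X : C, coev X ▷ X ≫ (α_ X (dual X) X).hom ≫ X ◁ ev X = (λ_ X).hom ≫ (ρ_ X).inv
  zagzig : ∀ X : C, dual X ◁ coev X ≫ (α_ (dual X) X (dual X)).inv ≫ ev X ▷ dual X =
    (ρ_ (dual X)).hom ≫ (λ_ (dual X)).inv
  dualHom_eq : ∀ {X Y : C} (f : X ⟶ Y), dualHom f =
    (ρ_ (dual Y)).inv ≫ dual Y ◁ coev X ≫ dual Y ◁ (f ▷ dual X) ≫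
      (α_ (dual Y) Y (dual X)).inv ≫ ev Y ▷ dual X ≫ (λ_ (dual X)).hom
  dualHom_eq_left : ∀ {X Y : C} (f : X ⟶ Y), dualHom f =
    (λ_ (dual Y)).inv ≫ adj (ev X) ▷ dual Y ≫ (α_ (dual X) X (dual Y)).hom ≫
      dual X ◁ (f ▷ dual Y) ≫ dual X ◁ adj (coev Y) ≫ (ρ_ (dual X)).hom
  adj_dualHom : ∀ {X Y : C} (f : X ⟶ Y), adj (dualHom f) = dualHom (adj f)
  dual_tensor : ∀ X Y : C, ∃ ν : dual (X ⊗ Y) ⟶ dual Y ⊗ dual X, IsUnitary ν ∧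
    ev (X ⊗ Y) = ν ▷ (X ⊗ Y) ≫ (α_ (dual Y) (dual X) (X ⊗ Y)).hom ≫
      dual Y ◁ ((α_ (dual X) X Y).inv ≫ ev X ▷ Y ≫ (λ_ Y).hom) ≫ ev Y ∧
    coev (X ⊗ Y) ≫ (X ⊗ Y) ◁ ν = coev X ≫
      ((ρ_ X).inv ≫ X ◁ coev Y ≫ (α_ X Y (dual Y)).inv) ▷ dual X ≫
        (α_ (X ⊗ Y) (dual Y) (dual X)).hom
  double_dual : ∃ φ : ∀ X : C, X ⟶ dual (dual X), (∀ X, IsUnitary (φ X)) ∧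
    (∀ {X Y : C} (f : X ⟶ Y), f ≫ φ Y = φ X ≫ dualHom (dualHom f)) ∧
    ∀ X, coev X ≫ φ X ▷ dual X = adj (ev (dual X))
  spherical : ∀ {X : C} (f : X ⟶ X),
    adj (ev X) ≫ dual X ◁ f ≫ ev X = coev X ≫ f ▷ dual X ≫ adj (coev X)

namespace Projection

open PlanarAlg PlanarAlgebra FactorPlanarAlgebra DualStarStruct

variable {L : Type u} {P : FactorPlanarAlgebra.{u, v} L} {p q r s t : Projection P}

/-- The cup of the word of `p ⊗ q` consists of the cup of `p` nested inside that of `q`; both sides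
are these nested cups once superfluous copies of the projections are absorbed. -/
theorem ev_tensor (p q : Projection P) : ev (p ⊗ q) = eqToHom (dual_tensor' p q) ▷ (p ⊗ q) ≫
    (α_ (DualStarStruct.dual q) (DualStarStruct.dual p) (p ⊗ q)).hom ≫
      DualStarStruct.dual q ◁ ((α_ (DualStarStruct.dual p) p q).inv ≫ ev p ▷ q ≫ (λ_ q).hom) ≫ ev q := by
  refine diag_inj (Eqv.symm ?_)
  have hp := reads_diag (𝟙 p)
  have hq := reads_diag (𝟙 q)
  have hR := reads_diag (𝟙 (DualStarStruct.dual (p ⊗ q)))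
  simp only [word_dual, word_tensor, List.reverse_append] at hR
  rw [associator_inv, associator_hom, leftUnitor_hom]
  have h1 := diag_whiskerRight_comp (eqToHom (dual_tensor' p q)) (eqToHom (tensor_assoc' _ _ _) ≫
    DualStarStruct.dual q ◁ (eqToHom (tensor_assoc' _ _ _).symm ≫ ev p ▷ q ≫
      eqToHom (unit_tensor' q)) ≫ ev q)
  rw [diag_eqToHom_comp, diag_eqToHom] at h1
  have h2 := (diag_whiskerLeft_comp (eqToHom (tensor_assoc' _ _ _).symm ≫ ev p ▷ q ≫
    eqToHom (unit_tensor' q)) (ev q)).append_left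
    (F := (diag (𝟙 (DualStarStruct.dual (p ⊗ q)))).map (Layer.whisker [] (p.word ++ q.word)))
    (a := q.word.reverse ++ p.word.reverse ++ p.word ++ q.word)
    (rd_wh _ _ hR (by simp) (by simp))
  rw [diag_eqToHom_comp] at h2
  have h3 := (((diag_whiskerRight_comp (ev p) (eqToHom (unit_tensor' q))).whisker q.word.reverse []).append_left
    (F := (diag (𝟙 (DualStarStruct.dual (p ⊗ q)))).map (Layer.whisker [] (p.word ++ q.word)))
    (a := q.word.reverse ++ p.word.reverse ++ p.word ++ q.word)
    (rd_wh _ _ hR (by simp) (by simp))).append_right (F := diag (ev q)) (c := [])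
    (by simpa using reads_diag (ev q))
  rw [diag_eqToHom'] at h3
  have h4 := (diag_ev_diag q).append_left
    (F := (diag (𝟙 (DualStarStruct.dual (p ⊗ q)))).map (Layer.whisker [] (p.word ++ q.word)) ++
      (diag (ev p)).map (Layer.whisker q.word.reverse q.word))
    (a := q.word.reverse ++ p.word.reverse ++ p.word ++ q.word)
    (Reads.append (rd_wh _ _ hR (by simp) rfl) (rd_wh _ _ (reads_diag (ev p)) (by simp) (by simp)))
  have h5 := (((diag_ev p).whisker q.word.reverse q.word).append
    (by simpa using diag_ev q)).append_left
    (F := (diag (𝟙 (DualStarStruct.dual (p ⊗ q)))).map (Layer.whisker [] (p.word ++ q.word)))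
    (a := q.word.reverse ++ p.word.reverse ++ p.word ++ q.word)
    (rd_wh _ _ hR (by simp) (by simp))
  have h6 := ((((Eqv.interchange (P := P.toPlanarAlgebra)
    (rd_cups (P := P.toPlanarAlgebra) [] p.word.reverse [] (x := p.word.reverse ++ p.word) (by simp) rfl)
    hq).whisker q.word.reverse []).append_right (F := cups [] q.word.reverse []) (c := [])
    (rd_cups (P := P.toPlanarAlgebra) [] q.word.reverse [] (by simp) (by simp)))).append_left
    (F := (diag (𝟙 (DualStarStruct.dual (p ⊗ q)))).map (Layer.whisker [] (p.word ++ q.word)) ++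
      (diag (𝟙 p)).map (Layer.whisker (q.word.reverse ++ p.word.reverse) q.word))
    (a := q.word.reverse ++ p.word.reverse ++ p.word ++ q.word)
    (Reads.append (rd_wh _ _ hR (by simp) rfl) (rd_wh _ _ hp (by simp) (by simp)))
  have h7 := (((diag_tensor (𝟙 p) (𝟙 q)).whisker (q.word.reverse ++ p.word.reverse) []).append_right
    (F := cups [] (q.word.reverse ++ p.word.reverse) []) (c := [])
    (rd_cups _ _ _ (by simp) (by simp))).append_left
    (F := (diag (𝟙 (DualStarStruct.dual (p ⊗ q)))).map (Layer.whisker [] (p.word ++ q.word)))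
    (a := q.word.reverse ++ p.word.reverse ++ p.word ++ q.word)
    (rd_wh _ _ hR (by simp) (by simp))
  rw [tensorHom_id_id] at h7
  have h8 := (diag_ev (p ⊗ q)).append_left
    (F := (diag (𝟙 (DualStarStruct.dual (p ⊗ q)))).map (Layer.whisker [] (p.word ++ q.word)))
    (a := q.word.reverse ++ p.word.reverse ++ p.word ++ q.word)
    (rd_wh _ _ hR (by simp) (by simp))
  have h9 := id_left_diag (ev (p ⊗ q))
  refine (by simpa using h1 : Eqv _ _ _ _ _).trans ((by simpa using h2 : Eqv _ _ _ _ _).trans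
    ((by simpa using h3 : Eqv _ _ _ _ _).trans ((by simpa using h4 : Eqv _ _ _ _ _).trans
    ((by simpa using h5 : Eqv _ _ _ _ _).trans ((by simpa using h6 : Eqv _ _ _ _ _).trans
    (Eqv.trans (by simpa [cups_append] using h7.symm) 
    (Eqv.trans (by simpa [cups_append] using h8.symm) (by simpa using h9))))))))

theorem coev_tensor (p q : Projection P) :
    coev (p ⊗ q) ≫ (p ⊗ q) ◁ eqToHom (dual_tensor' p q) = coev p ≫
      ((ρ_ p).inv ≫ p ◁ coev q ≫ (α_ p q (DualStarStruct.dual q)).inv) ▷ DualStarStruct.dual p ≫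
        (α_ (p ⊗ q) (DualStarStruct.dual q) (DualStarStruct.dual p)).hom := by
  refine diag_inj ?_
  have hp := reads_diag (𝟙 p)
  have hq := reads_diag (𝟙 q)
  rw [rightUnitor_inv, associator_inv, associator_hom]
  have h1 := diag_comp_whiskerLeft (eqToHom (dual_tensor' p q)) (coev (p ⊗ q))
  rw [diag_eqToHom] at h1
  have h2 := diag_id_right (coev (p ⊗ q))
  have h3 := diag_coev (p ⊗ q)
  have h4 := ((diag_tensor (𝟙 p) (𝟙 q)).whisker [] (q.word.reverse ++ p.word.reverse)).append_left
    (F := caps [] (p.word ++ q.word) []) (a := []) (rd_caps _ _ _ (by simp) (by simp))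
  rw [tensorHom_id_id] at h4
  have h5 := (((Eqv.interchange (P := P.toPlanarAlgebra) hp (rd_caps (P := P.toPlanarAlgebra) [] q.word []
    (y := q.word ++ q.word.reverse) (by simp) rfl)).whisker [] p.word.reverse).append_left
    (F := caps [] p.word []) (a := []) (rd_caps _ _ _ (by simp) (by simp))).append_right
    (F := (diag (𝟙 q)).map (Layer.whisker p.word (q.word.reverse ++ p.word.reverse)))
    (c := p.word ++ q.word ++ q.word.reverse ++ p.word.reverse) (rd_wh _ _ hq (by simp) (by simp))
  have k1 := diag_comp (coev p) (((eqToHom (tensor_unit' p).symm ≫ p ◁ coev q ≫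
    eqToHom (tensor_assoc' _ _ _).symm) ▷ DualStarStruct.dual p) ≫ eqToHom (tensor_assoc' _ _ _))
  rw [diag_comp_eqToHom] at k1
  have k1' : diag (coev p ≫ (eqToHom (tensor_unit' p).symm ≫ p ◁ coev q ≫
    eqToHom (tensor_assoc' _ _ _).symm) ▷ DualStarStruct.dual p ≫ eqToHom (tensor_assoc' _ _ _)) =
    diag (coev p ≫ (eqToHom (tensor_unit' p).symm ≫ p ◁ coev q ≫
    eqToHom (tensor_assoc' p q (DualStarStruct.dual q)).symm) ▷ DualStarStruct.dual p) := by
    rw [← Category.assoc, diag_comp_eqToHom]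
  have k2 := diag_comp_whiskerRight (eqToHom (tensor_unit' p).symm ≫ p ◁ coev q ≫
    eqToHom (tensor_assoc' p q (DualStarStruct.dual q)).symm) (coev p)
  rw [diag_eqToHom_comp, diag_comp_eqToHom] at k2
  have k3 := ((diag_tensor (𝟙 p) (coev q)).whisker [] p.word.reverse).append_left
    (a := []) (F := diag (coev p)) (by simpa using reads_diag (coev p))
  have k4 := (diag_id_left (coev p)).append_right
    (F := (diag (coev q)).map (Layer.whisker p.word p.word.reverse))
    (c := p.word ++ q.word ++ q.word.reverse ++ p.word.reverse)
    (rd_wh _ _ (reads_diag (coev q)) (by simp) (by simp))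
  have k5 := (diag_coev p).append (c := p.word ++ q.word ++ q.word.reverse ++ p.word.reverse)
    (by simpa using (diag_coev q).whisker p.word p.word.reverse)
  rw [k1']
  have l := (by simpa using h1 : Eqv _ _ _ _ _).trans ((by simpa using h2 : Eqv _ _ _ _ _).trans
    ((by simpa using h3 : Eqv _ _ _ _ _).trans (by simpa using h4 : Eqv _ _ _ _ _)))
  have r2 := (by simpa using k2 : Eqv _ _ _ _ _).trans (Eqv.trans (by simpa using k3)
    ((by simpa using k4 : Eqv _ _ _ _ _).trans (by simpa using k5)))
  exact Eqv.trans (by simpa [caps_append] using l) (Eqv.trans (by simpa using h5.symm)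
    (by simpa using r2.symm))

/-- The trace of each summand is the squared norm of `f i`, and nonnegative numbers with zero sum
vanish. Families are needed because a diagonal entry of a matrix times its adjoint is such a sum. -/
theorem tr_comp_adj_eq_zero {ι : Type*} [Fintype ι] {α : Word L} {β : ι → Word L}
    (f : ∀ i, P.Mor α (β i)) (h : ∑ i, comp (f i) (FactorPlanarAlgebra.adj (f i)) = 0) (i : ι) :
    f i = 0 := by
  have h1 : ∀ i, 0 ≤ (innerV (f i) (f i)).re ∧ (f i ≠ 0 → 0 < (innerV (f i) (f i)).re) := by
    intro i
    by_cases hi : f i = 0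
    · simp [hi, innerV_zero_left]
    · obtain ⟨t, ht, e⟩ := innerV_self (f i) hi
      simp [e, ht, ht.le]
  have h2 : ∑ i, (innerV (f i) (f i)).re = 0 := by
    have := congrArg tr h
    rw [map_sum, map_zero] at this
    simp_rw [innerV_eq_tr]
    rw [← Complex.re_sum, this, Complex.zero_re]
  have h3 := (Finset.sum_eq_zero_iff_of_nonneg fun i _ => (h1 i).1).1 h2 i (Finset.mem_univ i)
  by_contra hi
  exact ((h1 i).2 hi).ne' h3

theorem coe_sum {ι : Type*} (s : Finset ι) (f : ι → (p ⟶ q)) :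
    (∑ i ∈ s, f i).1 = ∑ i ∈ s, (f i).1 :=
  map_sum (homs p q).subtype f s

theorem isRigidStarCategory (P : FactorPlanarAlgebra.{u, v} L) :
    IsRigidStarCategory (Projection P) where
  monoidal := ⟨inferInstance, rfl⟩
  finiteDimensional p q := inferInstanceAs (FiniteDimensional ℂ (homs p q))
  add_tensor f f' g := Subtype.ext (PlanarAlgebra.add_tensor f.1 f'.1 g.1)
  tensor_add f g g' := Subtype.ext (PlanarAlgebra.tensor_add f.1 g.1 g'.1)
  smul_tensor z f g := Subtype.ext (PlanarAlgebra.smul_tensor z f.1 g.1)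
  tensor_smul z f g := Subtype.ext (PlanarAlgebra.tensor_smul z f.1 g.1)
  end_unit f := by
    have h : P.one [] = P.Z Tangle.empty := Z_ext _ _ rfl
    obtain ⟨z, hz, hu⟩ := P.evaluable f.1
    refine ⟨z, Subtype.ext (hz.trans (congrArg (z • ·) h.symm)), fun w hw => hu w ?_⟩
    exact (congrArg Subtype.val hw).trans (congrArg (w • ·) h)
  -- A self-adjoint idempotent endomorphism of `p` is itself a projection with the same word, hence
  -- an object; `e` also serves as the isometry from it into `p`.
  split {p} e h k := by
    refine ⟨⟨p.word, e.1, congrArg Subtype.val h, congrArg Subtype.val k⟩, ⟨e.1, mem_homs _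
      (congrArg Subtype.val h) (comp_right e)⟩, Subtype.ext ?_, Subtype.ext ?_⟩
    · exact (congrArg (comp e.1) (congrArg Subtype.val k)).trans (congrArg Subtype.val h)
    · exact (congrArg (fun x => comp x e.1) (congrArg Subtype.val k)).trans (congrArg Subtype.val h)
  adj_add f g := Subtype.ext (FactorPlanarAlgebra.adj_add f.1 g.1)
  adj_smul z f := Subtype.ext ((congrArg (P.castV _) (P.st_smul z f.1)).trans (castV_smul _ _ _))
  adj_adj f := Subtype.ext (FactorPlanarAlgebra.adj_adj f.1)
  adj_id p := Subtype.ext p.selfAdj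
  adj_comp f g := Subtype.ext (FactorPlanarAlgebra.adj_comp f.1 g.1)
  positive f h i := Subtype.ext (tr_comp_adj_eq_zero (fun i => (f i).1)
    ((coe_sum _ _).symm.trans (congrArg Subtype.val h)) i)
  adj_tensor f g := Subtype.ext (FactorPlanarAlgebra.adj_tensor f.1 g.1)
  associator_unitary p q r := by rw [associator_hom]; exact isUnitary_eqToHom _
  leftUnitor_unitary p := by rw [leftUnitor_hom]; exact isUnitary_eqToHom _
  rightUnitor_unitary p := by rw [rightUnitor_hom]; exact isUnitary_eqToHom _
  zigzag := zigzag
  zagzig := zagzig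
  dualHom_eq := dualHom_eq
  dualHom_eq_left := dualHom_eq_left
  adj_dualHom f := Subtype.ext (FactorPlanarAlgebra.rotate_adj f.1).symm
  dual_tensor p q := ⟨eqToHom (dual_tensor' p q), isUnitary_eqToHom _, ev_tensor p q, coev_tensor p q⟩
  double_dual := ⟨fun p => eqToHom (dual_dual p).symm, fun _ => isUnitary_eqToHom _,
    dualHom_dualHom, coev_dual_dual⟩
  spherical := spherical'

end Projection

/-! ### Transfer of the axioms to the bimodules `H_p` -/

namespace ProjectionBimodule

variable {L : Type u} (P : FactorPlanarAlgebra.{u, v} L)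

/-- Morphisms agree by definition in both categories, but the coherence maps are transports along
equalities of different types of objects. With these identified, each axiom is the one for
projections. -/
theorem eqToHom_proj {X Y : ProjectionBimodule P} (h : X = Y) :
    (eqToHom h : X ⟶ Y) = (eqToHom (congrArg proj h) : X.proj ⟶ Y.proj) := by subst h; rfl

theorem associator_hom (X Y Z : ProjectionBimodule P) :
    (α_ X Y Z).hom = (α_ X.proj Y.proj Z.proj).hom :=
  eqToHom_proj P ((ext_proj (Projection.tensor_assoc X.proj Y.proj Z.proj)))

theorem associator_inv (X Y Z : ProjectionBimodule P) :
    (α_ X Y Z).inv = (α_ X.proj Y.proj Z.proj).inv :=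
  eqToHom_proj P ((ext_proj (Projection.tensor_assoc X.proj Y.proj Z.proj)).symm)

theorem leftUnitor_hom (X : ProjectionBimodule P) :
    (λ_ X).hom = (λ_ X.proj).hom :=
  eqToHom_proj P ((ext_proj (Projection.unit_tensor X.proj)))

theorem leftUnitor_inv (X : ProjectionBimodule P) :
    (λ_ X).inv = (λ_ X.proj).inv :=
  eqToHom_proj P ((ext_proj (Projection.unit_tensor X.proj)).symm)

theorem rightUnitor_hom (X : ProjectionBimodule P) :
    (ρ_ X).hom = (ρ_ X.proj).hom :=
  eqToHom_proj P ((ext_proj (Projection.tensor_unit X.proj)))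

theorem rightUnitor_inv (X : ProjectionBimodule P) :
    (ρ_ X).inv = (ρ_ X.proj).inv :=
  eqToHom_proj P ((ext_proj (Projection.tensor_unit X.proj)).symm)

instance : MonoidalCategory (ProjectionBimodule P) where
  tensorHom_def {X Y Z W} f g :=
    MonoidalCategory.tensorHom_def (C := Projection P) (X₁ := X.proj) (X₂ := Z.proj) f g
  id_tensorHom_id X Y := MonoidalCategory.id_tensorHom_id (C := Projection P) X.proj Y.proj
  tensorHom_comp_tensorHom {X Y Z W A B} f g h k :=
    MonoidalCategory.tensorHom_comp_tensorHom (C := Projection P) (X₁ := X.proj) (X₂ := W.proj) f g h k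
  whiskerLeft_id X Y := MonoidalCategory.whiskerLeft_id (C := Projection P) X.proj Y.proj
  id_whiskerRight X Y := MonoidalCategory.id_whiskerRight (C := Projection P) X.proj Y.proj
  associator_naturality {X₁ X₂ X₃ Y₁ Y₂ Y₃} f g h := by
    rw [associator_hom, associator_hom]
    exact MonoidalCategory.associator_naturality (C := Projection P) (X₁ := X₁.proj) (X₂ := X₂.proj)
      (X₃ := X₃.proj) (Y₁ := Y₁.proj) (Y₂ := Y₂.proj) (Y₃ := Y₃.proj) f g h
  leftUnitor_naturality {X Y} f := by
    rw [leftUnitor_hom, leftUnitor_hom]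
    exact MonoidalCategory.leftUnitor_naturality (C := Projection P) (X := X.proj) (Y := Y.proj) f
  rightUnitor_naturality {X Y} f := by
    rw [rightUnitor_hom, rightUnitor_hom]
    exact MonoidalCategory.rightUnitor_naturality (C := Projection P) (X := X.proj) (Y := Y.proj) f
  pentagon W X Y Z := by
    simp only [associator_hom]
    exact MonoidalCategory.pentagon (C := Projection P) W.proj X.proj Y.proj Z.proj
  triangle X Y := by
    rw [associator_hom, leftUnitor_hom, rightUnitor_hom]
    exact MonoidalCategory.triangle (C := Projection P) X.proj Y.proj

theorem isRigidStarCategory : IsRigidStarCategory (ProjectionBimodule P) :=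
  have H := Projection.isRigidStarCategory P
  { monoidal := ⟨inferInstance, rfl⟩
    finiteDimensional := fun X Y => H.finiteDimensional X.proj Y.proj
    add_tensor := fun f f' g => H.add_tensor f f' g
    tensor_add := fun f g g' => H.tensor_add f g g'
    smul_tensor := fun z f g => H.smul_tensor z f g
    tensor_smul := fun z f g => H.tensor_smul z f g
    end_unit := fun f => H.end_unit f
    split := fun e h k => by
      obtain ⟨S, i, h1, h2⟩ := H.split e h k
      exact ⟨of S, i, h1, h2⟩
    adj_add := fun f g => H.adj_add f g
    adj_smul := fun z f => H.adj_smul z f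
    adj_adj := fun f => H.adj_adj f
    adj_id := fun X => H.adj_id X.proj
    adj_comp := fun f g => H.adj_comp f g
    positive := fun {ι _ X Y} f h => H.positive (X := X.proj) (Y := fun i => (Y i).proj) f h
    adj_tensor := fun f g => H.adj_tensor f g
    associator_unitary := fun X Y Z => by
      rw [associator_hom]; exact H.associator_unitary X.proj Y.proj Z.proj
    leftUnitor_unitary := fun X => by rw [leftUnitor_hom]; exact H.leftUnitor_unitary X.proj
    rightUnitor_unitary := fun X => by rw [rightUnitor_hom]; exact H.rightUnitor_unitary X.proj
    zigzag := fun X => by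
      rw [associator_hom, leftUnitor_hom, rightUnitor_inv]; exact H.zigzag X.proj
    zagzig := fun X => by
      rw [associator_inv, leftUnitor_inv, rightUnitor_hom]; exact H.zagzig X.proj
    dualHom_eq := fun {X Y} f => by
      rw [associator_inv, leftUnitor_hom, rightUnitor_inv]
      exact H.dualHom_eq (X := X.proj) (Y := Y.proj) f
    dualHom_eq_left := fun {X Y} f => by
      rw [associator_hom, leftUnitor_inv, rightUnitor_hom]
      exact H.dualHom_eq_left (X := X.proj) (Y := Y.proj) f
    adj_dualHom := fun f => H.adj_dualHom f
    dual_tensor := fun X Y => by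
      obtain ⟨ν, h1, h2, h3⟩ := H.dual_tensor X.proj Y.proj
      refine ⟨ν, h1, ?_, ?_⟩
      · rw [associator_hom, associator_inv, leftUnitor_hom]; exact h2
      · rw [associator_hom, associator_inv, rightUnitor_inv]; exact h3
    double_dual := by
      obtain ⟨φ, h1, h2, h3⟩ := H.double_dual
      exact ⟨fun X => φ X.proj, fun X => h1 X.proj, fun f => h2 f, fun X => h3 X.proj⟩
    spherical := fun {X} f => H.spherical (X := X.proj) f }

end ProjectionBimodule
end

/-! ### Categories with adjoints: supports, abelianness, simple objects -/

noncomputable section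

open CategoryTheory MonoidalCategory Limits

open DualStarStruct in
/-- The axioms of a `*`-category with finite dimensional morphism spaces. -/
structure IsStarCategory (C : Type*) [Category C] [Preadditive C] [Linear ℂ C]
    [MonoidalCategoryStruct C] [DualStarStruct C] : Prop where
  finiteDimensional : ∀ X Y : C, FiniteDimensional ℂ (X ⟶ Y)
  adj_add : ∀ {X Y : C} (f g : X ⟶ Y), adj (f + g) = adj f + adj g
  adj_smul : ∀ {X Y : C} (z : ℂ) (f : X ⟶ Y), adj (z • f) = (starRingEnd ℂ) z • adj f
  adj_adj : ∀ {X Y : C} (f : X ⟶ Y), adj (adj f) = f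
  adj_id : ∀ X : C, adj (𝟙 X) = 𝟙 X
  adj_comp : ∀ {X Y Z : C} (f : X ⟶ Y) (g : Y ⟶ Z), adj (f ≫ g) = adj g ≫ adj f
  positive : ∀ {X Y : C} (f : X ⟶ Y), f ≫ adj f = 0 → f = 0

namespace IsStarCategory

open DualStarStruct

variable {C : Type*} [Category C] [Preadditive C] [Linear ℂ C] [MonoidalCategoryStruct C]
  [DualStarStruct C] (H : IsStarCategory C)

include H

theorem adj_zero (X Y : C) : adj (0 : X ⟶ Y) = 0 := by
  simpa using H.adj_smul 0 (0 : X ⟶ Y)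

theorem adj_sub {X Y : C} (f g : X ⟶ Y) : adj (f - g) = adj f - adj g := by
  rw [eq_sub_iff_add_eq, ← H.adj_add, sub_add_cancel]

theorem adj_sum {ι : Type*} (s : Finset ι) {X Y : C} (f : ι → (X ⟶ Y)) :
    adj (∑ i ∈ s, f i) = ∑ i ∈ s, adj (f i) := by
  classical
  induction s using Finset.induction_on with
  | empty => simpa using H.adj_zero X Y
  | insert a s ha ih => rw [Finset.sum_insert ha, Finset.sum_insert ha, H.adj_add, ih]

/-- The support projection of a morphism. -/
theorem exists_support {X Y : C} (f : X ⟶ Y) :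
    ∃ (e : X ⟶ X) (y : Y ⟶ X), e ≫ e = e ∧ adj e = e ∧ e ≫ f = f ∧ f ≫ y = e := by
  have := H.finiteDimensional X X
  set c := f ≫ adj f with hc
  have hcs : adj c = c := by rw [hc, H.adj_comp, H.adj_adj]
  let T : (X ⟶ X) →ₗ[ℂ] (X ⟶ X) := Linear.leftComp ℂ X c
  have hT : ∀ x, T x = c ≫ x := fun x => rfl
  -- By positivity `c ≫ c ≫ x = 0` forces `c ≫ x = 0`. Finite dimension then gives `T ∘ T` and `T`
  -- the same range, so that `c = c ≫ c ≫ y` for some `y`; the support will be `c ≫ y`.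
  have hk : LinearMap.ker (T ∘ₗ T) = LinearMap.ker T := by
    refine le_antisymm (fun x hx => ?_) (fun x hx => ?_)
    · rw [LinearMap.mem_ker, LinearMap.comp_apply, hT, hT] at hx
      rw [LinearMap.mem_ker, hT]
      have h := H.positive (adj (c ≫ x)) (by
        rw [H.adj_adj, H.adj_comp, hcs, Category.assoc, hx, comp_zero])
      rw [← H.adj_adj (c ≫ x), h, H.adj_zero]
    · rw [LinearMap.mem_ker] at hx ⊢
      rw [LinearMap.comp_apply, hx, map_zero]
  have hr : LinearMap.range (T ∘ₗ T) = LinearMap.range T := by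
    refine Submodule.eq_of_le_of_finrank_eq (LinearMap.range_comp_le_range T T) ?_
    have h1 := LinearMap.finrank_range_add_finrank_ker (T ∘ₗ T)
    have h2 := LinearMap.finrank_range_add_finrank_ker T
    rw [hk] at h1
    omega
  obtain ⟨y, hy⟩ : c ∈ LinearMap.range (T ∘ₗ T) := by
    rw [hr]; exact ⟨𝟙 X, by rw [hT, Category.comp_id]⟩
  rw [LinearMap.comp_apply, hT, hT] at hy
  have hy' : adj y ≫ c ≫ c = c := by
    have := congrArg adj hy
    rwa [H.adj_comp, H.adj_comp, hcs, Category.assoc] at this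
  -- Being of the form `adj g ≫ g`, the element `c ≫ y` is self-adjoint, and then the same identity
  -- says that it is idempotent.
  have h1 : adj (c ≫ y) ≫ c ≫ y = c ≫ y := by
    rw [H.adj_comp, hcs, Category.assoc, ← Category.assoc c, ← Category.assoc (adj y), hy']
  have h2 : adj (c ≫ y) = c ≫ y := by
    rw [← h1, H.adj_comp, H.adj_adj]
  have h3 : (c ≫ y) ≫ c = c := by
    rw [← h2, H.adj_comp, hcs, Category.assoc, hy']
  refine ⟨c ≫ y, adj f ≫ y, ?_, h2, ?_, ?_⟩
  · rw [h2] at h1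
    exact h1
  · have h5 : f ≫ adj f ≫ c ≫ y = c := by rw [← Category.assoc, ← hc, hy]
    rw [Category.assoc] at h3
    -- For `e = c ≫ y` one has `e ≫ c = c = c ≫ e`, so `f - e ≫ f` composed with its adjoint is
    -- zero.
    have h4 := H.positive (f - (c ≫ y) ≫ f) (by
      rw [H.adj_sub, H.adj_comp (c ≫ y), h2]
      simp only [Preadditive.sub_comp, Preadditive.comp_sub, Category.assoc, h5, h3, ← hc]
      simp)
    exact (sub_eq_zero.1 h4).symm
  · rw [hc, Category.assoc]

/-- The support projection on the target. -/
theorem exists_cosupport {X Y : C} (f : X ⟶ Y) :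
    ∃ (e : Y ⟶ Y) (y : Y ⟶ X), e ≫ e = e ∧ adj e = e ∧ f ≫ e = f ∧ y ≫ f = e := by
  obtain ⟨e, y, h1, h2, h3, h4⟩ := H.exists_support (adj f)
  refine ⟨e, adj y, h1, h2, ?_, ?_⟩
  · rw [← H.adj_adj f, ← h2, ← H.adj_comp, h3]
  · rw [← H.adj_adj f, ← H.adj_comp, h4, h2]

/-- Choose a non-scalar `a` and an eigenvalue `z` of left composition with `a`, with eigenvector
`x`. The cosupport `e` of `a - z` is nonzero because `a` is not a scalar, and it is not the identity
because it kills `x`. -/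
theorem exists_projection {X : C} (h0 : 𝟙 X ≠ 0) (h1 : Module.finrank ℂ (X ⟶ X) ≠ 1) :
    ∃ e : X ⟶ X, e ≫ e = e ∧ adj e = e ∧ e ≠ 0 ∧ e ≠ 𝟙 X := by
  have := H.finiteDimensional X X
  obtain ⟨a, ha⟩ : ∃ a : X ⟶ X, ∀ z : ℂ, z • 𝟙 X ≠ a := by
    by_contra! h
    exact h1 (finrank_eq_one _ h0 h)
  have : Nontrivial (X ⟶ X) := ⟨_, _, h0⟩
  obtain ⟨z, hz⟩ := Module.End.exists_eigenvalue (Linear.leftComp ℂ X a : Module.End ℂ (X ⟶ X))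
  obtain ⟨x, hx⟩ := hz.exists_hasEigenvector
  have hx1 : a ≫ x = z • x := hx.apply_eq_smul
  obtain ⟨e, y, k1, k2, k3, k4⟩ := H.exists_cosupport (a - z • 𝟙 X)
  refine ⟨e, k1, k2, ?_, ?_⟩
  · rintro rfl
    rw [comp_zero] at k3
    exact ha z (sub_eq_zero.1 k3.symm).symm
  · rintro rfl
    apply hx.2
    rw [← Category.id_comp x, ← k4, Category.assoc, Preadditive.sub_comp, hx1]
    simp

variable (hs : ∀ {X : C} (e : X ⟶ X), e ≫ e = e → adj e = e →
    ∃ (S : C) (i : S ⟶ X), i ≫ adj i = 𝟙 S ∧ adj i ≫ i = e)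

omit H [Linear ℂ C] [MonoidalCategoryStruct C] [DualStarStruct C] in
theorem one_sub_idem {X : C} {e : X ⟶ X} (h : e ≫ e = e) :
    (𝟙 X - e) ≫ (𝟙 X - e) = 𝟙 X - e := by simp [h]

theorem adj_one_sub {X : C} {e : X ⟶ X} (h : adj e = e) : adj (𝟙 X - e) = 𝟙 X - e := by
  rw [H.adj_sub, H.adj_id, h]

include hs

/-- Split `1 - e` for the support `e` of `f`. Since `e` factors as `f ≫ y`, whatever is killed by
`f` is killed by `e` and hence factors through the splitting. -/
theorem hasKernels : HasKernels C where
  has_limit {X Y} f := by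
    obtain ⟨e, y, h1, h2, h3, h4⟩ := H.exists_support f
    obtain ⟨S, i, k1, k2⟩ := hs _ (one_sub_idem h1) (H.adj_one_sub h2)
    have k3 : i ≫ e = 0 := by
      have : i ≫ (𝟙 X - e) = i := by rw [← k2, ← Category.assoc, k1, Category.id_comp]
      simpa using this
    have k4 : i ≫ f = 0 := by rw [← h3, ← Category.assoc, k3, zero_comp]
    have : Mono i := ⟨fun g h w => by
      rw [← Category.comp_id g, ← Category.comp_id h, ← k1, ← Category.assoc, w, Category.assoc]⟩
    refine ⟨⟨_, KernelFork.IsLimit.ofι' i k4 fun {A} k hk => ⟨k ≫ adj i, ?_⟩⟩⟩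
    rw [Category.assoc, k2, Preadditive.comp_sub, Category.comp_id, ← h4, ← Category.assoc, hk,
      zero_comp, sub_zero]

theorem hasCokernels : HasCokernels C where
  has_colimit {X Y} f := by
    obtain ⟨e, y, h1, h2, h3, h4⟩ := H.exists_cosupport f
    obtain ⟨S, i, k1, k2⟩ := hs _ (one_sub_idem h1) (H.adj_one_sub h2)
    have k3 : e ≫ adj i = 0 := by
      have : (𝟙 Y - e) ≫ adj i = adj i := by rw [← k2, Category.assoc, k1, Category.comp_id]
      simpa using this
    have k4 : f ≫ adj i = 0 := by rw [← h3, Category.assoc, k3, comp_zero]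
    have : Epi (adj i) := ⟨fun g h w => by
      rw [← Category.id_comp g, ← Category.id_comp h, ← k1, Category.assoc, w, Category.assoc]⟩
    refine ⟨⟨_, CokernelCofork.IsColimit.ofπ' (adj i) k4 fun {A} k hk => ⟨i ≫ k, ?_⟩⟩⟩
    rw [← Category.assoc, k2, Preadditive.sub_comp, Category.id_comp, ← h4, Category.assoc, hk,
      comp_zero, sub_zero]

omit hs

/-- Cancelling a monomorphism shows that its support is the identity, so `f ≫ y = 1`, and `f` is a
kernel of `1 - y ≫ f`. -/
theorem isNormalMonoCategory : IsNormalMonoCategory C where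
  normalMonoOfMono {X Y} f _ := by
    obtain ⟨e, y, h1, h2, h3, h4⟩ := H.exists_support f
    obtain rfl : e = 𝟙 X := by rw [← cancel_mono f, h3, Category.id_comp]
    exact ⟨⟨Y, 𝟙 Y - y ≫ f, by simp [reassoc_of% h4], KernelFork.IsLimit.ofι' f _
      fun {A} k hk => ⟨k ≫ y, by simpa using (sub_eq_zero.1 (by simpa using hk)).symm⟩⟩⟩

theorem isNormalEpiCategory : IsNormalEpiCategory C where
  normalEpiOfEpi {X Y} f _ := by
    obtain ⟨e, y, h1, h2, h3, h4⟩ := H.exists_cosupport f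
    obtain rfl : e = 𝟙 Y := by rw [← cancel_epi f, h3, Category.comp_id]
    exact ⟨⟨X, 𝟙 X - f ≫ y, by simp [h4], CokernelCofork.IsColimit.ofπ' f _
      fun {A} k hk => ⟨y ≫ k, by simpa using (sub_eq_zero.1 (by simpa using hk)).symm⟩⟩⟩

include hs

theorem abelian [HasFiniteProducts C] :
    ∃ A : Abelian C, A.toPreadditive = (inferInstance : Preadditive C) := by
  have := H.hasKernels hs
  have := H.hasCokernels hs
  have := H.isNormalMonoCategory
  have := H.isNormalEpiCategory
  exact ⟨{}, rfl⟩

/-- A nonzero morphism does not vanish on all simple objects. -/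
theorem exists_simple (n : ℕ) : ∀ {X Y : C} (g : X ⟶ Y), g ≠ 0 → Module.finrank ℂ (X ⟶ X) ≤ n →
    ∃ (S : C) (i : S ⟶ X), Module.finrank ℂ (S ⟶ S) = 1 ∧ i ≫ g ≠ 0 := by
  induction n with
  | zero =>
    intro X Y g hg hn
    have := H.finiteDimensional X X
    have : Subsingleton (X ⟶ X) := Module.finrank_zero_iff (R := ℂ).1 (by omega)
    exact absurd (by rw [← Category.id_comp g, Subsingleton.elim (𝟙 X) 0, zero_comp]) hg
  | succ n ih =>
    intro X Y g hg hn
    by_cases h1 : Module.finrank ℂ (X ⟶ X) = 1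
    · exact ⟨X, 𝟙 X, h1, by rwa [Category.id_comp]⟩
    have h0 : 𝟙 X ≠ 0 := fun h => hg (by rw [← Category.id_comp g, h, zero_comp])
    have key : ∀ e : X ⟶ X, e ≫ e = e → adj e = e → e ≠ 𝟙 X → e ≫ g ≠ 0 →
        ∃ (S : C) (i : S ⟶ X), Module.finrank ℂ (S ⟶ S) = 1 ∧ i ≫ g ≠ 0 := by
      intro e k1 k2 k3 k4
      obtain ⟨S, i, l1, l2⟩ := hs e k1 k2
      have := H.finiteDimensional X X
      have := H.finiteDimensional S S
      -- This embeds `End S` into `End X` as the corner cut out by `e`. The corner misses the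
      -- identity because `e ≠ 𝟙 X`, so the dimension drops.
      let T : (S ⟶ S) →ₗ[ℂ] (X ⟶ X) :=
        (Linear.leftComp ℂ X (adj i)) ∘ₗ (Linear.rightComp ℂ S i)
      have hT : ∀ x, T x = adj i ≫ x ≫ i := fun x => rfl
      have hinj : Function.Injective T := fun x y h => by
        have := congrArg (fun z => i ≫ z ≫ adj i) h
        simpa [hT, l1, reassoc_of% l1] using this
      have hlt : Module.finrank ℂ (S ⟶ S) < Module.finrank ℂ (X ⟶ X) := by
        rw [← LinearMap.finrank_range_of_inj hinj]
        refine Submodule.finrank_lt fun h => k3 ?_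
        obtain ⟨x, hx⟩ : 𝟙 X ∈ LinearMap.range T := h ▸ Submodule.mem_top
        rw [hT] at hx
        rw [← Category.comp_id e, ← hx, ← l2]
        simp [reassoc_of% l1]
      obtain ⟨S', j, m1, m2⟩ := ih (i ≫ g) (fun h => k4 (by rw [← l2, Category.assoc, h, comp_zero]))
        (by omega)
      exact ⟨S', j ≫ i, m1, by rwa [Category.assoc]⟩
    obtain ⟨e, k1, k2, k3, k4⟩ := H.exists_projection h0 h1
    -- At least one of `e` and `1 - e` does not annihilate `g`.
    by_cases hz : e ≫ g = 0
    · refine key (𝟙 X - e) (one_sub_idem k1) (H.adj_one_sub k2) (by simpa using k3) ?_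
      simpa [hz] using hg
    · exact key e k1 k2 k4 hz

end IsStarCategory
end

/-! ### Direct sums: semisimplicity and splitting of projections -/

noncomputable section

open CategoryTheory MonoidalCategory Limits DualStarStruct

theorem MatSum.sum_apply {C : Type*} [Category C] [Preadditive C] {X Y : Mat_ C} {κ : Type*}
    (s : Finset κ) (f : κ → (X ⟶ Y)) (i : X.ι) (j : Y.ι) :
    (∑ k ∈ s, f k) i j = ∑ k ∈ s, f k i j :=
  map_sum (⟨⟨fun f => f i j, rfl⟩, fun _ _ => rfl⟩ : (X ⟶ Y) →+ (X.X i ⟶ Y.X j)) f s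

namespace IsRigidStarCategory

variable {C : Type*} [Category C] [Preadditive C] [Linear ℂ C] [MonoidalCategoryStruct C]
  [DualStarStruct C]

theorem isStarCategory (H : IsRigidStarCategory C) : IsStarCategory C where
  finiteDimensional := H.finiteDimensional
  adj_add := H.adj_add
  adj_smul := H.adj_smul
  adj_adj := H.adj_adj
  adj_id := H.adj_id
  adj_comp := H.adj_comp
  positive f h := H.positive (fun _ : Unit => f) (by simpa using h) ()

variable (H : IsRigidStarCategory C)

include H

theorem mat_isStarCategory : IsStarCategory (Mat_ C) where
  finiteDimensional X Y := by
    have := H.finiteDimensional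
    exact inferInstanceAs (FiniteDimensional ℂ (∀ i j, X.X i ⟶ Y.X j))
  adj_add f g := by ext i j; exact H.adj_add _ _
  adj_smul z f := by ext i j; exact H.adj_smul _ _
  adj_adj f := by ext i j; exact H.adj_adj _
  adj_id X := by
    ext i j
    change adj ((𝟙 X : X ⟶ X) j i) = _
    by_cases h : i = j
    · subst h
      rw [Mat_.id_apply_self, H.adj_id]
    · rw [Mat_.id_apply_of_ne _ _ _ h, Mat_.id_apply_of_ne _ _ _ (Ne.symm h),
        H.isStarCategory.adj_zero]
  adj_comp f g := by
    ext i j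
    change adj (∑ k, f j k ≫ g k i) = ∑ k, adj (g k i) ≫ adj (f j k)
    simp only [H.isStarCategory.adj_sum, H.adj_comp]
  -- A diagonal entry of `f ≫ adj f` is a sum over a row of `f`, to which positivity for families
  -- applies.
  positive f h := by
    ext i j
    exact H.positive (fun j => f i j) (congrFun (congrFun h i) i) j

/-- The object `S` as a direct sum with one summand. -/
abbrev sum₁ (S : C) : Mat_ C := ⟨Unit, fun _ => S⟩

/-- As `End S` is one-dimensional, `w ≫ adj w` is a scalar: real by self-adjointness, and positive
since `w ≠ 0`. Rescaling `w` by the inverse square root normalises it. -/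
theorem exists_isometry {S : C} {X : Mat_ C} (hS : Module.finrank ℂ (S ⟶ S) = 1)
    (w : sum₁ S ⟶ X) (hw : w ≠ 0) : ∃ z : ℂ, (z • w) ≫ adj (z • w) = 𝟙 (sum₁ S) := by
  have hM := H.mat_isStarCategory
  have h0 : 𝟙 S ≠ 0 := by
    intro h
    apply hw
    ext i j
    rw [← Category.id_comp (w i j)]
    exact (congrArg (· ≫ w i j) h).trans zero_comp
  obtain ⟨z, hz⟩ := (finrank_eq_one_iff_of_nonzero' _ h0).1 hS ((w ≫ adj w) () ())
  have hz' : ∑ j, w () j ≫ adj (w () j) = z • 𝟙 S := hz.symm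
  have hr : (starRingEnd ℂ) z = z := by
    have h1 : adj ((w ≫ adj w) () ()) = (w ≫ adj w) () () := by
      have : adj (w ≫ adj w) = w ≫ adj w := by rw [hM.adj_comp, hM.adj_adj]
      exact congrFun (congrFun this ()) ()
    rw [← hz, H.adj_smul, H.adj_id] at h1
    exact smul_left_injective ℂ h0 h1
  obtain ⟨t, rfl⟩ := Complex.conj_eq_iff_real.1 hr
  have ht : 0 < t := by
    by_contra! ht
    -- If `t ≤ 0`, adjoining `√(-t)` times the identity to the entries of `w` produces a family with
    -- vanishing sum of squares, so `w = 0`.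
    have h1 := H.positive (ι := Option X.ι) (X := S) (Y := fun j => j.elim S X.X)
      (fun j => match j with
        | none => (Real.sqrt (-t) : ℂ) • 𝟙 S
        | some j => w () j) (by
      rw [Fintype.sum_option]
      refine (congrArg (_ + ·) hz').trans ?_
      change ((Real.sqrt (-t) : ℂ) • 𝟙 S) ≫ adj ((Real.sqrt (-t) : ℂ) • 𝟙 S) + (t : ℂ) • 𝟙 S = 0
      rw [H.adj_smul, H.adj_id, Complex.conj_ofReal, Linear.smul_comp, Linear.comp_smul, smul_smul,
        ← Complex.ofReal_mul, Real.mul_self_sqrt (by linarith), Category.comp_id, ← add_smul]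
      simp)
    apply hw
    ext i j
    exact h1 (some j)
  refine ⟨((Real.sqrt t)⁻¹ : ℝ), ?_⟩
  ext ⟨⟩ ⟨⟩
  rw [hM.adj_smul, Complex.conj_ofReal, Linear.smul_comp, Linear.comp_smul, smul_smul,
    ← Complex.ofReal_mul, ← mul_inv, Real.mul_self_sqrt ht.le, MatSum.smul_apply, ← hz, smul_smul,
    ← Complex.ofReal_mul, inv_mul_cancel₀ ht.ne', Complex.ofReal_one, one_smul,
    Mat_.id_apply_self]

/-- Every self-adjoint projection is an orthogonal sum of projections onto simple objects. -/
theorem exists_simples {X : Mat_ C} (n : ℕ) : ∀ e : X ⟶ X, e ≫ e = e → adj e = e →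
    Module.finrank ℂ (LinearMap.range (Linear.leftComp ℂ X e ∘ₗ Linear.rightComp ℂ X e)) ≤ n →
    ∃ (ι : Type) (_ : Fintype ι) (_ : DecidableEq ι) (S : ι → C) (i : ∀ k, sum₁ (S k) ⟶ X),
      (∀ k, Module.finrank ℂ (S k ⟶ S k) = 1) ∧ (∀ k, i k ≫ adj (i k) = 𝟙 _) ∧
      (∀ k l, k ≠ l → i k ≫ adj (i l) = 0) ∧ ∑ k, adj (i k) ≫ i k = e := by
  have hM := H.mat_isStarCategory
  have hD := hM.finiteDimensional X X
  have hT : ∀ e x : X ⟶ X, (Linear.leftComp ℂ X e ∘ₗ Linear.rightComp ℂ X e) x = e ≫ x ≫ e :=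
    fun e x => rfl
  induction n with
  | zero =>
    intro e h1 h2 hn
    refine ⟨Empty, inferInstance, inferInstance, Empty.elim, fun k => k.elim, by simp, by simp,
      by simp, ?_⟩
    have h3 := Submodule.finrank_eq_zero.1 (Nat.le_zero.1 hn)
    have h4 : e ∈ LinearMap.range (Linear.leftComp ℂ X e ∘ₗ Linear.rightComp ℂ X e) :=
      ⟨e, by rw [hT, h1, h1]⟩
    rw [h3, Submodule.mem_bot] at h4
    simp [h4]
  | succ n ih =>
    intro e h1 h2 hn
    by_cases he : e = 0
    · exact ⟨Empty, inferInstance, inferInstance, Empty.elim, fun k => k.elim, by simp, by simp,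
        by simp, by simp [he]⟩
    obtain ⟨a, b, hab⟩ : ∃ a b, e a b ≠ 0 := by
      by_contra! h
      exact he (by ext a b; exact h a b)
    obtain ⟨S, v, hS, hv⟩ := H.isStarCategory.exists_simple H.split _ (e a b) hab le_rfl
    -- This is row `a` of `e` precomposed with `v`. It lies under `e` because `e` is idempotent, and
    -- its entry at `b` is nonzero by the choice of `v`.
    let w : sum₁ S ⟶ X := fun _ j => v ≫ e a j
    have hw : w ≠ 0 := fun h => hv (congrFun (congrFun h ()) b)
    have hwe : w ≫ e = w := by
      ext ⟨⟩ j
      change ∑ k, (v ≫ e a k) ≫ e k j = v ≫ e a j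
      simp only [Category.assoc, ← Preadditive.comp_sum]
      exact congrArg (v ≫ ·) (congrFun (congrFun h1 a) j)
    obtain ⟨z, hz⟩ := H.exists_isometry hS w hw
    set i := z • w with hi
    have hie : i ≫ e = i := by rw [hi, Linear.smul_comp, hwe]
    have hei : e ≫ adj i = adj i := by
      conv_rhs => rw [← hie, hM.adj_comp, h2]
    have h3 : (e - adj i ≫ i) ≫ (e - adj i ≫ i) = e - adj i ≫ i := by
      simp [hie, h1, reassoc_of% hz, reassoc_of% hei]
    have h4 : adj (e - adj i ≫ i) = e - adj i ≫ i := by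
      rw [hM.adj_sub, h2, hM.adj_comp, hM.adj_adj]
    have h5 : (e - adj i ≫ i) ≫ adj i = 0 := by simp [hei, hz]
    have h6 : e ≫ (e - adj i ≫ i) = e - adj i ≫ i := by simp [h1, reassoc_of% hei]
    have h7 : (e - adj i ≫ i) ≫ e = e - adj i ≫ i := by simp [h1, hie]
    -- Continue with the complement `e - adj i ≫ i`: its corner is contained in that of `e` but
    -- omits `adj i ≫ i`, so the dimension is strictly smaller.
    obtain ⟨ι, _, _, T, j, k1, k2, k3, k4⟩ := ih (e - adj i ≫ i) h3 h4 (by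
      refine Nat.le_of_lt_succ (lt_of_lt_of_le (Submodule.finrank_lt_finrank_of_lt
        (lt_of_le_of_ne ?_ fun h => ?_)) hn)
      · rintro _ ⟨x, rfl⟩
        refine ⟨(e - adj i ≫ i) ≫ x ≫ (e - adj i ≫ i), ?_⟩
        rw [hT, hT, Category.assoc, Category.assoc, h7, ← Category.assoc, h6]
      · have h8 : adj i ≫ i ∈ LinearMap.range (Linear.leftComp ℂ X e ∘ₗ Linear.rightComp ℂ X e) :=
          ⟨adj i ≫ i, by rw [hT, Category.assoc, hie, ← Category.assoc, hei]⟩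
        rw [← h] at h8
        obtain ⟨x, hx⟩ := h8
        have h9 : ∀ y, (e - adj i ≫ i) ≫ x ≫ (e - adj i ≫ i) = y → (e - adj i ≫ i) ≫ y = y := by
          rintro _ rfl
          rw [← Category.assoc, h3]
        replace h9 := (h9 _ hx).symm
        rw [← Category.assoc, h5, zero_comp] at h9
        have h10 : i = 0 := by
          rw [← Category.id_comp i, ← hz, Category.assoc, h9, comp_zero]
        have h0 := hS
        rw [h10, zero_comp] at hz
        have h11 : 𝟙 S = 0 := (Mat_.id_apply_self (sum₁ S) ()).symm.trans
          (congrFun (congrFun hz.symm ()) ())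
        have : Subsingleton (S ⟶ S) := ⟨fun x y => by
          rw [← Category.comp_id x, ← Category.comp_id y, h11, comp_zero, comp_zero]⟩
        rw [Module.finrank_zero_of_subsingleton] at h0
        exact zero_ne_one h0)
    have h8 : ∀ k, j k ≫ (e - adj i ≫ i) = j k := by
      intro k
      rw [← k4, Preadditive.comp_sum, Finset.sum_eq_single k, ← Category.assoc, k2, Category.id_comp]
      · intro l _ hl
        rw [← Category.assoc, k3 k l hl.symm, zero_comp]
      · simp
    have h9 : ∀ k, j k ≫ adj i = 0 := by
      intro k
      rw [← h8, Category.assoc, h5, comp_zero]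
    refine ⟨Option ι, inferInstance, inferInstance, fun k => k.elim S T,
      fun k => match k with | none => i | some k => j k, ?_, ?_, ?_, ?_⟩
    · rintro (_ | k)
      exacts [hS, k1 k]
    · rintro (_ | k)
      exacts [hz, k2 k]
    · rintro (_ | k) (_ | l) hkl
      · exact absurd rfl hkl
      · change i ≫ adj (j l) = 0
        rw [← hM.adj_adj i, ← hM.adj_comp, h9, hM.adj_zero]
      · exact h9 k
      · exact k3 k l (fun h => hkl (congrArg some h))
    · rw [Fintype.sum_option]
      change adj i ≫ i + ∑ k, adj (j k) ≫ j k = e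
      rw [k4]
      simp

/-- The formal direct sum of the simple constituents of `e` is its image, and their isometries are
the rows of the inclusion. -/
theorem mat_split {X : Mat_ C} (e : X ⟶ X) (h : e ≫ e = e) (k : adj e = e) :
    ∃ (S : Mat_ C) (i : S ⟶ X), i ≫ adj i = 𝟙 S ∧ adj i ≫ i = e := by
  obtain ⟨ι, _, _, S, i, -, h2, h3, h4⟩ := H.exists_simples _ e h k le_rfl
  refine ⟨⟨ι, S⟩, fun k j => i k () j, ?_, ?_⟩
  · ext k l
    by_cases hkl : k = l
    · subst hkl
      rw [Mat_.id_apply_self]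
      exact (congrFun (congrFun (h2 k) ()) ()).trans (Mat_.id_apply_self _ _)
    · rw [Mat_.id_apply_of_ne _ _ _ hkl]
      exact congrFun (congrFun (h3 k l hkl) ()) ()
  · ext a b
    rw [← h4]
    rw [MatSum.sum_apply]
    refine Finset.sum_congr rfl fun k _ => ?_
    exact (Fintype.sum_unique fun l : Unit => adj (i k) a l ≫ i k l b).symm

theorem mat_semisimple (X : Mat_ C) : ∃ (n : ℕ) (S : Fin n → Mat_ C) (i : ∀ k, S k ⟶ X),
    (∀ k, Module.finrank ℂ (S k ⟶ S k) = 1) ∧ (∀ k, i k ≫ adj (i k) = 𝟙 (S k)) ∧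
      (∀ k l, k ≠ l → i k ≫ adj (i l) = 0) ∧ ∑ k, adj (i k) ≫ i k = 𝟙 X := by
  obtain ⟨ι, _, _, S, i, h1, h2, h3, h4⟩ := H.exists_simples _ (𝟙 X) (Category.comp_id _)
    (H.mat_isStarCategory.adj_id X) le_rfl
  let e := (Fintype.equivFin ι).symm
  refine ⟨Fintype.card ι, fun k => sum₁ (S (e k)), fun k => i (e k), fun k => ?_, fun k => h2 _,
    fun k l hkl => h3 _ _ (e.injective.ne hkl), ?_⟩
  · rw [← h1 (e k)]
    exact LinearEquiv.finrank_eq (R := ℂ)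
      ((LinearEquiv.funUnique Unit ℂ (Unit → (S (e k) ⟶ S (e k)))).trans
        (LinearEquiv.funUnique Unit ℂ (S (e k) ⟶ S (e k))))
  · rw [← h4]
    exact Equiv.sum_comp e fun k => adj (i k) ≫ i k

end IsRigidStarCategory
end

/-! ### Monoidal structure on direct sums -/

noncomputable section

open CategoryTheory MonoidalCategory Limits DualStarStruct

set_option linter.unusedSectionVars false

namespace MatSum

section Reindex

variable {C : Type*} [Category C] [Preadditive C] {X Y Z : Mat_ C} (e : X.ι ≃ Y.ι)
  (f : ∀ i, X.X i ≅ Y.X (e i))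

theorem reindex_hom_apply (i : X.ι) : (reindex e f).hom i (e i) = (f i).hom := by
  simp [reindex]

theorem reindex_hom_apply_ne {i : X.ι} {j : Y.ι} (h : e i ≠ j) : (reindex e f).hom i j = 0 := by
  simp [reindex, h]

theorem reindex_inv_apply (i : X.ι) : (reindex e f).inv (e i) i = (f i).inv := by
  simp [reindex]

theorem reindex_inv_apply_ne {i : X.ι} {j : Y.ι} (h : e i ≠ j) : (reindex e f).inv j i = 0 := by
  simp [reindex, h]

/-- A `reindex` is a permutation matrix with isomorphisms as entries, so a product with it has one
surviving term. The lemmas that follow treat the other sides and the inverse. -/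
theorem reindex_hom_comp (g : Y ⟶ Z) (i : X.ι) (k : Z.ι) :
    ((reindex e f).hom ≫ g) i k = (f i).hom ≫ g (e i) k := by
  rw [Mat_.comp_apply, Finset.sum_eq_single (e i), reindex_hom_apply]
  · intro j _ hj
    rw [reindex_hom_apply_ne e f hj.symm, zero_comp]
  · simp

theorem comp_reindex_hom (g : Z ⟶ X) (i : Z.ι) (j : X.ι) :
    (g ≫ (reindex e f).hom) i (e j) = g i j ≫ (f j).hom := by
  rw [Mat_.comp_apply, Finset.sum_eq_single j, reindex_hom_apply]
  · intro k _ hk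
    rw [reindex_hom_apply_ne e f (e.injective.ne hk), comp_zero]
  · simp

theorem reindex_inv_comp (g : X ⟶ Z) (i : X.ι) (k : Z.ι) :
    ((reindex e f).inv ≫ g) (e i) k = (f i).inv ≫ g i k := by
  rw [Mat_.comp_apply, Finset.sum_eq_single i, reindex_inv_apply]
  · intro j _ hj
    rw [reindex_inv_apply_ne e f (e.injective.ne hj), zero_comp]
  · simp

theorem comp_reindex_inv (g : Z ⟶ Y) (i : Z.ι) (j : X.ι) :
    (g ≫ (reindex e f).inv) i j = g i (e j) ≫ (f j).inv := by
  rw [Mat_.comp_apply, Finset.sum_eq_single (e j), reindex_inv_apply]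
  · intro k _ hk
    rw [reindex_inv_apply_ne e f hk.symm, comp_zero]
  · simp

theorem hom_eq_reindex (g : X ⟶ Y) (h : ∀ i, g i (e i) = (f i).hom)
    (h0 : ∀ i j, e i ≠ j → g i j = 0) : g = (reindex e f).hom := by
  ext i j
  by_cases hij : e i = j
  · subst hij
    rw [h, reindex_hom_apply]
  · rw [h0 i j hij, reindex_hom_apply_ne e f hij]

end Reindex

section Monoidal

variable {C : Type*} [Category C] [Preadditive C] [MonoidalCategory C] [MonoidalPreadditive C]
  {W X Y Z X' Y' Z' : Mat_ C}

theorem tensorHom_apply (f : X ⟶ Y) (g : X' ⟶ Y') (i j) :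
    (f ⊗ₘ g) i j = f i.1 j.1 ⊗ₘ g i.2 j.2 := rfl

theorem whiskerLeft_eq (f : X ⟶ Y) : W ◁ f = 𝟙 W ⊗ₘ f := rfl

theorem whiskerRight_eq (f : X ⟶ Y) : f ▷ W = f ⊗ₘ 𝟙 W := rfl

theorem whiskerLeft_apply (f : X ⟶ Y) (a : W.ι) (i j) : (W ◁ f) (a, i) (a, j) = W.X a ◁ f i j := by
  rw [whiskerLeft_eq, tensorHom_apply, Mat_.id_apply_self, id_tensorHom]

theorem whiskerLeft_apply_ne (f : X ⟶ Y) {a b : W.ι} (h : a ≠ b) (i j) :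
    (W ◁ f) (a, i) (b, j) = 0 := by
  rw [whiskerLeft_eq, tensorHom_apply, Mat_.id_apply_of_ne _ _ _ h, MonoidalPreadditive.zero_tensor]

theorem whiskerRight_apply (f : X ⟶ Y) (a : W.ι) (i j) :
    (f ▷ W) (i, a) (j, a) = f i j ▷ W.X a := by
  rw [whiskerRight_eq, tensorHom_apply, Mat_.id_apply_self, tensorHom_id]

theorem whiskerRight_apply_ne (f : X ⟶ Y) {a b : W.ι} (h : a ≠ b) (i j) :
    (f ▷ W) (i, a) (j, b) = 0 := by
  rw [whiskerRight_eq, tensorHom_apply, Mat_.id_apply_of_ne _ _ _ h, MonoidalPreadditive.tensor_zero]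

theorem whiskerLeft_comp_apply (f : X ⟶ Y) (g : W ⊗ Y ⟶ Z) (a : W.ι) (i k) :
    (W ◁ f ≫ g) (a, i) k = ∑ j, W.X a ◁ f i j ≫ g (a, j) k := by
  refine (Mat_.comp_apply _ _ _ _).trans ((Fintype.sum_prod_type _).trans ?_)
  rw [Finset.sum_eq_single a]
  · simp only [whiskerLeft_apply]
  · intro b _ hb
    refine Finset.sum_eq_zero fun j _ => ?_
    rw [whiskerLeft_apply_ne f hb.symm, zero_comp]
  · simp

theorem whiskerRight_comp_apply (f : X ⟶ Y) (g : Y ⊗ W ⟶ Z) (a : W.ι) (i k) :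
    (f ▷ W ≫ g) (i, a) k = ∑ j, f i j ▷ W.X a ≫ g (j, a) k := by
  refine (Mat_.comp_apply _ _ _ _).trans ((Fintype.sum_prod_type_right _).trans ?_)
  rw [Finset.sum_eq_single a]
  · simp only [whiskerRight_apply]
  · intro b _ hb
    refine Finset.sum_eq_zero fun j _ => ?_
    rw [whiskerRight_apply_ne f hb.symm, zero_comp]
  · simp

theorem tensor_comp_tensor (f : X ⟶ Y) (f' : X' ⟶ Y') (g : Y ⟶ Z) (g' : Y' ⟶ Z') :
    (f ⊗ₘ f') ≫ (g ⊗ₘ g') = (f ≫ g) ⊗ₘ (f' ≫ g') := by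
  ext i k
  refine (Mat_.comp_apply _ _ _ _).trans ((Fintype.sum_prod_type _).trans ?_)
  rw [tensorHom_apply, Mat_.comp_apply, Mat_.comp_apply, sum_tensor]
  simp only [tensor_sum, tensorHom_apply, tensorHom_comp_tensorHom]

theorem id_tensor_id (X Y : Mat_ C) : 𝟙 X ⊗ₘ 𝟙 Y = 𝟙 (X ⊗ Y) := by
  ext ⟨a, b⟩ ⟨c, d⟩
  rw [tensorHom_apply]
  by_cases h : a = c
  · by_cases k : b = d
    · subst h k
      rw [Mat_.id_apply_self, Mat_.id_apply_self, Mat_.id_apply_self]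
      exact id_tensorHom_id _ _
    · rw [Mat_.id_apply_of_ne _ b d k, MonoidalPreadditive.tensor_zero, Mat_.id_apply_of_ne]
      exact fun h => k (congrArg Prod.snd h)
  · rw [Mat_.id_apply_of_ne _ a c h, MonoidalPreadditive.zero_tensor, Mat_.id_apply_of_ne]
    exact fun k => h (congrArg Prod.fst k)

/-- Whiskered permutation matrices are again permutation matrices; this makes composites with
whiskered coherence maps computable entry by entry. -/
theorem whiskerLeft_reindex (W : Mat_ C) (e : X.ι ≃ Y.ι) (f : ∀ i, X.X i ≅ Y.X (e i)) :
    W ◁ (reindex e f).hom = (reindex (X := W ⊗ X) (Y := W ⊗ Y) ((Equiv.refl W.ι).prodCongr e)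
      (fun i => whiskerLeftIso (W.X i.1) (f i.2))).hom := by
  refine hom_eq_reindex (X := W ⊗ X) (Y := W ⊗ Y) _ _ _ (fun ⟨a, i⟩ => ?_) (fun ⟨a, i⟩ ⟨b, j⟩ h => ?_)
  · exact (whiskerLeft_apply _ _ _ _).trans (congrArg _ (reindex_hom_apply e f i))
  · by_cases hab : a = b
    · subst hab
      rw [whiskerLeft_apply, reindex_hom_apply_ne e f, MonoidalPreadditive.whiskerLeft_zero]
      exact fun k => h (congrArg (Prod.mk a) k)
    · exact whiskerLeft_apply_ne _ hab _ _

theorem whiskerRight_reindex (W : Mat_ C) (e : X.ι ≃ Y.ι) (f : ∀ i, X.X i ≅ Y.X (e i)) :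
    (reindex e f).hom ▷ W = (reindex (X := X ⊗ W) (Y := Y ⊗ W) (e.prodCongr (Equiv.refl W.ι))
      (fun i => whiskerRightIso (f i.1) (W.X i.2))).hom := by
  refine hom_eq_reindex (X := X ⊗ W) (Y := Y ⊗ W) _ _ _ (fun ⟨i, a⟩ => ?_) (fun ⟨i, a⟩ ⟨j, b⟩ h => ?_)
  · exact (whiskerRight_apply _ _ _ _).trans (congrArg (· ▷ W.X a) (reindex_hom_apply e f i))
  · by_cases hab : a = b
    · subst hab
      rw [whiskerRight_apply, reindex_hom_apply_ne e f, MonoidalPreadditive.zero_whiskerRight]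
      exact fun k => h (congrArg (fun l => (l, a)) k)
    · exact whiskerRight_apply_ne _ hab _ _

theorem associator_hom_comp (g : X ⊗ Y ⊗ Z ⟶ W) (a b c k) :
    ((α_ X Y Z).hom ≫ g) ((a, b), c) k = (α_ (X.X a) (Y.X b) (Z.X c)).hom ≫ g (a, (b, c)) k :=
  reindex_hom_comp (X := (X ⊗ Y) ⊗ Z) (Y := X ⊗ Y ⊗ Z) _ _ _ _ _

theorem comp_associator_hom (g : W ⟶ (X ⊗ Y) ⊗ Z) (a b c k) :
    (g ≫ (α_ X Y Z).hom) k (a, (b, c)) = g k ((a, b), c) ≫ (α_ (X.X a) (Y.X b) (Z.X c)).hom :=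
  comp_reindex_hom (X := (X ⊗ Y) ⊗ Z) (Y := X ⊗ Y ⊗ Z) (Equiv.prodAssoc X.ι Y.ι Z.ι) _ g k ((a, b), c)

theorem associator_inv_comp (g : (X ⊗ Y) ⊗ Z ⟶ W) (a b c k) :
    ((α_ X Y Z).inv ≫ g) (a, (b, c)) k = (α_ (X.X a) (Y.X b) (Z.X c)).inv ≫ g ((a, b), c) k :=
  reindex_inv_comp (X := (X ⊗ Y) ⊗ Z) (Y := X ⊗ Y ⊗ Z) (Equiv.prodAssoc X.ι Y.ι Z.ι) _ g ((a, b), c) k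

theorem comp_associator_inv (g : W ⟶ X ⊗ Y ⊗ Z) (a b c k) :
    (g ≫ (α_ X Y Z).inv) k ((a, b), c) = g k (a, (b, c)) ≫ (α_ (X.X a) (Y.X b) (Z.X c)).inv :=
  comp_reindex_inv (X := (X ⊗ Y) ⊗ Z) (Y := X ⊗ Y ⊗ Z) (Equiv.prodAssoc X.ι Y.ι Z.ι) _ g k ((a, b), c)

theorem leftUnitor_hom_comp (g : X ⟶ W) (a k) :
    ((λ_ X).hom ≫ g) ((), a) k = (λ_ (X.X a)).hom ≫ g a k :=
  reindex_hom_comp (X := 𝟙_ (Mat_ C) ⊗ X) (Y := X) _ _ _ _ _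

theorem comp_leftUnitor_hom (g : W ⟶ 𝟙_ (Mat_ C) ⊗ X) (a k) :
    (g ≫ (λ_ X).hom) k a = g k ((), a) ≫ (λ_ (X.X a)).hom :=
  comp_reindex_hom (X := 𝟙_ (Mat_ C) ⊗ X) (Y := X) (Equiv.punitProd X.ι) _ g k ((), a)

theorem leftUnitor_inv_comp (g : 𝟙_ (Mat_ C) ⊗ X ⟶ W) (a k) :
    ((λ_ X).inv ≫ g) a k = (λ_ (X.X a)).inv ≫ g ((), a) k :=
  reindex_inv_comp (X := 𝟙_ (Mat_ C) ⊗ X) (Y := X) (Equiv.punitProd X.ι) _ g ((), a) k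

theorem comp_leftUnitor_inv (g : W ⟶ X) (a k) :
    (g ≫ (λ_ X).inv) k ((), a) = g k a ≫ (λ_ (X.X a)).inv :=
  comp_reindex_inv (X := 𝟙_ (Mat_ C) ⊗ X) (Y := X) (Equiv.punitProd X.ι) _ g k ((), a)

theorem rightUnitor_hom_comp (g : X ⟶ W) (a k) :
    ((ρ_ X).hom ≫ g) (a, ()) k = (ρ_ (X.X a)).hom ≫ g a k :=
  reindex_hom_comp (X := X ⊗ 𝟙_ (Mat_ C)) (Y := X) _ _ _ _ _

theorem comp_rightUnitor_hom (g : W ⟶ X ⊗ 𝟙_ (Mat_ C)) (a k) :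
    (g ≫ (ρ_ X).hom) k a = g k (a, ()) ≫ (ρ_ (X.X a)).hom :=
  comp_reindex_hom (X := X ⊗ 𝟙_ (Mat_ C)) (Y := X) (Equiv.prodPUnit X.ι) _ g k (a, ())

theorem rightUnitor_inv_comp (g : X ⊗ 𝟙_ (Mat_ C) ⟶ W) (a k) :
    ((ρ_ X).inv ≫ g) a k = (ρ_ (X.X a)).inv ≫ g (a, ()) k :=
  reindex_inv_comp (X := X ⊗ 𝟙_ (Mat_ C)) (Y := X) (Equiv.prodPUnit X.ι) _ g (a, ()) k

theorem comp_rightUnitor_inv (g : W ⟶ X) (a k) :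
    (g ≫ (ρ_ X).inv) k (a, ()) = g k a ≫ (ρ_ (X.X a)).inv :=
  comp_reindex_inv (X := X ⊗ 𝟙_ (Mat_ C)) (Y := X) (Equiv.prodPUnit X.ι) _ g k (a, ())

theorem associator_hom_apply (a : X.ι) (b : Y.ι) (c : Z.ι) :
    (α_ X Y Z).hom ((a, b), c) (a, (b, c)) = (α_ (X.X a) (Y.X b) (Z.X c)).hom :=
  reindex_hom_apply (X := (X ⊗ Y) ⊗ Z) (Y := X ⊗ Y ⊗ Z) _ _ _

theorem associator_hom_apply_ne {a a' : X.ι} {b b' : Y.ι} {c c' : Z.ι}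
    (h : ¬(a = a' ∧ b = b' ∧ c = c')) : (α_ X Y Z).hom ((a, b), c) (a', (b', c')) = 0 :=
  reindex_hom_apply_ne (X := (X ⊗ Y) ⊗ Z) (Y := X ⊗ Y ⊗ Z) _ _ (fun k => h (by cases k; exact ⟨rfl, rfl, rfl⟩))

theorem leftUnitor_hom_apply (a : X.ι) : (λ_ X).hom ((), a) a = (λ_ (X.X a)).hom :=
  reindex_hom_apply (X := 𝟙_ (Mat_ C) ⊗ X) (Y := X) (Equiv.punitProd X.ι) _ ((), a)

theorem leftUnitor_hom_apply_ne {a b : X.ι} (h : a ≠ b) : (λ_ X).hom ((), a) b = 0 :=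
  reindex_hom_apply_ne (X := 𝟙_ (Mat_ C) ⊗ X) (Y := X) (Equiv.punitProd X.ι) _ h

theorem rightUnitor_hom_apply (a : X.ι) : (ρ_ X).hom (a, ()) a = (ρ_ (X.X a)).hom :=
  reindex_hom_apply (X := X ⊗ 𝟙_ (Mat_ C)) (Y := X) (Equiv.prodPUnit X.ι) _ (a, ())

theorem rightUnitor_hom_apply_ne {a b : X.ι} (h : a ≠ b) : (ρ_ X).hom (a, ()) b = 0 :=
  reindex_hom_apply_ne (X := X ⊗ 𝟙_ (Mat_ C)) (Y := X) (Equiv.prodPUnit X.ι) _ h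

theorem associator_whiskerRight_comp (g : (W ⊗ X ⊗ Y) ⊗ Z ⟶ X') (a b c d k) :
    ((α_ W X Y).hom ▷ Z ≫ g) (((a, b), c), d) k =
      (α_ (W.X a) (X.X b) (Y.X c)).hom ▷ Z.X d ≫ g ((a, (b, c)), d) k :=
  (congrArg (fun h : ((W ⊗ X) ⊗ Y) ⊗ Z ⟶ (W ⊗ X ⊗ Y) ⊗ Z => (h ≫ g) (((a, b), c), d) k)
    (whiskerRight_reindex (X := (W ⊗ X) ⊗ Y) (Y := W ⊗ X ⊗ Y) Z (Equiv.prodAssoc W.ι X.ι Y.ι)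
      fun i => α_ (W.X i.1.1) (X.X i.1.2) (Y.X i.2))).trans
    (reindex_hom_comp (X := ((W ⊗ X) ⊗ Y) ⊗ Z) (Y := (W ⊗ X ⊗ Y) ⊗ Z) _ _ g (((a, b), c), d) k)

theorem comp_whiskerLeft_associator (g : X' ⟶ W ⊗ (X ⊗ Y) ⊗ Z) (a b c d k) :
    (g ≫ W ◁ (α_ X Y Z).hom) k (a, (b, (c, d))) =
      g k (a, ((b, c), d)) ≫ W.X a ◁ (α_ (X.X b) (Y.X c) (Z.X d)).hom :=
  (congrArg (fun h : W ⊗ (X ⊗ Y) ⊗ Z ⟶ W ⊗ X ⊗ Y ⊗ Z => (g ≫ h) k (a, (b, (c, d))))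
    (whiskerLeft_reindex (X := (X ⊗ Y) ⊗ Z) (Y := X ⊗ Y ⊗ Z) W (Equiv.prodAssoc X.ι Y.ι Z.ι)
      fun i => α_ (X.X i.1.1) (Y.X i.1.2) (Z.X i.2))).trans
    (comp_reindex_hom (X := W ⊗ (X ⊗ Y) ⊗ Z) (Y := W ⊗ X ⊗ Y ⊗ Z)
      ((Equiv.refl W.ι).prodCongr (Equiv.prodAssoc X.ι Y.ι Z.ι)) _ g k (a, ((b, c), d)))

theorem pentagon (W X Y Z : Mat_ C) :
    (α_ W X Y).hom ▷ Z ≫ (α_ W (X ⊗ Y) Z).hom ≫ W ◁ (α_ X Y Z).hom =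
      (α_ (W ⊗ X) Y Z).hom ≫ (α_ W X (Y ⊗ Z)).hom := by
  ext ⟨⟨⟨a, b⟩, c⟩, d⟩ ⟨a', b', c', d'⟩
  refine ((associator_whiskerRight_comp _ a b c d _).trans (congrArg _
    (comp_whiskerLeft_associator _ a' b' c' d' _))).trans (Eq.trans ?_
    (comp_associator_hom (X := W) (Y := X) (Z := Y ⊗ Z) _ a' b' (c', d') _).symm)
  -- For matching indices this is the pentagon of the summands; otherwise the middle associator on
  -- the left and the first one on the right have a zero entry.
  by_cases h : a = a' ∧ b = b' ∧ c = c' ∧ d = d'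
  · obtain ⟨rfl, rfl, rfl, rfl⟩ := h
    rw [associator_hom_apply (X := W) (Y := X ⊗ Y) (Z := Z) a (b, c) d,
      associator_hom_apply (X := W ⊗ X) (Y := Y) (Z := Z) (a, b) c d]
    exact MonoidalCategory.pentagon (W.X a) (X.X b) (Y.X c) (Z.X d)
  · rw [associator_hom_apply_ne (X := W) (Y := X ⊗ Y) (Z := Z) (by rintro ⟨rfl, h', rfl⟩; cases h'; exact h ⟨rfl, rfl, rfl, rfl⟩),
      associator_hom_apply_ne (X := W ⊗ X) (Y := Y) (Z := Z) (by rintro ⟨h', rfl, rfl⟩; cases h'; exact h ⟨rfl, rfl, rfl, rfl⟩)]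
    simp

instance : MonoidalCategory (Mat_ C) where
  tensorHom_def f g := by
    rw [whiskerLeft_eq, whiskerRight_eq, tensor_comp_tensor, Category.comp_id, Category.id_comp]
  id_tensorHom_id := id_tensor_id
  tensorHom_comp_tensorHom f g h k := tensor_comp_tensor f g h k
  whiskerLeft_id := id_tensor_id
  id_whiskerRight := id_tensor_id
  associator_naturality f g h := by
    ext ⟨⟨a, b⟩, c⟩ ⟨a', b', c'⟩
    rw [comp_associator_hom, associator_hom_comp]
    exact MonoidalCategory.associator_naturality _ _ _
  leftUnitor_naturality f := by
    ext ⟨⟨⟩, a⟩ b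
    rw [comp_leftUnitor_hom, leftUnitor_hom_comp, whiskerLeft_apply]
    exact MonoidalCategory.leftUnitor_naturality _
  rightUnitor_naturality f := by
    ext ⟨a, ⟨⟩⟩ b
    rw [comp_rightUnitor_hom, rightUnitor_hom_comp, whiskerRight_apply]
    exact MonoidalCategory.rightUnitor_naturality _
  pentagon := pentagon
  triangle X Y := by
    ext ⟨⟨a, ⟨⟩⟩, b⟩ ⟨c, d⟩
    rw [associator_hom_comp]
    by_cases h : a = c
    · subst h
      rw [whiskerLeft_apply]
      by_cases k : b = d
      · subst k
        rw [whiskerRight_apply, leftUnitor_hom_apply, rightUnitor_hom_apply]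
        exact MonoidalCategory.triangle _ _
      · rw [whiskerRight_apply_ne _ k, leftUnitor_hom_apply_ne k]
        simp
    · rw [whiskerLeft_apply_ne _ h]
      by_cases k : b = d
      · subst k
        rw [whiskerRight_apply, rightUnitor_hom_apply_ne h]
        simp
      · rw [whiskerRight_apply_ne _ k, comp_zero]

end Monoidal

end MatSum
end

/-! ### Duality on direct sums -/

noncomputable section

open CategoryTheory MonoidalCategory Limits DualStarStruct

set_option linter.unusedSectionVars false

namespace MatSum

/-- Evaluation and coevaluation are diagonal matrices, so sums over pairs of indices collapse to the
diagonal. -/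
theorem sum_diag {ι M : Type*} [Fintype ι] [AddCommMonoid M] (f : ι × ι → M)
    (h : ∀ a b, a ≠ b → f (a, b) = 0) : ∑ j, f j = ∑ c, f (c, c) := by
  rw [Fintype.sum_prod_type]
  exact Finset.sum_congr rfl fun a _ => Finset.sum_eq_single a (fun b _ hb => h a b hb.symm) (by simp)

variable {C : Type*} [Category C] [Preadditive C] [Linear ℂ C] [MonoidalCategory C]
  [DualStarStruct C] {W X Y Z : Mat_ C}

theorem coev_apply (a : X.ι) : (coev X : 𝟙_ (Mat_ C) ⟶ X ⊗ dual X) () (a, a) = coev (X.X a) :=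
  (dif_pos rfl).trans (Category.comp_id _)

theorem coev_apply_ne {a b : X.ι} (h : a ≠ b) :
    (coev X : 𝟙_ (Mat_ C) ⟶ X ⊗ dual X) () (a, b) = 0 := dif_neg h.symm

theorem ev_apply (a : X.ι) : (ev X : dual X ⊗ X ⟶ 𝟙_ (Mat_ C)) (a, a) () = ev (X.X a) :=
  (dif_pos rfl).trans (Category.id_comp _)

theorem ev_apply_ne {a b : X.ι} (h : a ≠ b) :
    (ev X : dual X ⊗ X ⟶ 𝟙_ (Mat_ C)) (a, b) () = 0 := dif_neg h

variable (H : IsRigidStarCategory C)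

include H in
theorem _root_.IsRigidStarCategory.monoidalPreadditive : MonoidalPreadditive C := by
  have h0 : ∀ {W X Y Z : C} (f : W ⟶ X), f ⊗ₘ (0 : Y ⟶ Z) = 0 := fun {W X Y Z} f => by
    have := H.tensor_smul 0 f (0 : Y ⟶ Z)
    rwa [zero_smul, zero_smul] at this
  have h0' : ∀ {W X Y Z : C} (f : W ⟶ X), (0 : Y ⟶ Z) ⊗ₘ f = 0 := fun {W X Y Z} f => by
    have := H.smul_tensor 0 (0 : Y ⟶ Z) f
    rwa [zero_smul, zero_smul] at this
  exact
  { whiskerLeft_zero := fun {X Y Z} => by rw [← id_tensorHom, h0]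
    zero_whiskerRight := fun {X Y Z} => by rw [← tensorHom_id, h0']
    whiskerLeft_add := fun f g => by simp only [← id_tensorHom, H.tensor_add]
    add_whiskerRight := fun f g => by simp only [← tensorHom_id, H.add_tensor] }

include H in
theorem adj_ev_apply (a : X.ι) :
    (adj (ev X) : 𝟙_ (Mat_ C) ⟶ dual X ⊗ X) () (a, a) = adj (ev (X.X a)) :=
  congrArg adj (ev_apply a)

include H in
theorem adj_ev_apply_ne {a b : X.ι} (h : a ≠ b) :
    (adj (ev X) : 𝟙_ (Mat_ C) ⟶ dual X ⊗ X) () (a, b) = 0 :=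
  (congrArg adj (ev_apply_ne h)).trans (H.isStarCategory.adj_zero _ _)

include H in
theorem adj_coev_apply (a : X.ι) :
    (adj (coev X) : X ⊗ dual X ⟶ 𝟙_ (Mat_ C)) (a, a) () = adj (coev (X.X a)) :=
  congrArg adj (coev_apply a)

include H in
theorem adj_coev_apply_ne {a b : X.ι} (h : a ≠ b) :
    (adj (coev X) : X ⊗ dual X ⟶ 𝟙_ (Mat_ C)) (a, b) () = 0 :=
  (congrArg adj (coev_apply_ne h)).trans (H.isStarCategory.adj_zero _ _)

theorem coev_comp_apply (g : X ⊗ dual X ⟶ W) (k) :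
    (coev X ≫ g) () k = ∑ c, coev (X.X c) ≫ g (c, c) k :=
  (sum_diag (fun j : X.ι × X.ι => (coev X : 𝟙_ (Mat_ C) ⟶ X ⊗ dual X) () j ≫ g j k)
    fun a b h => by rw [coev_apply_ne h, zero_comp]).trans (Finset.sum_congr rfl fun c _ => by rw [coev_apply])

theorem comp_ev_apply (g : W ⟶ dual X ⊗ X) (k) :
    (g ≫ ev X) k () = ∑ c, g k (c, c) ≫ ev (X.X c) :=
  (sum_diag (fun j : X.ι × X.ι => g k j ≫ (ev X : dual X ⊗ X ⟶ 𝟙_ (Mat_ C)) j ())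
    fun a b h => by rw [ev_apply_ne h, comp_zero]).trans (Finset.sum_congr rfl fun c _ => by rw [ev_apply])

include H in
theorem adj_ev_comp_apply (g : dual X ⊗ X ⟶ W) (k) :
    (adj (ev X) ≫ g) () k = ∑ c, adj (ev (X.X c)) ≫ g (c, c) k :=
  (sum_diag (fun j : X.ι × X.ι => (adj (ev X) : 𝟙_ (Mat_ C) ⟶ dual X ⊗ X) () j ≫ g j k)
    fun a b h => by rw [adj_ev_apply_ne H h, zero_comp]).trans (Finset.sum_congr rfl fun c _ => by rw [adj_ev_apply H])

include H in
theorem comp_adj_coev_apply (g : W ⟶ X ⊗ dual X) (k) :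
    (g ≫ adj (coev X)) k () = ∑ c, g k (c, c) ≫ adj (coev (X.X c)) :=
  (sum_diag (fun j : X.ι × X.ι => g k j ≫ (adj (coev X) : X ⊗ dual X ⟶ 𝟙_ (Mat_ C)) j ())
    fun a b h => by rw [adj_coev_apply_ne H h, comp_zero]).trans (Finset.sum_congr rfl fun c _ => by rw [adj_coev_apply H])

variable [MonoidalPreadditive C]

theorem comp_whiskerLeft_apply (g : Z ⟶ W ⊗ X) (f : X ⟶ Y) (a : W.ι) (j k) :
    (g ≫ W ◁ f) k (a, j) = ∑ i, g k (a, i) ≫ W.X a ◁ f i j := by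
  refine (Mat_.comp_apply _ _ _ _).trans ((Fintype.sum_prod_type _).trans ?_)
  rw [Finset.sum_eq_single a]
  · simp only [whiskerLeft_apply]
  · intro b _ hb
    refine Finset.sum_eq_zero fun j _ => ?_
    rw [whiskerLeft_apply_ne f hb, comp_zero]
  · simp

theorem comp_whiskerRight_apply (g : Z ⟶ X ⊗ W) (f : X ⟶ Y) (a : W.ι) (j k) :
    (g ≫ f ▷ W) k (j, a) = ∑ i, g k (i, a) ≫ f i j ▷ W.X a := by
  refine (Mat_.comp_apply _ _ _ _).trans ((Fintype.sum_prod_type_right _).trans ?_)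
  rw [Finset.sum_eq_single a]
  · simp only [whiskerRight_apply]
  · intro b _ hb
    refine Finset.sum_eq_zero fun j _ => ?_
    rw [whiskerRight_apply_ne f hb, comp_zero]
  · simp

theorem whiskerLeft_whiskerRight_apply (f : X ⟶ Y) (a : W.ι) (b : Z.ι) (i j) :
    (W ◁ (f ▷ Z)) (a, (i, b)) (a, (j, b)) = W.X a ◁ (f i j ▷ Z.X b) :=
  (whiskerLeft_apply _ _ _ _).trans (congrArg _ (whiskerRight_apply _ _ _ _))

theorem whiskerLeft_whiskerRight_apply_ne (f : X ⟶ Y) (a : W.ι) {b c : Z.ι} (h : b ≠ c) (i j) :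
    (W ◁ (f ▷ Z)) (a, (i, b)) (a, (j, c)) = 0 :=
  (whiskerLeft_apply _ _ _ _).trans ((congrArg _ (whiskerRight_apply_ne _ h _ _)).trans
    (MonoidalPreadditive.whiskerLeft_zero))

theorem coev_whiskerRight_comp (g : (X ⊗ dual X) ⊗ Y ⟶ W) (a : Y.ι) (k) :
    (coev X ▷ Y ≫ g) ((), a) k = ∑ c, coev (X.X c) ▷ Y.X a ≫ g ((c, c), a) k :=
  (whiskerRight_comp_apply _ _ _ _ _).trans ((sum_diag (fun j : X.ι × X.ι =>
    (coev X : 𝟙_ (Mat_ C) ⟶ X ⊗ dual X) () j ▷ Y.X a ≫ g (j, a) k) fun a b h => by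
      rw [coev_apply_ne h, MonoidalPreadditive.zero_whiskerRight, zero_comp]).trans
    (Finset.sum_congr rfl fun c _ => by rw [coev_apply]))

theorem whiskerLeft_coev_comp (g : Y ⊗ X ⊗ dual X ⟶ W) (a : Y.ι) (k) :
    (Y ◁ coev X ≫ g) (a, ()) k = ∑ c, Y.X a ◁ coev (X.X c) ≫ g (a, (c, c)) k :=
  (whiskerLeft_comp_apply _ _ _ _ _).trans ((sum_diag (fun j : X.ι × X.ι =>
    Y.X a ◁ (coev X : 𝟙_ (Mat_ C) ⟶ X ⊗ dual X) () j ≫ g (a, j) k) fun a b h => by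
      rw [coev_apply_ne h, MonoidalPreadditive.whiskerLeft_zero, zero_comp]).trans
    (Finset.sum_congr rfl fun c _ => by rw [coev_apply]))

include H in
theorem adj_ev_whiskerRight_comp (g : (dual X ⊗ X) ⊗ Y ⟶ W) (a : Y.ι) (k) :
    (adj (ev X) ▷ Y ≫ g) ((), a) k = ∑ c, adj (ev (X.X c)) ▷ Y.X a ≫ g ((c, c), a) k :=
  (whiskerRight_comp_apply _ _ _ _ _).trans ((sum_diag (fun j : X.ι × X.ι =>
    (adj (ev X) : 𝟙_ (Mat_ C) ⟶ dual X ⊗ X) () j ▷ Y.X a ≫ g (j, a) k) fun a b h => by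
      rw [adj_ev_apply_ne H h, MonoidalPreadditive.zero_whiskerRight, zero_comp]).trans
    (Finset.sum_congr rfl fun c _ => by rw [adj_ev_apply H]))

theorem comp_ev_whiskerRight (g : W ⟶ (dual X ⊗ X) ⊗ Y) (a : Y.ι) (k) :
    (g ≫ ev X ▷ Y) k ((), a) = ∑ c, g k ((c, c), a) ≫ ev (X.X c) ▷ Y.X a :=
  (comp_whiskerRight_apply _ _ _ _ _).trans ((sum_diag (fun j : X.ι × X.ι =>
    g k (j, a) ≫ (ev X : dual X ⊗ X ⟶ 𝟙_ (Mat_ C)) j () ▷ Y.X a) fun a b h => by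
      rw [ev_apply_ne h, MonoidalPreadditive.zero_whiskerRight, comp_zero]).trans
    (Finset.sum_congr rfl fun c _ => by rw [ev_apply]))

include H in
theorem comp_whiskerLeft_adj_coev (g : W ⟶ Y ⊗ X ⊗ dual X) (a : Y.ι) (k) :
    (g ≫ Y ◁ adj (coev X)) k (a, ()) = ∑ c, g k (a, (c, c)) ≫ Y.X a ◁ adj (coev (X.X c)) :=
  (comp_whiskerLeft_apply _ _ _ _ _).trans ((sum_diag (fun j : X.ι × X.ι =>
    g k (a, j) ≫ Y.X a ◁ (adj (coev X) : X ⊗ dual X ⟶ 𝟙_ (Mat_ C)) j ()) fun a b h => by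
      rw [adj_coev_apply_ne H h, MonoidalPreadditive.whiskerLeft_zero, comp_zero]).trans
    (Finset.sum_congr rfl fun c _ => by rw [adj_coev_apply H]))

-- For a unitary isomorphism the adjoint is the inverse, and so the adjoint transpose of the
-- permutation matrix is its inverse.
include H in
theorem isUnitary_reindex (e : X.ι ≃ Y.ι) (f : ∀ i, X.X i ≅ Y.X (e i))
    (hf : ∀ i, IsUnitary (f i).hom) : IsUnitary (reindex e f).hom := by
  have h : adj (reindex e f).hom = (reindex e f).inv := by
    ext j i
    change adj ((reindex e f).hom i j) = _
    by_cases hij : e i = j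
    · subst hij
      rw [reindex_hom_apply, reindex_inv_apply, ← Category.id_comp (adj _), ← (f i).inv_hom_id,
        Category.assoc, (hf i).1, Category.comp_id]
    · rw [reindex_hom_apply_ne e f hij, reindex_inv_apply_ne e f hij, H.isStarCategory.adj_zero]
  rw [IsUnitary, h]
  exact ⟨Iso.hom_inv_id _, Iso.inv_hom_id _⟩

/-- In the entry from `a` to `b` only the loop index `c = b` contributes, since `X ◁ ev X` does not
change the first index; that term is diagonal in `a` and `b`. -/
theorem zigzag_apply (X : Mat_ C) (h : ∀ X : C, coev X ▷ X ≫ (α_ X (dual X) X).hom ≫ X ◁ ev X =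
    (λ_ X).hom ≫ (ρ_ X).inv) :
    coev X ▷ X ≫ (α_ X (dual X) X).hom ≫ X ◁ ev X = (λ_ X).hom ≫ (ρ_ X).inv := by
  ext ⟨⟨⟩, a⟩ ⟨b, ⟨⟩⟩
  refine (coev_whiskerRight_comp _ _ _).trans (Eq.trans ?_ (comp_rightUnitor_inv _ _ _).symm)
  rw [Finset.sum_eq_single b]
  · refine (congrArg _ ((associator_hom_comp _ _ _ _ _).trans (congrArg _
      (whiskerLeft_apply _ _ _ _)))).trans ?_
    by_cases hab : b = a
    · subst hab
      rw [ev_apply, leftUnitor_hom_apply]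
      exact h _
    · rw [ev_apply_ne hab, leftUnitor_hom_apply_ne (Ne.symm hab)]
      simp
  · intro c _ hc
    refine (congrArg _ ((associator_hom_comp _ _ _ _ _).trans (congrArg _
      (whiskerLeft_apply_ne _ hc _ _)))).trans (by simp)
  · simp

theorem zagzig_apply (X : Mat_ C) (h : ∀ X : C, dual X ◁ coev X ≫ (α_ (dual X) X (dual X)).inv ≫
      ev X ▷ dual X = (ρ_ (dual X)).hom ≫ (λ_ (dual X)).inv) :
    dual X ◁ coev X ≫ (α_ (dual X) X (dual X)).inv ≫ ev X ▷ dual X =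
      (ρ_ (dual X)).hom ≫ (λ_ (dual X)).inv := by
  ext ⟨a, ⟨⟩⟩ ⟨⟨⟩, b⟩
  refine (whiskerLeft_coev_comp _ _ _).trans (Eq.trans ?_ (comp_leftUnitor_inv _ _ _).symm)
  refine (Fintype.sum_eq_single (b : X.ι) fun c hc => ?_).trans ?_
  · refine (congrArg _ ((associator_inv_comp _ _ _ _ _).trans (congrArg _
      (whiskerRight_apply_ne _ hc _ _)))).trans (by simp)
  · refine (congrArg _ ((associator_inv_comp _ _ _ _ _).trans (congrArg _
      (whiskerRight_apply _ _ _ _)))).trans ?_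
    by_cases hab : a = b
    · subst hab
      rw [ev_apply, rightUnitor_hom_apply]
      exact h _
    · rw [ev_apply_ne (X := X) hab, rightUnitor_hom_apply_ne hab]
      simp

include H in
theorem spherical_apply (f : X ⟶ X) (h : ∀ {X : C} (f : X ⟶ X),
      adj (ev X) ≫ dual X ◁ f ≫ ev X = coev X ≫ f ▷ dual X ≫ adj (coev X)) :
    adj (ev X) ≫ dual X ◁ f ≫ ev X = coev X ≫ f ▷ dual X ≫ adj (coev X) := by
  ext ⟨⟩ ⟨⟩
  refine (adj_ev_comp_apply H _ _).trans (Eq.trans (Finset.sum_congr rfl fun a _ => ?_)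
    (coev_comp_apply _ _).symm)
  refine (congrArg _ (comp_ev_apply _ _)).trans (Eq.trans ?_
    (congrArg _ (comp_adj_coev_apply H _ _)).symm)
  refine (congrArg _ (Fintype.sum_eq_single a fun c hc => ?_)).trans (Eq.trans ?_
    (congrArg _ (Fintype.sum_eq_single a fun c hc => ?_)).symm)
  · rw [whiskerLeft_apply_ne (W := dual X) _ hc.symm, zero_comp]
  · rw [whiskerLeft_apply, whiskerRight_apply]
    exact h _
  · rw [whiskerRight_apply_ne (W := dual X) _ hc.symm, zero_comp]

theorem dualHom_eq_apply (f : X ⟶ Y) (h : ∀ {X Y : C} (f : X ⟶ Y), dualHom f =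
      (ρ_ (dual Y)).inv ≫ dual Y ◁ coev X ≫ dual Y ◁ (f ▷ dual X) ≫
        (α_ (dual Y) Y (dual X)).inv ≫ ev Y ▷ dual X ≫ (λ_ (dual X)).hom) :
    dualHom f = (ρ_ (dual Y)).inv ≫ dual Y ◁ coev X ≫ dual Y ◁ (f ▷ dual X) ≫
        (α_ (dual Y) Y (dual X)).inv ≫ ev Y ▷ dual X ≫ (λ_ (dual X)).hom := by
  ext j i
  -- Two loop indices are summed in the entry at `j`, `i`: `c` from `coev X` and `d` from `ev Y`.
  -- Only `c = i` and `d = j` will survive, leaving the formula for `f i j`.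
  have key : ∀ c : X.ι, (dual Y ◁ (f ▷ dual X) ≫ (α_ (dual Y) Y (dual X)).inv ≫ ev Y ▷ dual X ≫
      (λ_ (dual X)).hom) (j, (c, c)) i = ∑ d : Y.ι, ((dual Y ◁ (f ▷ dual X)) (j, (c, c)) (d, (d, i)) ≫
        (α_ (dual (Y.X d)) (Y.X d) (dual (X.X i))).inv ≫ ev (Y.X d) ▷ dual (X.X i)) ≫
        (λ_ (dual (X.X i))).hom := by
    intro c
    rw [← Category.assoc, ← Category.assoc]
    refine (comp_leftUnitor_hom _ _ _).trans ((congrArg (· ≫ _)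
      (comp_ev_whiskerRight _ _ _)).trans ((Preadditive.sum_comp _ _ _).trans
      (Finset.sum_congr rfl fun d _ => ?_)))
    refine congrArg (· ≫ _) ((congrArg (· ≫ _) (comp_associator_inv _ _ _ _ _)).trans
      (Category.assoc _ _ _))
  refine Eq.trans ?_ ((rightUnitor_inv_comp _ _ _).trans
    (congrArg _ (whiskerLeft_coev_comp _ _ _))).symm
  refine Eq.trans ?_ (congrArg _ (Fintype.sum_eq_single (i : X.ι) fun c hc => ?_)).symm
  · refine Eq.trans ?_ (congrArg (fun x => _ ≫ _ ≫ x) ((key i).trans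
      (Fintype.sum_eq_single (j : Y.ι) fun d hd => ?_))).symm
    · rw [whiskerLeft_whiskerRight_apply]
      refine (h (f i j)).trans ?_
      simp only [Category.assoc]
      rfl
    · rw [whiskerLeft_apply_ne (W := dual Y) _ hd.symm, zero_comp, zero_comp]
  · refine (congrArg _ ((key c).trans (Finset.sum_eq_zero fun d _ => ?_))).trans comp_zero
    by_cases hd : d = j
    · subst hd
      rw [whiskerLeft_whiskerRight_apply_ne (Z := dual X) f _ hc, zero_comp, zero_comp]
    · rw [whiskerLeft_apply_ne (W := dual Y) _ (Ne.symm hd), zero_comp, zero_comp]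

include H in
theorem dualHom_eq_left_apply (f : X ⟶ Y) (h : ∀ {X Y : C} (f : X ⟶ Y), dualHom f =
      (λ_ (dual Y)).inv ≫ adj (ev X) ▷ dual Y ≫ (α_ (dual X) X (dual Y)).hom ≫
        dual X ◁ (f ▷ dual Y) ≫ dual X ◁ adj (coev Y) ≫ (ρ_ (dual X)).hom) :
    dualHom f = (λ_ (dual Y)).inv ≫ adj (ev X) ▷ dual Y ≫ (α_ (dual X) X (dual Y)).hom ≫
        dual X ◁ (f ▷ dual Y) ≫ dual X ◁ adj (coev Y) ≫ (ρ_ (dual X)).hom := by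
  ext j i
  have key : ∀ c : X.ι, ((α_ (dual X) X (dual Y)).hom ≫ dual X ◁ (f ▷ dual Y) ≫
      dual X ◁ adj (coev Y) ≫ (ρ_ (dual X)).hom) ((c, c), j) i =
      (α_ (dual (X.X c)) (X.X c) (dual (Y.X j))).hom ≫ ∑ d : Y.ι, ((dual X ◁ (f ▷ dual Y)) (c, (c, j)) (i, (d, d)) ≫
        dual (X.X i) ◁ adj (coev (Y.X d))) ≫ (ρ_ (dual (X.X i))).hom := by
    intro c
    refine (associator_hom_comp (X := dual X) (Z := dual Y) _ _ _ _ _).trans (congrArg _ ?_)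
    rw [← Category.assoc]
    exact (comp_rightUnitor_hom _ _ _).trans ((congrArg (· ≫ _)
      (comp_whiskerLeft_adj_coev H _ _ _)).trans (Preadditive.sum_comp _ _ _))
  refine Eq.trans ?_ ((leftUnitor_inv_comp _ _ _).trans
    (congrArg _ (adj_ev_whiskerRight_comp H _ _ _))).symm
  refine Eq.trans ?_ (congrArg _ (Fintype.sum_eq_single (i : X.ι) fun c hc => ?_)).symm
  · refine Eq.trans ?_ (congrArg (fun x => _ ≫ _ ≫ x) ((key i).trans
      (congrArg _ (Fintype.sum_eq_single (j : Y.ι) fun d hd => ?_)))).symm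
    · rw [whiskerLeft_whiskerRight_apply]
      refine (h (f i j)).trans ?_
      simp only [Category.assoc]
      rfl
    · rw [whiskerLeft_whiskerRight_apply_ne (Z := dual Y) f _ hd.symm, zero_comp, zero_comp]
  · refine (congrArg _ ((key c).trans (congrArg _ (Finset.sum_eq_zero fun d _ => ?_)))).trans
      (by simp)
    rw [whiskerLeft_apply_ne (W := dual X) _ hc, zero_comp, zero_comp]

end MatSum
end

/-! ### Direct sums form a rigid C*-tensor category -/

noncomputable section

open CategoryTheory MonoidalCategory Limits DualStarStruct

set_option linter.unusedSectionVars false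

namespace MatSum

variable {C : Type*} [Category C] [Preadditive C] [Linear ℂ C] [MonoidalCategory C]
  [MonoidalPreadditive C] [DualStarStruct C] {W X Y Z X' : Mat_ C}

/-- The isomorphism given by a unitary. -/
def isoOfUnitary {X Y : C} (f : X ⟶ Y) (h : IsUnitary f) : X ≅ Y := ⟨f, adj f, h.1, h.2⟩

theorem reindex_whiskerRight_comp (W : Mat_ C) (e : X.ι ≃ Y.ι) (f : ∀ i, X.X i ≅ Y.X (e i))
    (g : Y ⊗ W ⟶ Z) (i a k) : ((reindex e f).hom ▷ W ≫ g) (i, a) k =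
      (f i).hom ▷ W.X a ≫ g (e i, a) k :=
  (congrArg (fun h : X ⊗ W ⟶ Y ⊗ W => (h ≫ g) (i, a) k) (whiskerRight_reindex W e f)).trans
    (reindex_hom_comp (X := X ⊗ W) (Y := Y ⊗ W) (e.prodCongr (Equiv.refl W.ι)) _ g (i, a) k)

theorem comp_whiskerRight_reindex (W : Mat_ C) (e : X.ι ≃ Y.ι) (f : ∀ i, X.X i ≅ Y.X (e i))
    (g : Z ⟶ X ⊗ W) (i a k) : (g ≫ (reindex e f).hom ▷ W) k (e i, a) =
      g k (i, a) ≫ (f i).hom ▷ W.X a :=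
  (congrArg (fun h : X ⊗ W ⟶ Y ⊗ W => (g ≫ h) k (e i, a)) (whiskerRight_reindex W e f)).trans
    (comp_reindex_hom (X := X ⊗ W) (Y := Y ⊗ W) (e.prodCongr (Equiv.refl W.ι)) _ g k (i, a))

theorem comp_whiskerLeft_reindex (W : Mat_ C) (e : X.ι ≃ Y.ι) (f : ∀ i, X.X i ≅ Y.X (e i))
    (g : Z ⟶ W ⊗ X) (i a k) : (g ≫ W ◁ (reindex e f).hom) k (a, e i) =
      g k (a, i) ≫ W.X a ◁ (f i).hom :=
  (congrArg (fun h : W ⊗ X ⟶ W ⊗ Y => (g ≫ h) k (a, e i)) (whiskerLeft_reindex W e f)).trans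
    (comp_reindex_hom (X := W ⊗ X) (Y := W ⊗ Y) ((Equiv.refl W.ι).prodCongr e) _ g k (a, i))

theorem dual_tensor_apply (H : IsRigidStarCategory C) (X Y : Mat_ C) :
    ∃ ν : dual (X ⊗ Y) ⟶ dual Y ⊗ dual X, IsUnitary ν ∧
    ev (X ⊗ Y) = ν ▷ (X ⊗ Y) ≫ (α_ (dual Y) (dual X) (X ⊗ Y)).hom ≫
      dual Y ◁ ((α_ (dual X) X Y).inv ≫ ev X ▷ Y ≫ (λ_ Y).hom) ≫ ev Y ∧
    coev (X ⊗ Y) ≫ (X ⊗ Y) ◁ ν = coev X ≫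
      ((ρ_ X).inv ≫ X ◁ coev Y ≫ (α_ X Y (dual Y)).inv) ▷ dual X ≫
        (α_ (X ⊗ Y) (dual Y) (dual X)).hom := by
  choose ν h1 h2 h3 using H.dual_tensor
  -- The unitaries for pairs of summands, placed along the exchange of the two indices, since
  -- duality reverses the order of factors.
  let N (i : X.ι × Y.ι) : (dual (X ⊗ Y)).X i ≅ (dual Y ⊗ dual X).X (Equiv.prodComm X.ι Y.ι i) :=
    isoOfUnitary (ν (X.X i.1) (Y.X i.2)) (h1 _ _)
  refine ⟨(reindex (X := dual (X ⊗ Y)) (Y := dual Y ⊗ dual X) (Equiv.prodComm X.ι Y.ι) N).hom,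
    isUnitary_reindex H _ _ (fun i => h1 _ _), ?_, ?_⟩
  · ext ⟨⟨a, b⟩, ⟨a', b'⟩⟩ ⟨⟩
    refine Eq.trans ?_ (reindex_whiskerRight_comp (X := dual (X ⊗ Y)) (Y := dual Y ⊗ dual X)
      (Z := 𝟙_ (Mat_ C))
      (X ⊗ Y) _ N _ (a, b) (a', b') ()).symm
    refine Eq.trans ?_ (congrArg ((N (a, b)).hom ▷ (X ⊗ Y).X (a', b') ≫ ·)
      ((associator_hom_comp (X := dual Y) (Y := dual X) (Z := X ⊗ Y) (W := 𝟙_ (Mat_ C)) _ b a (a', b') ()).trans (congrArg _ ((comp_ev_apply (X := Y) _ _).trans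
      (Fintype.sum_eq_single (b : Y.ι) fun c hc => ?_))))).symm
    · have K : ((α_ (dual X) X Y).inv ≫ ev X ▷ Y ≫ (λ_ Y).hom) (a, (a', b')) b =
          (α_ (dual (X.X a)) (X.X a') (Y.X b')).inv ≫
            (ev X ▷ Y) ((a, a'), b') ((), b) ≫ (λ_ (Y.X b)).hom :=
        (associator_inv_comp (X := dual X) _ _ _ _ _).trans
          (congrArg _ (comp_leftUnitor_hom _ _ _))
      rw [whiskerLeft_apply (W := dual Y), K]
      by_cases hab : a = a' ∧ b = b'
      · obtain ⟨rfl, rfl⟩ := hab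
        rw [whiskerRight_apply, ev_apply (X := X)]
        refine (ev_apply (X := X ⊗ Y) (a, b)).trans ?_
        exact h2 (X.X a) (Y.X b)
      · refine (ev_apply_ne (X := X ⊗ Y) (a := (a, b)) (b := (a', b'))
          (fun h => hab (by cases h; exact ⟨rfl, rfl⟩))).trans ?_
        have K0 : (ev X ▷ Y) ((a, a'), b') ((), b) = 0 := by
          by_cases hb : b' = b
          · subst hb
            rw [whiskerRight_apply, ev_apply_ne (X := X) (fun h => hab ⟨h, rfl⟩),
              MonoidalPreadditive.zero_whiskerRight]
          · exact whiskerRight_apply_ne _ hb _ _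
        rw [K0]
        simp
    · rw [whiskerLeft_apply_ne (W := dual Y) _ hc.symm, zero_comp]
  · ext ⟨⟩ ⟨⟨a, b⟩, ⟨b', a'⟩⟩
    refine (comp_whiskerLeft_reindex (X := dual (X ⊗ Y)) (Y := dual Y ⊗ dual X)
      (Z := 𝟙_ (Mat_ C)) (X ⊗ Y) (Equiv.prodComm X.ι Y.ι) N _ (a', b') (a, b) ()).trans ?_
    rw [← Category.assoc]
    refine Eq.trans ?_ ((comp_associator_hom (X := X ⊗ Y) (Y := dual Y) (Z := dual X) (W := 𝟙_ (Mat_ C)) _ (a, b) b' a'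
      ()).trans (congrArg (· ≫ _) ((coev_comp_apply (X := X) _ _).trans
      (Fintype.sum_eq_single (a' : X.ι) fun c hc => ?_)))).symm
    · have K : ((ρ_ X).inv ≫ X ◁ coev Y ≫ (α_ X Y (dual Y)).inv) a' ((a, b), b') =
          (ρ_ (X.X a')).inv ≫ (X ◁ coev Y) (a', ()) (a, (b, b')) ≫
            (α_ (X.X a) (Y.X b) (dual (Y.X b'))).inv :=
        (rightUnitor_inv_comp _ _ _).trans
          (congrArg _ (comp_associator_inv (Z := dual Y) _ _ _ _ _))
      refine Eq.trans ?_ (congrArg (fun x => (coev (X.X a') ≫ x) ≫ _)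
        ((whiskerRight_apply (W := dual X) (X := X) (Y := (X ⊗ Y) ⊗ dual Y)
          ((ρ_ X).inv ≫ X ◁ coev Y ≫ (α_ X Y (dual Y)).inv) a' a' ((a, b), b')).trans
          (congrArg (· ▷ dual (X.X a')) K))).symm
      by_cases hab : a = a' ∧ b = b'
      · obtain ⟨rfl, rfl⟩ := hab
        refine (congrArg (· ≫ _) (coev_apply (X := X ⊗ Y) (a, b))).trans ?_
        rw [whiskerLeft_apply, coev_apply (X := Y)]
        exact (h3 (X.X a) (Y.X b)).trans (Category.assoc _ _ _).symm
      · refine (congrArg (· ≫ _) (coev_apply_ne (X := X ⊗ Y) (a := (a, b)) (b := (a', b'))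
          (fun h => hab (by cases h; exact ⟨rfl, rfl⟩)))).trans ?_
        have K0 : (X ◁ coev Y) (a', ()) (a, (b, b')) = 0 := by
          by_cases ha : a' = a
          · subst ha
            rw [whiskerLeft_apply, coev_apply_ne (X := Y) (fun h => hab ⟨rfl, h⟩),
              MonoidalPreadditive.whiskerLeft_zero]
          · exact whiskerLeft_apply_ne (W := X) _ ha _ _
        rw [K0]
        simp only [zero_comp, comp_zero, MonoidalPreadditive.zero_whiskerRight]
        exact zero_comp.symm
    · rw [whiskerRight_apply_ne (W := dual X) _ hc, comp_zero]

theorem double_dual_apply (H : IsRigidStarCategory C) :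
    ∃ φ : ∀ X : Mat_ C, X ⟶ dual (dual X), (∀ X, IsUnitary (φ X)) ∧
    (∀ {X Y : Mat_ C} (f : X ⟶ Y), f ≫ φ Y = φ X ≫ dualHom (dualHom f)) ∧
    ∀ X, coev X ≫ φ X ▷ dual X = adj (ev (dual X)) := by
  obtain ⟨φ, h1, h2, h3⟩ := H.double_dual
  refine ⟨fun X => (reindex (X := X) (Y := dual (dual X)) (Equiv.refl X.ι)
    fun i => isoOfUnitary (φ (X.X i)) (h1 _)).hom, fun X => isUnitary_reindex H _ _ (fun i => h1 _),
    fun {X Y} f => ?_, fun X => ?_⟩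
  · ext i j
    refine (comp_reindex_hom (X := Y) (Y := dual (dual Y)) (Equiv.refl Y.ι) _ f i j).trans
      (Eq.trans ?_ (reindex_hom_comp (X := X) (Y := dual (dual X)) _ _ _ i j).symm)
    exact h2 _
  · ext ⟨⟩ ⟨a, b⟩
    refine (comp_whiskerRight_reindex (X := X) (Y := dual (dual X)) (Z := 𝟙_ (Mat_ C)) (dual X)
      (Equiv.refl X.ι) (fun i => isoOfUnitary (φ (X.X i)) (h1 _)) _ a b ()).trans ?_
    by_cases hab : a = b
    · subst hab
      refine (congrArg (· ≫ _) (coev_apply (X := X) a)).trans (Eq.trans ?_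
        (adj_ev_apply (X := dual X) H a).symm)
      exact h3 (X.X a)
    · refine (congrArg (· ≫ _) (coev_apply_ne (X := X) hab)).trans (Eq.trans zero_comp
        (adj_ev_apply_ne (X := dual X) H hab).symm)

end MatSum

open MatSum in
/-- The finite direct sums over a rigid `*`-category form a rigid C*-tensor category. -/
theorem IsRigidStarCategory.isRigidCStarTensorCategory {C : Type*} [Category C] [Preadditive C]
    [Linear ℂ C] [MonoidalCategory C] [DualStarStruct C] (H : IsRigidStarCategory C) :
    IsRigidCStarTensorCategory (Mat_ C) :=
  have := H.monoidalPreadditive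
  have hM := H.mat_isStarCategory
  { monoidal := ⟨inferInstance, rfl⟩
    abelian := hM.abelian H.mat_split
    finiteDimensional := hM.finiteDimensional
    add_tensor := fun f f' g => by ext i j; exact H.add_tensor _ _ _
    tensor_add := fun f g g' => by ext i j; exact H.tensor_add _ _ _
    smul_tensor := fun z f g => by ext i j; exact H.smul_tensor _ _ _
    tensor_smul := fun z f g => by ext i j; exact H.tensor_smul _ _ _
    end_unit := fun f => by
      obtain ⟨z, hz, hu⟩ := H.end_unit (f () ())
      have h1 : (𝟙 (𝟙_ (Mat_ C)) : 𝟙_ (Mat_ C) ⟶ 𝟙_ (Mat_ C)) () () = 𝟙 (𝟙_ C) :=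
        Mat_.id_apply_self _ _
      refine ⟨z, ?_, fun w hw => hu w ?_⟩
      · ext ⟨⟩ ⟨⟩
        exact hz.trans (congrArg (z • ·) h1.symm)
      · exact (congrFun (congrFun hw ()) ()).trans (congrArg (w • ·) h1)
    semisimple := H.mat_semisimple
    adj_add := hM.adj_add
    adj_smul := hM.adj_smul
    adj_adj := hM.adj_adj
    adj_id := hM.adj_id
    adj_comp := hM.adj_comp
    positive := hM.positive
    adj_tensor := fun f g => by ext i j; exact H.adj_tensor _ _
    associator_unitary := fun X Y Z => isUnitary_reindex (X := (X ⊗ Y) ⊗ Z) (Y := X ⊗ Y ⊗ Z) H _ _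
      fun i => H.associator_unitary _ _ _
    leftUnitor_unitary := fun X => isUnitary_reindex (X := 𝟙_ (Mat_ C) ⊗ X) (Y := X) H _ _
      fun i => H.leftUnitor_unitary _
    rightUnitor_unitary := fun X => isUnitary_reindex (X := X ⊗ 𝟙_ (Mat_ C)) (Y := X) H _ _
      fun i => H.rightUnitor_unitary _
    zigzag := fun X => zigzag_apply X H.zigzag
    zagzig := fun X => zagzig_apply X H.zagzig
    dualHom_eq := fun f => dualHom_eq_apply f H.dualHom_eq
    dualHom_eq_left := fun f => dualHom_eq_left_apply H f H.dualHom_eq_left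
    adj_dualHom := fun f => by ext i j; exact H.adj_dualHom _
    dual_tensor := dual_tensor_apply H
    double_dual := double_dual_apply H
    spherical := fun f => spherical_apply H f H.spherical }

theorem Pro.isRigidCStarTensorCategory {L : Type u} (P : FactorPlanarAlgebra.{u, v} L) :
    IsRigidCStarTensorCategory (Pro P) :=
  (Projection.isRigidStarCategory P).isRigidCStarTensorCategory

theorem Bim.isRigidCStarTensorCategory {L : Type u} (P : FactorPlanarAlgebra.{u, v} L) :
    IsRigidCStarTensorCategory (Bim P) :=
  (ProjectionBimodule.isRigidStarCategory P).isRigidCStarTensorCategory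
end

/-! ### The functor from `Pro` to `Bim` -/

noncomputable section

open CategoryTheory MonoidalCategory Limits DualStarStruct

section

variable {L : Type u} (P : FactorPlanarAlgebra.{u, v} L)

namespace proToBim

instance : (proToBim P).Faithful where
  map_injective {X Y} f g h := by
    ext i j
    exact congrFun (congrFun h i) j

instance : (proToBim P).Full where
  map_surjective f := ⟨fun i j => f i j, rfl⟩

/-- Each summand of an object of `Bim` carries its projection and is determined by it, so the object
even equals the image of the family of its projections. -/
instance : (proToBim P).EssSurj where
  mem_essImage X := ⟨⟨X.ι, fun i => (X.X i).proj⟩, ⟨eqToIso (by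
    obtain ⟨ι, X⟩ := X
    exact congrArg (Mat_.mk ι) (funext fun i => ProjectionBimodule.ext_proj rfl))⟩⟩

variable {P}

theorem map_ev (X : Pro P) : (proToBim P).map (ev X) = ev ((proToBim P).obj X) := by
  ext ⟨a, b⟩ ⟨⟩
  change (ev X : dual X ⊗ X ⟶ 𝟙_ (Pro P)) (a, b) () = _
  by_cases h : a = b
  · subst h
    exact (MatSum.ev_apply (X := X) a).trans (MatSum.ev_apply (X := (proToBim P).obj X) a).symm
  · exact (MatSum.ev_apply_ne (X := X) h).trans (MatSum.ev_apply_ne (X := (proToBim P).obj X) h).symm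

theorem map_coev (X : Pro P) : (proToBim P).map (coev X) = coev ((proToBim P).obj X) := by
  ext ⟨⟩ ⟨a, b⟩
  change (coev X : 𝟙_ (Pro P) ⟶ X ⊗ dual X) () (a, b) = _
  by_cases h : a = b
  · subst h
    exact (MatSum.coev_apply (X := X) a).trans (MatSum.coev_apply (X := (proToBim P).obj X) a).symm
  · exact (MatSum.coev_apply_ne (X := X) h).trans
      (MatSum.coev_apply_ne (X := (proToBim P).obj X) h).symm

/-- Since the functor leaves matrix entries untouched, it respects permutation matrices; associators
and unitors are the instances needed. -/
theorem map_reindex {X Y : Pro P} (e : X.ι ≃ Y.ι) (f : ∀ i, X.X i ≅ Y.X (e i)) :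
    (proToBim P).map (MatSum.reindex e f).hom =
      (MatSum.reindex (X := (proToBim P).obj X) (Y := (proToBim P).obj Y) e
        fun i => (projectionToBimodule P).mapIso (f i)).hom :=
  MatSum.hom_eq_reindex (X := (proToBim P).obj X) (Y := (proToBim P).obj Y) e _ _
    (fun i => MatSum.reindex_hom_apply e f i) fun _ _ h => MatSum.reindex_hom_apply_ne e f h

theorem map_associator (X Y Z : Pro P) : (proToBim P).map (α_ X Y Z).hom =
    (α_ ((proToBim P).obj X) ((proToBim P).obj Y) ((proToBim P).obj Z)).hom := by
  refine (map_reindex (X := (X ⊗ Y) ⊗ Z) (Y := X ⊗ Y ⊗ Z) _ _).trans (congrArg (fun f =>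
    (MatSum.reindex (X := (proToBim P).obj ((X ⊗ Y) ⊗ Z)) (Y := (proToBim P).obj (X ⊗ Y ⊗ Z))
      (Equiv.prodAssoc X.ι Y.ι Z.ι) f).hom) (funext fun i => Iso.ext ?_))
  exact (ProjectionBimodule.associator_hom P (.of (X.X i.1.1)) (.of (Y.X i.1.2)) (.of (Z.X i.2))).symm

theorem map_leftUnitor (X : Pro P) : (proToBim P).map (λ_ X).hom =
    (λ_ ((proToBim P).obj X)).hom := by
  refine (map_reindex (X := 𝟙_ _ ⊗ X) (Y := X) _ _).trans (congrArg (fun f =>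
    (MatSum.reindex (X := (proToBim P).obj (𝟙_ _ ⊗ X)) (Y := (proToBim P).obj X)
      (Equiv.punitProd X.ι) f).hom) (funext fun i => Iso.ext ?_))
  exact (ProjectionBimodule.leftUnitor_hom P (.of (X.X i.2))).symm

theorem map_rightUnitor (X : Pro P) : (proToBim P).map (ρ_ X).hom =
    (ρ_ ((proToBim P).obj X)).hom := by
  refine (map_reindex (X := X ⊗ 𝟙_ _) (Y := X) _ _).trans (congrArg (fun f =>
    (MatSum.reindex (X := (proToBim P).obj (X ⊗ 𝟙_ _)) (Y := (proToBim P).obj X)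
      (Equiv.prodPUnit X.ι) f).hom) (funext fun i => Iso.ext ?_))
  exact (ProjectionBimodule.rightUnitor_hom P (.of (X.X i.1))).symm

end proToBim

variable {P}

theorem isUnitary_id {C : Type*} [Category C] [Preadditive C] [Linear ℂ C] [MonoidalCategory C]
    [DualStarStruct C] (H : IsRigidCStarTensorCategory C) (X : C) : IsUnitary (𝟙 X) := by
  simp [IsUnitary, H.adj_id]

open proToBim in
/-- The functor `p ↦ H_p` is an equivalence of rigid C*-tensor categories. -/
theorem isRigidCStarTensorEquivalence_proToBim (P : FactorPlanarAlgebra.{u, v} L) :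
    IsRigidCStarTensorEquivalence (proToBim P) := by
  have := (ProjectionBimodule.isRigidStarCategory P).monoidalPreadditive
  have H := Bim.isRigidCStarTensorCategory P
  have k1 {A B Z : Bim P} (g : A ⊗ B ⟶ Z) : 𝟙 A ▷ B ≫ 𝟙 (A ⊗ B) ≫ g = g := by simp
  have k2 {A B Z : Bim P} (g : A ⊗ B ⟶ Z) : A ◁ 𝟙 B ≫ 𝟙 (A ⊗ B) ≫ g = g := by simp
  have k3 {A B Z : Bim P} (g : A ⊗ B ⟶ Z) : 𝟙 A ▷ B ≫ g ≫ 𝟙 Z = g := by simp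
  -- The functor is strict: all comparison isomorphisms are identities, and the remaining work is to
  -- cancel them.
  refine ⟨{}, fun f g => rfl, fun z f => rfl, fun f => rfl, Iso.refl (𝟙_ (Bim P)),
    fun X Y => Iso.refl ((proToBim P).obj X ⊗ (proToBim P).obj Y),
    fun X => Iso.refl (dual ((proToBim P).obj X)), isUnitary_id H _, fun _ _ => isUnitary_id H _,
    fun _ => isUnitary_id H _, fun f g => ?_, fun X Y Z => ?_, fun X => ?_, fun X => ?_,
    fun f => ?_, fun X => ?_, fun X => ?_⟩
  · exact (Category.comp_id _).trans (Category.id_comp _).symm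
  · refine ((congrArg (fun h => h ≫ _) (id_whiskerRight _ _)).trans ((Category.id_comp _).trans
      ((Category.id_comp _).trans ?_)))
    refine (map_associator X Y Z).trans (Eq.trans ?_ (congrArg (fun h => _ ≫ h ≫ _)
      (whiskerLeft_id _ _)).symm)
    exact ((congrArg _ (Category.id_comp _)).trans (Category.comp_id _)).symm
  · exact (map_leftUnitor X).symm.trans (k1 (A := 𝟙_ (Bim P)) (B := (proToBim P).obj X)
      (Z := (proToBim P).obj X) ((proToBim P).map (λ_ X).hom)).symm
  · exact (map_rightUnitor X).symm.trans (k2 (A := (proToBim P).obj X) (B := 𝟙_ (Bim P))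
      (Z := (proToBim P).obj X) ((proToBim P).map (ρ_ X).hom)).symm
  · exact (Category.comp_id _).trans (Category.id_comp _).symm
  · exact (Category.id_comp _).trans ((map_ev X).trans (k3 (Z := 𝟙_ (Bim P)) _).symm)
  · refine (Category.id_comp _).trans ((map_coev X).trans (Eq.trans ?_ (congrArg (fun h => _ ≫ h ≫ _)
      (whiskerLeft_id _ _)).symm))
    exact ((congrArg _ (Category.id_comp _)).trans (Category.comp_id _)).symm

end
end

/-! ### Inserting one rectangle into another -/

noncomputable section

namespace PlanarAlgebra

open PlanarAlg

variable {L : Type u} {P : PlanarAlgebra.{u, v} L} {a b c d e g : Word L}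

/-- The product of `x` and `y`: the strings `w` of `y` are joined to the strings `w.reverse` of `x`. -/
def ins (x : P.V a) (y : P.V b) (s w m t : Word L) (ha : a = s ++ w.reverse ++ t) (hb : b = w ++ m)
    (hc : c = s ++ m ++ t) : P.V c :=
  P.Z (Tangle.insert x y s w.reverse m t ha (by rw [hb, List.reverse_reverse]) hc)

theorem ins_heq {c' : Word L} (x : P.V a) (y : P.V b) (s w m t : Word L)
    (ha : a = s ++ w.reverse ++ t) (hb : b = w ++ m) (hc : c = s ++ m ++ t) (hc' : c' = s ++ m ++ t) :
    ins x y s w m t ha hb hc ≍ ins x y s w m t ha hb hc' := by subst hc hc'; rfl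

theorem Z_insert_congr {x : P.V a} {y : P.V b} {s k m t : Word L} {s' k' m' t' : Word L}
    {a' b' : Word L} {x' : P.V a'} {y' : P.V b'} (hx : x ≍ x') (hy : y ≍ y') (ea : a = a') (eb : b = b')
    (hs : s = s') (hk : k = k') (hm : m = m') (ht : t = t') {ha hb hc ha' hb' hc'} :
    P.Z (Tangle.insert (c := c) x y s k m t ha hb hc) =
      P.Z (Tangle.insert x' y' s' k' m' t' ha' hb' hc') := by
  subst ea eb hs hk hm ht
  obtain rfl := eq_of_heq hx
  obtain rfl := eq_of_heq hy
  rfl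

theorem ins_eqv (x : P.V a) (y : P.V b) (s w m t : Word L) (ha : a = s ++ w.reverse ++ t)
    (hb : b = w ++ m) (hc : c = s ++ m ++ t) :
    Eqv P c [] [⟨[], .box c (ins x y s w m t ha hb hc), []⟩]
      (caps s w.reverse (m ++ t) ++ [⟨s ++ w.reverse, .box b y, t⟩, ⟨[], .box a x, []⟩]) :=
  Eqv.box_Z _

theorem eq_of_eqv {x y : P.V c} (h : Eqv P c [] [⟨[], .box c x, []⟩] [⟨[], .box c y, []⟩]) : x = y := by
  rw [← P.Z_single x, ← P.Z_single y]
  exact Eqv.Z_eq h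

/-- Placing a diagram in a box. -/
theorem ins_eqv_right (x : P.V a) (y : P.V b) (s w m t : Word L) (ha : a = s ++ w.reverse ++ t)
    (hb : b = w ++ m) (hc : c = s ++ m ++ t) {D : List (Layer P.V)}
    (hy : Eqv P b [] [⟨[], .box b y, []⟩] D) :
    Eqv P c [] [⟨[], .box c (ins x y s w m t ha hb hc), []⟩]
      (caps s w.reverse (m ++ t) ++ D.map (Layer.whisker (s ++ w.reverse) t) ++
        [⟨[], .box a x, []⟩]) := by
  have h := ins_eqv x y s w m t ha hb hc
  refine h.trans (Eqv.part (caps s w.reverse (m ++ t)) [⟨[], .box a x, []⟩] (s ++ w.reverse) t hy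
    h.right ?_ (by simp) rfl)
  exact rd_caps _ _ _ (by simp [hb]) (by simp [hc])

theorem ins_eqv_left (x : P.V a) (y : P.V b) (s w m t : Word L) (ha : a = s ++ w.reverse ++ t)
    (hb : b = w ++ m) (hc : c = s ++ m ++ t) {D : List (Layer P.V)}
    (hx : Eqv P a [] [⟨[], .box a x, []⟩] D) :
    Eqv P c [] [⟨[], .box c (ins x y s w m t ha hb hc), []⟩]
      (caps s w.reverse (m ++ t) ++ [⟨s ++ w.reverse, .box b y, t⟩] ++ D) := by
  have h := ins_eqv x y s w m t ha hb hc
  refine h.trans (Eqv.part (caps s w.reverse (m ++ t) ++ [⟨s ++ w.reverse, .box b y, t⟩]) [] [] [] hx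
    h.right ?_ (by simp) (by simp))
  exact (rd_caps (y := s ++ w.reverse ++ b ++ t) _ _ _ (by simp [hb]) (by simp [hc])).append
    (reads_box _ rfl (by simp [ha]))

/-- Here `z` is joined only to strings of `y`. The caps between `x` and `y` and the diagram of `z`
occupy different positions and slide past each other. -/
theorem ins_assoc (x : P.V a) (y : P.V b) (z : P.V c) {s w m v n t₁ t₂ : Word L}
    (ha : a = s ++ w.reverse ++ t₁) (hb : b = w ++ (m ++ v.reverse ++ t₂)) (hc : c = v ++ n)
    (hd : d = s ++ (m ++ v.reverse ++ t₂) ++ t₁) (hd' : d = s ++ m ++ v.reverse ++ (t₂ ++ t₁))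
    (he : e = w ++ m ++ n ++ t₂) (he' : e = w ++ (m ++ n ++ t₂)) (hb' : b = w ++ m ++ v.reverse ++ t₂)
    (hg : g = s ++ m ++ n ++ (t₂ ++ t₁)) (hg' : g = s ++ (m ++ n ++ t₂) ++ t₁) :
    ins (ins x y s w _ t₁ ha hb hd) z (s ++ m) v n (t₂ ++ t₁) hd' hc hg =
      ins x (ins y z (w ++ m) v n t₂ hb' hc he) s w _ t₁ ha he' hg' := by
  refine eq_of_eqv ((ins_eqv_left _ z _ _ _ _ hd' hc hg (ins_eqv x y s w _ t₁ ha hb hd)).trans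
    (Eqv.trans ?_ (ins_eqv_right x _ _ _ _ _ ha he' hg' (ins_eqv y z _ _ _ _ hb' hc he)).symm))
  have hZ : Reads (caps (V := P.V) [] v.reverse n ++ [⟨v.reverse, .box c z, []⟩]) n v.reverse :=
    (rd_caps (P := P) [] v.reverse n (y := v.reverse ++ c) (by simp [hc]) rfl).append
      (reads_box _ (by simp) (by simp))
  have h := ((Eqv.slide (P := P) s m (t₂ ++ t₁) (D := caps [] w.reverse []) (a := [])
    (rd_caps [] w.reverse [] (y := w.reverse ++ w) (by simp) rfl) hZ).symm).append_right
    (F := [⟨s ++ w.reverse, .box b y, t₁⟩, ⟨[], .box a x, []⟩]) (c := [])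
    ⟨by simp [Event.top, hb], by simp [Event.top, Event.bot, ha, Reads]⟩
  subst hg
  simpa [caps_append, Layer.whisker] using h

/-- Here `z` is joined to the strings `v.reverse` of `y` and, beyond them, to the strings
`l.reverse` of `x`. In the other bracketing the strings `l` simply enlarge the contraction with `x`.
-/
theorem ins_assoc' (x : P.V a) (y : P.V b) (z : P.V c) {s l w v n t₁ t₂ : Word L}
    (ha : a = s ++ l.reverse ++ w.reverse ++ t₁) (hb : b = w ++ (v.reverse ++ t₂))
    (hc : c = v ++ l ++ n) (hd : d = s ++ l.reverse ++ (v.reverse ++ t₂) ++ t₁)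
    (hd' : d = s ++ (v ++ l).reverse ++ (t₂ ++ t₁)) (hb' : b = w ++ v.reverse ++ t₂)
    (hc' : c = v ++ (l ++ n)) (he : e = w ++ (l ++ n) ++ t₂) (ha' : a = s ++ (w ++ l).reverse ++ t₁)
    (he' : e = w ++ l ++ (n ++ t₂)) (hg : g = s ++ n ++ (t₂ ++ t₁)) (hg' : g = s ++ (n ++ t₂) ++ t₁) :
    ins (ins x y (s ++ l.reverse) w _ t₁ ha hb hd) z s (v ++ l) n (t₂ ++ t₁) hd' hc hg =
      ins x (ins y z w v (l ++ n) t₂ hb' hc' he) s (w ++ l) _ t₁ ha' he' hg' := by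
  refine eq_of_eqv ((ins_eqv_left _ z _ _ _ _ hd' hc hg (ins_eqv x y _ w _ t₁ ha hb hd)).trans
    (Eqv.trans ?_ (ins_eqv_right x _ _ _ _ _ ha' he' hg' (ins_eqv y z _ _ _ _ hb' hc' he)).symm))
  have hZ : Reads (caps (V := P.V) [] v.reverse (l ++ n) ++ [⟨v.reverse, .box c z, []⟩]) (l ++ n)
      v.reverse :=
    (rd_caps (P := P) [] v.reverse (l ++ n) (y := v.reverse ++ c) (by simp [hc]) rfl).append
      (reads_box _ (by simp) (by simp))
  have h := (((Eqv.slide (P := P) (s ++ l.reverse) [] (t₂ ++ t₁) (D := caps [] w.reverse []) (a := [])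
    (rd_caps [] w.reverse [] (y := w.reverse ++ w) (by simp) rfl) hZ).symm).append_right
    (F := [⟨s ++ l.reverse ++ w.reverse, .box b y, t₁⟩, ⟨[], .box a x, []⟩]) (c := [])
    ⟨by simp [Event.top, hb], by simp [Event.top, Event.bot, ha, Reads]⟩).append_left
    (F := caps s l.reverse (n ++ (t₂ ++ t₁))) (a := g)
    (rd_caps _ _ _ (by simp) (by simp [hg]))
  subst hg
  simpa [caps_append, Layer.whisker] using h

/-- The rectangles `y` and `z` are attached to parts of `x` separated by the strings `t`, so they
can exchange heights. -/
theorem ins_comm (x : P.V a) (y : P.V b) (z : P.V c) {s w m t v n t' : Word L}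
    (ha : a = s ++ w.reverse ++ (t ++ v.reverse ++ t')) (hb : b = w ++ m) (hc : c = v ++ n)
    (hd : d = s ++ m ++ (t ++ v.reverse ++ t')) (hd' : d = s ++ m ++ t ++ v.reverse ++ t')
    (ha' : a = s ++ w.reverse ++ t ++ v.reverse ++ t') (he : e = s ++ w.reverse ++ t ++ n ++ t')
    (he' : e = s ++ w.reverse ++ (t ++ n ++ t')) (hg : g = s ++ m ++ t ++ n ++ t')
    (hg' : g = s ++ m ++ (t ++ n ++ t')) :
    ins (ins x y s w m _ ha hb hd) z (s ++ m ++ t) v n t' hd' hc hg =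
      ins (ins x z (s ++ w.reverse ++ t) v n t' ha' hc he) y s w m _ he' hb hg' := by
  refine eq_of_eqv ((ins_eqv_left _ z _ _ _ _ hd' hc hg (ins_eqv x y s w m _ ha hb hd)).trans
    (Eqv.trans ?_ (ins_eqv_left _ y _ _ _ _ he' hb hg' (ins_eqv x z _ _ _ _ ha' hc he)).symm))
  have hY : Reads (caps (V := P.V) [] w.reverse m ++ [⟨w.reverse, .box b y, []⟩]) m w.reverse :=
    (rd_caps (P := P) [] w.reverse m (y := w.reverse ++ b) (by simp [hb]) rfl).append
      (reads_box _ (by simp) (by simp))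
  have hZ : Reads (caps (V := P.V) [] v.reverse n ++ [⟨v.reverse, .box c z, []⟩]) n v.reverse :=
    (rd_caps (P := P) [] v.reverse n (y := v.reverse ++ c) (by simp [hc]) rfl).append
      (reads_box _ (by simp) (by simp))
  have h := ((Eqv.slide (P := P) s t t' hY hZ).symm).append_right
    (F := [⟨[], .box a x, []⟩]) (c := []) (reads_box _ (by simp [ha]) (by simp))
  subst hg
  simpa [Layer.whisker] using h

end PlanarAlgebra
end

/-! ### Properties of the trace and uniform bounds for composition -/

noncomputable section

namespace FactorPlanarAlgebra

open PlanarAlg PlanarAlgebra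

variable {L : Type u} {P : FactorPlanarAlgebra.{u, v} L} {a b c d : Word L}

/-- Sliding the box along the closing strings turns the right closure of `rotate x` into the left
closure of `x`, which sphericality compares with the right one. -/
theorem tr_rotate (x : P.Mor a a) : tr (rotate x) = tr x := by
  refine congrArg scalar (Eqv.Z_eq ((closeRight_eqv (rotate x)).trans
    (Eqv.trans ?_ ((sphere x).symm.trans (closeRight_eqv x).symm))))
  have h := (rotate_cup (P := P.toPlanarAlgebra) x).append_left (F := caps [] a.reverse []) (a := [])
    (rd_caps _ _ _ (by simp) rfl)
  simpa using h

/-- The box `x` travels along the closing strings, making a half turn over the caps and undoing it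
under the cups, and arrives below `y`. -/
theorem tr_comp_comm (x : P.Mor a b) (y : P.Mor b a) : tr (comp x y) = tr (comp y x) := by
  refine congrArg scalar (Eqv.Z_eq ((closeRight_eqv (comp x y)).trans
    (Eqv.trans ?_ (closeRight_eqv (comp y x)).symm)))
  have hx := reads_dg (P := P.toPlanarAlgebra) x
  have hy := reads_dg (P := P.toPlanarAlgebra) y
  have hr := reads_dg (P := P.toPlanarAlgebra) (rotate x)
  have k {a b : Word L} (x : P.Mor a b) (y : P.Mor b a) : Eqv P.toPlanarAlgebra [] []
      (caps [] a [] ++ (dg (comp x y)).map (Layer.whisker [] a.reverse) ++ cups [] a [])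
      (caps [] a [] ++ (dg x).map (Layer.whisker [] a.reverse) ++
        (dg y).map (Layer.whisker [] a.reverse) ++ cups [] a []) := by
    have h := (((dg_comp (P := P.toPlanarAlgebra) x y).whisker [] a.reverse).append_left
      (F := caps [] a []) (a := []) (rd_caps _ _ _ (by simp) rfl)).append_right (F := cups [] a [])
      (c := []) (rd_cups _ _ _ (by simp) rfl)
    simpa using h
  refine (k x y).trans (Eqv.trans ?_ (k y x).symm)
  have h1 := (rotate_cap (P := P.toPlanarAlgebra) x).append_right
    (F := (dg y).map (Layer.whisker [] a.reverse) ++ cups [] a []) (c := [])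
    ((rd_wh _ _ hy rfl rfl).append (rd_cups _ _ _ (by simp) rfl))
  have h2 := ((Eqv.interchange (P := P.toPlanarAlgebra) hy hr).symm.append_left (F := caps [] b []) (a := [])
    (rd_caps (y := b ++ b.reverse) _ _ _ (by simp) rfl)).append_right (F := cups [] a []) (c := [])
    (rd_cups _ _ _ (by simp) rfl)
  have h3 := (rotate_cup' (P := P.toPlanarAlgebra) x).append_left
    (F := caps [] b [] ++ (dg y).map (Layer.whisker [] b.reverse)) (a := [])
    ((rd_caps (y := b ++ b.reverse) _ _ _ (by simp) rfl).append (rd_wh _ _ hy (by simp) rfl))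
  exact (by simpa using h1 : Eqv _ _ _ _ _).trans ((by simpa using h2 : Eqv _ _ _ _ _).trans
    (by simpa using h3))

theorem innerV_comp_left (x : P.Mor a b) (y : P.Mor b c) (z : P.Mor a c) :
    innerV (comp x y) z = innerV y (comp (adj x) z) := by
  rw [innerV_eq_tr, innerV_eq_tr, adj_comp, ← comp_assoc, tr_comp_comm, comp_assoc]

theorem innerV_comp_right (x : P.Mor a b) (y : P.Mor b c) (z : P.Mor a c) :
    innerV (comp x y) z = innerV x (comp z (adj y)) := by
  rw [innerV_eq_tr, innerV_eq_tr, adj_comp, ← comp_assoc]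

theorem innerV_adj (x y : P.Mor a b) : innerV (adj x) (adj y) = innerV y x := by
  rw [innerV_eq_tr, innerV_eq_tr, adj_adj, tr_comp_comm]

theorem innerV_rotate (x y : P.Mor a b) : innerV (rotate x) (rotate y) = innerV x y := by
  rw [innerV_eq_tr, innerV_eq_tr, ← rotate_adj, ← rotate_comp, tr_rotate, tr_comp_comm]

theorem inner_eq (x y : P.V a) : inner ℂ x y = innerV x y := rfl

theorem norm_adj (x : P.Mor a b) : ‖adj x‖ = ‖x‖ := by
  rw [@norm_eq_sqrt_re_inner ℂ, @norm_eq_sqrt_re_inner ℂ, inner_eq, inner_eq, innerV_adj]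

theorem norm_castV (h : a = b) (x : P.V a) : ‖P.castV h x‖ = ‖x‖ := by subst h; rfl

theorem innerV_castV (h : a = b) (x y : P.V a) : innerV (P.castV h x) (P.castV h y) = innerV x y := by
  subst h; rfl

theorem innerV_st (x y : P.V a) : innerV (P.st x) (P.st y) = innerV y x := by
  have k : ∀ {b : Word L} (h : b = a ++ ([] : Word L).reverse) (x y : P.V b),
      innerV (P.st x) (P.st y) = innerV y x := by
    rintro b rfl x y
    refine Eq.trans ?_ (innerV_adj (P := P) (b := []) x y)
    exact (innerV_castV _ _ _).symm
  exact k (by simp) x y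

end FactorPlanarAlgebra

/-- A self-adjoint operator annihilated by a polynomial is bounded by the roots of the polynomial. -/
theorem norm_le_of_aeval_eq_zero {E : Type*} [NormedAddCommGroup E] [InnerProductSpace ℂ E]
    [CompleteSpace E] {T : E →L[ℂ] E} (hT : IsSelfAdjoint T) {p : Polynomial ℂ} (hp : p ≠ 0)
    (h : Polynomial.aeval T p = 0) {r : ℝ} (hr : 0 ≤ r) (hroots : ∀ z ∈ p.roots, ‖z‖ ≤ r) : ‖T‖ ≤ r := by
  cases subsingleton_or_nontrivial E with
  | inl _ => rw [Subsingleton.elim T 0, norm_zero]; exact hr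
  | inr _ =>
    -- Spectral mapping confines the spectrum to the roots of `p`, and for a self-adjoint operator
    -- the spectral radius is the norm.
    have h1 : spectralRadius ℂ T ≤ ENNReal.ofReal r := by
      refine iSup₂_le fun z hz => ?_
      have h2 := spectrum.subset_polynomial_aeval T p ⟨z, hz, rfl⟩
      rw [h, spectrum.zero_eq, Set.mem_singleton_iff] at h2
      rw [← enorm_eq_nnnorm, ← ofReal_norm]
      exact ENNReal.ofReal_le_ofReal (hroots z ((Polynomial.mem_roots hp).2 h2))
    rw [hT.spectralRadius_eq_nnnorm, ← enorm_eq_nnnorm, ← ofReal_norm] at h1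
    exact (ENNReal.ofReal_le_ofReal_iff hr).1 h1


namespace FactorPlanarAlgebra

open PlanarAlg PlanarAlgebra

variable {L : Type u} {P : FactorPlanarAlgebra.{u, v} L} {a b c d : Word L}

/-- Vertical composition with a fixed element. -/
def compL (x : P.Mor a b) (c : Word L) : P.Mor b c →L[ℂ] P.Mor a c :=
  LinearMap.toContinuousLinearMap
    { toFun := fun y => comp x y
      map_add' := comp_add x
      map_smul' := fun z y => comp_smul z x y }

@[simp]
theorem compL_apply (x : P.Mor a b) (y : P.Mor b c) : compL x c y = comp x y := rfl

/-- The powers of an endomorphism. -/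
def npow (x : P.Mor a a) : ℕ → P.Mor a a
  | 0 => P.one a
  | n + 1 => comp x (npow x n)

theorem compL_pow (x : P.Mor a a) (n : ℕ) (y : P.Mor a c) : (compL x c ^ n) y = comp (npow x n) y := by
  induction n with
  | zero => simp [npow, one_comp]
  | succ n ih => rw [pow_succ', mul_apply_eq_comp, ih, npow, compL_apply, comp_assoc]

theorem sum_comp {ι : Type*} (s : Finset ι) (x : ι → P.Mor a b) (y : P.Mor b c) :
    comp (∑ i ∈ s, x i) y = ∑ i ∈ s, comp (x i) y :=
  map_sum (AddMonoidHom.mk' (fun x : P.Mor a b => comp x y) fun x x' => add_comp x x' y) x s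

/-- The powers of `x` lie in the finite dimensional space `P_{a → a}` and so satisfy a polynomial
relation. It is a relation in the algebra, hence holds on every `P_{a → c}` simultaneously. -/
theorem exists_aeval_compL (x : P.Mor a a) :
    ∃ p : Polynomial ℂ, p ≠ 0 ∧ ∀ c, Polynomial.aeval (compL x c) p = 0 := by
  let f : Polynomial ℂ →ₗ[ℂ] P.Mor a a :=
    Polynomial.lsum fun n => LinearMap.toSpanSingleton ℂ _ (npow x n)
  have hf : ¬ Function.Injective f := fun h =>
    Polynomial.not_finite (R := ℂ) (Module.Finite.of_injective f h)
  rw [← LinearMap.ker_eq_bot, Submodule.eq_bot_iff] at hf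
  push Not at hf
  obtain ⟨p, hp, hp0⟩ := hf
  refine ⟨p, hp0, fun c => ?_⟩
  have hp' : ∑ n ∈ p.support, p.coeff n • npow x n = 0 := by simpa [f, Polynomial.sum_def] using hp
  ext1 y
  rw [Polynomial.aeval_eq_sum_range, sum_apply]
  simp only [smul_apply, compL_pow, ← smul_comp, ← sum_comp]
  have : ∑ i ∈ Finset.range (p.natDegree + 1), p.coeff i • npow x i =
      ∑ n ∈ p.support, p.coeff n • npow x n := by
    refine (Finset.sum_subset (fun n hn => ?_) fun n _ hn => ?_).symm
    · exact Finset.mem_range.2 (Nat.lt_succ_of_le (Polynomial.le_natDegree_of_mem_supp n hn))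
    · rw [Polynomial.notMem_support_iff.1 hn, zero_smul]
  rw [this, hp']
  simpa using smul_comp (0 : ℂ) (0 : P.Mor a a) y

theorem inner_compL (x : P.Mor a b) (y : P.Mor b c) (z : P.Mor a c) :
    inner ℂ (compL x c y) z = inner ℂ y (compL (adj x) c z) := innerV_comp_left x y z

/-- Composition with a fixed element is bounded, uniformly in the remaining strings. -/
theorem exists_norm_comp_le (x : P.Mor a b) :
    ∃ C : ℝ, 0 ≤ C ∧ ∀ (c : Word L) (y : P.Mor b c), ‖comp x y‖ ≤ C * ‖y‖ := by
  obtain ⟨p, hp, h⟩ := exists_aeval_compL (comp (adj x) x)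
  obtain ⟨r, hr⟩ : ∃ r : ℝ, 0 ≤ r ∧ ∀ z ∈ p.roots, ‖z‖ ≤ r := by
    refine ⟨∑ z ∈ p.roots.toFinset, ‖z‖, Finset.sum_nonneg fun _ _ => norm_nonneg _, fun z hz => ?_⟩
    exact Finset.single_le_sum (f := fun z => ‖z‖) (fun _ _ => norm_nonneg _)
      (Multiset.mem_toFinset.2 hz)
  -- The estimate is `‖x y‖² = ⟨y, x* x y⟩ ≤ r ‖y‖²`, where `r` bounds the roots of a polynomial
  -- annihilating `x* x`. As the polynomial does not depend on `c`, neither does the constant.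
  refine ⟨√r, Real.sqrt_nonneg _, fun c y => ?_⟩
  have hs : IsSelfAdjoint (compL (comp (adj x) x) c) := by
    rw [ContinuousLinearMap.isSelfAdjoint_iff_isSymmetric]
    intro y z
    refine (inner_compL _ y z).trans ?_
    rw [adj_comp, adj_adj]
    rfl
  have h1 := norm_le_of_aeval_eq_zero hs hp (h c) hr.1 hr.2
  have h2 : ‖comp x y‖ ^ 2 ≤ r * ‖y‖ ^ 2 := by
    have h3 : ‖comp x y‖ ^ 2 = RCLike.re (inner ℂ y (compL (comp (adj x) x) c y)) := by
      rw [← inner_self_eq_norm_sq (𝕜 := ℂ), compL_apply, comp_assoc]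
      exact congrArg _ (inner_compL x y (comp x y))
    rw [h3]
    refine (re_inner_le_norm _ _).trans ?_
    nlinarith [(compL (comp (adj x) x) c).le_of_opNorm_le h1 y, norm_nonneg y]
  rw [← abs_of_nonneg (norm_nonneg (comp x y)), ← abs_of_nonneg (norm_nonneg y)]
  rw [← Real.sqrt_sq_eq_abs, ← Real.sqrt_sq_eq_abs, ← Real.sqrt_mul hr.1]
  exact Real.sqrt_le_sqrt h2

theorem exists_norm_comp_le' (y : P.Mor b c) :
    ∃ C : ℝ, 0 ≤ C ∧ ∀ (a : Word L) (x : P.Mor a b), ‖comp x y‖ ≤ C * ‖x‖ := by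
  obtain ⟨C, h0, h⟩ := exists_norm_comp_le (adj y)
  refine ⟨C, h0, fun a x => ?_⟩
  rw [← norm_adj, adj_comp, ← norm_adj x]
  exact h _ _

end FactorPlanarAlgebra
end

/-! ### Insertions as vertical compositions -/

noncomputable section

namespace PlanarAlgebra

open PlanarAlg

variable {L : Type u} {P : PlanarAlgebra.{u, v} L} {a b c d e : Word L}

/-- With no strings to the right of the insertion the two tangles differ only in the heights of
their rectangles. -/
theorem Z_glue_eq_ins (x : P.V a) (y : P.V b) (s w m : Word L) (ha : a = s ++ w.reverse)
    (hb : b = w ++ m) (hc : c = s ++ m) :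
    P.Z (Tangle.glue x y s w m ha hb hc) =
      ins x y s w m [] (by simp [ha]) hb (by simp [hc]) := by
  refine Eqv.Z_eq ?_
  have h := (Eqv.slide (P := P) [] [] [] (D := [⟨[], .box a x, []⟩]) (E := [⟨[], .box b y, []⟩])
    (reads_box (a := a) (b := []) x (by simp) rfl)
    (reads_box (a := b) (b := []) y (by simp) rfl)).append_left
    (F := caps s w.reverse m) (a := c) (rd_caps _ _ _ (by simp [ha, hb]) (by simp [hc]))
  subst ha
  simpa [Tangle.glue, Tangle.insert] using h

/-- Moving the last strings `q` of `x` to the front. -/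
def turn (x : P.V a) (p q : Word L) (h : a = p ++ q) (h' : b = q ++ p) : P.V b :=
  P.Z ⟨caps (q ++ p) q [] ++ [⟨q, .box a x, q.reverse⟩] ++ cups [] q [], by
    refine ((rd_caps _ _ _ (y := q ++ a ++ q.reverse) ?_ ?_).append (reads_box _ rfl rfl)).append
      (rd_cups _ _ _ ?_ ?_) <;> simp [h, h']⟩

theorem turn_eqv (x : P.V a) (p q : Word L) (h : a = p ++ q) (h' : b = q ++ p) {D : List (Layer P.V)}
    (hx : Eqv P a [] [⟨[], .box a x, []⟩] D) : Eqv P b [] [⟨[], .box b (turn x p q h h'), []⟩]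
      (caps (q ++ p) q [] ++ D.map (Layer.whisker q q.reverse) ++ cups [] q []) := by
  refine (Eqv.box_Z _).trans (Eqv.part (caps (q ++ p) q []) (cups [] q []) q q.reverse hx
    (Tangle.reads _) ?_ (by simp) rfl)
  exact rd_caps _ _ _ (by simp [h]) (by simp [h'])

/-- The strings `t` can be carried to the front before or after inserting `y`, as they do not touch
it. Afterwards nothing stands to the right, and the insertion is a vertical composition. -/
theorem turn_ins (x : P.V a) (y : P.V b) (s w m t : Word L) (ha : a = s ++ w.reverse ++ t)
    (hb : b = w ++ m) (hc : c = s ++ m ++ t) (hd : d = t ++ (s ++ w.reverse))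
    (he : e = t ++ (s ++ m)) (hd' : d = t ++ s ++ w.reverse ++ []) (he' : e = t ++ s ++ m ++ []) :
    turn (ins x y s w m t ha hb hc) (s ++ m) t hc he =
      ins (turn x (s ++ w.reverse) t ha hd) y (t ++ s) w m [] hd' hb he' := by
  refine eq_of_eqv ((turn_eqv _ _ _ hc he (ins_eqv x y s w m t ha hb hc)).trans (Eqv.trans ?_
    (ins_eqv_left _ y _ _ _ _ hd' hb he' (turn_eqv x _ _ ha hd (Eqv.refl
      (reads_box _ (by simp) rfl)))).symm))
  have hY : Reads (caps (V := P.V) [] w.reverse m ++ [⟨w.reverse, .box b y, []⟩]) m w.reverse :=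
    (rd_caps (P := P) [] w.reverse m (y := w.reverse ++ b) (by simp [hb]) rfl).append
      (reads_box _ (by simp) (by simp))
  have h := ((Eqv.slide (P := P) (t ++ s) [] [] hY (E := caps [] t []) (c := [])
    (rd_caps _ _ _ rfl rfl)).symm).append_right
    (F := [⟨t, .box a x, t.reverse⟩] ++ cups [] t []) (c := [])
    ((reads_box (b := t ++ t.reverse) _ (by simp [ha]) (by simp)).append
      (rd_cups _ _ _ (by simp) (by simp)))
  subst he
  simpa [Layer.whisker] using h

theorem turn_eq_rotate (x : P.Mor a b) (h : a ++ b.reverse = a ++ b.reverse)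
    (h' : b.reverse ++ a.reverse.reverse = b.reverse ++ a) : turn x a b.reverse h h' = rotate x := by
  rw [turn, rotate, Tangle.rotate]
  refine Z_ext _ _ ?_
  simp

theorem comp_eq_ins (x : P.Mor a b) (y : P.Mor b c) :
    comp x y = ins x y a b c.reverse [] (by simp) rfl (by simp) := Z_glue_eq_ins _ _ _ _ _ _ _ _

end PlanarAlgebra

namespace FactorPlanarAlgebra

open PlanarAlg PlanarAlgebra

variable {L : Type u} {P : FactorPlanarAlgebra.{u, v} L} {a b c d : Word L}

/-- For a suitable splitting of the boundary word, moving the last strings to the front is a half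
turn, and half turns are isometric by `innerV_rotate`. -/
theorem innerV_turn (x y : P.V a) (p q : Word L) (h : a = p ++ q) (h' : b = q ++ p) :
    innerV (turn x p q h h') (turn y p q h h') = innerV x y := by
  obtain ⟨r, rfl⟩ : ∃ r : Word L, q = r.reverse := ⟨q.reverse, by simp⟩
  subst h
  obtain rfl : b = r.reverse ++ p.reverse.reverse := by simp [h']
  rw [turn_eq_rotate (P := P.toPlanarAlgebra) x, turn_eq_rotate (P := P.toPlanarAlgebra) y]
  exact innerV_rotate (P := P) (a := p) x y

theorem norm_eq_of_innerV {x : P.V a} {y : P.V b} (h : innerV x x = innerV y y) : ‖x‖ = ‖y‖ := by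
  rw [@norm_eq_sqrt_re_inner ℂ, @norm_eq_sqrt_re_inner ℂ, inner_eq, inner_eq, h]

theorem norm_turn (x : P.V a) (p q : Word L) (h : a = p ++ q) (h' : b = q ++ p) :
    ‖turn x p q h h'‖ = ‖x‖ := norm_eq_of_innerV (innerV_turn _ _ _ _ _ _)

theorem norm_ins (x : P.V a) (y : P.V b) (s w m t : Word L) (ha : a = s ++ w.reverse ++ t)
    (hb : b = w ++ m) (hc : c = s ++ m ++ t) (hd : d = t ++ (s ++ w.reverse)) :
    ‖ins x y s w m t ha hb hc‖ = ‖comp (P := P.toPlanarAlgebra) (α := t ++ s) (β := w) (γ := m.reverse)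
      (P.castV (by simp [hd]) (turn x (s ++ w.reverse) t ha hd)) (P.castV (by simp [hb]) y)‖ := by
  rw [← norm_turn (ins x y s w m t ha hb hc) (s ++ m) t hc rfl,
    turn_ins (P := P.toPlanarAlgebra) x y s w m t ha hb hc hd rfl (by simp [hd]) (by simp)]
  rw [comp_eq_ins]
  have k : ∀ {a a' b b' c c' m m' s : Word L} {x : P.V a} {y : P.V b} (h1 : a = a') (h2 : b = b')
      (h3 : m = m') (ha : a = s ++ w.reverse ++ []) (hb : b = w ++ m) (hc : c = s ++ m ++ [])
      (ha' : a' = s ++ w.reverse ++ []) (hb' : b' = w ++ m') (hc' : c' = s ++ m' ++ []),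
      ‖ins x y s w m [] ha hb hc‖ =
        ‖ins (P.castV h1 x) (P.castV h2 y) s w m' [] ha' hb' hc'‖ := by
    rintro a a' b b' c c' m m' s x y rfl rfl rfl ha hb rfl ha' hb' rfl
    rfl
  exact k _ _ (by simp) _ _ _ _ _ _

/-- By `norm_ins` this is the bound for composition with a fixed element, which is uniform in the
remaining strings `m`. -/
theorem exists_norm_ins_le (x : P.V a) (s w t : Word L) (ha : a = s ++ w.reverse ++ t) :
    ∃ C : ℝ, 0 ≤ C ∧ ∀ {b c : Word L} (y : P.V b) (m : Word L) (hb : b = w ++ m)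
      (hc : c = s ++ m ++ t), ‖ins x y s w m t ha hb hc‖ ≤ C * ‖y‖ := by
  obtain ⟨C, h0, h⟩ := exists_norm_comp_le (P := P) (a := t ++ s) (b := w)
    (P.castV (by simp) (turn x (s ++ w.reverse) t ha rfl))
  refine ⟨C, h0, fun y m hb hc => ?_⟩
  rw [norm_ins x y s w m t ha hb hc rfl, ← norm_castV (b := w ++ m.reverse.reverse) (by simp [hb]) y]
  exact h _ _

theorem exists_norm_ins_le' (y : P.V b) (w m : Word L) (hb : b = w ++ m) :
    ∃ C : ℝ, 0 ≤ C ∧ ∀ {a c : Word L} (x : P.V a) (s t : Word L) (ha : a = s ++ w.reverse ++ t)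
      (hc : c = s ++ m ++ t), ‖ins x y s w m t ha hb hc‖ ≤ C * ‖x‖ := by
  obtain ⟨C, h0, h⟩ := exists_norm_comp_le' (P := P) (b := w) (c := m.reverse)
    (P.castV (by simp [hb]) y)
  refine ⟨C, h0, fun x s t ha hc => ?_⟩
  rw [norm_ins x y s w m t ha hb hc rfl, ← norm_turn x (s ++ w.reverse) t ha rfl,
    ← norm_castV (b := t ++ s ++ w.reverse) (by simp) (turn x _ _ _ _)]
  exact h _ _

end FactorPlanarAlgebra
end

/-! ### Adjoints of insertions -/

noncomputable section

namespace FactorPlanarAlgebra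

open PlanarAlg PlanarAlgebra

variable {L : Type u} {P : FactorPlanarAlgebra.{u, v} L} {a b c d : Word L}

theorem ins_castV {a' b' c' : Word L} (h : a = a') (k : b = b') (l : c = c') (x : P.V a) (y : P.V b)
    (s w m t : Word L) (ha hb hc ha' hb' hc') :
    ins (P := P.toPlanarAlgebra) (P.castV h x) (P.castV k y) s w m t ha hb hc =
      P.castV l (ins x y s w m t ha' hb' hc') := by subst h k l; rfl

theorem innerV_ins_left (x : P.V a) (y : P.V b) (z : P.V c) (s w m : Word L)
    (ha : a = s ++ w.reverse ++ []) (hb : b = w ++ m) (hc : c = s ++ m ++ [])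
    (ha' : a.reverse = w ++ s.reverse ++ []) (hb' : b = w ++ m ++ []) (hc' : c = s ++ m) :
    innerV (ins x y s w m [] ha hb hc) z = innerV y (ins (P.st x) z w s m [] ha' hc' hb') := by
  obtain ⟨n, rfl⟩ : ∃ n : Word L, m = n.reverse := ⟨m.reverse, by simp⟩
  subst hb hc'
  obtain rfl : a = s ++ w.reverse := by simpa using ha
  refine (congrArg (innerV · z) (comp_eq_ins (P := P.toPlanarAlgebra) x y).symm).trans
    ((innerV_comp_left (P := P) x y z).trans (congrArg (innerV y) ?_))
  rw [comp_eq_ins]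
  exact ins_castV _ rfl rfl _ _ _ _ _ _ _ _ _ ha' rfl hb'

/-- Once the strings `t` are turned to the front, both insertions are compositions on the right, and
composition with `y` has composition with `y*` as its adjoint. -/
theorem innerV_ins_right (x : P.V a) (y : P.V b) (z : P.V c) (s w m t : Word L)
    (ha : a = s ++ w.reverse ++ t) (hb : b = w ++ m) (hc : c = s ++ m ++ t)
    (hb' : b.reverse = m.reverse ++ w.reverse) (hc' : c = s ++ m.reverse.reverse ++ t) :
    innerV (ins x y s w m t ha hb hc) z = innerV x (ins z (P.st y) s m.reverse w.reverse t hc' hb' ha) := by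
  obtain ⟨n, rfl⟩ : ∃ n : Word L, m = n.reverse := ⟨m.reverse, by simp⟩
  subst hb
  have e1 : t ++ (s ++ w.reverse) = t ++ s ++ w.reverse := by simp
  have e2 : t ++ (s ++ n.reverse) = t ++ s ++ n.reverse := by simp
  have h1 := turn_ins (P := P.toPlanarAlgebra) x y s w n.reverse t ha rfl hc e1.symm e2.symm
    (by simp) (by simp)
  have h2 := turn_ins (P := P.toPlanarAlgebra) z (adj (P := P) (α := w) (β := n) y) s n w.reverse
    t hc rfl ha (d := t ++ s ++ n.reverse) e2.symm e1.symm (by simp) (by simp)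
  have h3 : ins z (P.st y) s n.reverse.reverse w.reverse t hc' hb' ha =
      ins z (adj (P := P) (α := w) (β := n) y) s n w.reverse t hc rfl ha :=
    Z_insert_congr HEq.rfl (castV_heq (P := P.toPlanarAlgebra) _ _).symm rfl (by simp) rfl (by simp) rfl rfl
  rw [← innerV_turn _ z (s ++ n.reverse) t hc e2.symm, ← innerV_turn x _ (s ++ w.reverse) t ha e1.symm,
    h1, h3, h2]
  have k {a b c : Word L} (x : P.Mor a b) (y : P.Mor b c) (z : P.Mor a c) (h1 h2 h3 h4 h5 h6) :
      innerV (ins x y a b c.reverse [] h1 h2 h3) z = innerV x (ins z (adj y) a c b.reverse [] h4 h5 h6) := by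
    rw [← comp_eq_ins, ← comp_eq_ins]
    exact innerV_comp_right x y z
  exact k (a := t ++ s) _ _ _ _ _ _ _ _ _

end FactorPlanarAlgebra
end

/-! ### The terms of the graded product -/

noncomputable section

namespace PlanarAlgebra

open PlanarAlg

variable {L : Type u} {P : PlanarAlgebra.{u, v} L} {a b c : Word L}

theorem ins_add_left (x x' : P.V a) (y : P.V b) (s w m t : Word L) (ha : a = s ++ w.reverse ++ t)
    (hb : b = w ++ m) (hc : c = s ++ m ++ t) : ins (x + x') y s w m t ha hb hc =
      ins x y s w m t ha hb hc + ins x' y s w m t ha hb hc :=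
  P.map_add x x' _ _ _ (caps s w.reverse (m ++ t) ++ [⟨s ++ w.reverse, .box _ y, t⟩]) [] [] []
    (by simp [Tangle.insert]) (by simp [Tangle.insert]) (by simp [Tangle.insert])

theorem ins_smul_left (z : ℂ) (x : P.V a) (y : P.V b) (s w m t : Word L) (ha : a = s ++ w.reverse ++ t)
    (hb : b = w ++ m) (hc : c = s ++ m ++ t) : ins (z • x) y s w m t ha hb hc =
      z • ins x y s w m t ha hb hc :=
  P.map_smul z x _ _ (caps s w.reverse (m ++ t) ++ [⟨s ++ w.reverse, .box _ y, t⟩]) [] [] []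
    (by simp [Tangle.insert]) (by simp [Tangle.insert])

theorem ins_add_right (x : P.V a) (y y' : P.V b) (s w m t : Word L) (ha : a = s ++ w.reverse ++ t)
    (hb : b = w ++ m) (hc : c = s ++ m ++ t) : ins x (y + y') s w m t ha hb hc =
      ins x y s w m t ha hb hc + ins x y' s w m t ha hb hc :=
  P.map_add y y' _ _ _ (caps s w.reverse (m ++ t)) [⟨[], .box _ x, []⟩] (s ++ w.reverse) t
    (by simp [Tangle.insert]) (by simp [Tangle.insert]) (by simp [Tangle.insert])

theorem ins_smul_right (z : ℂ) (x : P.V a) (y : P.V b) (s w m t : Word L) (ha : a = s ++ w.reverse ++ t)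
    (hb : b = w ++ m) (hc : c = s ++ m ++ t) : ins x (z • y) s w m t ha hb hc =
      z • ins x y s w m t ha hb hc :=
  P.map_smul z y _ _ (caps s w.reverse (m ++ t)) [⟨[], .box _ x, []⟩] (s ++ w.reverse) t
    (by simp [Tangle.insert]) (by simp [Tangle.insert])

end PlanarAlgebra

namespace FactorPlanarAlgebra

open PlanarAlg PlanarAlgebra

variable {L : Type u} {P : FactorPlanarAlgebra.{u, v} L} {a b c ρ σ γ t₁ t₂ t₃ T : Word L}

theorem cancels_iff {k : ℕ} : Cancels k σ γ ↔
    ∃ s w r : Word L, w.length = k ∧ σ = s ++ w.reverse ∧ γ = w ++ r := by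
  constructor
  · rintro ⟨h1, h2⟩
    exact ⟨_, γ.take k, γ.drop k, by simpa using h1, h2, (List.take_append_drop _ _).symm⟩
  · rintro ⟨s, w, r, rfl, rfl, rfl⟩
    exact ⟨by simp, by simp⟩

theorem cancel_eq (s w r : Word L) : cancel w.length (s ++ w.reverse) (w ++ r) = s ++ r := by
  simp [cancel]

open Classical in
/-- The term of the product of `x` and `y` in which `k` strings are joined. -/
def mulAt (k : ℕ) (x : P.V a) (y : P.V b) (ha : a = σ ++ t₁) (hb : b = γ ++ t₂) (hT : T = t₂ ++ t₁) :
    P.V (cancel k σ γ ++ T) :=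
  if h : Cancels k σ γ then
    ins x y (σ.take (σ.length - k)) (γ.take k) (γ.drop k ++ t₂) t₁ (ha.trans (congrArg (· ++ t₁) h.2))
      (by rw [hb, ← List.append_assoc, List.take_append_drop]) (by simp [cancel, hT])
  else 0

theorem mulAt_of_not {k : ℕ} (h : ¬ Cancels k σ γ) (x : P.V a) (y : P.V b) (ha : a = σ ++ t₁)
    (hb : b = γ ++ t₂) (hT : T = t₂ ++ t₁) : mulAt k x y ha hb hT = 0 := dif_neg h

/-- The definition cuts words by `take` and `drop`; here these are replaced by any words witnessing
the cancellation. The degrees then agree only propositionally, whence the heterogeneous equality. -/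
theorem mulAt_heq {k : ℕ} {s w r m d : Word L} (hk : w.length = k) (hσ : σ = s ++ w.reverse)
    (hγ : γ = w ++ r) (hm : m = r ++ t₂) (x : P.V a) (y : P.V b) (ha : a = σ ++ t₁) (hb : b = γ ++ t₂)
    (hT : T = t₂ ++ t₁) (ha' : a = s ++ w.reverse ++ t₁) (hb' : b = w ++ m) (hd : d = s ++ m ++ t₁) :
    mulAt k x y ha hb hT ≍ ins x y s w m t₁ ha' hb' hd := by
  rw [mulAt, dif_pos (cancels_iff.2 ⟨s, w, r, hk, hσ, hγ⟩)]
  have k : ∀ {s' w' m' : Word L} {c c' : Word L} (_ : s' = s) (_ : w' = w) (_ : m' = m) {ha hb hc hc'}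
      {ha' hb'}, ins (P := P.toPlanarAlgebra) (c := c) x y s' w' m' t₁ ha hb hc ≍
        ins (P := P.toPlanarAlgebra) (c := c') x y s w m t₁ ha' hb' hc' := by
    rintro s' w' m' c c' rfl rfl rfl ha hb rfl rfl ha' hb'
    rfl
  subst hk hσ hγ hm
  exact k (by simp) (by simp) (by simp)

theorem mulAt_add_left (k : ℕ) (x x' : P.V a) (y : P.V b) (ha : a = σ ++ t₁) (hb : b = γ ++ t₂)
    (hT : T = t₂ ++ t₁) : mulAt k (x + x') y ha hb hT = mulAt k x y ha hb hT + mulAt k x' y ha hb hT := by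
  unfold mulAt
  split_ifs
  · exact ins_add_left _ _ _ _ _ _ _ _ _ _
  · exact (add_zero _).symm

theorem mulAt_add_right (k : ℕ) (x : P.V a) (y y' : P.V b) (ha : a = σ ++ t₁) (hb : b = γ ++ t₂)
    (hT : T = t₂ ++ t₁) : mulAt k x (y + y') ha hb hT = mulAt k x y ha hb hT + mulAt k x y' ha hb hT := by
  unfold mulAt
  split_ifs
  · exact ins_add_right _ _ _ _ _ _ _ _ _ _
  · exact (add_zero _).symm

theorem mulAt_smul_left (k : ℕ) (z : ℂ) (x : P.V a) (y : P.V b) (ha : a = σ ++ t₁) (hb : b = γ ++ t₂)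
    (hT : T = t₂ ++ t₁) : mulAt k (z • x) y ha hb hT = z • mulAt k x y ha hb hT := by
  unfold mulAt
  split_ifs
  · exact ins_smul_left _ _ _ _ _ _ _ _ _ _
  · exact (smul_zero _).symm

theorem mulAt_smul_right (k : ℕ) (z : ℂ) (x : P.V a) (y : P.V b) (ha : a = σ ++ t₁) (hb : b = γ ++ t₂)
    (hT : T = t₂ ++ t₁) : mulAt k x (z • y) ha hb hT = z • mulAt k x y ha hb hT := by
  unfold mulAt
  split_ifs
  · exact ins_smul_right _ _ _ _ _ _ _ _ _ _
  · exact (smul_zero _).symm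

theorem zero_mulAt (k : ℕ) (y : P.V b) (ha : a = σ ++ t₁) (hb : b = γ ++ t₂) (hT : T = t₂ ++ t₁) :
    mulAt k (0 : P.V a) y ha hb hT = 0 := by
  simpa using mulAt_smul_left k 0 (0 : P.V a) y ha hb hT

theorem mulAt_zero (k : ℕ) (x : P.V a) (ha : a = σ ++ t₁) (hb : b = γ ++ t₂) (hT : T = t₂ ++ t₁) :
    mulAt k x (0 : P.V b) ha hb hT = 0 := by
  simpa using mulAt_smul_right k 0 x (0 : P.V b) ha hb hT

open Classical in
/-- The element `x` in degree `γ`. -/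
def sg {γ T : Word L} (x : P.V (γ ++ T)) : ∀ τ : Word L, P.V (τ ++ T) := Pi.single γ x

/-- Once elements are regarded as families supported in one degree, heterogeneous equalities between
equal degrees become honest equalities. -/
theorem sg_congr {γ γ' : Word L} (h : γ = γ') {x : P.V (γ ++ T)} {x' : P.V (γ' ++ T)} (e : x ≍ x') :
    sg x = sg x' := by
  subst h; rw [eq_of_heq e]

open Classical in
theorem sg_zero : sg (0 : P.V (γ ++ T)) = 0 := Pi.single_zero _

theorem sg_mulAt_congr_left {σ' a' : Word L} (k : ℕ) {x : P.V a} {x' : P.V a'} (y : P.V b) (h : σ = σ')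
    (e : x ≍ x') (ea : a = a') (ha : a = σ ++ t₁) (hb : b = γ ++ t₂) (hT : T = t₂ ++ t₁) :
    sg (mulAt k x y ha hb hT) = sg (mulAt k x' y (ea.symm.trans (by rw [ha, h])) hb hT) := by
  subst h ea; rw [eq_of_heq e]

theorem sg_mulAt_congr_right {γ' b' : Word L} (k : ℕ) (x : P.V a) {y : P.V b} {y' : P.V b'} (h : γ = γ')
    (e : y ≍ y') (eb : b = b') (ha : a = σ ++ t₁) (hb : b = γ ++ t₂) (hT : T = t₂ ++ t₁) :
    sg (mulAt k x y ha hb hT) = sg (mulAt k x y' ha (eb.symm.trans (by rw [hb, h])) hT) := by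
  subst h eb; rw [eq_of_heq e]

theorem sg_mulAt {k : ℕ} {s w r m : Word L} (hk : w.length = k) (hσ : σ = s ++ w.reverse)
    (hγ : γ = w ++ r) (hm : m = r ++ t₂) (x : P.V a) (y : P.V b) (ha : a = σ ++ t₁) (hb : b = γ ++ t₂)
    (hT : T = t₂ ++ t₁) (ha' : a = s ++ w.reverse ++ t₁) (hb' : b = w ++ m)
    (hd : s ++ r ++ T = s ++ m ++ t₁) : sg (mulAt k x y ha hb hT) = sg (ins x y s w m t₁ ha' hb' hd) :=
  sg_congr (by subst hk hσ hγ; exact cancel_eq _ _ _) (mulAt_heq hk hσ hγ hm x y ha hb hT ha' hb' hd)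

section Assoc

variable {T₁₂ T₂₃ : Word L} (x : P.V a) (y : P.V b) (z : P.V c) (ha : a = ρ ++ t₁) (hb : b = σ ++ t₂)
  (hc : c = γ ++ t₃) (h₁₂ : T₁₂ = t₂ ++ t₁) (h₂₃ : T₂₃ = t₃ ++ t₂) (hT : T = t₃ ++ T₁₂)
  (hT' : T = T₂₃ ++ t₁)

-- When the words match, `σ` has the form `w ++ m ++ v.reverse`, with `w` joined to `x` and `v`
-- joined to `z`, and `ins_assoc` applies. When they do not match, both terms are zero.
include ha in
theorem mulAt_mulAt_of_le {k j : ℕ} (h : k + j ≤ σ.length) :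
    sg (mulAt j (mulAt k x y ha hb h₁₂) z rfl hc hT) =
      sg (mulAt k x (mulAt j y z hb hc h₂₃) ha rfl hT') := by
  by_cases H : ∃ s w m v r : Word L, w.length = k ∧ v.length = j ∧ ρ = s ++ w.reverse ∧
      σ = w ++ m ++ v.reverse ∧ γ = v ++ r
  · obtain ⟨s, w, m, v, r, rfl, rfl, rfl, rfl, rfl⟩ := H
    have e1 : mulAt w.length x y ha hb h₁₂ ≍ ins (c := s ++ m ++ v.reverse ++ T₁₂) x y s w
        (m ++ v.reverse ++ t₂) t₁ ha (by simp [hb]) (by simp [h₁₂]) :=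
      mulAt_heq rfl rfl (List.append_assoc _ _ _) rfl x y ha hb h₁₂ _ _ _
    have e2 : mulAt v.length y z hb hc h₂₃ ≍ ins (c := w ++ (m ++ r) ++ T₂₃) y z (w ++ m) v
        (r ++ t₃) t₂ hb (by simp [hc]) (by simp [h₂₃]) :=
      mulAt_heq rfl rfl rfl rfl y z hb hc h₂₃ _ _ _
    have c1 : cancel w.length (s ++ w.reverse) (w ++ m ++ v.reverse) = s ++ m ++ v.reverse := by
      simp [cancel]
    have c2 : cancel v.length (w ++ m ++ v.reverse) (v ++ r) = w ++ (m ++ r) := by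
      rw [cancel_eq, List.append_assoc]
    rw [sg_mulAt_congr_left _ z c1 e1 (by rw [c1]) rfl hc hT,
      sg_mulAt_congr_right _ x c2 e2 (by rw [c2]) ha rfl hT',
      sg_mulAt (s := s ++ m) rfl rfl rfl rfl _ z rfl hc hT (by simp) (by simp [hc]) (by simp [hT]),
      sg_mulAt (s := s) (r := m ++ r) (m := m ++ (r ++ t₃) ++ t₂) rfl rfl rfl (by simp [h₂₃]) x _ ha rfl
        hT' ha (by simp [h₂₃]) (by simp [hT', h₂₃])]
    subst h₁₂ h₂₃
    exact sg_congr (by simp) ((heq_of_eq (ins_assoc x y z ha (by simp [hb]) (by simp [hc]) (by simp)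
      (by simp) (by simp) (by simp) hb (by simp [hT]) (by simp [hT]))).trans
      (ins_heq _ _ _ _ _ _ _ _ _ (by simp [hT])))
  · have hl : mulAt j (mulAt k x y ha hb h₁₂) z rfl hc hT = 0 := by
      by_cases h1 : Cancels k ρ σ
      · obtain ⟨s, w, q, rfl, rfl, rfl⟩ := cancels_iff.1 h1
        refine mulAt_of_not (fun h2 => H ?_) _ _ _ _ _
        rw [cancel_eq] at h2
        obtain ⟨s', v, r, rfl, h3, rfl⟩ := cancels_iff.1 h2
        rcases List.append_eq_append_iff.1 h3 with ⟨l, h4, h5⟩ | ⟨l, rfl, h5⟩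
        · exact ⟨s, w, l, v, r, rfl, rfl, rfl, by simp [h5], rfl⟩
        · have h6 := congrArg List.length h5
          simp only [List.length_append, List.length_reverse] at h6 h
          obtain rfl : l = [] := List.length_eq_zero_iff.1 (by omega)
          exact ⟨_, w, [], v, r, rfl, rfl, rfl, by simpa using h5.symm, rfl⟩
      · rw [mulAt_of_not h1, zero_mulAt]
    have hr : mulAt k x (mulAt j y z hb hc h₂₃) ha rfl hT' = 0 := by
      by_cases h1 : Cancels j σ γ
      · obtain ⟨p, v, r, rfl, rfl, rfl⟩ := cancels_iff.1 h1
        refine mulAt_of_not (fun h2 => H ?_) _ _ _ _ _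
        rw [cancel_eq] at h2
        obtain ⟨s, w, q, rfl, rfl, h3⟩ := cancels_iff.1 h2
        rcases List.append_eq_append_iff.1 h3 with ⟨l, rfl, h5⟩ | ⟨l, rfl, h5⟩
        · simp only [List.length_append, List.length_reverse] at h
          obtain rfl : l = [] := List.length_eq_zero_iff.1 (by omega)
          exact ⟨s, p, [], v, r, by simp, rfl, by simp, by simp, rfl⟩
        · exact ⟨s, w, l, v, r, rfl, rfl, rfl, rfl, rfl⟩
      · rw [mulAt_of_not h1, mulAt_zero]
    rw [hl, hr, sg_zero, sg_zero]

-- The word `σ` of the middle factor is used up, `k` strings by `x` and `j` by `z`, while `l` more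
-- strings of `z` reach `x` directly. This is the situation of `ins_assoc'`; without matching words
-- both terms vanish.
include ha in
theorem mulAt_mulAt_of_ge {k j l : ℕ} (h : k + j = σ.length) :
    sg (mulAt (j + l) (mulAt k x y ha hb h₁₂) z rfl hc hT) =
      sg (mulAt (k + l) x (mulAt j y z hb hc h₂₃) ha rfl hT') := by
  by_cases H : ∃ s u w v r : Word L, w.length = k ∧ u.length = l ∧ v.length = j ∧
      ρ = s ++ u.reverse ++ w.reverse ∧ σ = w ++ v.reverse ∧ γ = v ++ u ++ r
  · obtain ⟨s, u, w, v, r, rfl, rfl, rfl, rfl, rfl, rfl⟩ := H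
    have e1 : mulAt w.length x y ha hb h₁₂ ≍ ins (c := s ++ u.reverse ++ v.reverse ++ T₁₂) x y
        (s ++ u.reverse) w (v.reverse ++ t₂) t₁ ha (by simp [hb]) (by simp [h₁₂]) :=
      mulAt_heq rfl rfl rfl rfl x y ha hb h₁₂ _ _ _
    have e2 : mulAt v.length y z hb hc h₂₃ ≍ ins (c := w ++ (u ++ r) ++ T₂₃) y z w v
        (u ++ (r ++ t₃)) t₂ hb (by simp [hc]) (by simp [h₂₃]) :=
      mulAt_heq rfl rfl (List.append_assoc _ _ _) (by simp) y z hb hc h₂₃ _ _ _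
    have c1 : cancel w.length (s ++ u.reverse ++ w.reverse) (w ++ v.reverse) =
        s ++ u.reverse ++ v.reverse := cancel_eq _ _ _
    have c2 : cancel v.length (w ++ v.reverse) (v ++ u ++ r) = w ++ (u ++ r) := by
      rw [List.append_assoc, cancel_eq]
    rw [sg_mulAt_congr_left _ z c1 e1 (by rw [c1]) rfl hc hT,
      sg_mulAt_congr_right _ x c2 e2 (by rw [c2]) ha rfl hT',
      sg_mulAt (s := s) (w := v ++ u) (r := r) (by simp) (by simp) rfl rfl _ z rfl hc hT (by simp)
        (by simp [hc]) (by simp [hT]),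
      sg_mulAt (s := s) (w := w ++ u) (r := r) (m := r ++ t₃ ++ t₂) (by simp) (by simp) (by simp)
        (by simp [h₂₃]) x _ ha rfl hT' (by simp [ha]) (by simp [h₂₃]) (by simp [hT', h₂₃])]
    subst h₁₂ h₂₃
    exact sg_congr rfl (heq_of_eq (ins_assoc' x y z ha (by simp [hb]) (by simp [hc]) (by simp)
      (by simp) hb (by simp [hc]) (by simp) (by simp [ha]) (by simp) (by simp [hT]) (by simp [hT])))
  · have hl : mulAt (j + l) (mulAt k x y ha hb h₁₂) z rfl hc hT = 0 := by
      by_cases h1 : Cancels k ρ σ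
      · obtain ⟨s, w, q, rfl, rfl, rfl⟩ := cancels_iff.1 h1
        refine mulAt_of_not (fun h2 => H ?_) _ _ _ _ _
        rw [cancel_eq] at h2
        obtain ⟨s', v, r, h6, h3, rfl⟩ := cancels_iff.1 h2
        simp only [List.length_append] at h
        rcases List.append_eq_append_iff.1 h3 with ⟨m, h4, h5⟩ | ⟨m, rfl, h5⟩
        · have h7 := congrArg List.length h5
          simp only [List.length_append, List.length_reverse] at h7
          obtain rfl : m = [] := List.length_eq_zero_iff.1 (by omega)
          exact ⟨s, [], w, v, r, rfl, by simp; omega, by omega, by simp, by simp [h5], by simp⟩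
        · obtain rfl : v = q.reverse ++ m.reverse := by
            rw [← List.reverse_append, ← h5, List.reverse_reverse]
          simp only [List.length_append, List.length_reverse] at h6
          exact ⟨s', m.reverse, w, q.reverse, r, rfl, by simp; omega, by simp; omega, by simp,
            by simp, rfl⟩
      · rw [mulAt_of_not h1, zero_mulAt]
    have hr : mulAt (k + l) x (mulAt j y z hb hc h₂₃) ha rfl hT' = 0 := by
      by_cases h1 : Cancels j σ γ
      · obtain ⟨p, v, r, rfl, rfl, rfl⟩ := cancels_iff.1 h1
        refine mulAt_of_not (fun h2 => H ?_) _ _ _ _ _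
        rw [cancel_eq] at h2
        obtain ⟨s, w, q, h6, rfl, h3⟩ := cancels_iff.1 h2
        simp only [List.length_append, List.length_reverse] at h
        rcases List.append_eq_append_iff.1 h3 with ⟨u, rfl, rfl⟩ | ⟨u, rfl, h5⟩
        · simp only [List.length_append] at h6
          exact ⟨s, u, p, v, q, by omega, by omega, rfl, by simp, rfl, by simp⟩
        · simp only [List.length_append] at h
          obtain rfl : u = [] := List.length_eq_zero_iff.1 (by omega)
          exact ⟨s, [], w, v, r, by omega, by simp; omega, rfl, by simp, by simp, by simp⟩
      · rw [mulAt_of_not h1, mulAt_zero]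
    rw [hl, hr, sg_zero, sg_zero]

end Assoc

end FactorPlanarAlgebra
end

/-! ### Associativity of the product -/

noncomputable section

namespace FactorPlanarAlgebra

open PlanarAlg PlanarAlgebra

variable {L : Type u} {P : FactorPlanarAlgebra.{u, v} L} {a b c ρ σ γ t t₁ t₂ t₃ T : Word L}

theorem le_of_cancels {k : ℕ} (h : Cancels k σ γ) : k ≤ σ.length ∧ k ≤ γ.length := by
  obtain ⟨s, w, r, rfl, rfl, rfl⟩ := cancels_iff.1 h
  simp

theorem le_of_mulAt_ne {k : ℕ} {x : P.V a} {y : P.V b} {ha : a = σ ++ t₁} {hb : b = γ ++ t₂}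
    {hT : T = t₂ ++ t₁} (h : mulAt k x y ha hb hT ≠ 0) : k ≤ σ.length ∧ k ≤ γ.length :=
  le_of_cancels (by by_contra H; exact h (mulAt_of_not H _ _ _ _ _))

theorem mulAt_ne {k : ℕ} {x : P.V a} {y : P.V b} {ha : a = σ ++ t₁} {hb : b = γ ++ t₂}
    {hT : T = t₂ ++ t₁} (h : mulAt k x y ha hb hT ≠ 0) : x ≠ 0 ∧ y ≠ 0 :=
  ⟨fun e => h (by subst e; exact zero_mulAt _ _ _ _ _), fun e => h (by subst e; exact mulAt_zero _ _ _ _ _)⟩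

theorem ne_of_sg_ne {x : P.V (γ ++ T)} (h : sg x ≠ 0) : x ≠ 0 := fun e => h (by rw [e, sg_zero])

/-- Associativity of the product. -/
theorem sum_mulAt_mulAt {T₁₂ T₂₃ : Word L} (x : P.V a) (y : P.V b) (z : P.V c) (ha : a = ρ ++ t₁)
    (hb : b = σ ++ t₂) (hc : c = γ ++ t₃) (h₁₂ : T₁₂ = t₂ ++ t₁) (h₂₃ : T₂₃ = t₃ ++ t₂)
    (hT : T = t₃ ++ T₁₂) (hT' : T = T₂₃ ++ t₁) {N : ℕ} (hρ : ρ.length < N) (hσ : σ.length < N)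
    (hγ : γ.length < N) :
    ∑ k ∈ Finset.range N, ∑ j ∈ Finset.range N, sg (mulAt j (mulAt k x y ha hb h₁₂) z rfl hc hT) =
      ∑ j ∈ Finset.range N, ∑ k ∈ Finset.range N,
        sg (mulAt k x (mulAt j y z hb hc h₂₃) ha rfl hT') := by
  rw [← Finset.sum_product', ← Finset.sum_product']
  have hf {k j : ℕ} (h : sg (mulAt j (mulAt k x y ha hb h₁₂) z rfl hc hT) ≠ 0) : k ≤ σ.length :=
    (le_of_mulAt_ne (mulAt_ne (ne_of_sg_ne h)).1).2
  have hg {k j : ℕ} (h : sg (mulAt k x (mulAt j y z hb hc h₂₃) ha rfl hT') ≠ 0) :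
      k ≤ ρ.length ∧ j ≤ σ.length ∧ j ≤ γ.length :=
    ⟨(le_of_mulAt_ne (ne_of_sg_ne h)).1, (le_of_mulAt_ne (mulAt_ne (ne_of_sg_ne h)).2)⟩
  have hle {k j : ℕ} (h : k + j ≤ σ.length) :=
    mulAt_mulAt_of_le x y z ha hb hc h₁₂ h₂₃ hT hT' h
  have hge {k j l : ℕ} (h : k + j = σ.length) :=
    mulAt_mulAt_of_ge x y z ha hb hc h₁₂ h₂₃ hT hT' (l := l) h
  have key {k j : ℕ} (h : k ≤ σ.length) : sg (mulAt j (mulAt k x y ha hb h₁₂) z rfl hc hT) =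
      if k + j ≤ σ.length then sg (mulAt k x (mulAt j y z hb hc h₂₃) ha rfl hT') else
        sg (mulAt (k + (k + j - σ.length)) x (mulAt (σ.length - k) y z hb hc h₂₃) ha rfl hT') := by
    split_ifs with h1
    · exact hle h1
    · have := hge (k := k) (j := σ.length - k) (l := k + j - σ.length) (by omega)
      rw [← this, show σ.length - k + (k + j - σ.length) = j by omega]
  -- If `k + j ≤ |σ|`, the joined parts of `σ` are disjoint and the indices are kept. Otherwise `z`
  -- takes the `|σ| - k` strings left over from the first product and `l = k + j - |σ|` strings of
  -- `x`; in the other bracketing this is the term with `|σ| - k` joins, followed by one with `k +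
  -- l`.
  refine Finset.sum_bij_ne_zero (fun p _ _ => if p.1 + p.2 ≤ σ.length then (p.2, p.1) else
    (σ.length - p.1, p.1 + (p.1 + p.2 - σ.length))) ?_ ?_ ?_ ?_
  · rintro ⟨k, j⟩ _ h
    have h1 := hf h
    simp only at h ⊢
    rw [key h1] at h
    split_ifs at h ⊢ with h2
    · have := hg h; simp; omega
    · have := hg h; simp; omega
  · rintro ⟨k, j⟩ _ h ⟨k', j'⟩ _ h'
    have h1 := hf h
    have h1' := hf h'
    simp only
    split_ifs <;> simp only [Prod.mk.injEq] <;> omega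
  · rintro ⟨j, k⟩ _ h
    have h1 := hg h
    by_cases h2 : k + j ≤ σ.length
    · refine ⟨(k, j), by simp; omega, ?_, by simp [h2]⟩
      simp only
      rw [hle h2]; exact h
    · have e := hge (k := σ.length - j) (j := j) (l := k + j - σ.length) (by omega)
      rw [show σ.length - j + (k + j - σ.length) = k by omega] at e
      have h3 : sg (mulAt (j + (k + j - σ.length)) (mulAt (σ.length - j) x y ha hb h₁₂) z rfl hc hT) ≠ 0 := by
        rw [e]; exact h
      have h4 := le_of_mulAt_ne (ne_of_sg_ne h3)
      refine ⟨(σ.length - j, j + (k + j - σ.length)), by simp; omega, h3, ?_⟩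
      simp only
      split_ifs <;> simp only [Prod.mk.injEq] <;> omega
  · rintro ⟨k, j⟩ _ h
    have h1 : k ≤ σ.length := hf h
    have h3 : ∀ q : ℕ × ℕ, q = (if k + j ≤ σ.length then (j, k) else
        (σ.length - k, k + (k + j - σ.length))) → sg (mulAt j (mulAt k x y ha hb h₁₂) z rfl hc hT) =
        sg (mulAt q.2 x (mulAt q.1 y z hb hc h₂₃) ha rfl hT') := by
      intro q hq
      by_cases h2 : k + j ≤ σ.length
      · rw [if_pos h2] at hq
        subst hq
        exact hle h2
      · rw [if_neg h2] at hq
        subst hq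
        exact (key h1).trans (if_neg h2)
    exact h3 _ rfl

theorem sg_self (x : P.V (γ ++ T)) : sg x γ = x := by
  classical
  unfold sg; convert Pi.single_eq_same _ _

theorem sg_of_ne {τ : Word L} (h : τ ≠ γ) (x : P.V (γ ++ T)) : sg x τ = 0 := by
  classical
  unfold sg; convert Pi.single_eq_of_ne h _

/-- No more strings can be joined than either word has, so the range of summation is immaterial once
it is large enough, and several products may share one bound. -/
theorem sum_sg_mulAt_eq {N N' : ℕ} (x : P.V a) (y : P.V b) (ha : a = σ ++ t₁) (hb : b = γ ++ t₂)
    (hT : T = t₂ ++ t₁) (h : N ≤ N') (hN : σ.length < N ∨ γ.length < N) :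
    ∑ k ∈ Finset.range N', sg (mulAt k x y ha hb hT) = ∑ k ∈ Finset.range N, sg (mulAt k x y ha hb hT) := by
  refine (Finset.sum_subset (Finset.range_mono h) fun k _ hk => ?_).symm
  by_contra H
  have := le_of_mulAt_ne (ne_of_sg_ne H)
  simp at hk
  omega

theorem leftMul_eq (x : P.V σ) (ξ : P.V (γ ++ t)) {N : ℕ} (hN : γ.length < N) (τ : Word L) :
    leftMul x ξ τ = ∑ k ∈ Finset.range N,
      sg (mulAt k x ξ (List.append_nil σ).symm rfl (List.append_nil t).symm) τ := by
  rw [← Finset.sum_apply, sum_sg_mulAt_eq (N := γ.length + 1) _ _ _ _ _ hN (Or.inr (by simp)),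
    Finset.sum_apply, leftMul]
  refine Finset.sum_congr rfl fun k _ => ?_
  split_ifs with h
  · obtain ⟨h1, rfl⟩ := h
    rw [sg_self, mulAt, dif_pos h1]
    exact (Z_glue_eq_ins _ _ _ _ _ _ _ _).trans (Z_insert_congr HEq.rfl HEq.rfl rfl rfl rfl rfl rfl rfl)
  · by_cases h1 : Cancels k σ γ
    · exact (sg_of_ne (fun h2 => h ⟨h1, h2⟩) _).symm
    · rw [mulAt_of_not h1, sg_zero]; rfl

theorem rightMul_eq (ξ : P.V (γ ++ t)) (x : P.V σ) {N : ℕ} (hN : σ.length < N) (τ : Word L) :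
    rightMul ξ x τ = ∑ k ∈ Finset.range N,
      sg (mulAt k ξ x rfl (List.append_nil σ).symm (List.nil_append t).symm) τ := by
  rw [← Finset.sum_apply, sum_sg_mulAt_eq (N := σ.length + 1) _ _ _ _ _ hN (Or.inr (by simp)),
    Finset.sum_apply, rightMul]
  refine Finset.sum_congr rfl fun k _ => ?_
  split_ifs with h
  · obtain ⟨h1, rfl⟩ := h
    rw [sg_self, mulAt, dif_pos h1, ins]
    exact Z_insert_congr HEq.rfl HEq.rfl rfl rfl rfl rfl (by simp) rfl
  · by_cases h1 : Cancels k γ σ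
    · exact (sg_of_ne (fun h2 => h ⟨h1, h2⟩) _).symm
    · rw [mulAt_of_not h1, sg_zero]; rfl

end FactorPlanarAlgebra
end

/-! ### Operators between Hilbert sums -/

noncomputable section

open scoped ENNReal

/-- A bounded family of operators `E i → F (c i)` with `c` injective on its support gives an operator
between the Hilbert sums. -/
theorem lp.exists_map_single {ι κ : Type*} [DecidableEq ι] [DecidableEq κ] {E : ι → Type*} {F : κ → Type*}
    [∀ i, NormedAddCommGroup (E i)]
    [∀ i, InnerProductSpace ℂ (E i)] [∀ i, NormedAddCommGroup (F i)] [∀ i, InnerProductSpace ℂ (F i)]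
    [∀ i, CompleteSpace (F i)] (c : ι → κ) (D : ∀ i, E i →ₗ[ℂ] F (c i)) {C : ℝ} (hC : 0 ≤ C)
    (hD : ∀ i x, ‖D i x‖ ≤ C * ‖x‖) (hc : ∀ i j, D i ≠ 0 → D j ≠ 0 → c i = c j → i = j) :
    ∃ T : lp E 2 →L[ℂ] lp F 2, ∀ i x, T (lp.single 2 i x) = lp.single 2 (c i) (D i x) := by
  -- As `c` is injective where `D` is nonzero, different indices hit orthogonal summands. The
  -- operator is a bounded diagonal map `U` onto these indices, followed by the isometry assembled
  -- from `V`.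
  let V : ∀ i : {i | D i ≠ 0}, F (c i) →ₗᵢ[ℂ] lp F 2 := fun i =>
    { toLinearMap := lp.lsingle 2 (c i), norm_map' := lp.norm_single (by simp) _ }
  have hV : OrthogonalFamily ℂ (fun i : {i | D i ≠ 0} => F (c i)) V := by
    intro i j h x y
    refine (lp.inner_single_left _ _ _).trans ?_
    have h1 : c i ≠ c j := fun e => h (Subtype.ext (hc _ _ i.2 j.2 e))
    have h2 : (V j y : ∀ k, F k) (c i) = 0 := lp.single_apply_ne _ _ _ h1
    rw [h2, inner_zero_right]
  have hb (f : lp E 2) (i : {i | D i ≠ 0}) : ‖D i (f i)‖ ^ (2 : ℝ≥0∞).toReal ≤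
      C ^ (2 : ℝ≥0∞).toReal * ‖f i‖ ^ (2 : ℝ≥0∞).toReal := by
    rw [← Real.mul_rpow hC (norm_nonneg _)]
    exact Real.rpow_le_rpow (norm_nonneg _) (hD _ _) (by simp)
  have h2 : 0 < (2 : ℝ≥0∞).toReal := by simp
  have hm (f : lp E 2) : Memℓp (fun i : {i | D i ≠ 0} => D i (f i)) 2 := memℓp_gen
    (Summable.of_nonneg_of_le (fun _ => by positivity) (hb f)
      ((((lp.memℓp f).summable h2).subtype _).mul_left _))
  let U₀ : lp E 2 →ₗ[ℂ] lp (fun i : {i | D i ≠ 0} => F (c i)) 2 :=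
    { toFun := fun f => ⟨_, hm f⟩
      map_add' := fun f g => by ext i; exact (D i).map_add _ _
      map_smul' := fun z f => by ext i; exact (D i).map_smul _ _ }
  let U := U₀.mkContinuous C fun f => by
    refine lp.norm_le_of_forall_sum_le h2 (by positivity) fun s => ?_
    rw [Real.mul_rpow hC (norm_nonneg _)]
    refine (Finset.sum_le_sum fun i _ => hb f i).trans ?_
    rw [← Finset.mul_sum]
    refine mul_le_mul_of_nonneg_left ?_ (by positivity)
    have := lp.sum_rpow_le_norm_rpow h2 f (s.map (Function.Embedding.subtype _))
    rwa [Finset.sum_map] at this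
  refine ⟨hV.linearIsometry.toContinuousLinearMap ∘L U, fun i x => ?_⟩
  by_cases h : D i = 0
  · have : U (lp.single 2 i x) = 0 := by
      ext j
      change D j ((lp.single 2 i x : ∀ k, E k) j) = 0
      rw [lp.single_apply_ne _ _ _ (fun e : (j : ι) = i => j.2 (by rw [e]; exact h)), map_zero]
    simp [this, h]
  · have : U (lp.single 2 i x) = lp.single 2 (⟨i, h⟩ : {i | D i ≠ 0}) (D i x) := by
      ext j
      change D j ((lp.single 2 i x : ∀ k, E k) j) = _
      by_cases e : j = ⟨i, h⟩
      · subst e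
        rw [lp.single_apply_self, lp.single_apply_self]
      · rw [lp.single_apply_ne _ _ _ e, lp.single_apply_ne _ _ _ (fun e' => e (Subtype.ext e')), map_zero]
    rw [ContinuousLinearMap.comp_apply, this]
    exact hV.linearIsometry_apply_single _

/-- Continuous maps on a Hilbert sum agreeing on the summands are equal. -/
theorem lp.continuousLinearMap_ext {ι G : Type*} [DecidableEq ι] {E : ι → Type*} [∀ i, NormedAddCommGroup (E i)]
    [∀ i, InnerProductSpace ℂ (E i)] [NormedAddCommGroup G] [NormedSpace ℂ G]
    {S T : lp E 2 →L[ℂ] G}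
    (h : ∀ i x, S (lp.single 2 i x) = T (lp.single 2 i x)) : S = T := by
  ext f
  have hf := lp.hasSum_single (p := 2) (by simp) f
  refine (hf.mapL S).unique ?_
  simpa only [h] using hf.mapL T

end

section

namespace FactorPlanarAlgebra

open PlanarAlg PlanarAlgebra

variable {L : Type u}

/-- The cancelled word is the reversed end of `σ`, so it is determined by `σ` and `k`, and `γ` can
be read off from the result. This supplies the orthogonality hypothesis of `lp.exists_map_single`.
-/
theorem cancel_left_injective {k : ℕ} {σ γ γ' : Word L} (h : Cancels k σ γ) (h' : Cancels k σ γ')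
    (e : cancel k σ γ = cancel k σ γ') : γ = γ' := by
  obtain ⟨s, w, r, hk, h1, rfl⟩ := cancels_iff.1 h
  obtain ⟨s', w', r', hk', h1', rfl⟩ := cancels_iff.1 h'
  subst h1 hk
  obtain ⟨rfl, h2⟩ := List.append_inj' h1' (by simp [hk'])
  obtain rfl := List.reverse_injective h2
  rw [cancel_eq, cancel_eq] at e
  rw [List.append_cancel_left e]

theorem cancel_right_injective {k : ℕ} {σ σ' γ : Word L} (h : Cancels k σ γ) (h' : Cancels k σ' γ)
    (e : cancel k σ γ = cancel k σ' γ) : σ = σ' := by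
  obtain ⟨s, w, r, hk, rfl, h1⟩ := cancels_iff.1 h
  obtain ⟨s', w', r', hk', rfl, h1'⟩ := cancels_iff.1 h'
  subst h1 hk
  obtain ⟨rfl, rfl⟩ := List.append_inj h1' hk'.symm
  rw [cancel_eq, cancel_eq] at e
  rw [List.append_cancel_right e]

end FactorPlanarAlgebra
end

/-! ### Vectors of `H_p` and stability of its degree spaces -/

noncomputable section

namespace FactorPlanarAlgebra

open PlanarAlg PlanarAlgebra

variable {L : Type u} {P : FactorPlanarAlgebra.{u, v} L} {p q : Projection P}
  {a b σ γ γ' t t₁ t₂ T : Word L}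

theorem vec_eq [DecidableEq (Word L)] (ξ : p.fibre γ) : vec p ξ = lp.single 2 γ ξ := by
  unfold vec
  congr!

/-- The components of a vector. -/
def coord (p : Projection P) : p.H →ₗ[ℂ] ∀ τ : Word L, P.V (τ ++ p.word.reverse) where
  toFun f τ := f τ
  map_add' _ _ := rfl
  map_smul' _ _ := rfl

theorem coord_apply (f : p.H) (τ : Word L) : coord p f τ = f τ := rfl

theorem coord_injective : Function.Injective (coord p) := fun f g h => by
  ext τ
  exact congrFun h τ

theorem coord_vec (ξ : p.fibre γ) : coord p (vec p ξ) = sg (ξ : P.V (γ ++ p.word.reverse)) := by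
  classical
  funext τ
  rw [coord_apply, vec_eq]
  by_cases h : τ = γ
  · subst h
    rw [lp.single_apply_self, sg_self]
  · rw [lp.single_apply_ne _ _ _ h, sg_of_ne h]; rfl

theorem mem_fibre_of_heq (h : γ = γ') {x : P.V (γ ++ p.word.reverse)} {x' : P.V (γ' ++ p.word.reverse)}
    (hx : x ≍ x') (hx' : x' ∈ p.fibre γ') : x ∈ p.fibre γ := by
  subst h
  rwa [eq_of_heq hx]

theorem comp_eq_of_mem {ξ : P.V (γ ++ p.word.reverse)} (h : ξ ∈ p.fibre γ) {ha hb hc} :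
    ins (c := γ ++ p.word.reverse) ξ p.elt γ p.word p.word.reverse [] ha hb hc = ξ :=
  (comp_eq_ins (P := P.toPlanarAlgebra) (a := γ) ξ p.elt).symm.trans h

/-- The projection is attached to strings of `ξ` that take no part in the product, so `ins_assoc`
moves it inside, where `ξ` absorbs it. -/
theorem mulAt_mem_left (k : ℕ) (x : P.V a) {ξ : P.V b} (ha : a = σ ++ t₁) (ht : t₁ = [])
    (hb : b = γ ++ p.word.reverse) (hT : p.word.reverse = p.word.reverse ++ t₁)
    (hξ : P.castV hb ξ ∈ p.fibre γ) :
    mulAt k x ξ ha hb hT ∈ p.fibre (cancel k σ γ) := by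
  by_cases h : Cancels k σ γ
  · obtain ⟨s, w, r, hk, rfl, rfl⟩ := cancels_iff.1 h
    subst ha hb ht hk
    refine mem_fibre_of_heq (cancel_eq s w r) (mulAt_heq (s := s) (w := w) (r := r) rfl rfl rfl rfl x ξ
      rfl rfl hT rfl (List.append_assoc _ _ _) (by simp)) ?_
    refine (comp_eq_ins (P := P.toPlanarAlgebra) (a := s ++ r) _ _).trans ?_
    have h := ins_assoc (P := P.toPlanarAlgebra) x ξ p.elt (s := s) (w := w) (m := r) (v := p.word)
      (n := p.word.reverse) (t₁ := []) (t₂ := []) (d := s ++ r ++ p.word.reverse)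
      (e := w ++ r ++ p.word.reverse) (g := s ++ r ++ p.word.reverse) rfl (by simp) rfl (by simp) (by simp)
      (by simp) (by simp) (by simp) (by simp) (by simp)
    replace hξ : ξ ∈ p.fibre (w ++ r) := hξ
    rw [comp_eq_of_mem hξ] at h
    simpa only [List.append_nil] using h
  · rw [mulAt_of_not h]
    exact zero_mem _

/-- The projection and `y` are attached to separate strings of `ξ`, so `ins_comm` lets `ξ` absorb
the projection before `y` is inserted. -/
theorem mulAt_mem_right (k : ℕ) {ξ : P.V a} (y : P.V b) (ha : a = σ ++ p.word.reverse)
    (hb : b = γ ++ t₂) (ht : t₂ = []) (hT : p.word.reverse = t₂ ++ p.word.reverse)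
    (hξ : P.castV ha ξ ∈ p.fibre σ) :
    mulAt k ξ y ha hb hT ∈ p.fibre (cancel k σ γ) := by
  by_cases h : Cancels k σ γ
  · obtain ⟨s, w, r, hk, rfl, rfl⟩ := cancels_iff.1 h
    subst ha hb ht hk
    refine mem_fibre_of_heq (cancel_eq s w r) (mulAt_heq (s := s) (w := w) (r := r) (m := r)
      rfl rfl rfl (by simp) ξ y rfl rfl hT rfl (by simp) (by simp)) ?_
    refine (comp_eq_ins (P := P.toPlanarAlgebra) (a := s ++ r) _ _).trans ?_
    have h := ins_comm (P := P.toPlanarAlgebra) ξ y p.elt (s := s) (w := w) (m := r) (t := []) (v := p.word)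
      (n := p.word.reverse) (t' := []) (d := s ++ r ++ p.word.reverse)
      (e := s ++ w.reverse ++ p.word.reverse) (g := s ++ r ++ p.word.reverse) (by simp) (by simp) rfl
      (by simp) (by simp)
      (by simp) (by simp) (by simp) (by simp) (by simp)
    replace hξ : ξ ∈ p.fibre (s ++ w.reverse) := hξ
    simp only [List.append_nil, List.nil_append] at h
    rw [comp_eq_of_mem hξ] at h
    exact h
  · rw [mulAt_of_not h]
    exact zero_mem _

end FactorPlanarAlgebra
end

/-! ### Boundedness of multiplications -/

noncomputable section

namespace FactorPlanarAlgebra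

open PlanarAlg PlanarAlgebra

variable {L : Type u} {P : FactorPlanarAlgebra.{u, v} L} {p q : Projection P}
  {a b σ γ γ' t t₁ t₂ T : Word L}

theorem sum_vec_mulAt {N N' : ℕ} (x : P.V a) (y : P.V b) (ha : a = σ ++ t₁) (hb : b = γ ++ t₂)
    (hT : q.word.reverse = t₂ ++ t₁) (hm : ∀ k, mulAt k x y ha hb hT ∈ q.fibre (cancel k σ γ))
    (h : N ≤ N') (hN : σ.length < N ∨ γ.length < N) :
    ∑ k ∈ Finset.range N', vec q ⟨_, hm k⟩ = ∑ k ∈ Finset.range N, vec q ⟨_, hm k⟩ := by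
  apply coord_injective
  simp only [map_sum, coord_vec]
  exact sum_sg_mulAt_eq x y ha hb hT h hN

/-- The joined strings can only be the last `k` of `σ`. There is thus one insertion to bound, and
its constant depends neither on `y` nor on its word. -/
theorem exists_norm_mulAt_le (k : ℕ) (x : P.V a) (ha : a = σ ++ t₁) :
    ∃ C : ℝ, 0 ≤ C ∧ ∀ {γ b t₂ T : Word L} (y : P.V b) (hb : b = γ ++ t₂) (hT : T = t₂ ++ t₁),
      ‖mulAt k x y ha hb hT‖ ≤ C * ‖y‖ := by
  by_cases h : ∃ s w : Word L, σ = s ++ w.reverse ∧ w.length = k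
  · obtain ⟨s, w, rfl, rfl⟩ := h
    obtain ⟨C, h0, h⟩ := exists_norm_ins_le x s w t₁ ha
    refine ⟨C, h0, fun {γ b t₂ T} y hb hT => ?_⟩
    by_cases hc : Cancels w.length (s ++ w.reverse) γ
    · obtain ⟨s', w', r, hk, h1, rfl⟩ := cancels_iff.1 hc
      obtain ⟨rfl, h2⟩ := List.append_inj' h1 (by simp [hk])
      obtain rfl := List.reverse_injective h2
      refine (congrArg (· ≤ _) ?_).mpr (h (c := s ++ r ++ T) y (r ++ t₂) (by simp [hb]) (by simp [hT]))
      have e := mulAt_heq (s := s) (w := w) (r := r) (d := s ++ r ++ T) rfl rfl rfl rfl x y ha hb hT ha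
        (by simp [hb]) (by simp [hT])
      have k : ∀ {c d : Word L} {z : P.V c} {z' : P.V d} (_ : c = d), z ≍ z' → ‖z‖ = ‖z'‖ := by
        rintro c _ z z' rfl h
        rw [eq_of_heq h]
      exact k (by rw [cancel_eq]) e
    · rw [mulAt_of_not hc, norm_zero]; positivity
  · refine ⟨0, le_rfl, fun {γ b t₂ T} y hb hT => ?_⟩
    rw [mulAt_of_not fun hc => ?_, norm_zero]
    · positivity
    · obtain ⟨s, w, r, hk, h1, rfl⟩ := cancels_iff.1 hc
      exact h ⟨s, w, h1, hk⟩

theorem exists_norm_mulAt_le' (k : ℕ) (y : P.V b) (hb : b = γ ++ t₂) :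
    ∃ C : ℝ, 0 ≤ C ∧ ∀ {σ a t₁ T : Word L} (x : P.V a) (ha : a = σ ++ t₁) (hT : T = t₂ ++ t₁),
      ‖mulAt k x y ha hb hT‖ ≤ C * ‖x‖ := by
  by_cases h : ∃ w r : Word L, γ = w ++ r ∧ w.length = k
  · obtain ⟨w, r, rfl, rfl⟩ := h
    obtain ⟨C, h0, h⟩ := exists_norm_ins_le' y w (r ++ t₂) (by simp [hb])
    refine ⟨C, h0, fun {σ a t₁ T} x ha hT => ?_⟩
    by_cases hc : Cancels w.length σ (w ++ r)
    · obtain ⟨s, w', r', hk, rfl, h1⟩ := cancels_iff.1 hc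
      obtain ⟨rfl, rfl⟩ := List.append_inj h1 hk.symm
      refine (congrArg (· ≤ _) ?_).mpr (h (c := s ++ r ++ T) x s t₁ ha (by simp [hT]))
      have e := mulAt_heq (s := s) (w := w) (r := r) (d := s ++ r ++ T) rfl rfl rfl rfl x y ha hb hT ha
        (by simp [hb]) (by simp [hT])
      have k : ∀ {c d : Word L} {z : P.V c} {z' : P.V d} (_ : c = d), z ≍ z' → ‖z‖ = ‖z'‖ := by
        rintro c _ z z' rfl h
        rw [eq_of_heq h]
      exact k (by rw [cancel_eq]) e
    · rw [mulAt_of_not hc, norm_zero]; positivity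
  · refine ⟨0, le_rfl, fun {σ a t₁ T} x ha hT => ?_⟩
    rw [mulAt_of_not fun hc => ?_, norm_zero]
    · positivity
    · obtain ⟨s, w, r, hk, rfl, h1⟩ := cancels_iff.1 hc
      exact h ⟨w, r, h1, hk⟩

/-- The bounded operators given by multiplication by a fixed element on the left. -/
theorem exists_mul_left (p q : Projection P) (x : P.V a) (ha : a = σ ++ t₁)
    (hT : q.word.reverse = p.word.reverse ++ t₁)
    (hm : ∀ k γ (ξ : p.fibre γ), mulAt k x (ξ : P.V (γ ++ p.word.reverse)) ha rfl hT ∈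
      q.fibre (cancel k σ γ)) :
    ∃ S : p.H →L[ℂ] q.H, ∀ (N : ℕ), σ.length < N → ∀ γ (ξ : p.fibre γ),
      S (vec p ξ) = ∑ k ∈ Finset.range N, vec q ⟨_, hm k γ ξ⟩ := by
  classical
  -- For each fixed `k` the term maps single degrees to single degrees, injectively where it is
  -- nonzero, and is bounded uniformly. The operator sought is a finite sum of these over `k ≤ |σ|`.
  have hS (k : ℕ) : ∃ S : p.H →L[ℂ] q.H, ∀ γ (ξ : p.fibre γ), S (vec p ξ) = vec q ⟨_, hm k γ ξ⟩ := by
    obtain ⟨C, h0, hC⟩ := exists_norm_mulAt_le k x ha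
    let D (τ : Word L) : p.fibre τ →ₗ[ℂ] q.fibre (cancel k σ τ) :=
      { toFun := fun ξ => ⟨_, hm k τ ξ⟩
        map_add' := fun ξ η => Subtype.ext (mulAt_add_right k x _ _ ha rfl hT)
        map_smul' := fun z ξ => Subtype.ext (mulAt_smul_right k z x _ ha rfl hT) }
    have hD {τ : Word L} (h : D τ ≠ 0) : Cancels k σ τ := by
      by_contra hc
      exact h (LinearMap.ext fun ξ => Subtype.ext (mulAt_of_not hc x _ ha rfl hT))
    obtain ⟨S, hS⟩ := lp.exists_map_single (E := fun τ => p.fibre τ) (F := fun τ => q.fibre τ) _ D h0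
      (fun τ ξ => hC (ξ : P.V (τ ++ p.word.reverse)) rfl hT)
      (fun _ _ h h' e => cancel_left_injective (hD h) (hD h') e)
    exact ⟨S, fun τ ξ => by rw [vec_eq, vec_eq]; exact hS τ ξ⟩
  choose S hS using hS
  refine ⟨∑ k ∈ Finset.range (σ.length + 1), S k, fun N hN γ ξ => ?_⟩
  rw [sum_vec_mulAt (σ := σ) (γ := γ) (t₁ := t₁) x _ ha rfl hT (fun k => hm k γ ξ) (Nat.succ_le_of_lt hN)
    (Or.inl (Nat.lt_succ_self _))]
  simp only [FunLike.coe_sum, Finset.sum_apply, hS]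

/-- The bounded operators given by multiplication by a fixed element on the right. -/
theorem exists_mul_right (p q : Projection P) (y : P.V b) (hb : b = γ ++ t₂)
    (hT : q.word.reverse = t₂ ++ p.word.reverse)
    (hm : ∀ k σ (ξ : p.fibre σ), mulAt k (ξ : P.V (σ ++ p.word.reverse)) y rfl hb hT ∈
      q.fibre (cancel k σ γ)) :
    ∃ S : p.H →L[ℂ] q.H, ∀ (N : ℕ), γ.length < N → ∀ σ (ξ : p.fibre σ),
      S (vec p ξ) = ∑ k ∈ Finset.range N, vec q ⟨_, hm k σ ξ⟩ := by
  classical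
  have hS (k : ℕ) : ∃ S : p.H →L[ℂ] q.H, ∀ σ (ξ : p.fibre σ), S (vec p ξ) = vec q ⟨_, hm k σ ξ⟩ := by
    obtain ⟨C, h0, hC⟩ := exists_norm_mulAt_le' k y hb
    let D (τ : Word L) : p.fibre τ →ₗ[ℂ] q.fibre (cancel k τ γ) :=
      { toFun := fun ξ => ⟨_, hm k τ ξ⟩
        map_add' := fun ξ η => Subtype.ext (mulAt_add_left k _ _ y rfl hb hT)
        map_smul' := fun z ξ => Subtype.ext (mulAt_smul_left k z _ y rfl hb hT) }
    have hD {τ : Word L} (h : D τ ≠ 0) : Cancels k τ γ := by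
      by_contra hc
      exact h (LinearMap.ext fun ξ => Subtype.ext (mulAt_of_not hc _ y rfl hb hT))
    obtain ⟨S, hS⟩ := lp.exists_map_single (E := fun τ => p.fibre τ) (F := fun τ => q.fibre τ) _ D h0
      (fun τ ξ => hC (ξ : P.V (τ ++ p.word.reverse)) rfl hT)
      (fun _ _ h h' e => cancel_right_injective (hD h) (hD h') e)
    exact ⟨S, fun τ ξ => by rw [vec_eq, vec_eq]; exact hS τ ξ⟩
  choose S hS using hS
  refine ⟨∑ k ∈ Finset.range (γ.length + 1), S k, fun N hN σ ξ => ?_⟩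
  rw [sum_vec_mulAt (σ := σ) (γ := γ) (t₁ := p.word.reverse) _ y rfl hb hT (fun k => hm k σ ξ)
    (Nat.succ_le_of_lt hN) (Or.inr (Nat.lt_succ_self _))]
  simp only [FunLike.coe_sum, Finset.sum_apply, hS]

end FactorPlanarAlgebra
end

/-! ### Multiplication operators and module maps -/

noncomputable section

namespace FactorPlanarAlgebra

open PlanarAlg PlanarAlgebra

variable {L : Type u} {P : FactorPlanarAlgebra.{u, v} L} {p q r s : Projection P}
  {a b c σ γ γ' t t₁ t₂ t₃ T : Word L}

/-- `S` is multiplication by `x` on the left. -/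
def IsMulLeft (x : P.V a) (ha : a = σ ++ t₁) (S : p.H →L[ℂ] q.H) : Prop :=
  ∃ (hT : q.word.reverse = p.word.reverse ++ t₁) (hm : ∀ k γ (ξ : p.fibre γ),
      mulAt k x (ξ : P.V (γ ++ p.word.reverse)) ha rfl hT ∈ q.fibre (cancel k σ γ)),
    ∀ (N : ℕ), σ.length < N → ∀ γ (ξ : p.fibre γ),
      S (vec p ξ) = ∑ k ∈ Finset.range N, vec q ⟨_, hm k γ ξ⟩

/-- `S` is multiplication by `y` on the right. -/
def IsMulRight (y : P.V b) (hb : b = γ ++ t₂) (S : p.H →L[ℂ] q.H) : Prop :=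
  ∃ (hT : q.word.reverse = t₂ ++ p.word.reverse) (hm : ∀ k σ (ξ : p.fibre σ),
      mulAt k (ξ : P.V (σ ++ p.word.reverse)) y rfl hb hT ∈ q.fibre (cancel k σ γ)),
    ∀ (N : ℕ), γ.length < N → ∀ σ (ξ : p.fibre σ),
      S (vec p ξ) = ∑ k ∈ Finset.range N, vec q ⟨_, hm k σ ξ⟩

theorem clm_ext {E : Type*} [NormedAddCommGroup E] [NormedSpace ℂ E] {S T : p.H →L[ℂ] E}
    (h : ∀ γ (ξ : p.fibre γ), S (vec p ξ) = T (vec p ξ)) : S = T := by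
  classical
  refine lp.continuousLinearMap_ext fun γ ξ => ?_
  rw [← vec_eq]
  exact h γ ξ

/-- Multiplications on the left and on the right commute. -/
theorem IsMulLeft.comp_comm {x : P.V a} {z : P.V c} {ha : a = σ ++ t₁} {hc : c = γ ++ t₃}
    {A : p.H →L[ℂ] q.H} {A' : r.H →L[ℂ] s.H} {B : p.H →L[ℂ] r.H} {B' : q.H →L[ℂ] s.H}
    (hA : IsMulLeft x ha A) (hA' : IsMulLeft x ha A') (hB : IsMulRight z hc B)
    (hB' : IsMulRight z hc B') : B' ∘L A = A' ∘L B := by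
  obtain ⟨h₁, m₁, hA⟩ := hA
  obtain ⟨h₂, m₂, hA'⟩ := hA'
  obtain ⟨h₃, m₃, hB⟩ := hB
  obtain ⟨h₄, m₄, hB'⟩ := hB'
  refine clm_ext fun τ ξ => coord_injective ?_
  let N := σ.length + γ.length + τ.length + 1
  have e₁ : σ.length < N := by omega
  have e₂ : τ.length < N := by omega
  have e₃ : γ.length < N := by omega
  rw [ContinuousLinearMap.comp_apply, ContinuousLinearMap.comp_apply, hA N e₁, hB N e₃]
  simp only [map_sum, hA' N e₁, hB' N e₃, coord_vec]
  exact sum_mulAt_mulAt x (ξ : P.V (τ ++ p.word.reverse)) z ha rfl hc h₁ h₃ h₄ h₂ e₁ e₂ e₃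

/-- The left multiplication by `x` on `H_p`. -/
theorem exists_leftMulOp (p : Projection P) (x : P.V σ) :
    ∃ S : p.H →L[ℂ] p.H, IsMulLeft x (List.append_nil σ).symm S :=
  have hT : p.word.reverse = p.word.reverse ++ [] := (List.append_nil _).symm
  have hm (k : ℕ) (γ : Word L) (ξ : p.fibre γ) := mulAt_mem_left (σ := σ) (t₁ := []) (ξ := (ξ : P.V (γ ++ p.word.reverse))) k x
    (List.append_nil σ).symm rfl rfl hT ξ.2
  (exists_mul_left p p x _ hT hm).imp fun _ h => ⟨hT, hm, h⟩

theorem exists_rightMulOp (p : Projection P) (y : P.V γ) :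
    ∃ S : p.H →L[ℂ] p.H, IsMulRight y (List.append_nil γ).symm S :=
  have hT : p.word.reverse = [] ++ p.word.reverse := rfl
  have hm (k : ℕ) (σ : Word L) (ξ : p.fibre σ) := mulAt_mem_right (γ := γ) (t₂ := []) (ξ := (ξ : P.V (σ ++ p.word.reverse))) k y
    rfl (List.append_nil γ).symm rfl hT ξ.2
  (exists_mul_right p p y _ hT hm).imp fun _ h => ⟨hT, hm, h⟩

/-- In contrast to the multiplication operators on `H_p`, the strings of `p` sit here on the fixed
factor `η` and not on the variable vector. -/
theorem exists_leftVec (η : p.fibre σ) :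
    ∃ S : P.L2 →L[ℂ] p.H, IsMulLeft (η : P.V (σ ++ p.word.reverse)) rfl S :=
  have hT : p.word.reverse = (Projection.unit P).word.reverse ++ p.word.reverse := rfl
  have hm (k : ℕ) (γ : Word L) (ξ : (Projection.unit P).fibre γ) :=
    mulAt_mem_right (γ := γ) (ξ := (η : P.V (σ ++ p.word.reverse))) k
      (ξ : P.V (γ ++ (Projection.unit P).word.reverse)) rfl rfl rfl hT η.2
  (exists_mul_left _ p _ _ hT hm).imp fun _ h => ⟨hT, hm, h⟩

theorem exists_rightVec (η : p.fibre γ) :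
    ∃ S : P.L2 →L[ℂ] p.H, IsMulRight (η : P.V (γ ++ p.word.reverse)) rfl S :=
  have hT : p.word.reverse = p.word.reverse ++ (Projection.unit P).word.reverse :=
    (List.append_nil _).symm
  have hm (k : ℕ) (σ : Word L) (ξ : (Projection.unit P).fibre σ) :=
    mulAt_mem_left (σ := σ) (ξ := (η : P.V (γ ++ p.word.reverse))) k
      (ξ : P.V (σ ++ (Projection.unit P).word.reverse)) rfl rfl rfl hT η.2
  (exists_mul_right _ p _ _ hT hm).imp fun _ h => ⟨hT, hm, h⟩

/-- The left multiplication by `x` on `H_p`. -/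
def leftMulOp (p : Projection P) (x : P.V σ) : p.H →L[ℂ] p.H := (exists_leftMulOp p x).choose

/-- The right multiplication by `y` on `H_p`. -/
def rightMulOp (p : Projection P) (y : P.V γ) : p.H →L[ℂ] p.H := (exists_rightMulOp p y).choose

/-- The map `ζ ↦ η ⋆ ζ` from `L²(M)` to `H_p`. -/
def leftVec (η : p.fibre σ) : P.L2 →L[ℂ] p.H := (exists_leftVec η).choose

/-- The map `ζ ↦ ζ ⋆ η` from `L²(M)` to `H_p`. -/
def rightVec (η : p.fibre γ) : P.L2 →L[ℂ] p.H := (exists_rightVec η).choose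

theorem isMulLeft_leftMulOp (p : Projection P) (x : P.V σ) :
    IsMulLeft x (List.append_nil σ).symm (leftMulOp p x) := (exists_leftMulOp p x).choose_spec

theorem isMulRight_rightMulOp (p : Projection P) (y : P.V γ) :
    IsMulRight y (List.append_nil γ).symm (rightMulOp p y) := (exists_rightMulOp p y).choose_spec

theorem isMulLeft_leftVec (η : p.fibre σ) : IsMulLeft (η : P.V (σ ++ p.word.reverse)) rfl (leftVec η) :=
  (exists_leftVec η).choose_spec

theorem isMulRight_rightVec (η : p.fibre γ) :
    IsMulRight (η : P.V (γ ++ p.word.reverse)) rfl (rightVec η) := (exists_rightVec η).choose_spec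

theorem rightMulOp_comp_leftMulOp (p : Projection P) (x : P.V σ) (y : P.V γ) :
    rightMulOp p y ∘L leftMulOp p x = leftMulOp p x ∘L rightMulOp p y :=
  (isMulLeft_leftMulOp p x).comp_comm (isMulLeft_leftMulOp p x) (isMulRight_rightMulOp p y)
    (isMulRight_rightMulOp p y)

theorem rightVec_comp_leftMulOp (x : P.V σ) (η : p.fibre γ) :
    rightVec η ∘L leftMulOp (Projection.unit P) x = leftMulOp p x ∘L rightVec η :=
  (isMulLeft_leftMulOp _ x).comp_comm (isMulLeft_leftMulOp p x) (isMulRight_rightVec η)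
    (isMulRight_rightVec η)

theorem rightMulOp_comp_leftVec (η : p.fibre σ) (y : P.V γ) :
    rightMulOp p y ∘L leftVec η = leftVec η ∘L rightMulOp (Projection.unit P) y :=
  (isMulLeft_leftVec η).comp_comm (isMulLeft_leftVec η) (isMulRight_rightMulOp _ y)
    (isMulRight_rightMulOp p y)

/-- Prescribed components on the degree spaces determine a bounded operator, and `leftMulOp` has
them. So the quantifiers over operators in the definitions of `M` and of module maps concern one
operator. -/
theorem isLeftMul_iff {x : P.V σ} {S : p.H →L[ℂ] p.H} : IsLeftMul p x S ↔ S = leftMulOp p x := by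
  have h1 : IsLeftMul p x (leftMulOp p x) := fun γ ξ τ => by
    obtain ⟨hT, hm, h⟩ := isMulLeft_leftMulOp p x
    rw [leftMul_eq x _ (N := σ.length + γ.length + 1) (by omega)]
    have := congrFun (congrArg (coord p) (h (σ.length + γ.length + 1) (by omega) γ ξ)) τ
    simp only [map_sum, coord_vec, Finset.sum_apply] at this
    exact this
  refine ⟨fun h => clm_ext fun γ ξ => coord_injective (funext fun τ => ?_), fun h => h ▸ h1⟩
  exact (h γ ξ τ).trans (h1 γ ξ τ).symm

theorem isRightMul_iff {y : P.V γ} {S : p.H →L[ℂ] p.H} : IsRightMul p y S ↔ S = rightMulOp p y := by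
  have h1 : IsRightMul p y (rightMulOp p y) := fun σ ξ τ => by
    obtain ⟨hT, hm, h⟩ := isMulRight_rightMulOp p y
    rw [rightMul_eq _ y (N := γ.length + 1) (by omega)]
    have := congrFun (congrArg (coord p) (h (γ.length + 1) (by omega) σ ξ)) τ
    simp only [map_sum, coord_vec, Finset.sum_apply] at this
    exact this
  refine ⟨fun h => clm_ext fun γ ξ => coord_injective (funext fun τ => ?_), fun h => h ▸ h1⟩
  exact (h γ ξ τ).trans (h1 γ ξ τ).symm

theorem isLeftModuleMap_iff {R : P.L2 →L[ℂ] p.H} : IsLeftModuleMap p R ↔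
    ∀ (σ : Word L) (x : P.V σ), R ∘L leftMulOp (Projection.unit P) x = leftMulOp p x ∘L R := by
  refine forall₂_congr fun σ x => ?_
  simp only [isLeftMul_iff]
  exact ⟨fun h => h _ _ rfl rfl, by rintro h _ _ rfl rfl; exact h⟩

theorem isRightModuleMap_iff {R : P.L2 →L[ℂ] p.H} : IsRightModuleMap p R ↔
    ∀ (σ : Word L) (x : P.V σ), R ∘L rightMulOp (Projection.unit P) x = rightMulOp p x ∘L R := by
  refine forall₂_congr fun σ x => ?_
  simp only [isRightMul_iff]
  exact ⟨fun h => h _ _ rfl rfl, by rintro h _ _ rfl rfl; exact h⟩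

/-- Multiplying by `η` on the right commutes with left multiplications, by associativity. These maps
supply enough left bounded vectors. -/
theorem isLeftModuleMap_rightVec (η : p.fibre γ) : IsLeftModuleMap p (rightVec η) :=
  isLeftModuleMap_iff.2 fun _ x => rightVec_comp_leftMulOp x η

theorem isRightModuleMap_leftVec (η : p.fibre γ) : IsRightModuleMap p (leftVec η) :=
  isRightModuleMap_iff.2 fun _ x => (rightMulOp_comp_leftVec η x).symm

end FactorPlanarAlgebra
end

/-! ### The vacuum vector -/

noncomputable section

namespace PlanarAlgebra

open PlanarAlg

variable {L : Type u} {P : PlanarAlgebra.{u, v} L} {a b c s t : Word L}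

theorem one_nil_eqv : Eqv P [] [] [⟨[], .box [] (P.one []), []⟩] [] := Eqv.box_Z _

theorem ins_one (x : P.V a) {e : P.V []} (he : e = P.one []) (hb : [] = [] ++ ([] : Word L))
    (ha : a = s ++ ([] : Word L).reverse ++ t)
    (hc : a = s ++ [] ++ t) : ins x e s [] [] t ha hb hc = x := by
  refine eq_of_eqv ((ins_eqv_right x e s [] [] t ha hb hc (he ▸ one_nil_eqv)).trans ?_)
  exact Eqv.refl (reads_box x (by simp) rfl)

theorem one_ins (y : P.V b) {e : P.V []} (he : e = P.one []) (ha : [] = [] ++ ([] : Word L).reverse ++ [])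
    (hb : b = [] ++ b) (hc : b = [] ++ b ++ []) : ins e y [] [] b [] ha hb hc = y := by
  refine eq_of_eqv ((ins_eqv_left e y [] [] b [] ha hb hc (he ▸ one_nil_eqv)).trans ?_)
  exact Eqv.refl (reads_box y (by simp) rfl)

end PlanarAlgebra

namespace FactorPlanarAlgebra

open PlanarAlg PlanarAlgebra

variable {L : Type u} {P : FactorPlanarAlgebra.{u, v} L} {p q r s : Projection P}
  {a b c σ γ γ' t t₁ t₂ t₃ T : Word L}

/-- Since the word of `e` is empty, only the term without joined strings survives, and inserting the
empty diagram changes nothing. -/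
theorem sum_mulAt_one (x : P.V a) {e : P.V []} (he : e = P.one []) (ha : a = σ ++ t)
    (hb : [] = [] ++ ([] : Word L)) (hT : T = [] ++ t) (h : a = σ ++ T) (N : ℕ) :
    ∑ k ∈ Finset.range (N + 1), sg (mulAt k x e ha hb hT) = sg (P.castV h x) := by
  rw [sum_sg_mulAt_eq (N := 1) _ _ _ _ _ (by omega) (by simp), Finset.sum_range_one]
  obtain rfl : T = t := hT
  subst h
  change _ = sg x
  refine sg_congr (by simp [cancel]) ((mulAt_heq (s := σ) (w := []) (r := []) (m := []) (d := σ ++ T) rfl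
    (by simp) rfl rfl x e ha hb rfl (by simp) rfl (by simp)).trans ?_)
  exact heq_of_eq (ins_one _ he _ _ _)

theorem sum_one_mulAt (y : P.V b) {e : P.V []} (he : e = P.one []) (ha : [] = [] ++ ([] : Word L))
    (hb : b = γ ++ t) (hT : T = t ++ []) (h : b = γ ++ T) (N : ℕ) :
    ∑ k ∈ Finset.range (N + 1), sg (mulAt k e y ha hb hT) = sg (P.castV h y) := by
  rw [sum_sg_mulAt_eq (N := 1) _ _ _ _ _ (by omega) (by simp), Finset.sum_range_one]
  obtain rfl : T = t := by simpa using hT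
  subst h
  change _ = sg y
  refine sg_congr (by simp [cancel]) ((mulAt_heq (s := []) (w := []) (r := γ) (m := γ ++ T) (d := γ ++ T)
    rfl (by simp) rfl rfl e y ha hb hT rfl rfl (by simp)).trans ?_)
  exact heq_of_eq (one_ins _ he _ _ _)

theorem leftVec_vacuum (η : p.fibre σ) : leftVec η P.vacuum = vec p η := by
  obtain ⟨hT, hm, h⟩ := isMulLeft_leftVec η
  apply coord_injective
  rw [vacuum, h _ (Nat.lt_succ_self _)]
  simp only [map_sum, coord_vec]
  exact sum_mulAt_one _ rfl _ _ _ rfl _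

theorem rightVec_vacuum (η : p.fibre γ) : rightVec η P.vacuum = vec p η := by
  obtain ⟨hT, hm, h⟩ := isMulRight_rightVec η
  apply coord_injective
  rw [vacuum, h _ (Nat.lt_succ_self _)]
  simp only [map_sum, coord_vec]
  exact sum_one_mulAt _ rfl _ _ _ rfl _

theorem mem_fibre_unit (x : P.V (γ ++ (Projection.unit P).word.reverse)) : x ∈ (Projection.unit P).fibre γ :=
  comp_one (P := P.toPlanarAlgebra) (β := []) x

/-- The element `x` as a vector of `L²(M)`. -/
def vec₀ (x : P.V σ) : P.L2 :=
  vec (Projection.unit P) (γ := σ) ⟨P.castV (List.append_nil σ).symm x, mem_fibre_unit _⟩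

theorem leftMulOp_vacuum (x : P.V σ) : leftMulOp (Projection.unit P) x P.vacuum = vec₀ x := by
  obtain ⟨hT, hm, h⟩ := isMulLeft_leftMulOp (Projection.unit P) x
  apply coord_injective
  rw [vacuum, h _ (Nat.lt_succ_self _)]
  simp only [vec₀, map_sum, coord_vec]
  exact sum_mulAt_one _ rfl _ _ _ _ _

theorem rightMulOp_vacuum (x : P.V σ) : rightMulOp (Projection.unit P) x P.vacuum = vec₀ x := by
  obtain ⟨hT, hm, h⟩ := isMulRight_rightMulOp (Projection.unit P) x
  apply coord_injective
  rw [vacuum, h _ (Nat.lt_succ_self _)]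
  simp only [vec₀, map_sum, coord_vec]
  exact sum_one_mulAt _ rfl _ _ _ _ _

theorem vec_ext {f g : p.H} (h : ∀ γ (ζ : p.fibre γ), inner ℂ (vec p ζ) f = inner ℂ (vec p ζ) g) : f = g := by
  classical
  ext γ
  congr 1
  refine ext_inner_left ℂ fun ζ => ?_
  have := h γ ζ
  rwa [vec_eq, lp.inner_single_left, lp.inner_single_left] at this

theorem inner_vec_left (ζ : p.fibre γ) (f : p.H) :
    inner ℂ (vec p ζ) f = inner ℂ (ζ : P.V (γ ++ p.word.reverse)) (coord p f γ) := by
  classical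
  rw [vec_eq, lp.inner_single_left]
  rfl

theorem inner_vec_right (ζ : p.fibre γ) (f : p.H) :
    inner ℂ f (vec p ζ) = inner ℂ (coord p f γ) (ζ : P.V (γ ++ p.word.reverse)) := by
  classical
  rw [vec_eq, lp.inner_single_right]
  rfl

/-- An operator is determined to be the adjoint of another by matrix entries. -/
theorem eq_adjoint_of_inner {A B : p.H →L[ℂ] p.H} (h : ∀ γ (ξ : p.fibre γ) γ' (ζ : p.fibre γ'),
    inner ℂ (coord p (A (vec p ξ)) γ') (ζ : P.V (γ' ++ p.word.reverse)) =
      inner ℂ (ξ : P.V (γ ++ p.word.reverse)) (coord p (B (vec p ζ)) γ)) : star A = B := by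
  refine clm_ext fun γ' ζ => vec_ext fun γ ξ => ?_
  rw [ContinuousLinearMap.star_eq_adjoint, ContinuousLinearMap.adjoint_inner_right, inner_vec_left,
    inner_vec_right, h]

end FactorPlanarAlgebra
end

/-! ### Adjoints of the multiplication operators -/

noncomputable section

namespace FactorPlanarAlgebra

open PlanarAlg PlanarAlgebra

variable {L : Type u} {P : FactorPlanarAlgebra.{u, v} L} {p q r s : Projection P}
  {a b c σ γ γ' τ t t₁ t₂ t₃ T : Word L}

theorem sg_mulAt_apply_of_not {k : ℕ} (x : P.V a) (y : P.V b) (ha : a = σ ++ t₁) (hb : b = γ ++ t₂)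
    (hT : T = t₂ ++ t₁) (h : ¬ (Cancels k σ γ ∧ τ = cancel k σ γ)) : sg (mulAt k x y ha hb hT) τ = 0 := by
  by_cases hc : Cancels k σ γ
  · exact sg_of_ne (fun e => h ⟨hc, e⟩) _
  · rw [mulAt_of_not hc, sg_zero]; rfl

theorem sg_mulAt_apply {k : ℕ} {s w r m : Word L} (hk : w.length = k) (hσ : σ = s ++ w.reverse)
    (hγ : γ = w ++ r) (hm : m = r ++ t₂) (hτ : τ = s ++ r) (x : P.V a) (y : P.V b) (ha : a = σ ++ t₁)
    (hb : b = γ ++ t₂) (hT : T = t₂ ++ t₁) (ha' : a = s ++ w.reverse ++ t₁) (hb' : b = w ++ m)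
    (hd : τ ++ T = s ++ m ++ t₁) :
    sg (mulAt k x y ha hb hT) τ = ins x y s w m t₁ ha' hb' hd := by
  rw [sg_congr (γ' := τ) (by subst hk hσ hγ hτ; exact cancel_eq _ _ _)
    (mulAt_heq hk hσ hγ hm x y ha hb hT ha' hb' hd), sg_self]

/-- In the closed diagram, `k` strings of `x` meet `ξ` and the other `|σ| - k` meet `ζ`. Reading it
as a product of `x*` with `ζ` exchanges the two numbers. -/
theorem inner_sg_mulAt_left {k : ℕ} (x : P.V σ) (ξ : P.V (γ ++ t)) (ζ : P.V (γ' ++ t)) (hk : k ≤ σ.length)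
    (h₁ : σ = σ ++ []) (h₂ : σ.reverse = σ.reverse ++ []) (hT : t = t ++ []) :
    inner ℂ (sg (mulAt k x ξ h₁ rfl hT) γ') ζ =
      inner ℂ ξ (sg (mulAt (σ.length - k) (P.st x) ζ h₂ rfl hT) γ) := by
  by_cases hA : Cancels k σ γ ∧ γ' = cancel k σ γ
  · obtain ⟨hc, rfl⟩ := hA
    obtain ⟨s, w, r, rfl, rfl, rfl⟩ := cancels_iff.1 hc
    rw [sg_mulAt_apply (s := s) (w := w) (r := r) (m := r ++ t) rfl rfl rfl rfl (cancel_eq _ _ _) x ξ h₁ rfl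
      hT (by simp) (by simp) (by simp [cancel_eq]),
      sg_mulAt_apply (s := w) (w := s) (r := r) (m := r ++ t) (by simp) (by simp) (cancel_eq _ _ _) rfl rfl
        (P.st x) ζ h₂ rfl hT (by simp) (by simp [cancel_eq]) (by simp), inner_eq, inner_eq]
    exact innerV_ins_left x ξ ζ s w (r ++ t) _ _ _ _ _ _
  · rw [sg_mulAt_apply_of_not _ _ _ _ _ hA, sg_mulAt_apply_of_not, inner_zero_left, inner_zero_right]
    rintro ⟨hc, rfl⟩
    obtain ⟨s, w, r, h1, h2, rfl⟩ := cancels_iff.1 hc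
    obtain rfl : σ = w ++ s.reverse := by
      rw [← List.reverse_reverse σ, h2]; simp
    have h3 : s.length = k := by simp at h1 hk; omega
    refine hA ⟨cancels_iff.2 ⟨w, s, r, h3, rfl, ?_⟩, ?_⟩
    · rw [← h1, h2, cancel_eq]
    · rw [← h1, h2, cancel_eq, ← h3, cancel_eq]

theorem inner_sg_mulAt_right {k : ℕ} (ξ : P.V (σ ++ t)) (y : P.V γ) (ζ : P.V (τ ++ t)) (hk : k ≤ γ.length)
    (h₁ : γ = γ ++ []) (h₂ : γ.reverse = γ.reverse ++ []) (hT : t = [] ++ t) :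
    inner ℂ (sg (mulAt k ξ y rfl h₁ hT) τ) ζ =
      inner ℂ ξ (sg (mulAt (γ.length - k) ζ (P.st y) rfl h₂ hT) σ) := by
  by_cases hA : Cancels k σ γ ∧ τ = cancel k σ γ
  · obtain ⟨hc, rfl⟩ := hA
    obtain ⟨s, w, r, rfl, rfl, rfl⟩ := cancels_iff.1 hc
    rw [sg_mulAt_apply (s := s) (w := w) (r := r) (m := r) rfl rfl rfl (by simp) (cancel_eq _ _ _) ξ y rfl h₁
      hT rfl (by simp) (by simp [cancel_eq]),
      sg_mulAt_apply (s := s) (w := r.reverse) (r := w.reverse) (m := w.reverse) (by simp)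
        (by rw [cancel_eq]; simp) (by simp) (by simp) rfl
        ζ (P.st y) rfl h₂ hT (by simp [cancel_eq]) (by simp) (by simp), inner_eq, inner_eq]
    exact innerV_ins_right ξ y ζ s w r t _ _ _ _ _
  · rw [sg_mulAt_apply_of_not _ _ _ _ _ hA, sg_mulAt_apply_of_not, inner_zero_left, inner_zero_right]
    rintro ⟨hc, rfl⟩
    obtain ⟨s, w, r, h1, rfl, h2⟩ := cancels_iff.1 hc
    obtain rfl : γ = r.reverse ++ w.reverse := by
      rw [← List.reverse_reverse γ, h2]; simp
    have h3 : r.reverse.length = k := by simp at h1 hk ⊢; omega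
    refine hA ⟨cancels_iff.2 ⟨s, r.reverse, w.reverse, h3, ?_, rfl⟩, ?_⟩
    · rw [← h1, h2, cancel_eq]; simp
    · rw [← h1, h2, cancel_eq, ← h3]
      conv_rhs => rw [show s ++ r = s ++ r.reverse.reverse by simp, cancel_eq]

theorem star_leftMulOp (p : Projection P) (x : P.V σ) : star (leftMulOp p x) = leftMulOp p (P.st x) := by
  refine eq_adjoint_of_inner fun γ ξ γ' ζ => ?_
  obtain ⟨hT, hm, h⟩ := isMulLeft_leftMulOp p x
  obtain ⟨hT', hm', h'⟩ := isMulLeft_leftMulOp p (P.st x)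
  rw [h (σ.length + 1) (Nat.lt_succ_self _), h' (σ.length + 1) (by simp)]
  simp only [map_sum, coord_vec, Finset.sum_apply, sum_inner, inner_sum]
  -- Joining `k` strings is adjoint to joining `|σ| - k`, so one of the sums is taken in reverse
  -- order.
  rw [← Finset.sum_range_reflect]
  refine Finset.sum_congr rfl fun k hk => ?_
  rw [inner_sg_mulAt_left x _ _ (by simp) _ (List.append_nil _).symm hT]
  simp at hk
  rw [show σ.length - (σ.length + 1 - 1 - k) = k by omega]

theorem star_rightMulOp (p : Projection P) (y : P.V γ) : star (rightMulOp p y) = rightMulOp p (P.st y) := by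
  refine eq_adjoint_of_inner fun γ₁ ξ γ' ζ => ?_
  obtain ⟨hT, hm, h⟩ := isMulRight_rightMulOp p y
  obtain ⟨hT', hm', h'⟩ := isMulRight_rightMulOp p (P.st y)
  rw [h (γ.length + 1) (Nat.lt_succ_self _), h' (γ.length + 1) (by simp)]
  simp only [map_sum, coord_vec, Finset.sum_apply, sum_inner, inner_sum]
  rw [← Finset.sum_range_reflect]
  refine Finset.sum_congr rfl fun k hk => ?_
  rw [inner_sg_mulAt_right _ y _ (by simp) _ (List.append_nil _).symm hT]
  simp at hk
  rw [show γ.length - (γ.length + 1 - 1 - k) = k by omega]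

end FactorPlanarAlgebra
end

/-! ### Extending operators through a family of intertwiners -/

noncomputable section

open scoped InnerProductSpace Topology

namespace Intertwine

variable {ι H₀ H : Type*} [NormedAddCommGroup H₀] [InnerProductSpace ℂ H₀]
  [NormedAddCommGroup H] [InnerProductSpace ℂ H] (R : ι → H₀ →L[ℂ] H)

/-- Finite sums of values of the maps `R i`. -/
def ev : (ι →₀ H₀) →ₗ[ℂ] H := Finsupp.lsum ℂ fun i => (R i).toLinearMap

variable {R}

theorem ev_single (i : ι) (v : H₀) : ev R (Finsupp.single i v) = R i v := by
  simp [ev]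

/-- The operator `a` on each summand. -/
abbrev diag (ι : Type*) (a : H₀ →L[ℂ] H₀) : (ι →₀ H₀) →ₗ[ℂ] (ι →₀ H₀) :=
  Finsupp.mapRange.linearMap a.toLinearMap

theorem inner_ev_diag {a b : H₀ →L[ℂ] H₀}
    (h : ∀ i j v w, ⟪R i (a v), R j w⟫_ℂ = ⟪R i v, R j (b w)⟫_ℂ) (f g : ι →₀ H₀) :
    ⟪ev R (diag ι a f), ev R g⟫_ℂ = ⟪ev R f, ev R (diag ι b g)⟫_ℂ := by
  induction f using Finsupp.induction_linear with
  | zero => simp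
  | add f f' hf hf' => simp only [map_add, inner_add_left, hf, hf']
  | single i v =>
    induction g using Finsupp.induction_linear with
    | zero => simp
    | add g g' hg hg' => simp only [map_add, inner_add_right, hg, hg']
    | single j w => simp [ev_single, h]

variable (R) in
/-- `T` is the action of `a` through the maps `R i`. -/
def Acts (a : H₀ →L[ℂ] H₀) (T : H →L[ℂ] H) : Prop := ∀ i v, T (R i v) = R i (a v)

theorem Acts.one : Acts R 1 1 := fun _ _ => rfl

theorem Acts.mul {a b : H₀ →L[ℂ] H₀} {S T : H →L[ℂ] H} (hS : Acts R a S) (hT : Acts R b T) :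
    Acts R (a * b) (S * T) := fun i v => by
  change S (T (R i v)) = R i (a (b v))
  rw [hT, hS]

theorem Acts.add {a b : H₀ →L[ℂ] H₀} {S T : H →L[ℂ] H} (hS : Acts R a S) (hT : Acts R b T) :
    Acts R (a + b) (S + T) := fun i v => by
  change S (R i v) + T (R i v) = R i (a v + b v)
  rw [hT, hS, map_add]

theorem Acts.smul (z : ℂ) {a : H₀ →L[ℂ] H₀} {S : H →L[ℂ] H} (hS : Acts R a S) :
    Acts R (z • a) (z • S) := fun i v => by
  change z • S (R i v) = R i (z • a v)
  rw [hS, map_smul]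

theorem ext_of_dense (hR : DenseRange (ev R)) {E : Type*} [NormedAddCommGroup E] [NormedSpace ℂ E]
    {S T : H →L[ℂ] E} (h : ∀ i v, S (R i v) = T (R i v)) : S = T := by
  have h1 : S.toLinearMap ∘ₗ ev R = T.toLinearMap ∘ₗ ev R := by
    ext i v
    simp [ev_single, h]
  ext x
  exact congrFun (hR.equalizer S.continuous T.continuous (funext fun f => LinearMap.congr_fun h1 f)) x

theorem Acts.unique (hR : DenseRange (ev R)) {a : H₀ →L[ℂ] H₀} {S T : H →L[ℂ] H} (hS : Acts R a S)
    (hT : Acts R a T) : S = T := ext_of_dense hR fun i v => (hS i v).trans (hT i v).symm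

/-- A net of uniformly Lipschitz functions converges when it does so on a dense set. -/
theorem tendsto_of_denseRange {α κ G : Type*} [SeminormedAddCommGroup G] {l : Filter κ} {D : α → G}
    (hD : DenseRange D)
    {φ : κ → G → ℂ} {φ₀ : G → ℂ} {C : ℝ} (hC : 0 ≤ C) (h : ∀ᶠ n in l, ∀ x y, ‖φ n x - φ n y‖ ≤ C * ‖x - y‖)
    (h₀ : ∀ x y, ‖φ₀ x - φ₀ y‖ ≤ C * ‖x - y‖)
    (ht : ∀ a, Filter.Tendsto (fun n => φ n (D a)) l (𝓝 (φ₀ (D a)))) (x : G) :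
    Filter.Tendsto (fun n => φ n x) l (𝓝 (φ₀ x)) := by
  rw [Metric.tendsto_nhds]
  intro ε hε
  -- Three errors of at most `ε / 3` each; `C + 1` in place of `C` avoids a division by zero.
  obtain ⟨a, ha⟩ := hD.exists_dist_lt x (ε := ε / (3 * (C + 1))) (by positivity)
  have hd : C * ‖x - D a‖ ≤ ε / 3 := by
    rw [dist_eq_norm, lt_div_iff₀ (by positivity)] at ha
    nlinarith [norm_nonneg (x - D a)]
  filter_upwards [h, Metric.tendsto_nhds.1 (ht a) (ε / 3) (by positivity)] with n hn hn'
  have e1 := (hn x (D a)).trans hd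
  have e2 := (h₀ (D a) x).trans ((congrArg (C * ·) (norm_sub_rev _ _)).le.trans hd)
  rw [dist_eq_norm] at hn' ⊢
  calc ‖φ n x - φ₀ x‖ = ‖(φ n x - φ n (D a)) + (φ n (D a) - φ₀ (D a)) + (φ₀ (D a) - φ₀ x)‖ := by
        congr 1; ring
    _ ≤ ‖φ n x - φ n (D a)‖ + ‖φ n (D a) - φ₀ (D a)‖ + ‖φ₀ (D a) - φ₀ x‖ := norm_add₃_le
    _ < ε := by linarith

/-- A bounded net converges weakly when it does so on a total set. -/
theorem tendsto_of_dense {κ : Type*} {l : Filter κ} (hR : DenseRange (ev R)) {B : κ → H →L[ℂ] H}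
    {B₀ : H →L[ℂ] H} (hB : ∀ᶠ n in l, ‖B n‖ ≤ 1)
    (h : ∀ i v j w, Filter.Tendsto (fun n => ⟪R i v, B n (R j w)⟫_ℂ) l (𝓝 ⟪R i v, B₀ (R j w)⟫_ℂ)) (ξ η : H) :
    Filter.Tendsto (fun n => ⟪ξ, B n η⟫_ℂ) l (𝓝 ⟪ξ, B₀ η⟫_ℂ) := by
  have h1 (f g : ι →₀ H₀) :
      Filter.Tendsto (fun n => ⟪ev R f, B n (ev R g)⟫_ℂ) l (𝓝 ⟪ev R f, B₀ (ev R g)⟫_ℂ) := by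
    induction f using Finsupp.induction_linear with
    | zero => simpa using tendsto_const_nhds
    | add f f' hf hf' => simpa only [map_add, inner_add_left] using hf.add hf'
    | single i v =>
      induction g using Finsupp.induction_linear with
      | zero => simpa using tendsto_const_nhds
      | add g g' hg hg' => simpa only [map_add, inner_add_right] using hg.add hg'
      | single j w => simpa only [ev_single] using h i v j w
  have hb (S : H →L[ℂ] H) (ξ x y : H) : ‖⟪ξ, S x⟫_ℂ - ⟪ξ, S y⟫_ℂ‖ ≤ ‖ξ‖ * ‖S‖ * ‖x - y‖ := by
    rw [← inner_sub_right, ← map_sub, mul_assoc]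
    exact (norm_inner_le_norm _ _).trans (by gcongr; exact S.le_opNorm _)
  have hb' (S : H →L[ℂ] H) (η x y : H) : ‖⟪x, S η⟫_ℂ - ⟪y, S η⟫_ℂ‖ ≤ ‖η‖ * ‖S‖ * ‖x - y‖ := by
    rw [← inner_sub_left, mul_comm, mul_comm ‖η‖]
    exact (norm_inner_le_norm _ _).trans (by gcongr; exact S.le_opNorm _)
  have h2 (f : ι →₀ H₀) (η : H) :
      Filter.Tendsto (fun n => ⟪ev R f, B n η⟫_ℂ) l (𝓝 ⟪ev R f, B₀ η⟫_ℂ) := by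
    refine tendsto_of_denseRange (φ := fun n η => ⟪ev R f, B n η⟫_ℂ) (φ₀ := fun η => ⟪ev R f, B₀ η⟫_ℂ)
      hR (C := ‖ev R f‖ * (1 + ‖B₀‖)) (by positivity) (hB.mono fun n hn x y => ?_) (fun x y => ?_) (h1 f) η
    · exact (hb _ _ _ _).trans (by gcongr; linarith [norm_nonneg B₀])
    · exact (hb _ _ _ _).trans (by gcongr; linarith)
  refine tendsto_of_denseRange (φ := fun n ξ => ⟪ξ, B n η⟫_ℂ) (φ₀ := fun ξ => ⟪ξ, B₀ η⟫_ℂ)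
    hR (C := ‖η‖ * (1 + ‖B₀‖)) (by positivity) (hB.mono fun n hn x y => ?_) (fun x y => ?_) (h2 · η) ξ
  · exact (hb' _ _ _ _).trans (by gcongr; linarith [norm_nonneg B₀])
  · exact (hb' _ _ _ _).trans (by gcongr; linarith)

variable [CompleteSpace H₀] [CompleteSpace H]

variable (R) in
/-- `a` commutes with the operators `R j† R i`. -/
def Comm (a : H₀ →L[ℂ] H₀) : Prop := ∀ i j, Commute a (ContinuousLinearMap.adjoint (R j) ∘L R i)

theorem Comm.inner {a : H₀ →L[ℂ] H₀} (h : Comm R a) (i j : ι) (v w : H₀) :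
    ⟪R i (a v), R j w⟫_ℂ = ⟪R i v, R j (star a w)⟫_ℂ := by
  rw [← ContinuousLinearMap.adjoint_inner_left, ← ContinuousLinearMap.adjoint_inner_left (R j),
    ContinuousLinearMap.star_eq_adjoint, ContinuousLinearMap.adjoint_inner_right]
  exact congrArg (⟪·, w⟫_ℂ) (DFunLike.congr_fun (h i j).eq v).symm

theorem Comm.star {a : H₀ →L[ℂ] H₀} (h : Comm R a) : Comm R (star a) := fun i j => by
  have h1 := (h j i).star_star
  rwa [ContinuousLinearMap.star_eq_adjoint (ContinuousLinearMap.adjoint (R i) ∘L R j),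
    ContinuousLinearMap.adjoint_comp, ContinuousLinearMap.adjoint_adjoint] at h1

theorem Comm.mul {a b : H₀ →L[ℂ] H₀} (ha : Comm R a) (hb : Comm R b) : Comm R (a * b) := fun i j =>
  (ha i j).mul_left (hb i j)

/-- The positive square root `k` of `‖a‖² - a* a` commutes with all `R j† R i`, because `a` and `a*`
do. Therefore `‖a‖² ‖Σ R i v_i‖² - ‖Σ R i (a v_i)‖² = ‖Σ R i (k v_i)‖² ≥ 0`. -/
theorem norm_ev_diag_le {a : H₀ →L[ℂ] H₀} (h : Comm R a) (f : ι →₀ H₀) :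
    ‖ev R (diag ι a f)‖ ≤ ‖a‖ * ‖ev R f‖ := by
  let d : H₀ →L[ℂ] H₀ := algebraMap ℝ _ (‖a‖ ^ 2) - Star.star a * a
  have hd : 0 ≤ d := sub_nonneg.2 CStarAlgebra.star_mul_le_algebraMap_norm_sq
  let k := CFC.sqrt d
  have hk : k * k = d := CFC.sqrt_mul_sqrt_self d hd
  have hks : Star.star k = k := (CFC.sqrt_nonneg d).isSelfAdjoint
  have hc : Comm R k := fun i j => by
    refine Commute.cfcₙ_nnreal (Commute.sub_left (Algebra.commute_algebraMap_left _ _) ?_) _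
    exact (h.star.mul h) i j
  have e1 := inner_ev_diag hc.inner f (diag ι k f)
  rw [hks] at e1
  have e2 : ev R (diag ι k (diag ι k f)) =
      ((‖a‖ ^ 2 : ℝ) : ℂ) • ev R f - ev R (diag ι (Star.star a) (diag ι a f)) := by
    rw [← map_smul, ← map_sub]
    congr 1
    ext i
    have := DFunLike.congr_fun hk (f i)
    simpa [d, Algebra.algebraMap_eq_smul_one, -Complex.ofReal_pow, Complex.coe_smul] using this
  have e3 := inner_ev_diag h.inner f (diag ι a f)
  rw [e2, inner_sub_right, inner_smul_right, ← e3] at e1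
  have e4 : ‖ev R (diag ι k f)‖ ^ 2 = ‖a‖ ^ 2 * ‖ev R f‖ ^ 2 - ‖ev R (diag ι a f)‖ ^ 2 := by
    simp only [← inner_self_eq_norm_sq (𝕜 := ℂ)] at *
    rw [e1, map_sub]
    congr 1
    exact Complex.re_ofReal_mul _ _
  refine le_of_sq_le_sq ?_ (by positivity)
  rw [mul_pow]
  have := sq_nonneg ‖ev R (diag ι k f)‖
  linarith

/-- By `norm_ev_diag_le` the assignment `Σ R i v_i ↦ Σ R i (a v_i)` is well defined and bounded on a
dense subspace, so it extends by continuity. -/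
theorem exists_acts (hR : DenseRange (ev R)) {a : H₀ →L[ℂ] H₀} (h : Comm R a) :
    ∃ T : H →L[ℂ] H, ‖T‖ ≤ ‖a‖ ∧ Acts R a T := by
  have hb := norm_ev_diag_le h
  refine ⟨(ev R ∘ₗ diag ι a).extendOfNorm (ev R),
    LinearMap.opNorm_extendOfNorm_le hR (norm_nonneg _) hb, fun i v => ?_⟩
  have := LinearMap.extendOfNorm_eq (f := ev R ∘ₗ diag ι a) hR ⟨_, hb⟩ (Finsupp.single i v)
  simpa [ev_single] using this

theorem Acts.star (hR : DenseRange (ev R)) {a : H₀ →L[ℂ] H₀} (h : Comm R a) {S : H →L[ℂ] H}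
    (hS : Acts R a S) : Acts R (star a) (star S) := by
  have h1 := h.star.inner
  rw [star_star] at h1
  intro i v
  have : innerSL ℂ (Star.star S (R i v)) = innerSL ℂ (R i (Star.star a v)) := by
    refine ext_of_dense hR fun j w => ?_
    rw [innerSL_apply_apply, innerSL_apply_apply, ContinuousLinearMap.star_eq_adjoint,
      ContinuousLinearMap.adjoint_inner_left, hS, h1]
  exact ext_inner_right ℂ fun w => DFunLike.congr_fun this w

/-- Matrix entries between vectors of the form `R i v` are matrix entries of `a n` on `H₀`, because
`⟨R i v, R j (a w)⟩ = ⟨R j† R i v, a w⟩`. The operators `B n` inherit the norm bound, so convergence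
extends from this total set. -/
theorem Acts.tendsto {κ : Type*} {l : Filter κ} (hR : DenseRange (ev R)) {a : κ → H₀ →L[ℂ] H₀}
    {a₀ : H₀ →L[ℂ] H₀} {B : κ → H →L[ℂ] H} {B₀ : H →L[ℂ] H} (hc : ∀ n, Comm R (a n))
    (ha : ∀ᶠ n in l, ‖a n‖ ≤ 1) (hB : ∀ n, Acts R (a n) (B n)) (hB₀ : Acts R a₀ B₀)
    (h : ∀ v w, Filter.Tendsto (fun n => ⟪v, a n w⟫_ℂ) l (𝓝 ⟪v, a₀ w⟫_ℂ)) (ξ η : H) :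
    Filter.Tendsto (fun n => ⟪ξ, B n η⟫_ℂ) l (𝓝 ⟪ξ, B₀ η⟫_ℂ) := by
  refine tendsto_of_dense hR (ha.mono fun n hn => ?_) (fun i v j w => ?_) ξ η
  · obtain ⟨T, h1, h2⟩ := exists_acts hR (hc n)
    rw [(hB n).unique hR h2]
    exact h1.trans hn
  · simp only [(hB _) _ _, hB₀ _ _, ← ContinuousLinearMap.adjoint_inner_left (R j)]
    exact h _ _

end Intertwine
end

/-! ### The conjugation of `L²(M)` -/

noncomputable section

open scoped ENNReal InnerProductSpace

namespace FactorPlanarAlgebra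

open PlanarAlg PlanarAlgebra

variable {L : Type u} {P : FactorPlanarAlgebra.{u, v} L} {p q : Projection P} {σ γ : Word L}

theorem castV_st_castV_st {a b c : Word L} (h : a.reverse = b) (k : b.reverse = c) (e : a = c) (x : P.V a) :
    P.castV k (P.st (P.castV h (P.st x))) = P.castV e x := by
  subst h e
  exact eq_of_heq ((castV_heq _ _).trans (P.st_st x))

theorem castV_zero {a b : Word L} (h : a = b) : P.castV h 0 = 0 := by subst h; rfl

theorem st_heq {a b : Word L} (h : a = b) {x : P.V a} {y : P.V b} (e : x ≍ y) : P.st x ≍ P.st y := by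
  subst h
  rw [eq_of_heq e]

/-- The involution on a degree of `L²(M)`. -/
def conjAt (γ : Word L) (x : (Projection.unit P).fibre γ.reverse) : (Projection.unit P).fibre γ :=
  ⟨P.castV (by simp [Projection.unit]) (P.st (x : P.V (γ.reverse ++ (Projection.unit P).word.reverse))),
    mem_fibre_unit _⟩

theorem inner_conjAt (x y : (Projection.unit P).fibre γ.reverse) :
    ⟪conjAt γ x, conjAt γ y⟫_ℂ = ⟪y, x⟫_ℂ :=
  (innerV_castV _ _ _).trans (innerV_st _ _)

theorem norm_conjAt (x : (Projection.unit P).fibre γ.reverse) : ‖conjAt γ x‖ = ‖x‖ := by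
  rw [@norm_eq_sqrt_re_inner ℂ, @norm_eq_sqrt_re_inner ℂ, inner_conjAt]

/-- The conjugation on `L²(M)`. -/
def conjFun (f : P.L2) : P.L2 :=
  ⟨fun γ => conjAt γ (f γ.reverse), memℓp_gen (by
    simp only [norm_conjAt]
    exact (List.reverse_involutive.toPerm List.reverse).summable_iff.2 ((lp.memℓp f).summable (by simp)))⟩

/-- Reversal of words permutes the degrees, and between corresponding degrees the involution `st`
interchanges the two arguments of the inner product. -/
theorem inner_conjFun (f g : P.L2) : ⟪conjFun f, conjFun g⟫_ℂ = ⟪g, f⟫_ℂ := by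
  rw [lp.inner_eq_tsum, lp.inner_eq_tsum,
    ← (List.reverse_involutive.toPerm List.reverse).tsum_eq (fun γ => ⟪g γ, f γ⟫_ℂ)]
  exact tsum_congr fun γ => inner_conjAt _ _

/-- The conjugation on `L²(M)`. -/
def conj : P.L2 →L⋆[ℂ] P.L2 :=
  LinearMap.mkContinuous
    { toFun := conjFun
      map_add' := fun f g => by
        ext γ : 2
        exact Subtype.ext ((congrArg _ (P.st_add _ _)).trans (castV_add _ _ _))
      map_smul' := fun z f => by
        ext γ : 2
        exact Subtype.ext ((congrArg _ (P.st_smul _ _)).trans (castV_smul _ _ _)) } 1 fun f => by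
    rw [@norm_eq_sqrt_re_inner ℂ, @norm_eq_sqrt_re_inner ℂ _ _ _ _ f, one_mul]
    exact (congrArg (fun z : ℂ => √(RCLike.re z)) (inner_conjFun f f)).le

theorem inner_conj (f g : P.L2) : ⟪conj f, conj g⟫_ℂ = ⟪g, f⟫_ℂ := inner_conjFun f g

theorem conj_conj (f : P.L2) : conj (conj f) = f := by
  ext γ : 2
  refine Subtype.ext ?_
  have k : ∀ {γ' a : Word L} (h : γ.reverse.reverse = γ')
      (e₁ : a.reverse = γ' ++ (Projection.unit P).word.reverse)
      (e₂ : (γ.reverse.reverse ++ (Projection.unit P).word.reverse).reverse = a),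
      P.castV e₁ (P.st (P.castV e₂ (P.st (f γ.reverse.reverse : P.V (γ.reverse.reverse ++ (Projection.unit P).word.reverse))))) =
      (f γ' : P.V (γ' ++ (Projection.unit P).word.reverse)) := by
    rintro _ a rfl e₁ e₂
    exact castV_st_castV_st _ _ rfl _
  exact k (List.reverse_reverse _) _ _

theorem coord_vec₀_self (x : P.V σ) (h : γ = σ) :
    coord _ (vec₀ x) γ = P.castV (by subst h; exact (List.append_nil γ).symm) x := by
  subst h
  rw [vec₀, coord_vec]
  exact sg_self _

theorem coord_vec₀_of_ne (x : P.V σ) (h : γ ≠ σ) : coord _ (vec₀ x) γ = 0 := by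
  rw [vec₀, coord_vec]
  exact sg_of_ne h _

theorem conj_vec₀ (x : P.V σ) : conj (vec₀ x) = vec₀ (P.st x) := by
  apply coord_injective
  funext τ
  have h1 : coord _ (conj (vec₀ x)) τ = P.castV (by simp [Projection.unit])
    (P.st (coord _ (vec₀ x) τ.reverse)) := rfl
  rw [h1]
  by_cases h : τ.reverse = σ
  · rw [coord_vec₀_self _ h, coord_vec₀_self _ (by rw [← h, List.reverse_reverse])]
    subst h
    exact eq_of_heq ((castV_heq _ _).trans ((st_heq (by simp [Projection.unit]) (castV_heq _ _)).trans
      (castV_heq _ _).symm))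
  · rw [coord_vec₀_of_ne _ h, coord_vec₀_of_ne _ (fun e => h (by rw [e, List.reverse_reverse]))]
    have h2 := P.st_smul (α := τ.reverse ++ (Projection.unit P).word.reverse) 0 0
    rw [zero_smul, map_zero, zero_smul] at h2
    rw [h2]
    exact castV_zero _

theorem norm_conj (f : P.L2) : ‖conj f‖ = ‖f‖ := by
  rw [@norm_eq_sqrt_re_inner ℂ, @norm_eq_sqrt_re_inner ℂ _ _ _ _ f, inner_conj]

end FactorPlanarAlgebra
end

/-! ### The algebra `M` and its conjugate -/

noncomputable section

open scoped InnerProductSpace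

namespace FactorPlanarAlgebra

open PlanarAlg PlanarAlgebra

variable {L : Type u} {P : FactorPlanarAlgebra.{u, v} L} {p q : Projection P} {σ γ : Word L}

theorem star_star_op (a : p.H →L[ℂ] p.H) : star (star a) = a := star_star a

theorem star_mul_op (a b : p.H →L[ℂ] p.H) : star (a * b) = star b * star a := star_mul a b

theorem star_one_op : star (1 : p.H →L[ℂ] p.H) = 1 :=
  star_one (p.H →L[ℂ] p.H)

theorem star_add_op (a b : p.H →L[ℂ] p.H) : star (a + b) = star a + star b := star_add a b

theorem star_smul_op (z : ℂ) (a : p.H →L[ℂ] p.H) : star (z • a) = star z • star a := star_smul z a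

theorem norm_star_op (a : p.H →L[ℂ] p.H) : ‖star a‖ = ‖a‖ :=
  LinearIsometryEquiv.norm_map ContinuousLinearMap.adjoint a

theorem castV_cancel {a b : Word L} (h : a = b) (k : b = a) (x : P.V a) : P.castV k (P.castV h x) = x := by
  subst h; rfl

theorem exists_vec₀ (ξ : (Projection.unit P).fibre γ) : ∃ x : P.V γ, vec _ ξ = vec₀ x := by
  refine ⟨P.castV (List.append_nil γ) (ξ : P.V (γ ++ (Projection.unit P).word.reverse)), congrArg _ (Subtype.ext ?_)⟩
  exact (castV_cancel (P := P) (a := γ ++ (Projection.unit P).word.reverse) (List.append_nil γ) _ ξ.1).symm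

theorem ext_vec₀ {E : Type*} [NormedAddCommGroup E] [NormedSpace ℂ E] {S T : P.L2 →L[ℂ] E}
    (h : ∀ (γ : Word L) (x : P.V γ), S (vec₀ x) = T (vec₀ x)) : S = T :=
  clm_ext fun γ ξ => by
    obtain ⟨x, hx⟩ := exists_vec₀ ξ
    rw [hx, h]

theorem inner_conj_right (f g : P.L2) : ⟪f, conj g⟫_ℂ = ⟪g, conj f⟫_ℂ := by
  rw [← inner_conj (conj g) f, conj_conj]

theorem inner_conj_left (f g : P.L2) : ⟪conj f, g⟫_ℂ = ⟪conj g, f⟫_ℂ := by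
  rw [← inner_conj g (conj f), conj_conj]

theorem commute_leftMulOp_rightMulOp (p : Projection P) (x : P.V σ) (y : P.V γ) :
    Commute (leftMulOp p x) (rightMulOp p y) := (rightMulOp_comp_leftMulOp p x y).symm

/-- The conjugation implements the adjoint on operators commuting with the right multiplications. -/
theorem conj_apply_vacuum {a : P.L2 →L[ℂ] P.L2}
    (h : ∀ (γ : Word L) (y : P.V γ), Commute a (rightMulOp (Projection.unit P) y)) :
    conj (a P.vacuum) = star a P.vacuum := by
  -- Test against `vec₀ z = R_z Ω`, with `R_z` the right multiplication by `z`. The left side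
  -- becomes `⟨R_z a Ω, Ω⟩` and the right side `⟨a R_z Ω, Ω⟩`.
  refine vec_ext fun γ ζ => ?_
  obtain ⟨z, hz⟩ := exists_vec₀ ζ
  rw [hz, inner_conj_right, conj_vec₀, ← rightMulOp_vacuum, ← star_rightMulOp,
    ContinuousLinearMap.star_eq_adjoint, ContinuousLinearMap.adjoint_inner_right,
    ContinuousLinearMap.star_eq_adjoint, ContinuousLinearMap.adjoint_inner_right, ← rightMulOp_vacuum]
  exact congrArg (⟪·, P.vacuum⟫_ℂ) (DFunLike.congr_fun (h γ z).eq _).symm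

/-- Conjugation of an operator. -/
def conjOp (a : P.L2 →L[ℂ] P.L2) : P.L2 →L[ℂ] P.L2 := conj.comp (a.comp conj)

theorem conjOp_apply (a : P.L2 →L[ℂ] P.L2) (f : P.L2) : conjOp a f = conj (a (conj f)) := rfl

theorem conjOp_conjOp (a : P.L2 →L[ℂ] P.L2) : conjOp (conjOp a) = a := by
  ext1 f
  simp only [conjOp_apply, conj_conj]

theorem conjOp_mul (a b : P.L2 →L[ℂ] P.L2) : conjOp (a * b) = conjOp a * conjOp b := by
  ext1 f
  change conj (a (b (conj f))) = conj (a (conj (conj (b (conj f)))))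
  rw [conj_conj]

theorem conjOp_one : conjOp (1 : P.L2 →L[ℂ] P.L2) = 1 := by
  ext1 f
  exact conj_conj f

theorem conjOp_add (a b : P.L2 →L[ℂ] P.L2) : conjOp (a + b) = conjOp a + conjOp b := by
  ext1 f
  exact map_add (conj (P := P)) (a (conj f)) (b (conj f))

theorem conjOp_smul (z : ℂ) (a : P.L2 →L[ℂ] P.L2) : conjOp (z • a) = starRingEnd ℂ z • conjOp a := by
  ext1 f
  exact map_smulₛₗ (conj (P := P)) z (a (conj f))

theorem star_conjOp (a : P.L2 →L[ℂ] P.L2) : star (conjOp a) = conjOp (star a) := by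
  ext1 f
  refine ext_inner_left ℂ fun g => ?_
  rw [ContinuousLinearMap.star_eq_adjoint, ContinuousLinearMap.adjoint_inner_right, conjOp_apply, conjOp_apply,
    inner_conj_left, inner_conj_right, ContinuousLinearMap.star_eq_adjoint,
    ContinuousLinearMap.adjoint_inner_left]

theorem norm_conjOp_le (a : P.L2 →L[ℂ] P.L2) : ‖conjOp a‖ ≤ ‖a‖ :=
  ContinuousLinearMap.opNorm_le_bound _ a.opNorm_nonneg fun f => by
    rw [conjOp_apply, norm_conj, ← norm_conj f]
    exact a.le_opNorm _

theorem Commute.conjOp {a b : P.L2 →L[ℂ] P.L2} (h : Commute a b) : Commute (conjOp a) (conjOp b) := by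
  rw [commute_iff_eq, ← conjOp_mul, h.eq, conjOp_mul]

/-- On the vector `z Ω` this is `J (x z*) Ω = (x z*)* Ω = z x* Ω`, by `conj_apply_vacuum` for the
product of two left multiplications; the result is `z Ω` multiplied by `x*` on the right. -/
theorem conjOp_leftMulOp (x : P.V σ) :
    conjOp (leftMulOp (Projection.unit P) x) = rightMulOp (Projection.unit P) (P.st x) := by
  refine ext_vec₀ fun γ z => ?_
  have h := conj_apply_vacuum (P := P)
    (a := leftMulOp (Projection.unit P) x * leftMulOp (Projection.unit P) (P.st z))
    fun _ y => (commute_leftMulOp_rightMulOp _ _ y).mul_left (commute_leftMulOp_rightMulOp _ _ y)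
  rw [conjOp_apply, conj_vec₀, ← leftMulOp_vacuum]
  refine h.trans ?_
  rw [star_mul_op, ← star_leftMulOp, star_star_op, star_leftMulOp, ← leftMulOp_vacuum z]
  change leftMulOp _ z (leftMulOp _ (P.st x) _) = _
  rw [leftMulOp_vacuum, ← rightMulOp_vacuum]
  exact DFunLike.congr_fun (commute_leftMulOp_rightMulOp _ z (P.st x)).eq _

/-- Left multiplications are closed under adjoints by `star_leftMulOp`, so the conditions on
adjoints in the star-centralizers are automatic. -/
theorem mem_M_iff {a : P.L2 →L[ℂ] P.L2} : a ∈ P.M ↔ ∀ b : P.L2 →L[ℂ] P.L2,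
    (∀ (σ : Word L) (x : P.V σ), Commute b (leftMulOp (Projection.unit P) x)) → Commute a b := by
  have hS {b : P.L2 →L[ℂ] P.L2} : b ∈ StarSubalgebra.centralizer ℂ {T : P.L2 →L[ℂ] P.L2 |
      ∃ (σ : Word L) (x : P.V σ), IsLeftMul (Projection.unit P) x T} ↔
      ∀ (σ : Word L) (x : P.V σ), Commute b (leftMulOp (Projection.unit P) x) := by
    rw [StarSubalgebra.mem_centralizer_iff]
    refine ⟨fun h σ x => (h _ ⟨σ, x, isLeftMul_iff.2 rfl⟩).1.symm, ?_⟩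
    rintro h _ ⟨σ, x, hx⟩
    rw [isLeftMul_iff.1 hx, star_leftMulOp]
    exact ⟨(h σ x).eq.symm, (h _ _).eq.symm⟩
  refine (StarSubalgebra.mem_centralizer_iff ℂ).trans ⟨fun h b hb => (h b (hS.2 hb)).1.symm, fun h b hb => ?_⟩
  exact ⟨(h b (hS.1 hb)).eq.symm, (h _ (hS.1 (star_mem hb))).eq.symm⟩

theorem commute_rightMulOp_of_mem {a : P.L2 →L[ℂ] P.L2} (h : a ∈ P.M) (y : P.V γ) :
    Commute a (rightMulOp (Projection.unit P) y) :=
  mem_M_iff.1 h _ fun _ x => (commute_leftMulOp_rightMulOp _ x y).symm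

/-- Both applications of `J` are controlled at the vacuum: `J Ω = Ω` and `J m* Ω = m Ω`. So `J m* J`
plays the role of right multiplication by `m` on `L²(M)`. -/
theorem conjOp_star_vacuum {a : P.L2 →L[ℂ] P.L2} (h : a ∈ P.M) :
    conjOp (star a) P.vacuum = a P.vacuum := by
  have h1 : conj (P.vacuum) = P.vacuum := by
    have := conj_apply_vacuum (P := P) (a := 1) fun _ _ => Commute.one_left _
    rwa [star_one_op] at this
  rw [conjOp_apply, h1, conj_apply_vacuum fun γ y => ?_, star_star_op]
  exact commute_rightMulOp_of_mem (star_mem h) y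

/-- The conjugation exchanges left and right multiplications, so it carries the bicommutant of the
former into that of the latter. -/
theorem commute_conjOp_of_mem {a b : P.L2 →L[ℂ] P.L2} (h : a ∈ P.M)
    (hb : ∀ (σ : Word L) (x : P.V σ), Commute b (rightMulOp (Projection.unit P) x)) :
    Commute (conjOp (star a)) b := by
  rw [← conjOp_conjOp b]
  refine Commute.conjOp (mem_M_iff.1 (star_mem h) _ fun σ x => ?_)
  rw [← conjOp_conjOp (leftMulOp _ x), conjOp_leftMulOp]
  exact Commute.conjOp (hb _ _)

end FactorPlanarAlgebra
end

/-! ### The actions of `M` on `H_p` -/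

noncomputable section

open scoped InnerProductSpace Topology

/-- Take adjoints in the second relation and compose. With multiplication operators for `A` and `B`
it places `R'† R` in a commutant, for any two module maps. -/
theorem Intertwine.commute_adjoint_comp {H₀ H : Type*} [NormedAddCommGroup H₀] [InnerProductSpace ℂ H₀]
    [NormedAddCommGroup H] [InnerProductSpace ℂ H] [CompleteSpace H₀] [CompleteSpace H]
    {A : H₀ →L[ℂ] H₀} {B : H →L[ℂ] H} {R R' : H₀ →L[ℂ] H} (h : R ∘L A = B ∘L R)
    (h' : R' ∘L star A = star B ∘L R') : Commute (ContinuousLinearMap.adjoint R' ∘L R) A := by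
  have h1 := congrArg ContinuousLinearMap.adjoint h'
  rw [ContinuousLinearMap.adjoint_comp, ContinuousLinearMap.adjoint_comp, ContinuousLinearMap.star_eq_adjoint,
    ContinuousLinearMap.star_eq_adjoint, ContinuousLinearMap.adjoint_adjoint,
    ContinuousLinearMap.adjoint_adjoint] at h1
  change (ContinuousLinearMap.adjoint R' ∘L R) ∘L A = A ∘L (ContinuousLinearMap.adjoint R' ∘L R)
  rw [ContinuousLinearMap.comp_assoc, h, ← ContinuousLinearMap.comp_assoc, ← ContinuousLinearMap.comp_assoc, h1]

namespace FactorPlanarAlgebra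

open PlanarAlg PlanarAlgebra Intertwine

variable {L : Type u} {P : FactorPlanarAlgebra.{u, v} L} {p : Projection P} {σ γ : Word L}

theorem dense_of_vec_mem {S : Submodule ℂ p.H} (h : ∀ γ (ξ : p.fibre γ), vec p ξ ∈ S) :
    Dense (S : Set p.H) := by
  classical
  intro f
  refine mem_closure_of_tendsto (lp.hasSum_single (p := 2) (by simp) f)
    (Filter.Eventually.of_forall fun s => sum_mem fun γ _ => ?_)
  rw [← vec_eq]
  exact h _ _

variable (p) in
/-- The bounded operators from `L²(M)` to `H_p` commuting with left multiplications. -/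
def leftMaps (R : {R : P.L2 →L[ℂ] p.H // IsLeftModuleMap p R}) : P.L2 →L[ℂ] p.H := R.1

variable (p) in
/-- The bounded operators from `L²(M)` to `H_p` commuting with right multiplications. -/
def rightMaps (R : {R : P.L2 →L[ℂ] p.H // IsRightModuleMap p R}) : P.L2 →L[ℂ] p.H := R.1

theorem denseRange_leftMaps : DenseRange (ev (leftMaps p)) :=
  dense_of_vec_mem (S := LinearMap.range (ev (leftMaps p))) fun _ ξ =>
    ⟨Finsupp.single ⟨_, isLeftModuleMap_rightVec ξ⟩ P.vacuum, (ev_single _ _).trans (rightVec_vacuum ξ)⟩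

theorem denseRange_rightMaps : DenseRange (ev (rightMaps p)) :=
  dense_of_vec_mem (S := LinearMap.range (ev (rightMaps p))) fun _ ξ =>
    ⟨Finsupp.single ⟨_, isRightModuleMap_leftVec ξ⟩ P.vacuum, (ev_single _ _).trans (leftVec_vacuum ξ)⟩

/-- For left module maps `R'† R` commutes with all left multiplications, hence with `m`, which lies
in their bicommutant. -/
theorem comm_leftMaps {m : P.L2 →L[ℂ] P.L2} (hm : m ∈ P.M) : Comm (leftMaps p) m := fun R R' =>
  mem_M_iff.1 hm _ fun σ x => commute_adjoint_comp (isLeftModuleMap_iff.1 R.2 σ x) (by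
    rw [star_leftMulOp, star_leftMulOp]
    exact isLeftModuleMap_iff.1 R'.2 _ (P.st x))

theorem comm_rightMaps {m : P.L2 →L[ℂ] P.L2} (hm : m ∈ P.M) : Comm (rightMaps p) (conjOp (star m)) :=
  fun R R' => commute_conjOp_of_mem hm fun σ x => commute_adjoint_comp (isRightModuleMap_iff.1 R.2 σ x) (by
    rw [star_rightMulOp, star_rightMulOp]
    exact isRightModuleMap_iff.1 R'.2 _ (P.st x))

/-- The definition of the action prescribes its values on vectors `R Ω` only. These include all
`rightVec ξ Ω = ξ`, which are total, so the chosen operator is the extension that satisfies `T R = R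
m` everywhere. -/
theorem acts_leftAction (m : P.M) : Acts (leftMaps p) m (leftAction p m) := by
  obtain ⟨T, -, hT⟩ := exists_acts denseRange_leftMaps (comm_leftMaps (p := p) m.2)
  have h : ∃ T : p.H →L[ℂ] p.H, ∀ R : P.L2 →L[ℂ] p.H, IsLeftModuleMap p R →
    T (R P.vacuum) = R ((m : P.L2 →L[ℂ] P.L2) P.vacuum) := ⟨T, fun R hR => hT ⟨R, hR⟩ _⟩
  have e : h.choose = T := clm_ext fun γ ξ => by
    rw [← rightVec_vacuum, h.choose_spec _ (isLeftModuleMap_rightVec ξ)]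
    exact (hT ⟨_, isLeftModuleMap_rightVec ξ⟩ _).symm
  rw [leftAction, dif_pos h, e]
  exact hT

/-- The extension principle is applied to `J m* J`, not to `m`, since it is the former that commutes
with `R'† R` for right module maps. It fits the definition because `J m* J Ω = m Ω`. -/
theorem acts_rightAction (m : P.M) : Acts (rightMaps p) (conjOp (star (m : P.L2 →L[ℂ] P.L2))) (rightAction p m) := by
  obtain ⟨T, -, hT⟩ := exists_acts denseRange_rightMaps (comm_rightMaps (p := p) m.2)
  have h0 (R) (hR : IsRightModuleMap p R) :
      T (R P.vacuum) = R ((m : P.L2 →L[ℂ] P.L2) P.vacuum) := by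
    rw [← conjOp_star_vacuum m.2]
    exact hT ⟨R, hR⟩ _
  have h : ∃ T : p.H →L[ℂ] p.H, ∀ R : P.L2 →L[ℂ] p.H, IsRightModuleMap p R →
    T (R P.vacuum) = R ((m : P.L2 →L[ℂ] P.L2) P.vacuum) := ⟨T, h0⟩
  have e : h.choose = T := clm_ext fun γ ξ => by
    rw [← leftVec_vacuum, h.choose_spec _ (isRightModuleMap_leftVec ξ), h0 _ (isRightModuleMap_leftVec ξ)]
  rw [rightAction, dif_pos h, e]
  exact hT

theorem leftAction_unique {m : P.M} {T : p.H →L[ℂ] p.H} (h : Acts (leftMaps p) m T) : leftAction p m = T :=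
  (acts_leftAction m).unique denseRange_leftMaps h

theorem rightAction_unique {m : P.M} {T : p.H →L[ℂ] p.H}
    (h : Acts (rightMaps p) (conjOp (star (m : P.L2 →L[ℂ] P.L2))) T) : rightAction p m = T :=
  (acts_rightAction m).unique denseRange_rightMaps h

/-- A left module map followed by a right multiplication is again a left module map, and the left
action is natural in such maps. -/
theorem commute_leftAction_rightMulOp (m : P.M) (y : P.V γ) :
    Commute (leftAction p m) (rightMulOp p y) := by
  refine ext_of_dense (R := leftMaps p) denseRange_leftMaps fun R v => ?_
  have hR : IsLeftModuleMap p (rightMulOp p y ∘L R.1) := isLeftModuleMap_iff.2 fun σ x => by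
    rw [ContinuousLinearMap.comp_assoc, isLeftModuleMap_iff.1 R.2 σ x, ← ContinuousLinearMap.comp_assoc,
      ← ContinuousLinearMap.comp_assoc, rightMulOp_comp_leftMulOp]
  exact (acts_leftAction m ⟨_, hR⟩ v).trans (congrArg (rightMulOp p y) (acts_leftAction m R v)).symm

/-- The left action commutes with right multiplications, so composing a right module map with it
gives a right module map, and naturality of the right action applies. -/
theorem commute_leftAction_rightAction (m n : P.M) : Commute (leftAction p m) (rightAction p n) := by
  refine ext_of_dense (R := rightMaps p) denseRange_rightMaps fun R v => ?_
  have hR : IsRightModuleMap p (leftAction p m ∘L R.1) := isRightModuleMap_iff.2 fun σ x => by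
    rw [ContinuousLinearMap.comp_assoc, isRightModuleMap_iff.1 R.2 σ x, ← ContinuousLinearMap.comp_assoc,
      ← ContinuousLinearMap.comp_assoc]
    exact congrArg (· ∘L R.1) (commute_leftAction_rightMulOp m x).eq
  exact (congrArg (leftAction p m) (acts_rightAction n R v)).trans (acts_rightAction n ⟨_, hR⟩ v).symm

end FactorPlanarAlgebra

open FactorPlanarAlgebra Intertwine

/-- Each algebraic law holds on `L²(M)` for `m`, respectively for the antimultiplicative `m ↦ J m*
J`, and passes to `H_p` by uniqueness of the operator through which a given operator acts. -/
theorem Projection.isBimodule {L : Type u} {P : FactorPlanarAlgebra.{u, v} L} (p : Projection P) :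
    p.bimodule.IsBimodule where
  left_one := leftAction_unique Acts.one
  left_mul m n := leftAction_unique ((acts_leftAction m).mul (acts_leftAction n))
  left_add m n := leftAction_unique ((acts_leftAction m).add (acts_leftAction n))
  left_smul z m n h := leftAction_unique (by rw [h]; exact (acts_leftAction m).smul z)
  left_star m := leftAction_unique ((acts_leftAction m).star denseRange_leftMaps (comm_leftMaps m.2))
  right_one := rightAction_unique (by
    change Acts _ (conjOp (star 1)) _
    rw [star_one_op, conjOp_one]
    exact Acts.one)
  right_mul m n := rightAction_unique (by
    change Acts _ (conjOp (star ((m : P.L2 →L[ℂ] P.L2) * (n : P.L2 →L[ℂ] P.L2)))) _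
    rw [star_mul_op, conjOp_mul]
    exact (acts_rightAction n).mul (acts_rightAction m))
  right_add m n := rightAction_unique (by
    change Acts _ (conjOp (star ((m : P.L2 →L[ℂ] P.L2) + (n : P.L2 →L[ℂ] P.L2)))) _
    rw [star_add_op, conjOp_add]
    exact (acts_rightAction m).add (acts_rightAction n))
  right_smul z m n h := rightAction_unique (by
    rw [h, star_smul_op, conjOp_smul, RCLike.star_def, RingHomCompTriple.comp_apply, RingHom.id_apply]
    exact (acts_rightAction m).smul z)
  right_star m := rightAction_unique (by
    have h := (acts_rightAction (p := p) m).star denseRange_rightMaps (comm_rightMaps m.2)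
    rw [star_conjOp] at h
    exact h)
  commute m n := (commute_leftAction_rightAction m n).eq
  normal l m hl h ξ η := by
    refine ⟨Acts.tendsto denseRange_leftMaps (fun n : P.M => comm_leftMaps n.2) hl acts_leftAction
      (acts_leftAction m) h ξ η, Acts.tendsto denseRange_rightMaps (fun n : P.M => comm_rightMaps n.2)
      (hl.mono fun n hn => ?_) acts_rightAction (acts_rightAction m) (fun v w => ?_) ξ η⟩
    · exact (norm_conjOp_le _).trans ((norm_star_op _).le.trans hn)
    -- Matrix entries of `J n* J` are matrix entries of `n` at conjugated vectors, so weak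
    -- convergence is preserved.
    · have e (a : P.L2 →L[ℂ] P.L2) : ⟪v, conjOp (star a) w⟫_ℂ = ⟪conj w, a (conj v)⟫_ℂ := by
        rw [conjOp_apply, inner_conj_right, ContinuousLinearMap.star_eq_adjoint,
          ContinuousLinearMap.adjoint_inner_left]
      simp only [e]
      exact h _ _

end

/-! ### Finite direct sums of bimodules -/

noncomputable section

open scoped InnerProductSpace Topology

variable {L : Type u} {P : FactorPlanarAlgebra.{u, v} L}

namespace PreBimodule

variable {ι : Type} [Fintype ι] {B : ι → PreBimodule P}

/-- The components of a vector of a direct sum. -/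
def component (f : (directSum B).carrier) (i : ι) : (B i).carrier :=
  WithLp.ofLp (p := 2) (V := ∀ i, (B i).carrier) f i

theorem component_left (m : P.M) (f : (directSum B).carrier) (i : ι) :
    component ((directSum B).left m f) i = (B i).left m (component f i) := rfl

theorem component_right (m : P.M) (f : (directSum B).carrier) (i : ι) :
    component ((directSum B).right m f) i = (B i).right m (component f i) := rfl

theorem directSum_inner (f g : (directSum B).carrier) :
    ⟪f, g⟫_ℂ = ∑ i, ⟪component f i, component g i⟫_ℂ :=
  PiLp.inner_apply (𝕜 := ℂ) (f := fun i => (B i).carrier) f g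

theorem directSum_ext {S T : (directSum B).carrier →L[ℂ] (directSum B).carrier}
    (h : ∀ f i, component (S f) i = component (T f) i) : S = T :=
  ContinuousLinearMap.ext fun f => PiLp.ext (h f)

theorem star_apply_inner {H : Type*} [NormedAddCommGroup H] [InnerProductSpace ℂ H] [CompleteSpace H]
    (T : H →L[ℂ] H) (f g : H) : ⟪star T f, g⟫_ℂ = ⟪f, T g⟫_ℂ := by
  rw [ContinuousLinearMap.star_eq_adjoint, ContinuousLinearMap.adjoint_inner_left]

theorem eq_star_of_inner {H : Type*} [NormedAddCommGroup H] [InnerProductSpace ℂ H] [CompleteSpace H]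
    {S T : H →L[ℂ] H} (h : ∀ f g, ⟪S f, g⟫_ℂ = ⟪f, T g⟫_ℂ) : S = star T :=
  (ContinuousLinearMap.eq_adjoint_iff S T).2 h

theorem IsBimodule.directSum (hB : ∀ i, (B i).IsBimodule) : (directSum B).IsBimodule where
  left_one := directSum_ext fun f i => DFunLike.congr_fun (hB i).left_one (component f i)
  left_mul m n := directSum_ext fun f i => DFunLike.congr_fun ((hB i).left_mul m n) (component f i)
  left_add m n := directSum_ext fun f i => DFunLike.congr_fun ((hB i).left_add m n) (component f i)
  left_smul z m n h := directSum_ext fun f i => DFunLike.congr_fun ((hB i).left_smul z m n h) (component f i)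
  left_star m := eq_star_of_inner fun f g => by
    rw [directSum_inner, directSum_inner]
    refine Finset.sum_congr rfl fun i _ => ?_
    rw [component_left, component_left, (hB i).left_star, star_apply_inner]
  right_one := directSum_ext fun f i => DFunLike.congr_fun (hB i).right_one (component f i)
  right_mul m n := directSum_ext fun f i => DFunLike.congr_fun ((hB i).right_mul m n) (component f i)
  right_add m n := directSum_ext fun f i => DFunLike.congr_fun ((hB i).right_add m n) (component f i)
  right_smul z m n h := directSum_ext fun f i => DFunLike.congr_fun ((hB i).right_smul z m n h) (component f i)
  right_star m := eq_star_of_inner fun f g => by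
    rw [directSum_inner, directSum_inner]
    refine Finset.sum_congr rfl fun i _ => ?_
    rw [component_right, component_right, (hB i).right_star, star_apply_inner]
  commute m n := directSum_ext fun f i => DFunLike.congr_fun ((hB i).commute m n) (component f i)
  normal l m hl h ξ η := by
    simp only [directSum_inner]
    exact ⟨tendsto_finsetSum _ fun i _ => ((hB i).normal l m hl h _ _).1,
      tendsto_finsetSum _ fun i _ => ((hB i).normal l m hl h _ _).2⟩

end PreBimodule

theorem Bim.isBimodule (X : Bim P) : (Bim.bimodule X).IsBimodule :=
  PreBimodule.IsBimodule.directSum fun i => by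
    rw [(X.X i).eq]
    exact (X.X i).proj.isBimodule

end

/-! ### Conclusion -/

theorem theorem3p17 {L : Type u} [Countable L] (P : FactorPlanarAlgebra.{u, v} L)
    (hδ : ∀ c : L, 1 < (P.loopParameter c).re) :
    (∀ X : Bim P, (Bim.bimodule X).IsBimodule) ∧
      IsRigidCStarTensorCategory (Pro P) ∧ IsRigidCStarTensorCategory (Bim P) ∧
      IsRigidCStarTensorEquivalence (proToBim P) :=
  ⟨Bim.isBimodule, Pro.isRigidCStarTensorCategory P, Bim.isRigidCStarTensorCategory P,
    isRigidCStarTensorEquivalence_proToBim P⟩
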